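/- Let $K\subset\mathbb R^2$ be a polygonal element: the bounded open region enclosed by a simple closed polygonal curve with vertices $\mathsf v_1,\dots,\mathsf v_N$ (straight angles are allowed). Every edge $e$ of $\partial K$, of length $h_e$, carries a fixed unit normal $\mathbf n$; $h_K$ is the diameter of $K$, and $h_{\mathsf v}>0$ is a length scale attached to each vertex $\mathsf v$. $\mathbb P_d$ denotes the polynomials of degree at most $d$, with $\mathbb P_d=\{0\}$ for $d<0$. Let $p\ge 1$. For $r\ge 2p-1$ the local virtual element space is $$V^{K,p}_{h,r}=\Big\{v\in H^p(K):\ \Delta^p v\in\mathbb P_{r-2p}(K),\ D^\nu v\in C^0(\partial K)\ (|\nu|\le p-1),\ \partial_n^j v\in\mathbb P_{r-j}(e)\ (j=0,\dots,p-1)\ \text{for every edge } e\subset\partial K\Big\},$$ where $\partial_n^0v=v$ and boundary values are understood in the sense of traces. A family of degrees of freedom is called unisolvent for a space $V$ if they are well-defined linear functionals on $V$ and, for every prescription of their values (for moments against a polynomial space: for every linear functional on that space), exactly one $v\in V$ attains these values; that is, the map from $V$ to the space of all values is a linear isomorphism. 1. Let $r\ge 2p-1$. The following degrees of freedom are unisolvent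 for $V^{K,p}_{h,r}$: - (D1) $h_{\mathsf v}^{|\nu|}D^\nu v(\mathsf v)$ for $|\nu|\le p-1$ and every vertex $\mathsf v$ of $K$; - (D2) $h_e^{-1}\int_e q\,v\,ds$ for $q\in\mathbb P_{r-2p}(e)$ and every edge $e$; - (D3) $h_e^{-1+j}\int_e q\,\partial_n^jv\,ds$ for $q\in\mathbb P_{r-2p+j}(e)$, $j=1,\dots,p-1$, and every edge $e$; - (D4) $h_K^{-2}\int_K q\,v\,dx$ for $q\in\mathbb P_{r-2p}(K)$. 2. Let $r\ge 2p-1$ and $0\le t\le p-1$, and replace (D4) by - (D4') $h_K^{-2}\int_K q\,v\,dx$ for $q\in\mathbb P_{r-2(p-t)}(K)$. Then (D1)–(D3), (D4') are well-defined linear functionals on $V^{K,p}_{h,r}$ that determine its elements: two functions of $V^{K,p}_{h,r}$ with the same values are equal. Moreover, (D1)–(D3), (D4') are unisolvent for the space that is defined as $V^{K,p}_{h,r}$ but with the condition $\Delta^pv\in\mathbb P_{r-2(p-t)}(K)$ in place of $\Delta^pv\in\mathbb P_{r-2p}(K)$. 3. The modified lowest-order space $$\widetilde V^{K,p}_{h,2p-1}=\Big\{v\in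 H^p(K):\ \Delta^p v=0,\ D^\nu v\in C^0(\partial K)\ (|\nu|\le p-1),\ v\in\mathbb P_{2p-1}(e),\ \partial_n^i v\in\mathbb P_{2p-2-i}(e)\ (i=1,\dots,p-1)\ \text{for every edge } e\subset\partial K\Big\}$$ has as unisolvent degrees of freedom - (D1') $h_{\mathsf v}^{|\nu|}D^\nu v(\mathsf v)$ for $|\nu|\le p-1$ and every vertex $\mathsf v$ of $K$; - (D2') $h_e^{-1+i}\int_e q\,\partial_n^iv\,ds$ for $q\in\mathbb P_{i-2}(e)$, $i=1,\dots,p-1$, and every edge $e$. -/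

import Mathlib

namespace VEM

open MeasureTheory Set Filter Topology TopologicalSpace
open scoped ContDiff Distributions

/-- The plane `ℝ²` with its Euclidean norm and Lebesgue measure. -/
abbrev Plane : Type := EuclideanSpace ℝ (Fin 2)

/-! ### Polygonal elements -/

/-- `P` lists the vertices of a simple closed polygonal curve in cyclic order: consecutive vertices
are distinct, and two different edges meet at most in a common endpoint, as consecutive edges do.
(This forces at least three pairwise distinct vertices. Straight angles are allowed.) -/
def IsSimplePolygon {N : ℕ} (P : Polygon Plane N) : Prop :=
  P.HasNondegenerateEdges ∧
    ∀ i j : Fin N, i ≠ j → ∀ x ∈ P.edgeSet ℝ i ∩ P.edgeSet ℝ j,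
      (j = finRotate N i ∧ x = P j) ∨ (i = finRotate N j ∧ x = P i)

/-- `K` is the polygonal element (the open bounded region) enclosed by the simple polygon `P`. -/
structure IsElement {N : ℕ} (P : Polygon Plane N) (K : Opens Plane) : Prop where
  simple : IsSimplePolygon P
  connected : IsConnected (K : Set Plane)
  bounded : Bornology.IsBounded (K : Set Plane)
  frontier_eq : frontier (K : Set Plane) = P.boundary ℝ

/-- The length `h_e` of the `i`-th edge. -/
noncomputable def edgeLength {N : ℕ} (P : Polygon Plane N) (i : Fin N) : ℝ :=
  dist (P i) (P (finRotate N i))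

/-- The unit normal `n = (τ₂, -τ₁)` of the `i`-th edge, with `τ` the unit tangent pointing from its
first to its second endpoint. -/
noncomputable def edgeNormal {N : ℕ} (P : Polygon Plane N) (i : Fin N) : Plane :=
  (edgeLength P i)⁻¹ •
    !₂[P (finRotate N i) 1 - P i 1, -(P (finRotate N i) 0 - P i 0)]

/-- The arc length integral `∫_e f ds` over the `i`-th edge. -/
noncomputable def edgeIntegral {N : ℕ} (P : Polygon Plane N) (i : Fin N) (f : ℝ → ℝ) : ℝ :=
  edgeLength P i * ∫ t in (0 : ℝ)..1, f t

/-! ### Derivatives, Sobolev functions and traces -/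

/-- The classical partial derivative of `f` in the `k`-th coordinate. -/
noncomputable def partialD (k : Fin 2) (f : Plane → ℝ) : Plane → ℝ :=
  fun x => fderiv ℝ f x (EuclideanSpace.single k 1)

/-- The classical partial derivative `D^ν f` for a multi-index `ν = (ν₁, ν₂)`. -/
noncomputable def multiD (ν : ℕ × ℕ) (f : Plane → ℝ) : Plane → ℝ :=
  (partialD 0)^[ν.1] ((partialD 1)^[ν.2] f)

/-- The classical polyharmonic operator `Δ^p f`. -/
noncomputable def polyLaplacian (p : ℕ) (f : Plane → ℝ) : Plane → ℝ :=
  Laplacian.laplacian^[p] f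

/-- The space `L²(K)`. -/
abbrev L2 (K : Opens Plane) : Type := Lp ℝ 2 (volume.restrict (K : Set Plane))

/-- `w ∈ L²(K)` is the weak derivative `D^ν v` of `v ∈ L²(K)`. -/
def HasWeakDeriv (K : Opens Plane) (ν : ℕ × ℕ) (v w : L2 K) : Prop :=
  ∀ φ : 𝓓(K, ℝ), ∫ x in (K : Set Plane), v x * multiD ν φ x =
    (-1 : ℝ) ^ (ν.1 + ν.2) * ∫ x in (K : Set Plane), w x * φ x

/-- `v ∈ H^p(K)`. -/
def MemSobolev (K : Opens Plane) (p : ℕ) (v : L2 K) : Prop :=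
  ∀ ν : ℕ × ℕ, ν.1 + ν.2 ≤ p → ∃ w : L2 K, HasWeakDeriv K ν v w

/-- `g` is the trace on `∂K` of `w ∈ H¹(K)`: there are functions smooth up to the boundary that
converge to `w` in `H¹(K)` and whose restrictions to `∂K` converge to `g` in `L²(∂K)`. Only the
values of `g` on `∂K` matter. -/
def HasTrace {N : ℕ} (P : Polygon Plane N) (K : Opens Plane) (w : L2 K) (g : Plane → ℝ) : Prop :=
  (∀ i, MemLp (fun t : ℝ => g (P.edgePath ℝ i t)) 2 (volume.restrict (Icc 0 1))) ∧
  ∃ (w₁ w₂ : L2 K) (φ : ℕ → Plane → ℝ),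
    HasWeakDeriv K (1, 0) w w₁ ∧ HasWeakDeriv K (0, 1) w w₂ ∧
    (∀ n, ContDiff ℝ ∞ (φ n)) ∧
    Tendsto (fun n => eLpNorm (φ n - ⇑w) 2 (volume.restrict (K : Set Plane))) atTop (𝓝 0) ∧
    Tendsto (fun n => eLpNorm (partialD 0 (φ n) - ⇑w₁) 2 (volume.restrict (K : Set Plane)))
      atTop (𝓝 0) ∧
    Tendsto (fun n => eLpNorm (partialD 1 (φ n) - ⇑w₂) 2 (volume.restrict (K : Set Plane)))
      atTop (𝓝 0) ∧
    ∀ i, Tendsto (fun n => eLpNorm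
      (fun t : ℝ => φ n (P.edgePath ℝ i t) - g (P.edgePath ℝ i t)) 2
      (volume.restrict (Icc 0 1))) atTop (𝓝 0)

/-- For every `|ν| ≤ p - 1` the trace of `D^ν v` on `∂K` is the continuous function `g ν`; in
particular `D^ν v ∈ C⁰(∂K)`. -/
def IsTraceJet {N : ℕ} (P : Polygon Plane N) (K : Opens Plane) (p : ℕ) (v : L2 K)
    (g : ℕ × ℕ → Plane → ℝ) : Prop :=
  ∀ ν : ℕ × ℕ, ν.1 + ν.2 < p → ContinuousOn (g ν) (P.boundary ℝ) ∧
    ∃ w : L2 K, HasWeakDeriv K ν v w ∧ HasTrace P K w (g ν)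

/-- The `j`-th normal derivative `∂_n^j v = ∑_{a+b=j} (j choose a) n₁^a n₂^b D^{(a,b)} v` along the
`i`-th edge, as a function of `t ∈ [0,1]`, where `g` is the family of traces of the `D^ν v`. -/
noncomputable def normalTrace {N : ℕ} (P : Polygon Plane N) (i : Fin N) (j : ℕ)
    (g : ℕ × ℕ → Plane → ℝ) (t : ℝ) : ℝ :=
  ∑ a ∈ Finset.range (j + 1), (j.choose a : ℝ) * edgeNormal P i 0 ^ a *
    edgeNormal P i 1 ^ (j - a) * g (a, j - a) (P.edgePath ℝ i t)

/-! ### Polynomials -/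

/-- Polynomials of degree at most `d` on an edge, in the parameter `t ∈ [0,1]` of the edge; this is
`{0}` for `d < 0`. -/
noncomputable def edgePoly (d : ℤ) : Submodule ℝ (Polynomial ℝ) :=
  Polynomial.degreeLT ℝ (d + 1).toNat

/-- Polynomials of total degree at most `d` in two variables; this is `{0}` for `d < 0`. -/
noncomputable def bulkPoly (d : ℤ) : Submodule ℝ (MvPolynomial (Fin 2) ℝ) :=
  if d < 0 then ⊥ else MvPolynomial.restrictTotalDegree (Fin 2) ℝ d.toNat

/-- `f` coincides on `[0,1]` with a polynomial of degree at most `d`. -/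
def IsEdgePoly (d : ℤ) (f : ℝ → ℝ) : Prop :=
  ∃ q ∈ edgePoly d, ∀ t ∈ Icc (0 : ℝ) 1, f t = q.eval t

/-- `Δ^p v` (in the sense of distributions on `K`) is a polynomial of degree at most `m`. -/
def HasPolyLaplacian (K : Opens Plane) (p : ℕ) (m : ℤ) (v : L2 K) : Prop :=
  ∃ q ∈ bulkPoly m, ∀ φ : 𝓓(K, ℝ), ∫ x in (K : Set Plane), v x * polyLaplacian p φ x =
    ∫ x in (K : Set Plane), MvPolynomial.eval (fun k => x k) q * φ x

/-! ### Closure under linear combinations -/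

lemma contDiff_partialD {f : Plane → ℝ} (hf : ContDiff ℝ ∞ f) (k : Fin 2) :
    ContDiff ℝ ∞ (partialD k f) :=
  (hf.fderiv_right (m := ∞) (by simp)).clm_apply contDiff_const

lemma hasCompactSupport_partialD {f : Plane → ℝ} (hf : HasCompactSupport f) (k : Fin 2) :
    HasCompactSupport (partialD k f) :=
  hf.fderiv_apply ℝ _

lemma contDiff_multiD {f : Plane → ℝ} (hf : ContDiff ℝ ∞ f) (ν : ℕ × ℕ) :
    ContDiff ℝ ∞ (multiD ν f) := by
  have key : ∀ (k : Fin 2) (n : ℕ) (h : Plane → ℝ), ContDiff ℝ ∞ h →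
      ContDiff ℝ ∞ ((partialD k)^[n] h) := by
    intro k n
    induction n with
    | zero => intro h hh; simpa using hh
    | succ n ih => intro h hh; exact ih _ (contDiff_partialD hh k)
  exact key 0 _ _ (key 1 _ _ hf)

lemma hasCompactSupport_multiD {f : Plane → ℝ} (hf : HasCompactSupport f) (ν : ℕ × ℕ) :
    HasCompactSupport (multiD ν f) := by
  have key : ∀ (k : Fin 2) (n : ℕ) (h : Plane → ℝ), HasCompactSupport h →
      HasCompactSupport ((partialD k)^[n] h) := by
    intro k n
    induction n with
    | zero => intro h hh; simpa using hh
    | succ n ih => intro h hh; exact ih _ (hasCompactSupport_partialD hh k)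
  exact key 0 _ _ (key 1 _ _ hf)

lemma laplacian_eq_sum (f : Plane → ℝ) : Laplacian.laplacian f = fun x =>
    ∑ k : Fin 2, iteratedFDeriv ℝ 2 f x
      ![EuclideanSpace.basisFun (Fin 2) ℝ k, EuclideanSpace.basisFun (Fin 2) ℝ k] :=
  InnerProductSpace.laplacian_eq_iteratedFDeriv_orthonormalBasis f
    (EuclideanSpace.basisFun (Fin 2) ℝ)

lemma contDiff_polyLaplacian (p : ℕ) {f : Plane → ℝ} (hf : ContDiff ℝ ∞ f) :
    ContDiff ℝ ∞ (polyLaplacian p f) := by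
  unfold polyLaplacian
  induction p generalizing f with
  | zero => simpa using hf
  | succ n ih =>
    refine ih ?_
    rw [laplacian_eq_sum]
    refine ContDiff.sum fun k _ => ?_
    exact (ContinuousMultilinearMap.apply ℝ (fun _ : Fin 2 => Plane) ℝ _).contDiff.comp
      (hf.iteratedFDeriv_right (m := ∞) (by rfl))

lemma hasCompactSupport_polyLaplacian (p : ℕ) {f : Plane → ℝ} (hf : HasCompactSupport f) :
    HasCompactSupport (polyLaplacian p f) := by
  unfold polyLaplacian
  induction p generalizing f with
  | zero => simpa using hf
  | succ n ih =>
    refine ih ?_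
    rw [laplacian_eq_sum]
    refine (hf.iteratedFDeriv (𝕜 := ℝ) 2).mono ?_
    intro x hx
    contrapose! hx
    have h0 : iteratedFDeriv ℝ 2 f x = 0 := by simpa using hx
    simp [h0]

lemma integrable_mul_test {K : Opens Plane} (v : L2 K) {ψ : Plane → ℝ} (hψ : Continuous ψ)
    (hc : HasCompactSupport ψ) :
    Integrable (fun x => v x * ψ x) (volume.restrict (K : Set Plane)) :=
  (Lp.memLp v).integrable_mul ((hψ.memLp_of_hasCompactSupport (p := 2) hc).restrict _)

lemma integral_add_mul {K : Opens Plane} (v w : L2 K) {ψ : Plane → ℝ} (hψ : Continuous ψ)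
    (hc : HasCompactSupport ψ) :
    ∫ x in (K : Set Plane), (v + w : L2 K) x * ψ x =
      (∫ x in (K : Set Plane), v x * ψ x) + ∫ x in (K : Set Plane), w x * ψ x := by
  rw [← integral_add (integrable_mul_test v hψ hc) (integrable_mul_test w hψ hc)]
  refine integral_congr_ae ?_
  filter_upwards [Lp.coeFn_add v w] with x hx
  rw [hx, Pi.add_apply, add_mul]

lemma integral_smul_mul {K : Opens Plane} (c : ℝ) (v : L2 K) (ψ : Plane → ℝ) :
    ∫ x in (K : Set Plane), (c • v : L2 K) x * ψ x = c * ∫ x in (K : Set Plane), v x * ψ x := by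
  rw [← integral_const_mul]
  refine integral_congr_ae ?_
  filter_upwards [Lp.coeFn_smul c v] with x hx
  rw [hx, Pi.smul_apply, smul_eq_mul, mul_assoc]

lemma integral_zero_mul {K : Opens Plane} (ψ : Plane → ℝ) :
    ∫ x in (K : Set Plane), (0 : L2 K) x * ψ x = 0 := by
  simpa using integral_smul_mul (K := K) 0 0 ψ

lemma HasWeakDeriv.add {K : Opens Plane} {ν : ℕ × ℕ} {v w v' w' : L2 K}
    (h : HasWeakDeriv K ν v w) (h' : HasWeakDeriv K ν v' w') :
    HasWeakDeriv K ν (v + v') (w + w') := by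
  intro φ
  rw [integral_add_mul v v' (contDiff_multiD φ.contDiff ν).continuous
      (hasCompactSupport_multiD φ.hasCompactSupport ν),
    integral_add_mul w w' φ.continuous φ.hasCompactSupport, h φ, h' φ, mul_add]

lemma HasWeakDeriv.smul {K : Opens Plane} {ν : ℕ × ℕ} {v w : L2 K} (c : ℝ)
    (h : HasWeakDeriv K ν v w) : HasWeakDeriv K ν (c • v) (c • w) := by
  intro φ
  rw [integral_smul_mul, integral_smul_mul, h φ, mul_left_comm]

lemma hasWeakDeriv_zero (K : Opens Plane) (ν : ℕ × ℕ) : HasWeakDeriv K ν 0 0 := by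
  intro φ
  rw [integral_zero_mul, integral_zero_mul, mul_zero]

lemma tendsto_eLpNorm_add {α : Type*} [MeasurableSpace α] {μ : Measure α} {f g : ℕ → α → ℝ}
    (hf : ∀ n, AEStronglyMeasurable (f n) μ) (hg : ∀ n, AEStronglyMeasurable (g n) μ)
    (h : Tendsto (fun n => eLpNorm (f n) 2 μ) atTop (𝓝 0))
    (h' : Tendsto (fun n => eLpNorm (g n) 2 μ) atTop (𝓝 0)) :
    Tendsto (fun n => eLpNorm (f n + g n) 2 μ) atTop (𝓝 0) := by
  refine tendsto_of_tendsto_of_tendsto_of_le_of_le tendsto_const_nhds (by simpa using h.add h')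
    (fun _ => zero_le) fun n => ?_
  exact eLpNorm_add_le (hf n) (hg n) (by norm_num)

lemma tendsto_eLpNorm_smul {α : Type*} [MeasurableSpace α] {μ : Measure α} {f : ℕ → α → ℝ} (c : ℝ)
    (h : Tendsto (fun n => eLpNorm (f n) 2 μ) atTop (𝓝 0)) :
    Tendsto (fun n => eLpNorm (c • f n) 2 μ) atTop (𝓝 0) := by
  simp only [eLpNorm_const_smul]
  simpa using ENNReal.Tendsto.const_mul h (Or.inr enorm_ne_top)

lemma partialD_add {f g : Plane → ℝ} (hf : ContDiff ℝ ∞ f) (hg : ContDiff ℝ ∞ g) (k : Fin 2) :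
    partialD k (f + g) = partialD k f + partialD k g := by
  funext x
  simp only [partialD, Pi.add_apply]
  rw [fderiv_add (hf.differentiable (by simp) x) (hg.differentiable (by simp) x)]
  rfl

lemma partialD_smul {f : Plane → ℝ} (hf : ContDiff ℝ ∞ f) (c : ℝ) (k : Fin 2) :
    partialD k (c • f) = c • partialD k f := by
  funext x
  simp only [partialD, Pi.smul_apply]
  rw [fderiv_const_smul (hf.differentiable (by simp) x)]
  rfl

lemma continuous_edgePath {N : ℕ} (P : Polygon Plane N) (i : Fin N) :
    Continuous (fun t : ℝ => P.edgePath ℝ i t) :=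
  AffineMap.lineMap_continuous

lemma HasTrace.add {N : ℕ} {P : Polygon Plane N} {K : Opens Plane} {w w' : L2 K}
    {g g' : Plane → ℝ} (h : HasTrace P K w g) (h' : HasTrace P K w' g') :
    HasTrace P K (w + w') (g + g') := by
  obtain ⟨hm, w₁, w₂, φ, h1, h2, hs, ht, ht1, ht2, hb⟩ := h
  obtain ⟨hm', w₁', w₂', φ', h1', h2', hs', ht', ht1', ht2', hb'⟩ := h'
  have aux : ∀ (u u' : L2 K) (f f' : ℕ → Plane → ℝ), (∀ n, Continuous (f n)) →
      (∀ n, Continuous (f' n)) →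
      Tendsto (fun n => eLpNorm (f n - ⇑u) 2 (volume.restrict (K : Set Plane))) atTop (𝓝 0) →
      Tendsto (fun n => eLpNorm (f' n - ⇑u') 2 (volume.restrict (K : Set Plane))) atTop (𝓝 0) →
      Tendsto (fun n => eLpNorm (f n + f' n - ⇑(u + u' : L2 K)) 2
        (volume.restrict (K : Set Plane))) atTop (𝓝 0) := by
    intro u u' f f' hf hf' hu hu'
    refine (tendsto_eLpNorm_add (fun n => ?_) (fun n => ?_) hu hu').congr fun n => ?_
    · exact (hf n).aestronglyMeasurable.sub (Lp.aestronglyMeasurable u)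
    · exact (hf' n).aestronglyMeasurable.sub (Lp.aestronglyMeasurable u')
    · refine eLpNorm_congr_ae ?_
      filter_upwards [Lp.coeFn_add u u'] with x hx
      simp only [Pi.add_apply, Pi.sub_apply, hx]
      ring
  refine ⟨fun i => (hm i).add (hm' i), w₁ + w₁', w₂ + w₂', fun n => φ n + φ' n, h1.add h1',
    h2.add h2', fun n => (hs n).add (hs' n), ?_, ?_, ?_, fun i => ?_⟩
  · exact aux w w' φ φ' (fun n => (hs n).continuous) (fun n => (hs' n).continuous) ht ht'
  · simp only [partialD_add (hs _) (hs' _)]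
    exact aux w₁ w₁' _ _ (fun n => (contDiff_partialD (hs n) 0).continuous)
      (fun n => (contDiff_partialD (hs' n) 0).continuous) ht1 ht1'
  · simp only [partialD_add (hs _) (hs' _)]
    exact aux w₂ w₂' _ _ (fun n => (contDiff_partialD (hs n) 1).continuous)
      (fun n => (contDiff_partialD (hs' n) 1).continuous) ht2 ht2'
  · refine (tendsto_eLpNorm_add (fun n => ?_) (fun n => ?_) (hb i) (hb' i)).congr fun n => ?_
    · exact ((hs n).continuous.comp (continuous_edgePath P i)).aestronglyMeasurable.sub (hm i).1
    · exact ((hs' n).continuous.comp (continuous_edgePath P i)).aestronglyMeasurable.sub (hm' i).1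
    · congr 1
      funext t
      simp only [Pi.add_apply]
      ring

lemma HasTrace.smul {N : ℕ} {P : Polygon Plane N} {K : Opens Plane} {w : L2 K}
    {g : Plane → ℝ} (c : ℝ) (h : HasTrace P K w g) : HasTrace P K (c • w) (c • g) := by
  obtain ⟨hm, w₁, w₂, φ, h1, h2, hs, ht, ht1, ht2, hb⟩ := h
  have aux : ∀ (u : L2 K) (f : ℕ → Plane → ℝ),
      Tendsto (fun n => eLpNorm (f n - ⇑u) 2 (volume.restrict (K : Set Plane))) atTop (𝓝 0) →
      Tendsto (fun n => eLpNorm (c • f n - ⇑(c • u : L2 K)) 2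
        (volume.restrict (K : Set Plane))) atTop (𝓝 0) := by
    intro u f hu
    refine (tendsto_eLpNorm_smul c hu).congr fun n => ?_
    refine eLpNorm_congr_ae ?_
    filter_upwards [Lp.coeFn_smul c u] with x hx
    simp only [Pi.smul_apply, Pi.sub_apply, hx, smul_sub]
  refine ⟨fun i => (hm i).const_smul c, c • w₁, c • w₂, fun n => c • φ n, h1.smul c, h2.smul c,
    fun n => (hs n).const_smul c, aux w φ ht, ?_, ?_, fun i => ?_⟩
  · simp only [partialD_smul (hs _)]
    exact aux w₁ _ ht1
  · simp only [partialD_smul (hs _)]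
    exact aux w₂ _ ht2
  · refine (tendsto_eLpNorm_smul c (hb i)).congr fun n => ?_
    congr 1
    funext t
    simp only [Pi.smul_apply, smul_sub]

lemma hasTrace_zero {N : ℕ} (P : Polygon Plane N) (K : Opens Plane) :
    HasTrace P K 0 (0 : Plane → ℝ) := by
  have h0 : ∀ k : Fin 2, partialD k (0 : Plane → ℝ) = 0 := by
    intro k
    have := partialD_smul (f := (0 : Plane → ℝ)) contDiff_const 0 k
    simpa using this
  have hz : eLpNorm ((0 : Plane → ℝ) - ⇑(0 : L2 K)) 2 (volume.restrict (K : Set Plane)) = 0 := by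
    rw [← eLpNorm_zero (ε := ℝ) (p := 2) (μ := volume.restrict (K : Set Plane))]
    refine eLpNorm_congr_ae ?_
    filter_upwards [Lp.coeFn_zero ℝ 2 (volume.restrict (K : Set Plane))] with x hx
    simp only [Pi.sub_apply, hx, Pi.zero_apply, sub_zero]
  refine ⟨fun i => MemLp.zero, 0, 0, fun _ => 0, hasWeakDeriv_zero K _, hasWeakDeriv_zero K _,
    fun _ => contDiff_const, ?_, ?_, ?_, fun i => ?_⟩
  · simp only [hz, tendsto_const_nhds]
  · simp only [h0, hz, tendsto_const_nhds]
  · simp only [h0, hz, tendsto_const_nhds]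
  · simp

lemma IsTraceJet.add {N : ℕ} {P : Polygon Plane N} {K : Opens Plane} {p : ℕ} {v v' : L2 K}
    {g g' : ℕ × ℕ → Plane → ℝ} (h : IsTraceJet P K p v g) (h' : IsTraceJet P K p v' g') :
    IsTraceJet P K p (v + v') (g + g') := by
  intro ν hν
  obtain ⟨hc, w, hw, ht⟩ := h ν hν
  obtain ⟨hc', w', hw', ht'⟩ := h' ν hν
  exact ⟨hc.add hc', w + w', hw.add hw', ht.add ht'⟩

lemma IsTraceJet.smul {N : ℕ} {P : Polygon Plane N} {K : Opens Plane} {p : ℕ} {v : L2 K}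
    {g : ℕ × ℕ → Plane → ℝ} (c : ℝ) (h : IsTraceJet P K p v g) :
    IsTraceJet P K p (c • v) (c • g) := by
  intro ν hν
  obtain ⟨hc, w, hw, ht⟩ := h ν hν
  exact ⟨hc.const_smul c, c • w, hw.smul c, ht.smul c⟩

lemma isTraceJet_zero {N : ℕ} (P : Polygon Plane N) (K : Opens Plane) (p : ℕ) :
    IsTraceJet P K p 0 0 :=
  fun ν _ => ⟨continuousOn_const, 0, hasWeakDeriv_zero K ν, hasTrace_zero P K⟩

lemma normalTrace_add {N : ℕ} (P : Polygon Plane N) (i : Fin N) (j : ℕ)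
    (g g' : ℕ × ℕ → Plane → ℝ) (t : ℝ) :
    normalTrace P i j (g + g') t = normalTrace P i j g t + normalTrace P i j g' t := by
  simp only [normalTrace, Pi.add_apply, mul_add, Finset.sum_add_distrib]

lemma normalTrace_smul {N : ℕ} (P : Polygon Plane N) (i : Fin N) (j : ℕ) (c : ℝ)
    (g : ℕ × ℕ → Plane → ℝ) (t : ℝ) :
    normalTrace P i j (c • g) t = c * normalTrace P i j g t := by
  simp only [normalTrace, Pi.smul_apply, smul_eq_mul, Finset.mul_sum]
  exact Finset.sum_congr rfl fun a _ => by ring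

lemma integrable_poly_test {K : Opens Plane} (q : MvPolynomial (Fin 2) ℝ) (φ : 𝓓(K, ℝ)) :
    Integrable (fun x : Plane => MvPolynomial.eval (fun k => x k) q * φ x)
      (volume.restrict (K : Set Plane)) := by
  have hq : Continuous fun x : Plane => MvPolynomial.eval (fun k => x k) q :=
    (MvPolynomial.continuous_eval q).comp (by fun_prop)
  exact ((hq.mul φ.continuous).integrable_of_hasCompactSupport
    φ.hasCompactSupport.mul_left).restrict

lemma HasPolyLaplacian.add {K : Opens Plane} {p : ℕ} {m : ℤ} {v v' : L2 K}
    (h : HasPolyLaplacian K p m v) (h' : HasPolyLaplacian K p m v') :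
    HasPolyLaplacian K p m (v + v') := by
  obtain ⟨q, hq, hv⟩ := h
  obtain ⟨q', hq', hv'⟩ := h'
  refine ⟨q + q', add_mem hq hq', fun φ => ?_⟩
  rw [integral_add_mul v v' (contDiff_polyLaplacian p φ.contDiff).continuous
    (hasCompactSupport_polyLaplacian p φ.hasCompactSupport), hv φ, hv' φ,
    ← integral_add (integrable_poly_test q φ) (integrable_poly_test q' φ)]
  simp only [map_add, add_mul]

lemma HasPolyLaplacian.smul {K : Opens Plane} {p : ℕ} {m : ℤ} {v : L2 K} (c : ℝ)
    (h : HasPolyLaplacian K p m v) : HasPolyLaplacian K p m (c • v) := by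
  obtain ⟨q, hq, hv⟩ := h
  refine ⟨c • q, Submodule.smul_mem _ c hq, fun φ => ?_⟩
  rw [integral_smul_mul, hv φ, ← integral_const_mul]
  simp only [MvPolynomial.smul_eval, mul_assoc]

/-! ### Virtual element spaces and degrees of freedom -/

/-- The space of all `v ∈ H^p(K)` with `Δ^p v ∈ ℙ_m(K)`, with `D^ν v ∈ C⁰(∂K)` for `|ν| ≤ p - 1`,
and with `∂_n^j v ∈ ℙ_{d j}(e)` for `j = 0, …, p - 1` and every edge `e`. -/
def vemSpace {N : ℕ} (P : Polygon Plane N) (K : Opens Plane) (p : ℕ) (m : ℤ) (d : ℕ → ℤ) :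
    Submodule ℝ (L2 K) where
  carrier := {v | MemSobolev K p v ∧ HasPolyLaplacian K p m v ∧
    ∃ g : ℕ × ℕ → Plane → ℝ, IsTraceJet P K p v g ∧
      ∀ i, ∀ j < p, IsEdgePoly (d j) (normalTrace P i j g)}
  zero_mem' := by
    refine ⟨fun ν _ => ⟨0, hasWeakDeriv_zero K ν⟩, ⟨0, zero_mem _, fun φ => ?_⟩, 0,
      isTraceJet_zero P K p, fun i j _ => ⟨0, zero_mem _, fun t _ => ?_⟩⟩
    · rw [integral_zero_mul]; simp
    · simp [normalTrace]
  add_mem' := by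
    rintro v v' ⟨hs, hl, g, hg, hd⟩ ⟨hs', hl', g', hg', hd'⟩
    refine ⟨fun ν hν => ?_, hl.add hl', g + g', hg.add hg', fun i j hj => ?_⟩
    · obtain ⟨w, hw⟩ := hs ν hν
      obtain ⟨w', hw'⟩ := hs' ν hν
      exact ⟨w + w', hw.add hw'⟩
    · obtain ⟨q, hq, he⟩ := hd i j hj
      obtain ⟨q', hq', he'⟩ := hd' i j hj
      refine ⟨q + q', add_mem hq hq', fun t ht => ?_⟩
      rw [normalTrace_add, he t ht, he' t ht, Polynomial.eval_add]
  smul_mem' := by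
    rintro c v ⟨hs, hl, g, hg, hd⟩
    refine ⟨fun ν hν => ?_, hl.smul c, c • g, hg.smul c, fun i j hj => ?_⟩
    · obtain ⟨w, hw⟩ := hs ν hν
      exact ⟨c • w, hw.smul c⟩
    · obtain ⟨q, hq, he⟩ := hd i j hj
      refine ⟨c • q, Submodule.smul_mem _ c hq, fun t ht => ?_⟩
      rw [normalTrace_smul, he t ht, Polynomial.eval_smul, smul_eq_mul]

/-- The local virtual element space `V^{K,p}_{h,r}`. -/
def localSpace {N : ℕ} (P : Polygon Plane N) (K : Opens Plane) (p r : ℕ) : Submodule ℝ (L2 K) :=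
  vemSpace P K p ((r : ℤ) - 2 * p) fun j => (r : ℤ) - j

/-- The local space `V^{K,p}_{h,r}` with `Δ^p v ∈ ℙ_{r-2p}(K)` replaced by
`Δ^p v ∈ ℙ_{r-2(p-t)}(K)`. -/
def enlargedSpace {N : ℕ} (P : Polygon Plane N) (K : Opens Plane) (p r t : ℕ) :
    Submodule ℝ (L2 K) :=
  vemSpace P K p ((r : ℤ) - 2 * ((p : ℤ) - t)) fun j => (r : ℤ) - j

/-- The modified lowest order space: `Δ^p v = 0`, `v ∈ ℙ_{2p-1}(e)`, and
`∂_n^j v ∈ ℙ_{2p-2-j}(e)` for `j = 1, …, p - 1`. -/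
def modifiedSpace {N : ℕ} (P : Polygon Plane N) (K : Opens Plane) (p : ℕ) : Submodule ℝ (L2 K) :=
  vemSpace P K p (-1) fun j => if j = 0 then 2 * (p : ℤ) - 1 else 2 * (p : ℤ) - 2 - j

/-- Values of the degrees of freedom: a number for every vertex and every multi-index with
`|ν| ≤ p - 1`; for every edge and every `j = 0, …, p - 1` the moments of `∂_n^j v` against
`ℙ_{μ j}(e)`, as a linear functional of the weight; and the moments of `v` against `ℙ_s(K)`. -/
abbrev DofData (N p : ℕ) (μ : ℕ → ℤ) (s : ℤ) : Type :=
  (Fin N → {ν : ℕ × ℕ // ν.1 + ν.2 < p} → ℝ) ×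
  (Fin N → (j : Fin p) → Module.Dual ℝ (edgePoly (μ j))) ×
  Module.Dual ℝ (bulkPoly s)

/-- `D` consists of the degrees of freedom of `v`, namely
`h_v^{|ν|} D^ν v(v)` for every vertex `v` and `|ν| ≤ p - 1` (here `h i > 0` is the length scale
attached to the `i`-th vertex),
`h_e^{-1+j} ∫_e q ∂_n^j v ds` for every edge `e`, `j = 0, …, p - 1` and `q ∈ ℙ_{μ j}(e)`, and
`h_K^{-2} ∫_K q v dx` for every `q ∈ ℙ_s(K)`. -/
def HasDofs {N : ℕ} (P : Polygon Plane N) (K : Opens Plane) (h : Fin N → ℝ) (p : ℕ) (μ : ℕ → ℤ)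
    (s : ℤ) (v : L2 K) (D : DofData N p μ s) : Prop :=
  (∃ g : ℕ × ℕ → Plane → ℝ, IsTraceJet P K p v g ∧
    (∀ i ν, D.1 i ν = h i ^ (ν.1.1 + ν.1.2) * g ν.1 (P i)) ∧
    ∀ i (j : Fin p) (q : edgePoly (μ j)), D.2.1 i j q =
      edgeLength P i ^ (-1 + (j : ℤ)) *
        edgeIntegral P i fun t => (q : Polynomial ℝ).eval t * normalTrace P i j g t) ∧
  ∀ q : bulkPoly s, D.2.2 q = Metric.diam (K : Set Plane) ^ (-2 : ℤ) *
    ∫ x in (K : Set Plane), MvPolynomial.eval (fun k => x k) (q : MvPolynomial (Fin 2) ℝ) * v x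

/-- The degrees of freedom are unisolvent for `V`: they are well-defined linear functionals on `V`,
and for every choice of their values there is exactly one `v ∈ V` that attains these values. -/
def Unisolvent {N : ℕ} (P : Polygon Plane N) (K : Opens Plane) (h : Fin N → ℝ) (p : ℕ) (μ : ℕ → ℤ)
    (s : ℤ) (V : Submodule ℝ (L2 K)) : Prop :=
  ∃ Φ : V ≃ₗ[ℝ] DofData N p μ s, ∀ (v : V) (D : DofData N p μ s),
    HasDofs P K h p μ s v D ↔ Φ v = D

/-- The degrees of freedom determine the elements of `V`: they are well-defined linear functionals
on `V`, and two elements of `V` with the same values coincide. -/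
def Determined {N : ℕ} (P : Polygon Plane N) (K : Opens Plane) (h : Fin N → ℝ) (p : ℕ) (μ : ℕ → ℤ)
    (s : ℤ) (V : Submodule ℝ (L2 K)) : Prop :=
  ∃ Φ : V →ₗ[ℝ] DofData N p μ s, Function.Injective Φ ∧ ∀ (v : V) (D : DofData N p μ s),
    HasDofs P K h p μ s v D ↔ Φ v = D

end VEM

namespace VEM

open MeasureTheory Set Filter Topology TopologicalSpace
open scoped ContDiff Distributions

/-! ### Constant coefficient differential operators and jets -/

/-! The degrees of the polynomials matter only through the count `dim ℙ_{d j} = 2 (p - j) + dim ℙ_{μ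
j}` for `j < p`; all parts are instances of `determined_vemSpace` and `unisolvent_vemSpace` under
this count.

Boundary. The jets at the vertices fix the tangential derivatives of order less than `p - j` of the
polynomial `∂_n^j v` at both ends of an edge, and the moments supply the remaining conditions. This
Hermite problem is uniquely solvable: with zero data the polynomial is, up to sign, `t^k (1 - t)^k
w` with `k = p - j`, and `w` is itself an admissible weight, so `w = 0` (`hermite_moment_unique`).
Since tangential and normal derivatives determine the whole jet, the boundary values fix the traces
of all `D^ν v` with `|ν| < p`.

Interior. On the closure of the jets of test functions, the model of `H^p_0(K)`, the energy
belonging to `(-1)^p Δ^p` is coercive by Poincaré's inequality, so the Dirichlet problem is uniquely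
solvable (`exists_dirichlet`, `zeroJet_eq_zero`). If all values vanish, then `v ∈ H^p_0(K)`, and
testing `Δ^p v = q` with `v` gives energy `± ∫ q v = 0`, because `q` is one of the weights.
Conversely, a weight `q` that annihilates every bubble annihilates the solution of `Δ^p u = q` with
zero data; then `u = 0` and `q = 0`. In finite dimension this means that bubbles attain all bulk
moments (`exists_bubble`).

Two bridges carry the analytic weight. Vanishing traces must put `v` into `H^p_0(K)`
(`exists_weakJet`): the extension by zero has weak derivatives on the whole plane, the vertices
being negligible because points have zero capacity, and it is then cut into pieces that are
translated into `K` and mollified. The translations exist because `K` lies on one side only of each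
edge, which follows from the `2π` jump of the angle under which the polygon is seen
(`not_two_sided`). In the other direction, Hermite data must lift to `H^p(K)`
(`exists_polynomial_lift`): two edgewise polynomials with the same jet of order less than `p` at a
vertex are joined by a cut-off that is homogeneous of degree zero there. Their difference is `O(|x -
V|^p)`, so the derivatives of the product up to order `p` remain bounded. -/

lemma partialD_comm {f : Plane → ℝ} (hf : ContDiff ℝ ∞ f) (k l : Fin 2) :
    partialD k (partialD l f) = partialD l (partialD k f) := by
  have key : ∀ (k l : Fin 2) (x : Plane), partialD k (partialD l f) x =
      fderiv ℝ (fderiv ℝ f) x (EuclideanSpace.single k 1) (EuclideanSpace.single l 1) := by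
    intro k l x
    unfold partialD
    have h : DifferentiableAt ℝ (fderiv ℝ f) x :=
      ((hf.fderiv_right (m := ∞) (by simp)).differentiable (by simp)) x
    rw [fderiv_clm_apply h (differentiableAt_const _)]
    simp
  funext x
  rw [key, key]
  exact (hf.contDiffAt.isSymmSndFDerivAt
    (by simpa using (WithTop.coe_le_coe.2 le_top : ((2 : ℕ∞) : WithTop ℕ∞) ≤ ∞))).eq _ _

/-- The multi-index of the `k`-th partial derivative. -/
def unitIndex (k : Fin 2) : ℕ × ℕ := if k = 0 then (1, 0) else (0, 1)

lemma multiD_unitIndex (k : Fin 2) (f : Plane → ℝ) : multiD (unitIndex k) f = partialD k f := by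
  fin_cases k <;> rfl

lemma unitIndex_sum (k : Fin 2) : (unitIndex k).1 + (unitIndex k).2 = 1 := by
  fin_cases k <;> rfl

lemma contDiff_iterate_partialD (k : Fin 2) (n : ℕ) {f : Plane → ℝ} (hf : ContDiff ℝ ∞ f) :
    ContDiff ℝ ∞ ((partialD k)^[n] f) := by
  fin_cases k
  · exact contDiff_multiD hf (n, 0)
  · exact contDiff_multiD hf (0, n)

lemma partialD_iterate_comm (k l : Fin 2) (n : ℕ) {f : Plane → ℝ} (hf : ContDiff ℝ ∞ f) :
    (partialD k)^[n] (partialD l f) = partialD l ((partialD k)^[n] f) := by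
  induction n with
  | zero => rfl
  | succ n ih =>
    rw [Function.iterate_succ_apply', ih, Function.iterate_succ_apply',
      partialD_comm (contDiff_iterate_partialD k n hf)]

lemma partialD_multiD (k : Fin 2) (ν : ℕ × ℕ) {f : Plane → ℝ} (hf : ContDiff ℝ ∞ f) :
    partialD k (multiD ν f) = multiD (ν + unitIndex k) f := by
  obtain ⟨a, b⟩ := ν
  fin_cases k
  · simp [multiD, unitIndex, Function.iterate_succ_apply']
  · simp only [multiD, unitIndex, Fin.mk_one, one_ne_zero, if_false, Prod.mk_add_mk, add_zero,
      Function.iterate_succ_apply']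
    rw [partialD_iterate_comm 0 1 a (contDiff_iterate_partialD 1 b hf)]

lemma multiD_partialD (k : Fin 2) (ν : ℕ × ℕ) {f : Plane → ℝ} (hf : ContDiff ℝ ∞ f) :
    multiD ν (partialD k f) = multiD (ν + unitIndex k) f := by
  rw [← partialD_multiD k ν hf]
  unfold multiD
  rw [partialD_iterate_comm 1 k _ hf,
    partialD_iterate_comm 0 k _ (contDiff_iterate_partialD 1 _ hf)]

/-- Allows identities for `D^ν` to be proved one partial derivative at a time, in whichever
direction comes next. -/
lemma index_induction {motive : ℕ × ℕ → Prop} (zero : motive 0)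
    (step : ∀ ν k, motive ν → motive (ν + unitIndex k)) (ν : ℕ × ℕ) : motive ν := by
  obtain ⟨a, b⟩ := ν
  induction b with
  | zero =>
    induction a with
    | zero => exact zero
    | succ a ih => simpa [unitIndex] using step _ 0 ih
  | succ b ih => simpa [unitIndex] using step _ 1 ih

lemma multiD_multiD (ν κ : ℕ × ℕ) {f : Plane → ℝ} (hf : ContDiff ℝ ∞ f) :
    multiD ν (multiD κ f) = multiD (ν + κ) f := by
  induction ν using index_induction with
  | zero => simp [multiD]
  | step ν k ih =>
    rw [← partialD_multiD k ν (contDiff_multiD hf κ), ih, partialD_multiD k _ hf, add_right_comm]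

lemma multiD_add (ν : ℕ × ℕ) {f g : Plane → ℝ} (hf : ContDiff ℝ ∞ f) (hg : ContDiff ℝ ∞ g) :
    multiD ν (f + g) = multiD ν f + multiD ν g := by
  induction ν using index_induction with
  | zero => rfl
  | step ν k ih =>
    have hfg : ContDiff ℝ ∞ (f + g) := hf.add hg
    rw [← partialD_multiD k ν hfg, ih,
      partialD_add (contDiff_multiD hf ν) (contDiff_multiD hg ν), partialD_multiD k ν hf,
      partialD_multiD k ν hg]

lemma multiD_smul (ν : ℕ × ℕ) {f : Plane → ℝ} (hf : ContDiff ℝ ∞ f) (c : ℝ) :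
    multiD ν (c • f) = c • multiD ν f := by
  induction ν using index_induction with
  | zero => rfl
  | step ν k ih =>
    have hcf : ContDiff ℝ ∞ (c • f) := hf.const_smul c
    rw [← partialD_multiD k ν hcf, ih, partialD_smul (contDiff_multiD hf ν),
      partialD_multiD k ν hf]

lemma multiD_zero (ν : ℕ × ℕ) : multiD ν (0 : Plane → ℝ) = 0 := by
  simpa using multiD_smul ν (f := (0 : Plane → ℝ)) contDiff_const 0

lemma multiD_sum {ι : Type*} (s : Finset ι) (ν : ℕ × ℕ) {f : ι → Plane → ℝ}
    (hf : ∀ i ∈ s, ContDiff ℝ ∞ (f i)) : multiD ν (∑ i ∈ s, f i) = ∑ i ∈ s, multiD ν (f i) := by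
  classical
  induction s using Finset.induction_on with
  | empty => simp [multiD_zero]
  | insert a s ha ih =>
    have hs : ContDiff ℝ ∞ (∑ i ∈ s, f i) := by
      have : (∑ i ∈ s, f i) = fun x => ∑ i ∈ s, f i x := by funext x; simp
      rw [this]
      exact ContDiff.sum fun i hi => hf i (Finset.mem_insert_of_mem hi)
    rw [Finset.sum_insert ha, Finset.sum_insert ha,
      multiD_add ν (hf a (Finset.mem_insert_self a s)) hs,
      ih fun i hi => hf i (Finset.mem_insert_of_mem hi)]

lemma partialD_congr {f g : Plane → ℝ} {x : Plane} (h : f =ᶠ[𝓝 x] g) (k : Fin 2) :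
    partialD k f =ᶠ[𝓝 x] partialD k g := by
  filter_upwards [Filter.EventuallyEq.fderiv (𝕜 := ℝ) h] with y hy
  simp [partialD, hy]

lemma multiD_congr {f g : Plane → ℝ} {x : Plane} (h : f =ᶠ[𝓝 x] g) (ν : ℕ × ℕ) :
    multiD ν f =ᶠ[𝓝 x] multiD ν g := by
  have key : ∀ (k : Fin 2) (n : ℕ) {f g : Plane → ℝ}, f =ᶠ[𝓝 x] g →
      (partialD k)^[n] f =ᶠ[𝓝 x] (partialD k)^[n] g := by
    intro k n
    induction n with
    | zero => intro f g h; exact h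
    | succ n ih => intro f g h; exact ih (partialD_congr h k)
  exact key 0 _ (key 1 _ h)

lemma tsupport_partialD_subset (f : Plane → ℝ) (k : Fin 2) :
    tsupport (partialD k f) ⊆ tsupport f :=
  (tsupport_comp_subset (g := fun L : Plane →L[ℝ] ℝ => L (EuclideanSpace.single k 1)) rfl _).trans
    (tsupport_fderiv_subset ℝ)

lemma tsupport_multiD_subset (f : Plane → ℝ) (ν : ℕ × ℕ) : tsupport (multiD ν f) ⊆ tsupport f := by
  have key : ∀ (k : Fin 2) (n : ℕ) (h : Plane → ℝ),
      tsupport ((partialD k)^[n] h) ⊆ tsupport h := by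
    intro k n
    induction n with
    | zero => intro h; exact subset_rfl
    | succ n ih => intro h; exact (ih _).trans (tsupport_partialD_subset h k)
  exact (key 0 _ _).trans (key 1 _ _)

/-- The pairing of the symbol of a differential operator with a jet. -/
noncomputable def pair (g : ℕ × ℕ → ℝ) : MvPolynomial (Fin 2) ℝ →ₗ[ℝ] ℝ :=
  (MvPolynomial.basisMonomials (Fin 2) ℝ).constr ℝ fun s => g (s 0, s 1)

lemma pair_monomial (g : ℕ × ℕ → ℝ) (s : Fin 2 →₀ ℕ) (c : ℝ) :
    pair g (MvPolynomial.monomial s c) = c * g (s 0, s 1) := by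
  have h1 : MvPolynomial.monomial s c = c • MvPolynomial.basisMonomials (Fin 2) ℝ s := by
    simp [MvPolynomial.coe_basisMonomials, MvPolynomial.smul_monomial]
  rw [h1, map_smul, pair, Module.Basis.constr_basis, smul_eq_mul]

lemma pair_one (g : ℕ × ℕ → ℝ) : pair g 1 = g 0 := by
  exact (pair_monomial g 0 1).trans (one_mul _)

/-- The jet of the `k`-th partial derivative. -/
def shiftJet (k : Fin 2) (g : ℕ × ℕ → ℝ) : ℕ × ℕ → ℝ := fun ν => g (ν + unitIndex k)

/-- Multiplying the symbol by a variable is the same as differentiating the jet. Differential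
operators in arbitrary directions thereby become polynomial algebra. -/
lemma pair_X_mul (g : ℕ × ℕ → ℝ) (k : Fin 2) (σ : MvPolynomial (Fin 2) ℝ) :
    pair g (MvPolynomial.X k * σ) = pair (shiftJet k g) σ := by
  induction σ using MvPolynomial.induction_on' with
  | monomial s c =>
    rw [MvPolynomial.X, MvPolynomial.monomial_mul, pair_monomial, pair_monomial, one_mul, shiftJet]
    congr 2
    fin_cases k <;> simp [unitIndex, add_comm]
  | add p q hp hq => rw [mul_add, map_add, map_add, hp, hq]

/-- The symbol of the directional derivative along `u`. -/
noncomputable def lin (u : Plane) : MvPolynomial (Fin 2) ℝ :=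
  MvPolynomial.C (u 0) * MvPolynomial.X 0 + MvPolynomial.C (u 1) * MvPolynomial.X 1

lemma pair_lin_mul (g : ℕ × ℕ → ℝ) (u : Plane) (σ : MvPolynomial (Fin 2) ℝ) :
    pair g (lin u * σ) = u 0 * pair (shiftJet 0 g) σ + u 1 * pair (shiftJet 1 g) σ := by
  rw [lin, add_mul, mul_assoc, mul_assoc, map_add, MvPolynomial.C_mul', MvPolynomial.C_mul',
    map_smul, map_smul, pair_X_mul, pair_X_mul, smul_eq_mul, smul_eq_mul]

lemma pair_sub_jet (g g' : ℕ × ℕ → ℝ) (σ : MvPolynomial (Fin 2) ℝ) :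
    pair (g - g') σ = pair g σ - pair g' σ := by
  induction σ using MvPolynomial.induction_on' with
  | monomial s c => simp [pair_monomial, mul_sub]
  | add p q hp hq => rw [map_add, map_add, map_add, hp, hq]; ring

lemma pair_eq_sum (g : ℕ × ℕ → ℝ) (σ : MvPolynomial (Fin 2) ℝ) :
    pair g σ = ∑ s ∈ σ.support, σ.coeff s * g (s 0, s 1) := by
  conv_lhs => rw [σ.as_sum]
  rw [map_sum]
  exact Finset.sum_congr rfl fun s _ => pair_monomial g s _

/-- The differential operator with symbol `σ`. -/
noncomputable def symb (σ : MvPolynomial (Fin 2) ℝ) (f : Plane → ℝ) : Plane → ℝ :=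
  fun x => pair (fun ν => multiD ν f x) σ

/-- The directional derivative along `u`. -/
noncomputable def dirD (u : Plane) (f : Plane → ℝ) : Plane → ℝ := fun x => fderiv ℝ f x u

lemma plane_eq_add (u : Plane) :
    u = u 0 • EuclideanSpace.single 0 1 + u 1 • EuclideanSpace.single 1 1 := by
  ext k
  fin_cases k <;> simp

lemma dirD_eq (u : Plane) (f : Plane → ℝ) (x : Plane) :
    dirD u f x = u 0 * partialD 0 f x + u 1 * partialD 1 f x := by
  unfold dirD partialD
  conv_lhs => rw [plane_eq_add u]
  simp

lemma contDiff_dirD {f : Plane → ℝ} (hf : ContDiff ℝ ∞ f) (u : Plane) : ContDiff ℝ ∞ (dirD u f) :=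
  (hf.fderiv_right (m := ∞) (by simp)).clm_apply contDiff_const

lemma symb_one (f : Plane → ℝ) : symb 1 f = f := by
  funext x
  simp [symb, pair_one, multiD]

lemma symb_eq_sum (σ : MvPolynomial (Fin 2) ℝ) (f : Plane → ℝ) :
    symb σ f = fun x => ∑ s ∈ σ.support, σ.coeff s * multiD (s 0, s 1) f x := by
  funext x
  rw [symb, pair_eq_sum]

lemma contDiff_symb {f : Plane → ℝ} (hf : ContDiff ℝ ∞ f) (σ : MvPolynomial (Fin 2) ℝ) :
    ContDiff ℝ ∞ (symb σ f) := by
  rw [symb_eq_sum]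
  exact ContDiff.sum fun s _ => contDiff_const.mul (contDiff_multiD hf _)

lemma partialD_symb {f : Plane → ℝ} (hf : ContDiff ℝ ∞ f) (k : Fin 2)
    (σ : MvPolynomial (Fin 2) ℝ) : partialD k (symb σ f) = symb (MvPolynomial.X k * σ) f := by
  have hadd : ∀ p q : MvPolynomial (Fin 2) ℝ, symb (p + q) f = symb p f + symb q f := by
    intro p q; funext x; simp [symb]
  induction σ using MvPolynomial.induction_on' with
  | monomial s c =>
    have h1 : symb (MvPolynomial.monomial s c) f = c • multiD (s 0, s 1) f := by
      funext x; simp [symb, pair_monomial]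
    rw [h1, partialD_smul (contDiff_multiD hf _), partialD_multiD k _ hf]
    funext x
    rw [symb, pair_X_mul, pair_monomial]
    rfl
  | add p q hp hq =>
    rw [hadd, partialD_add (contDiff_symb hf p) (contDiff_symb hf q), hp, hq, mul_add, hadd]

lemma symb_lin_mul {f : Plane → ℝ} (hf : ContDiff ℝ ∞ f) (u : Plane)
    (σ : MvPolynomial (Fin 2) ℝ) : symb (lin u * σ) f = dirD u (symb σ f) := by
  funext x
  rw [dirD_eq, partialD_symb hf, partialD_symb hf, symb, pair_lin_mul, symb, symb, pair_X_mul,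
    pair_X_mul]

lemma symb_lin_pow {f : Plane → ℝ} (hf : ContDiff ℝ ∞ f) (u w : Plane) (k j : ℕ) :
    symb (lin u ^ k * lin w ^ j) f = (dirD u)^[k] ((dirD w)^[j] f) := by
  have h1 : symb (lin w ^ j) f = (dirD w)^[j] f := by
    induction j with
    | zero => simp [symb_one]
    | succ j ih => rw [pow_succ', symb_lin_mul hf, ih, Function.iterate_succ_apply']
  induction k with
  | zero => simpa using h1
  | succ k ih => rw [pow_succ', mul_assoc, symb_lin_mul hf, ih, Function.iterate_succ_apply']

lemma laplacian_eq_partialD {f : Plane → ℝ} (hf : ContDiff ℝ ∞ f) :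
    Laplacian.laplacian f = symb (MvPolynomial.X 0 ^ 2 + MvPolynomial.X 1 ^ 2) f := by
  have key : ∀ k : Fin 2, symb (MvPolynomial.X k ^ 2) f = partialD k (partialD k f) := by
    intro k
    rw [pow_two, ← partialD_symb hf, ← mul_one (MvPolynomial.X k), ← partialD_symb hf, symb_one]
  have h2 : symb (MvPolynomial.X 0 ^ 2 + MvPolynomial.X 1 ^ 2) f =
      symb (MvPolynomial.X 0 ^ 2) f + symb (MvPolynomial.X 1 ^ 2) f := by
    funext x; simp [symb]
  rw [h2, key, key, laplacian_eq_sum]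
  funext x
  rw [Fin.sum_univ_two, Pi.add_apply]
  have h : DifferentiableAt ℝ (fderiv ℝ f) x :=
      ((hf.fderiv_right (m := ∞) (by simp)).differentiable (by simp)) x
  congr 1 <;>
  · rw [iteratedFDeriv_two_apply]
    unfold partialD
    rw [fderiv_clm_apply h (differentiableAt_const _)]
    simp

lemma symb_mul {f : Plane → ℝ} (hf : ContDiff ℝ ∞ f) (σ ρ : MvPolynomial (Fin 2) ℝ) :
    symb (σ * ρ) f = symb σ (symb ρ f) := by
  induction σ using MvPolynomial.induction_on with
  | C a =>
    funext x
    have h1 : ∀ h : Plane → ℝ, symb (MvPolynomial.C a) h x = a * h x := by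
      intro h
      have := pair_monomial (fun ν => multiD ν h x) 0 a
      rwa [MvPolynomial.monomial_zero'] at this
    rw [h1, symb, MvPolynomial.C_mul', map_smul]
    rfl
  | add p q hp hq =>
    have hadd : ∀ (p q : MvPolynomial (Fin 2) ℝ) (h : Plane → ℝ),
        symb (p + q) h = symb p h + symb q h := by
      intro p q h; funext x; simp [symb]
    rw [add_mul, hadd, hadd, hp, hq]
  | mul_X p k hp =>
    rw [mul_comm p, mul_assoc, ← partialD_symb hf, hp, partialD_symb (contDiff_symb hf ρ)]

lemma polyLaplacian_eq_symb (p : ℕ) {f : Plane → ℝ} (hf : ContDiff ℝ ∞ f) :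
    polyLaplacian p f = symb ((MvPolynomial.X 0 ^ 2 + MvPolynomial.X 1 ^ 2) ^ p) f := by
  unfold polyLaplacian
  induction p generalizing f with
  | zero => simp [symb_one]
  | succ p ih =>
    rw [Function.iterate_succ_apply, laplacian_eq_partialD hf, ih (contDiff_symb hf _),
      ← symb_mul hf, ← pow_succ]

lemma pair_X_pow_mul (g : ℕ × ℕ → ℝ) (a b : ℕ) (c : ℝ) :
    pair g (MvPolynomial.C c * (MvPolynomial.X 0 ^ a * MvPolynomial.X 1 ^ b)) = c * g (a, b) := by
  have h : MvPolynomial.C c * (MvPolynomial.X 0 ^ a * MvPolynomial.X 1 ^ b) =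
      MvPolynomial.monomial (Finsupp.single (0 : Fin 2) a + Finsupp.single 1 b) c := by
    rw [MvPolynomial.X_pow_eq_monomial, MvPolynomial.X_pow_eq_monomial, MvPolynomial.monomial_mul,
      MvPolynomial.C_mul_monomial]
    simp
  rw [h, pair_monomial]
  simp

/-- The binomial expansion of the symbol `(X 0 ^ 2 + X 1 ^ 2) ^ p`. Its coefficients are the weights
of `energy`. -/
lemma polyLaplacian_eq_sum (p : ℕ) {f : Plane → ℝ} (hf : ContDiff ℝ ∞ f) (x : Plane) :
    polyLaplacian p f x =
      ∑ a ∈ Finset.range (p + 1), (p.choose a : ℝ) * multiD (2 * a, 2 * (p - a)) f x := by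
  rw [polyLaplacian_eq_symb p hf, symb, add_pow, map_sum]
  refine Finset.sum_congr rfl fun a _ => ?_
  rw [← pair_X_pow_mul (fun ν => multiD ν f x), ← pow_mul, ← pow_mul, mul_comm]
  simp

lemma pair_lin_pow (g : ℕ × ℕ → ℝ) (u : Plane) (j : ℕ) :
    pair g (lin u ^ j) = ∑ a ∈ Finset.range (j + 1),
      (j.choose a : ℝ) * u 0 ^ a * u 1 ^ (j - a) * g (a, j - a) := by
  rw [lin, add_pow, map_sum]
  refine Finset.sum_congr rfl fun a _ => ?_
  rw [← pair_X_pow_mul]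
  congr 1
  simp only [map_mul, map_pow, mul_pow, map_natCast]
  ring

/-- The coordinate formula of `normalTrace` is the `j`-th power of one linear symbol, so it can be
combined with powers of the tangential symbol. -/
lemma normalTrace_eq_pair {N : ℕ} (P : Polygon Plane N) (i : Fin N) (j : ℕ)
    (g : ℕ × ℕ → Plane → ℝ) (t : ℝ) :
    normalTrace P i j g t = pair (fun ν => g ν (P.edgePath ℝ i t)) (lin (edgeNormal P i) ^ j) := by
  rw [pair_lin_pow]
  rfl

/-! ### Leibniz rule -/

/-- The jet of a product. -/
def jetMul (a b : ℕ × ℕ → ℝ) (ν : ℕ × ℕ) : ℝ :=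
  ∑ κ ∈ Finset.HasAntidiagonal.antidiagonal ν.1, ∑ l ∈ Finset.HasAntidiagonal.antidiagonal ν.2,
    (ν.1.choose κ.1 : ℝ) * (ν.2.choose l.1) * (a (κ.1, l.1) * b (κ.2, l.2))

lemma partialD_mul {f g : Plane → ℝ} (hf : ContDiff ℝ ∞ f) (hg : ContDiff ℝ ∞ g) (k : Fin 2) :
    partialD k (f * g) = partialD k f * g + f * partialD k g := by
  funext x
  simp only [partialD, Pi.add_apply, Pi.mul_apply]
  rw [fderiv_mul (hf.differentiable (by simp) x) (hg.differentiable (by simp) x)]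
  simp
  ring

lemma contDiff_finset_sum {ι : Type*} {s : Finset ι} {f : ι → Plane → ℝ}
    (hf : ∀ i ∈ s, ContDiff ℝ ∞ (f i)) : ContDiff ℝ ∞ (∑ i ∈ s, f i) := by
  have : (∑ i ∈ s, f i) = fun x => ∑ i ∈ s, f i x := by funext x; simp
  rw [this]
  exact ContDiff.sum hf

lemma partialD_sum {ι : Type*} (s : Finset ι) (k : Fin 2) {f : ι → Plane → ℝ}
    (hf : ∀ i ∈ s, ContDiff ℝ ∞ (f i)) :
    partialD k (∑ i ∈ s, f i) = ∑ i ∈ s, partialD k (f i) := by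
  simpa only [multiD_unitIndex] using multiD_sum s (unitIndex k) hf

lemma partialD_iterate_mul {f g : Plane → ℝ} (hf : ContDiff ℝ ∞ f) (hg : ContDiff ℝ ∞ g)
    (k : Fin 2) (n : ℕ) :
    (partialD k)^[n] (f * g) = ∑ κ ∈ Finset.HasAntidiagonal.antidiagonal n,
      (n.choose κ.1 : ℝ) • ((partialD k)^[κ.1] f * (partialD k)^[κ.2] g) := by
  induction n with
  | zero => simp
  | succ n ih =>
    have hs : ∀ a b : ℕ, ContDiff ℝ ∞ ((partialD k)^[a] f * (partialD k)^[b] g) := fun a b =>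
      (contDiff_iterate_partialD k a hf).mul (contDiff_iterate_partialD k b hg)
    have hs' : ∀ (c : ℝ) (a b : ℕ), ContDiff ℝ ∞ (c • ((partialD k)^[a] f * (partialD k)^[b] g)) :=
      fun c a b => (hs a b).const_smul c
    rw [Function.iterate_succ_apply', ih, partialD_sum _ _ fun κ _ => hs' _ _ _]
    -- Pascal's rule summed over an antidiagonal. Scalars are rewritten as constant functions so
    -- that it applies in the ring of functions.
    have h := Finset.sum_antidiagonal_choose_succ_mul
      (fun a b => (partialD k)^[a] f * (partialD k)^[b] g) n
    have hc : ∀ (m : ℕ) (F : Plane → ℝ), (m : ℝ) • F = (m : Plane → ℝ) * F := by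
      intro m F; funext x; simp
    simp only [hc] at h ⊢
    rw [h, ← Finset.sum_add_distrib]
    refine Finset.sum_congr rfl fun κ hκ => ?_
    rw [← hc, partialD_smul (hs _ _), partialD_mul (contDiff_iterate_partialD k _ hf)
      (contDiff_iterate_partialD k _ hg), ← Function.iterate_succ_apply' (partialD k),
      ← Function.iterate_succ_apply' (partialD k), hc,
      Nat.choose_symm_of_eq_add (Finset.HasAntidiagonal.mem_antidiagonal.1 hκ).symm]
    ring

lemma multiD_mul {f g : Plane → ℝ} (hf : ContDiff ℝ ∞ f) (hg : ContDiff ℝ ∞ g) (ν : ℕ × ℕ)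
    (x : Plane) : multiD ν (f * g) x =
      jetMul (fun κ => multiD κ f x) (fun κ => multiD κ g x) ν := by
  have hs : ∀ a b : ℕ, ContDiff ℝ ∞ ((partialD 1)^[a] f * (partialD 1)^[b] g) := fun a b =>
    (contDiff_iterate_partialD 1 a hf).mul (contDiff_iterate_partialD 1 b hg)
  have h1 : multiD ν (f * g) = multiD (ν.1, 0) (multiD (0, ν.2) (f * g)) := by
    simp [multiD]
  have h2 : multiD (0, ν.2) (f * g) = (partialD 1)^[ν.2] (f * g) := rfl
  have hs' : ∀ (c : ℝ) (a b : ℕ), ContDiff ℝ ∞ (c • ((partialD 1)^[a] f * (partialD 1)^[b] g)) :=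
    fun c a b => (hs a b).const_smul c
  rw [h1, h2, partialD_iterate_mul hf hg, multiD_sum _ _ fun κ _ => hs' _ _ _,
    Finset.sum_apply, jetMul, Finset.sum_comm]
  refine Finset.sum_congr rfl fun l _ => ?_
  rw [multiD_smul _ (hs _ _)]
  have h3 : ∀ F : Plane → ℝ, multiD (ν.1, 0) F = (partialD 0)^[ν.1] F := fun _ => rfl
  rw [h3, partialD_iterate_mul (contDiff_iterate_partialD 1 _ hf)
    (contDiff_iterate_partialD 1 _ hg), Pi.smul_apply, Finset.sum_apply, Finset.smul_sum]
  refine Finset.sum_congr rfl fun κ _ => ?_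
  simp only [Pi.smul_apply, Pi.mul_apply, smul_eq_mul, multiD]
  ring

end VEM

namespace VEM

open MeasureTheory Set Filter Topology TopologicalSpace
open scoped ContDiff Distributions Manifold

/-! ### Smooth partitions of unity on compact sets -/

/-- The sum is one on a neighbourhood of each point of `S`, not just on `S`, so that all its
derivatives vanish there; hence the intermediate compact set `S'`. The unit balls only serve to make
the supports compact. -/
lemma exists_smooth_partition {S : Set Plane} (hS : IsCompact S) {U : Plane → Set Plane}
    (hU : ∀ x ∈ S, U x ∈ 𝓝 x) :
    ∃ (s : Finset Plane) (θ : s → Plane → ℝ), (∀ x : s, (x : Plane) ∈ S) ∧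
      (∀ x, ContDiff ℝ ∞ (θ x)) ∧ (∀ x, HasCompactSupport (θ x)) ∧
      (∀ x : s, tsupport (θ x) ⊆ U x) ∧ ∀ y ∈ S, ∀ᶠ z in 𝓝 y, ∑ x, θ x z = 1 := by
  obtain ⟨s, hs, hcov⟩ := hS.elim_nhds_subcover (fun x => interior (U x) ∩ Metric.ball x 1)
    fun x hx => inter_mem (interior_mem_nhds.2 (hU x hx)) (Metric.ball_mem_nhds x one_pos)
  have hopen : IsOpen (⋃ x ∈ s, interior (U x) ∩ Metric.ball x 1) :=
    isOpen_biUnion fun x _ => isOpen_interior.inter Metric.isOpen_ball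
  obtain ⟨S', hS', h1, h2⟩ := exists_compact_between hS hopen hcov
  obtain ⟨f, hf⟩ := SmoothPartitionOfUnity.exists_isSubordinate 𝓘(ℝ, Plane) hS'.isClosed
    (fun x : s => interior (U x) ∩ Metric.ball (x : Plane) 1)
    (fun x => isOpen_interior.inter Metric.isOpen_ball) (by
      intro x hx
      obtain ⟨i, hi, hxi⟩ := mem_iUnion₂.1 (h2 hx)
      exact mem_iUnion.2 ⟨⟨i, hi⟩, hxi⟩)
  refine ⟨s, fun x => f x, fun x => hs x x.2, fun x => (f x).contMDiff.contDiff, fun x => ?_,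
    fun x => (hf x).trans (inter_subset_left.trans interior_subset), fun y hy => ?_⟩
  · refine HasCompactSupport.of_support_subset_isCompact (isCompact_closedBall (x : Plane) 1) ?_
    exact (subset_tsupport _).trans
      ((hf x).trans (inter_subset_right.trans Metric.ball_subset_closedBall))
  · filter_upwards [mem_interior_iff_mem_nhds.1 (h1 hy)] with z hz
    rw [← finsum_eq_sum_of_fintype]
    exact f.sum_eq_one hz

/-! ### Convergence of pairings and integration by parts -/

lemma tendsto_integral_mul {α : Type*} [MeasurableSpace α] {μ : Measure α} {f : ℕ → α → ℝ}
    {w ψ : α → ℝ} (hf : ∀ n, AEStronglyMeasurable (f n) μ) (hw : MemLp w 2 μ) (hψ : MemLp ψ 2 μ)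
    (h : Tendsto (fun n => eLpNorm (f n - w) 2 μ) atTop (𝓝 0)) :
    Tendsto (fun n => ∫ x, f n x * ψ x ∂μ) atTop (𝓝 (∫ x, w x * ψ x ∂μ)) := by
  have hle : ∀ n, eLpNorm ((fun x => f n x * ψ x) - fun x => w x * ψ x) 1 μ ≤
      eLpNorm (f n - w) 2 μ * eLpNorm ψ 2 μ := by
    intro n
    have h1 : ((fun x => f n x * ψ x) - fun x => w x * ψ x) = (f n - w) • ψ := by
      funext x; simp [sub_mul]
    rw [h1]
    exact eLpNorm_smul_le_mul_eLpNorm hψ.1 ((hf n).sub hw.1)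
  refine tendsto_integral_of_L1' _ (hw.integrable_mul hψ).1 ?_ ?_
  · filter_upwards [(tendsto_order.1 h).2 ⊤ ENNReal.zero_lt_top] with n hn
    have h2 : MemLp (f n - w) 2 μ := ⟨(hf n).sub hw.1, hn⟩
    have h3 := h2.add hw
    rw [sub_add_cancel] at h3
    exact h3.integrable_mul hψ
  · refine tendsto_of_tendsto_of_tendsto_of_le_of_le tendsto_const_nhds ?_ (fun _ => zero_le) hle
    simpa using ENNReal.Tendsto.mul_const h (Or.inr hψ.2.ne)

lemma integral_mul_partialD {f φ : Plane → ℝ} (hf : ContDiff ℝ ∞ f) (hφ : ContDiff ℝ ∞ φ)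
    (hc : HasCompactSupport φ) (k : Fin 2) :
    ∫ x, f x * partialD k φ x = -∫ x, partialD k f x * φ x := by
  unfold partialD
  refine integral_mul_fderiv_eq_neg_fderiv_mul_of_integrable ?_ ?_ ?_
    (fun x _ => hf.differentiable (by simp) x) (fun x _ => hφ.differentiable (by simp) x)
  · exact ((contDiff_partialD hf k).continuous.mul hφ.continuous).integrable_of_hasCompactSupport
      hc.mul_left
  · exact (hf.continuous.mul (contDiff_partialD hφ k).continuous).integrable_of_hasCompactSupport
      (hasCompactSupport_partialD hc k).mul_left
  · exact (hf.continuous.mul hφ.continuous).integrable_of_hasCompactSupport hc.mul_left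

lemma integral_mul_multiD {f φ : Plane → ℝ} (hf : ContDiff ℝ ∞ f) (hφ : ContDiff ℝ ∞ φ)
    (hc : HasCompactSupport φ) (ν : ℕ × ℕ) :
    ∫ x, f x * multiD ν φ x = (-1 : ℝ) ^ (ν.1 + ν.2) * ∫ x, multiD ν f x * φ x := by
  induction ν using index_induction generalizing φ with
  | zero => simp [multiD]
  | step ν k ih =>
    have hsum : (ν + unitIndex k).1 + (ν + unitIndex k).2 = ν.1 + ν.2 + 1 := by
      have := unitIndex_sum k
      simp only [Prod.fst_add, Prod.snd_add]
      omega
    rw [← multiD_partialD k ν hφ, ih (contDiff_partialD hφ k) (hasCompactSupport_partialD hc k),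
      integral_mul_partialD (contDiff_multiD hf ν) hφ hc, partialD_multiD k ν hf, hsum, pow_succ]
    ring

/-! ### Test functions and weak derivatives -/

/-- A test function from an explicit function. -/
def mkTest {K : Opens Plane} (f : Plane → ℝ) (hf : ContDiff ℝ ∞ f) (hc : HasCompactSupport f)
    (hs : tsupport f ⊆ K) : 𝓓(K, ℝ) := ⟨f, hf, hc, hs⟩

/-- The partial derivative of a test function. -/
noncomputable def testD {K : Opens Plane} (ν : ℕ × ℕ) (φ : 𝓓(K, ℝ)) : 𝓓(K, ℝ) :=
  mkTest (multiD ν φ) (contDiff_multiD φ.contDiff ν)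
    (hasCompactSupport_multiD φ.hasCompactSupport ν)
    ((tsupport_multiD_subset _ ν).trans φ.tsupport_subset)

lemma testD_apply {K : Opens Plane} (ν : ℕ × ℕ) (φ : 𝓓(K, ℝ)) (x : Plane) :
    testD ν φ x = multiD ν φ x := rfl

lemma setIntegral_mul_test {K : Opens Plane} (f : Plane → ℝ) {φ : Plane → ℝ}
    (hs : tsupport φ ⊆ K) : ∫ x in (K : Set Plane), f x * φ x = ∫ x, f x * φ x := by
  refine setIntegral_eq_integral_of_forall_compl_eq_zero fun x hx => ?_
  rw [image_eq_zero_of_notMem_tsupport fun h => hx (hs h), mul_zero]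

lemma L2_eq_of_test {K : Opens Plane} {w w' : L2 K}
    (h : ∀ φ : 𝓓(K, ℝ), ∫ x in (K : Set Plane), w x * φ x = ∫ x in (K : Set Plane), w' x * φ x) :
    w = w' := by
  rw [← sub_eq_zero]
  refine Lp.ext ?_
  have hmem := Lp.memLp (w - w')
  have hae : ∀ᵐ x, x ∈ (K : Set Plane) → (w - w' : L2 K) x = 0 := by
    refine K.isOpen.ae_eq_zero_of_integral_contDiff_smul_eq_zero ?_ fun g hg hgc hgs => ?_
    · intro x hx
      obtain ⟨r, hr, hrK⟩ := Metric.isOpen_iff.1 K.isOpen x hx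
      refine ⟨Metric.ball x r, mem_nhdsWithin_of_mem_nhds (Metric.ball_mem_nhds x hr), ?_⟩
      have h1 := hmem.restrict (Metric.ball x r)
      rw [Measure.restrict_restrict Metric.isOpen_ball.measurableSet,
        inter_eq_self_of_subset_left hrK] at h1
      have : IsFiniteMeasure (volume.restrict (Metric.ball x r)) :=
        ⟨by rw [Measure.restrict_apply_univ]; exact measure_ball_lt_top⟩
      exact h1.integrable (by norm_num)
    · have h2 := h (mkTest g hg hgc hgs)
      have h3 := integral_add_mul w (-w') (mkTest g hg hgc hgs : 𝓓(K, ℝ)).continuous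
        (mkTest g hg hgc hgs : 𝓓(K, ℝ)).hasCompactSupport
      have h4 := integral_smul_mul (-1) w' (mkTest g hg hgc hgs : 𝓓(K, ℝ))
      rw [neg_one_smul] at h4
      rw [← sub_eq_add_neg, h4, h2] at h3
      simp only [smul_eq_mul]
      calc ∫ x, g x * (w - w' : L2 K) x = ∫ x, (w - w' : L2 K) x * g x := by simp only [mul_comm]
        _ = ∫ x in (K : Set Plane), (w - w' : L2 K) x * g x := (setIntegral_mul_test _ hgs).symm
        _ = _ := h3
        _ = 0 := by ring
  filter_upwards [(ae_restrict_iff' K.isOpen.measurableSet).2 hae,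
    Lp.coeFn_zero ℝ 2 (volume.restrict (K : Set Plane))] with x hx h0
  rw [hx, h0, Pi.zero_apply]

lemma HasWeakDeriv.unique {K : Opens Plane} {ν : ℕ × ℕ} {v w w' : L2 K}
    (h : HasWeakDeriv K ν v w) (h' : HasWeakDeriv K ν v w') : w = w' := by
  refine L2_eq_of_test fun φ => ?_
  have := (h φ).symm.trans (h' φ)
  exact mul_left_cancel₀ (pow_ne_zero _ (by norm_num)) this

lemma HasWeakDeriv.comp {K : Opens Plane} {ν κ : ℕ × ℕ} {v w u : L2 K}
    (h : HasWeakDeriv K ν v w) (h' : HasWeakDeriv K κ w u) : HasWeakDeriv K (ν + κ) v u := by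
  intro φ
  have h1 := h (testD κ φ)
  have h2 := h' φ
  have h3 : (multiD ν (testD κ φ) : Plane → ℝ) = multiD (ν + κ) φ :=
    multiD_multiD ν κ φ.contDiff
  simp only [testD_apply] at h1
  rw [h3, h2] at h1
  rw [h1, ← mul_assoc, ← pow_add]
  congr 2
  simp only [Prod.fst_add, Prod.snd_add]
  ring

lemma HasWeakDeriv.self {K : Opens Plane} (v : L2 K) : HasWeakDeriv K 0 v v := by
  intro φ
  simp [multiD]

/-- Testing the derivative of order `ν` with `D^κ φ` yields the derivatives of a weak derivative
once those of `v` are known. -/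
lemma HasWeakDeriv.sub_index {K : Opens Plane} {ν κ : ℕ × ℕ} {v w u : L2 K}
    (h : HasWeakDeriv K ν v w) (h' : HasWeakDeriv K (ν + κ) v u) : HasWeakDeriv K κ w u := by
  intro φ
  have h1 := h (testD κ φ)
  have h2 := h' φ
  have h3 : (multiD ν (testD κ φ) : Plane → ℝ) = multiD (ν + κ) φ :=
    multiD_multiD ν κ φ.contDiff
  simp only [testD_apply] at h1
  rw [h3, h2] at h1
  have h4 : (-1 : ℝ) ^ ((ν + κ).1 + (ν + κ).2) = (-1) ^ (ν.1 + ν.2) * (-1) ^ (κ.1 + κ.2) := by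
    rw [← pow_add]
    congr 1
    simp only [Prod.fst_add, Prod.snd_add]
    ring
  rw [h4, mul_assoc] at h1
  exact (mul_left_cancel₀ (pow_ne_zero _ (by norm_num)) h1).symm

lemma test_memLp {K : Opens Plane} (φ : 𝓓(K, ℝ)) :
    MemLp φ 2 (volume.restrict (K : Set Plane)) :=
  (φ.continuous.memLp_of_hasCompactSupport φ.hasCompactSupport).restrict _

/-- Weak derivatives are closed under `L²` limits. This provides the weak derivatives both of
boundary lifts and of members of `zeroJets`. -/
lemma hasWeakDeriv_of_tendsto {K : Opens Plane} {ν : ℕ × ℕ} {v w : L2 K} {φ : ℕ → Plane → ℝ}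
    (hφ : ∀ n, ContDiff ℝ ∞ (φ n))
    (hv : Tendsto (fun n => eLpNorm (φ n - ⇑v) 2 (volume.restrict (K : Set Plane))) atTop (𝓝 0))
    (hw : Tendsto (fun n => eLpNorm (multiD ν (φ n) - ⇑w) 2 (volume.restrict (K : Set Plane)))
      atTop (𝓝 0)) : HasWeakDeriv K ν v w := by
  intro ψ
  have h1 := tendsto_integral_mul (fun n => (hφ n).continuous.aestronglyMeasurable) (Lp.memLp v)
    (test_memLp (testD ν ψ)) hv
  have h2 := (tendsto_integral_mul (fun n => (contDiff_multiD (hφ n) ν).continuous.aestronglyMeasurable)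
    (Lp.memLp w) (test_memLp ψ) hw).const_mul ((-1 : ℝ) ^ (ν.1 + ν.2))
  refine tendsto_nhds_unique h1 (h2.congr fun n => ?_)
  rw [setIntegral_mul_test _ ψ.tsupport_subset, setIntegral_mul_test _ (testD ν ψ).tsupport_subset]
  exact (integral_mul_multiD (hφ n) ψ.contDiff ψ.hasCompactSupport ν).symm

end VEM

namespace VEM

open MeasureTheory Set Filter Topology TopologicalSpace
open scoped ContDiff Distributions

/-! ### Plane geometry of polygonal elements -/

variable {N : ℕ} {P : Polygon Plane N} {K : Opens Plane}

/-- The vector of the `i`-th edge. -/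
noncomputable def edgeVec (P : Polygon Plane N) (i : Fin N) : Plane := P (finRotate N i) - P i

lemma edgePath_eq (P : Polygon Plane N) (i : Fin N) (t : ℝ) :
    P.edgePath ℝ i t = P i + t • edgeVec P i := by
  rw [Polygon.edgePath, AffineMap.lineMap_apply, vsub_eq_sub, vadd_eq_add, add_comm, edgeVec]

lemma edgePath_zero (P : Polygon Plane N) (i : Fin N) : P.edgePath ℝ i 0 = P i := by
  simp [edgePath_eq]

lemma edgePath_one (P : Polygon Plane N) (i : Fin N) :
    P.edgePath ℝ i 1 = P (finRotate N i) := by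
  simp [edgePath_eq, edgeVec]

lemma mem_edgeSet {i : Fin N} {x : Plane} :
    x ∈ P.edgeSet ℝ i ↔ ∃ t ∈ Icc (0 : ℝ) 1, P.edgePath ℝ i t = x := by
  rw [Polygon.edgeSet_eq_image_edgePath ℝ P]
  rfl

lemma edgePath_mem_edgeSet {i : Fin N} {t : ℝ} (ht : t ∈ Icc (0 : ℝ) 1) :
    P.edgePath ℝ i t ∈ P.edgeSet ℝ i := mem_edgeSet.2 ⟨t, ht, rfl⟩

lemma edgePath_mem_boundary {i : Fin N} {t : ℝ} (ht : t ∈ Icc (0 : ℝ) 1) :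
    P.edgePath ℝ i t ∈ P.boundary ℝ := mem_iUnion.2 ⟨i, edgePath_mem_edgeSet ht⟩

lemma isCompact_edgeSet (i : Fin N) : IsCompact (P.edgeSet ℝ i) := by
  rw [Polygon.edgeSet_eq_image_edgePath ℝ P]
  exact isCompact_Icc.image (continuous_edgePath P i)

lemma edgeVec_ne_zero (hP : IsSimplePolygon P) (i : Fin N) : edgeVec P i ≠ 0 :=
  sub_ne_zero.2 (hP.1 i).symm

lemma edgePath_injective (hP : IsSimplePolygon P) (i : Fin N) :
    Function.Injective (fun t : ℝ => P.edgePath ℝ i t) := by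
  intro s t h
  simp only [edgePath_eq, add_right_inj] at h
  exact smul_left_injective ℝ (edgeVec_ne_zero hP i) h

lemma edgePath_notMem_edgeSet (hP : IsSimplePolygon P) {i j : Fin N} (hij : j ≠ i) {t : ℝ}
    (ht : t ∈ Ioo (0 : ℝ) 1) : P.edgePath ℝ i t ∉ P.edgeSet ℝ j := by
  intro hj
  rcases hP.2 i j hij.symm _ ⟨edgePath_mem_edgeSet ⟨ht.1.le, ht.2.le⟩, hj⟩ with ⟨h1, h2⟩ | ⟨h1, h2⟩
  · rw [h1, ← edgePath_one] at h2
    exact ht.2.ne (edgePath_injective hP i h2)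
  · rw [← edgePath_zero P i] at h2
    exact ht.1.ne' (edgePath_injective hP i h2)

lemma eventually_notMem_edgeSet {s : Set (Fin N)} {x : Plane} (h : ∀ j ∈ s, x ∉ P.edgeSet ℝ j) :
    ∀ᶠ y in 𝓝 x, ∀ j ∈ s, y ∉ P.edgeSet ℝ j := by
  rw [eventually_all_finite (Set.toFinite s)]
  exact fun j hj => (isCompact_edgeSet j).isClosed.isOpen_compl.mem_nhds (h j hj)

/-- The cross product in the plane. -/
def cross (u w : Plane) : ℝ := u 0 * w 1 - u 1 * w 0

lemma continuous_cross_left (u w : Plane) : Continuous fun z : Plane => cross (z - u) w := by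
  unfold cross
  fun_prop

lemma cross_add_left (u v w : Plane) : cross (u + v) w = cross u w + cross v w := by
  simp [cross]; ring

lemma cross_smul_left (c : ℝ) (u w : Plane) : cross (c • u) w = c * cross u w := by
  simp [cross]; ring

lemma cross_self (u : Plane) : cross u u = 0 := by
  simp [cross]; ring

/-- The vector rotated by a quarter turn. -/
noncomputable def rot (d : Plane) : Plane := !₂[d 1, -d 0]

lemma normSq_eq (d : Plane) : ‖d‖ ^ 2 = d 0 ^ 2 + d 1 ^ 2 := by
  rw [EuclideanSpace.norm_sq_eq]
  simp

lemma cross_rot (d : Plane) : cross (rot d) d = ‖d‖ ^ 2 := by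
  rw [normSq_eq]
  simp [cross, rot]
  ring

/-- Complex coordinates of the plane. -/
def toC (x : Plane) : ℂ := ⟨x 0, x 1⟩

lemma continuous_toC : Continuous toC := by
  have : toC = fun x : Plane => (x 0 : ℂ) + (x 1 : ℂ) * Complex.I := by
    funext x
    apply Complex.ext <;> simp [toC]
  rw [this]
  fun_prop

lemma toC_injective : Function.Injective toC := by
  intro x y h
  have h0 := congrArg Complex.re h
  have h1 := congrArg Complex.im h
  ext k
  fin_cases k
  · exact h0
  · exact h1

/-- The quotient whose argument is the angle under which an edge is seen from `z`. -/
noncomputable def edgeRatio (P : Polygon Plane N) (i : Fin N) (z : Plane) : ℂ :=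
  (toC (P (finRotate N i)) - toC z) / (toC (P i) - toC z)

lemma left_mem_edgeSet (i : Fin N) : P i ∈ P.edgeSet ℝ i :=
  mem_edgeSet.2 ⟨0, by simp, edgePath_zero P i⟩

lemma toC_sub_ne_zero {x z : Plane} (h : x ≠ z) : toC x - toC z ≠ 0 :=
  sub_ne_zero.2 fun h' => h (toC_injective h')

/-- A nonpositive real ratio `r` would place `z` on the edge at parameter `1 / (1 - r)`. Off the
edge the principal argument is therefore continuous. -/
lemma edgeRatio_mem_slitPlane {i : Fin N} {z : Plane} (hz : z ∉ P.edgeSet ℝ i) :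
    edgeRatio P i z ∈ Complex.slitPlane := by
  by_contra hcon
  have h0 : toC (P i) - toC z ≠ 0 :=
    toC_sub_ne_zero fun h => hz (h ▸ left_mem_edgeSet i)
  rw [Complex.mem_slitPlane_iff] at hcon
  push Not at hcon
  obtain ⟨hre, him⟩ := hcon
  set r := (edgeRatio P i z).re with hr
  have h1 : edgeRatio P i z = (r : ℂ) := Complex.ext (by simp [hr]) (by simp [him])
  rw [edgeRatio, div_eq_iff h0] at h1
  have hx := congrArg Complex.re h1
  have hy := congrArg Complex.im h1
  simp only [toC, Complex.sub_re, Complex.mul_re, Complex.ofReal_re, Complex.ofReal_im,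
    Complex.sub_im, Complex.mul_im, zero_mul, sub_zero, add_zero] at hx hy
  have hpos : 0 < 1 - r := by linarith
  refine hz (mem_edgeSet.2 ⟨1 / (1 - r), ⟨by positivity, by rw [div_le_one hpos]; linarith⟩, ?_⟩)
  rw [edgePath_eq, edgeVec]
  generalize P (finRotate N i) = Q at hx hy
  ext k
  fin_cases k
  · simp
    field_simp
    linarith
  · simp
    field_simp
    linarith

/-- The total angle under which the polygon is seen from `z`. -/
noncomputable def totalAngle (P : Polygon Plane N) (z : Plane) : ℝ :=
  ∑ i, (edgeRatio P i z).arg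

/-- The ratios telescope to `1` around the closed polygon, so their arguments sum to a multiple of
`2π`, the winding number. -/
lemma totalAngle_eq_int {z : Plane} (hz : z ∉ P.boundary ℝ) :
    ∃ n : ℤ, totalAngle P z = n * (2 * Real.pi) := by
  have hz' : ∀ i, z ∉ P.edgeSet ℝ i := fun i hi => hz (mem_iUnion.2 ⟨i, hi⟩)
  have h0 : ∀ i, toC (P i) - toC z ≠ 0 := fun i =>
    toC_sub_ne_zero fun h => hz' i (h ▸ left_mem_edgeSet i)
  have hprod : ∏ i, edgeRatio P i z = 1 := by
    simp only [edgeRatio]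
    rw [Finset.prod_div_distrib,
      Equiv.prod_comp (finRotate N) (fun i => toC (P i) - toC z),
      div_self (Finset.prod_ne_zero_iff.2 fun i _ => h0 i)]
  have hnorm : ∏ i, ‖edgeRatio P i z‖ = 1 := by rw [← norm_prod, hprod, norm_one]
  have hexp : Complex.exp ((totalAngle P z : ℝ) * Complex.I) = 1 := by
    rw [totalAngle, Complex.ofReal_sum, Finset.sum_mul, Complex.exp_sum]
    calc ∏ i, Complex.exp ((edgeRatio P i z).arg * Complex.I)
        = (∏ i, (‖edgeRatio P i z‖ : ℂ)) *
            ∏ i, Complex.exp ((edgeRatio P i z).arg * Complex.I) := by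
          rw [← Complex.ofReal_prod, hnorm]; simp
      _ = ∏ i, edgeRatio P i z := by
          rw [← Finset.prod_mul_distrib]
          exact Finset.prod_congr rfl fun i _ => Complex.norm_mul_exp_arg_mul_I _
      _ = 1 := hprod
  obtain ⟨n, hn⟩ := Complex.exp_eq_one_iff.1 hexp
  refine ⟨n, ?_⟩
  have := congrArg Complex.im hn
  simpa using this

lemma continuousAt_edgeRatio {i : Fin N} {z : Plane} (hz : z ≠ P i) :
    ContinuousAt (edgeRatio P i) z := by
  unfold edgeRatio
  exact (continuous_const.sub continuous_toC).continuousAt.div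
    (continuous_const.sub continuous_toC).continuousAt (toC_sub_ne_zero hz.symm)

lemma continuousAt_arg_edgeRatio {i : Fin N} {z : Plane} (hz : z ∉ P.edgeSet ℝ i) :
    ContinuousAt (fun z => (edgeRatio P i z).arg) z :=
  (Complex.continuousAt_arg (edgeRatio_mem_slitPlane hz)).comp
    (continuousAt_edgeRatio fun h => hz (h ▸ left_mem_edgeSet i))

lemma IsElement.disjoint_boundary (hK : IsElement P K) {z : Plane} (hz : z ∈ (K : Set Plane)) :
    z ∉ P.boundary ℝ := by
  rw [← hK.frontier_eq]
  exact fun h => (K.isOpen.frontier_eq ▸ h).2 hz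

/-- A continuous function with values in the multiples of `2π` is constant on a connected set:
otherwise it would take a value halfway between two consecutive multiples. -/
lemma totalAngle_const (hK : IsElement P K) {x y : Plane} (hx : x ∈ (K : Set Plane))
    (hy : y ∈ (K : Set Plane)) : totalAngle P x = totalAngle P y := by
  have hcont : ContinuousOn (totalAngle P) (K : Set Plane) := by
    intro z hz
    refine ContinuousAt.continuousWithinAt ?_
    unfold totalAngle
    exact tendsto_finsetSum _ fun i _ => continuousAt_arg_edgeRatio fun hi =>
      hK.disjoint_boundary hz (mem_iUnion.2 ⟨i, hi⟩)
  have key : ∀ x ∈ (K : Set Plane), ∀ y ∈ (K : Set Plane), ¬ totalAngle P x < totalAngle P y := by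
    intro x hx y hy hlt
    obtain ⟨n, hn⟩ := totalAngle_eq_int (hK.disjoint_boundary hx)
    obtain ⟨m, hm⟩ := totalAngle_eq_int (hK.disjoint_boundary hy)
    have hpi := Real.pi_pos
    have hnm : n + 1 ≤ m := by
      rw [hn, hm] at hlt
      have : (n : ℝ) < m := lt_of_mul_lt_mul_right hlt (by positivity)
      exact_mod_cast this
    have hnm' : (n : ℝ) + 1 ≤ m := by exact_mod_cast hnm
    obtain ⟨z, hz, hzeq⟩ := hK.connected.isPreconnected.intermediate_value hx hy hcont
      (show (n + 1 / 2 : ℝ) * (2 * Real.pi) ∈ Icc (totalAngle P x) (totalAngle P y) by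
        rw [hn, hm]
        constructor <;> nlinarith)
    obtain ⟨l, hl⟩ := totalAngle_eq_int (hK.disjoint_boundary hz)
    rw [hl] at hzeq
    have h2 : (l : ℝ) = n + 1 / 2 := mul_right_cancel₀ (by positivity) hzeq
    have h3 : ((2 * l : ℤ) : ℝ) = ((2 * n + 1 : ℤ) : ℝ) := by push_cast; linarith
    have h4 : 2 * l = 2 * n + 1 := by exact_mod_cast h3
    omega
  exact le_antisymm (not_lt.1 (key y hy x hx)) (not_lt.1 (key x hx y hy))

/-- In complex coordinates `rot` is multiplication by `-I`, so the edge vector cancels from the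
quotient. -/
lemma edgeRatio_cross_edge (hP : IsSimplePolygon P) (i : Fin N) (t s : ℝ) :
    edgeRatio P i (P.edgePath ℝ i t + s • rot (edgeVec P i)) =
      ((1 - t : ℝ) + s * Complex.I) / ((-t : ℝ) + s * Complex.I) := by
  have hD : toC (edgeVec P i) ≠ 0 := by
    intro h
    have h0 : toC 0 = 0 := by apply Complex.ext <;> simp [toC]
    exact edgeVec_ne_zero hP i (toC_injective (h.trans h0.symm))
  rw [edgeRatio, edgePath_eq, ← mul_div_mul_right ((1 - t : ℝ) + s * Complex.I) _ hD, edgeVec]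
  generalize P (finRotate N i) = Q
  congr 1 <;>
  · apply Complex.ext
    · simp [toC, rot]; ring
    · simp [toC, rot]; ring

lemma cross_edgePath_rot (P : Polygon Plane N) (i : Fin N) (t s : ℝ) :
    cross (P.edgePath ℝ i t + s • rot (edgeVec P i) - P i) (edgeVec P i) =
      s * ‖edgeVec P i‖ ^ 2 := by
  rw [edgePath_eq, add_assoc, add_sub_cancel_left, cross_add_left, cross_smul_left, cross_self,
    cross_smul_left, cross_rot]
  ring

lemma cross_of_mem_edgeSet {i : Fin N} {z : Plane} (hz : z ∈ P.edgeSet ℝ i) :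
    cross (z - P i) (edgeVec P i) = 0 := by
  obtain ⟨t, _, rfl⟩ := mem_edgeSet.1 hz
  have := cross_edgePath_rot P i t 0
  simpa using this

/-- The element cannot lie on both sides of an edge. -/
lemma not_two_sided (hK : IsElement P K) (i : Fin N) {t : ℝ} (ht : t ∈ Ioo (0 : ℝ) 1)
    {U : Set Plane} (hU : U ∈ 𝓝 (P.edgePath ℝ i t)) :
    ¬ U \ P.boundary ℝ ⊆ (K : Set Plane) := by
  intro hUK
  have hP := hK.simple
  set x := P.edgePath ℝ i t with hx
  set m := rot (edgeVec P i) with hm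
  have hline : Tendsto (fun s : ℝ => x + s • m) (𝓝 0) (𝓝 x) := by
    have : Continuous fun s : ℝ => x + s • m := by fun_prop
    simpa using this.tendsto 0
  have hother : ∀ᶠ y in 𝓝 x, ∀ j ∈ ({i}ᶜ : Set (Fin N)), y ∉ P.edgeSet ℝ j :=
    eventually_notMem_edgeSet fun j hj => edgePath_notMem_edgeSet hP hj ht
  have hmemK : ∀ᶠ s in 𝓝 (0 : ℝ), s ≠ 0 → x + s • m ∈ (K : Set Plane) := by
    filter_upwards [hline hU, hline.eventually hother] with s hs1 hs2 hs0
    refine hUK ⟨hs1, fun hb => ?_⟩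
    obtain ⟨j, hj⟩ := mem_iUnion.1 hb
    by_cases hji : j = i
    · subst hji
      have h1 := cross_of_mem_edgeSet hj
      rw [hx, hm, cross_edgePath_rot] at h1
      have := edgeVec_ne_zero hP j
      have h2 : ‖edgeVec P j‖ ^ 2 ≠ 0 := by positivity
      exact (mul_ne_zero hs0 h2) h1
    · exact hs2 j hji hj
  obtain ⟨x0, hx0⟩ := hK.connected.nonempty
  set c := totalAngle P x0
  -- The contributions of all the other edges are continuous across edge `i`, while its own
  -- contribution jumps by `2π`. If `K` lay on both sides, this would contradict the constancy of
  -- the total angle on `K`.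
  set A : ℝ → ℝ := fun s => ∑ j ∈ Finset.univ.erase i, (edgeRatio P j (x + s • m)).arg with hA
  have hAlim : Tendsto A (𝓝 0) (𝓝 (A 0)) := by
    refine tendsto_finsetSum _ fun j hj => ?_
    have h1 : x ∉ P.edgeSet ℝ j := edgePath_notMem_edgeSet hP (Finset.ne_of_mem_erase hj) ht
    have h2 := (continuousAt_arg_edgeRatio h1).tendsto.comp hline
    simpa [Function.comp_def] using h2
  have hval : ∀ᶠ s in 𝓝 (0 : ℝ), s ≠ 0 → c - A s = (edgeRatio P i (x + s • m)).arg := by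
    filter_upwards [hmemK] with s hs hs0
    have h1 : totalAngle P (x + s • m) = c := totalAngle_const hK (hs hs0) hx0
    rw [← h1, totalAngle, ← Finset.add_sum_erase _ _ (Finset.mem_univ i)]
    simp [hA]
  have hr : ∀ s : ℝ, edgeRatio P i (x + s • m) =
      ((1 - t : ℝ) + s * Complex.I) / ((-t : ℝ) + s * Complex.I) := fun s =>
    edgeRatio_cross_edge hP i t s
  have hxP : x ≠ P i := by
    rw [hx, ← edgePath_zero P i]
    exact fun h => ht.1.ne' (edgePath_injective hP i h)
  have hrlim : Tendsto (fun s : ℝ => edgeRatio P i (x + s • m)) (𝓝 0) (𝓝 (edgeRatio P i x)) :=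
    (continuousAt_edgeRatio hxP).tendsto.comp hline
  have hr0 : edgeRatio P i x = ((-((1 - t) / t) : ℝ) : ℂ) := by
    have h1 := hr 0
    have ht0 : (t : ℂ) ≠ 0 := by exact_mod_cast ht.1.ne'
    simp only [zero_smul, add_zero, Complex.ofReal_zero, zero_mul] at h1
    rw [h1]
    push_cast
    field_simp
  have hre : (edgeRatio P i x).re < 0 := by
    rw [hr0, Complex.ofReal_re]
    have := div_pos (sub_pos.2 ht.2) ht.1
    linarith
  have him0 : (edgeRatio P i x).im = 0 := by rw [hr0, Complex.ofReal_im]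
  have him : ∀ s : ℝ, (edgeRatio P i (x + s • m)).im = -s / (t ^ 2 + s ^ 2) := by
    intro s
    rw [hr, Complex.div_im, Complex.normSq_apply]
    simp
    ring
  have hden : ∀ s : ℝ, 0 < t ^ 2 + s ^ 2 := fun s => by have := ht.1; positivity
  -- As `s` decreases to `0` the ratio approaches the negative real axis from below, and as `s`
  -- increases to `0` from above; the arguments tend to `-π` and `π`.
  have hneg : Tendsto (fun s : ℝ => (edgeRatio P i (x + s • m)).arg) (𝓝[>] 0) (𝓝 (-Real.pi)) := by
    refine (Complex.tendsto_arg_nhdsWithin_im_neg_of_re_neg_of_im_zero hre him0).comp ?_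
    refine tendsto_nhdsWithin_of_tendsto_nhds_of_eventually_within _
      (hrlim.mono_left nhdsWithin_le_nhds) ?_
    filter_upwards [self_mem_nhdsWithin] with s hs
    show (edgeRatio P i (x + s • m)).im < 0
    rw [him]
    exact div_neg_of_neg_of_pos (neg_neg_of_pos hs) (hden s)
  have hpos : Tendsto (fun s : ℝ => (edgeRatio P i (x + s • m)).arg) (𝓝[<] 0) (𝓝 Real.pi) := by
    refine (Complex.tendsto_arg_nhdsWithin_im_nonneg_of_re_neg_of_im_zero hre him0).comp ?_
    refine tendsto_nhdsWithin_of_tendsto_nhds_of_eventually_within _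
      (hrlim.mono_left nhdsWithin_le_nhds) ?_
    filter_upwards [self_mem_nhdsWithin] with s hs
    show 0 ≤ (edgeRatio P i (x + s • m)).im
    rw [him]
    exact (div_pos (neg_pos.2 hs) (hden s)).le
  have hl : Tendsto (fun s => c - A s) (𝓝 0) (𝓝 (c - A 0)) := tendsto_const_nhds.sub hAlim
  have e1 : c - A 0 = -Real.pi := by
    refine tendsto_nhds_unique (hl.mono_left nhdsWithin_le_nhds) (hneg.congr' ?_)
    filter_upwards [hval.filter_mono nhdsWithin_le_nhds, self_mem_nhdsWithin] with s hs hs0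
    exact (hs (ne_of_gt hs0)).symm
  have e2 : c - A 0 = Real.pi := by
    refine tendsto_nhds_unique (hl.mono_left nhdsWithin_le_nhds) (hpos.congr' ?_)
    filter_upwards [hval.filter_mono nhdsWithin_le_nhds, self_mem_nhdsWithin] with s hs hs0
    exact (hs (ne_of_lt hs0)).symm
  have := Real.pi_pos
  linarith

/-- A connected set that misses the frontier cannot leave `K`, since `K` and the exterior of its
closure would separate it. -/
lemma IsElement.subset_of_inter (hK : IsElement P K) {S : Set Plane} (hS : IsPreconnected S)
    (hb : ∀ z ∈ S, z ∉ P.boundary ℝ) {z : Plane} (hz : z ∈ S) (hzK : z ∈ (K : Set Plane)) :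
    S ⊆ (K : Set Plane) := by
  by_contra hcon
  obtain ⟨y, hy, hyK⟩ := not_subset.1 hcon
  have hf : ∀ w ∈ S, w ∈ closure (K : Set Plane) → w ∈ (K : Set Plane) := by
    intro w hw hwc
    by_contra hwK
    refine hb w hw ?_
    rw [← hK.frontier_eq, K.isOpen.frontier_eq]
    exact ⟨hwc, hwK⟩
  obtain ⟨w, _, hw1, hw2⟩ := hS (K : Set Plane) (closure (K : Set Plane))ᶜ K.isOpen
    isClosed_closure.isOpen_compl
    (fun w hw => (em (w ∈ closure (K : Set Plane))).imp (hf w hw) id) ⟨z, hz, hzK⟩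
    ⟨y, hy, fun hyc => hyK (hf y hy hyc)⟩
  exact hw2 (subset_closure hw1)

/-- Near a boundary point with two local sectors, the element is exactly one of them. -/
lemma sector_dichotomy (hK : IsElement P K) {x : Plane} {ρ : ℝ} {O₁ O₂ : Set Plane}
    (hρ : 0 < ρ) (hx : x ∈ closure (K : Set Plane))
    (h1 : IsPreconnected (O₁ ∩ Metric.ball x ρ)) (h2 : IsPreconnected (O₂ ∩ Metric.ball x ρ))
    (hd : ∀ z ∈ Metric.ball x ρ, z ∈ P.boundary ℝ ↔ z ∉ O₁ ∧ z ∉ O₂)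
    (hnot : ¬ Metric.ball x ρ \ P.boundary ℝ ⊆ (K : Set Plane)) :
    (O₁ ∩ Metric.ball x ρ ⊆ K ∧ ∀ z ∈ O₂ ∩ Metric.ball x ρ, z ∉ (K : Set Plane)) ∨
    (O₂ ∩ Metric.ball x ρ ⊆ K ∧ ∀ z ∈ O₁ ∩ Metric.ball x ρ, z ∉ (K : Set Plane)) := by
  have hb1 : ∀ z ∈ O₁ ∩ Metric.ball x ρ, z ∉ P.boundary ℝ :=
    fun z hz hzb => ((hd z hz.2).1 hzb).1 hz.1
  have hb2 : ∀ z ∈ O₂ ∩ Metric.ball x ρ, z ∉ P.boundary ℝ :=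
    fun z hz hzb => ((hd z hz.2).1 hzb).2 hz.1
  have hcov : ∀ z ∈ Metric.ball x ρ, z ∉ P.boundary ℝ → z ∈ O₁ ∨ z ∈ O₂ := by
    intro z hz hzb
    by_contra hcon
    push Not at hcon
    exact hzb ((hd z hz).2 hcon)
  have hboth : ¬ (O₁ ∩ Metric.ball x ρ ⊆ K ∧ O₂ ∩ Metric.ball x ρ ⊆ K) := by
    rintro ⟨ha, hb⟩
    refine hnot fun z hz => ?_
    rcases hcov z hz.1 hz.2 with h | h
    · exact ha ⟨h, hz.1⟩
    · exact hb ⟨h, hz.1⟩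
  obtain ⟨y, hyK, hy⟩ := Metric.mem_closure_iff.1 hx ρ hρ
  have hyB : y ∈ Metric.ball x ρ := by rwa [Metric.mem_ball, dist_comm]
  rcases hcov y hyB (hK.disjoint_boundary hyK) with h | h
  · have hs := hK.subset_of_inter h1 hb1 ⟨h, hyB⟩ hyK
    exact Or.inl ⟨hs, fun z hz hzK => hboth ⟨hs, hK.subset_of_inter h2 hb2 hz hzK⟩⟩
  · have hs := hK.subset_of_inter h2 hb2 ⟨h, hyB⟩ hyK
    exact Or.inr ⟨hs, fun z hz hzK => hboth ⟨hK.subset_of_inter h1 hb1 hz hzK, hs⟩⟩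

/-- The part of the closure of `K` near `x` can be moved into `K` by arbitrarily small
translations. -/
def ShiftAt (K : Opens Plane) (x : Plane) : Prop :=
  ∃ ρ > 0, ∀ η > 0, ∃ y : Plane, ‖y‖ < η ∧
    ∀ z ∈ closure (K : Set Plane) ∩ Metric.closedBall x ρ, z + y ∈ (K : Set Plane)

/-- The closure of `K` near `x` avoids the open sector `O₂` on the other side, and every positive
multiple of `d` carries the complement of `O₂` into `O₁`. -/
lemma shiftAt_of_sector {x : Plane} {ρ : ℝ} {O₁ O₂ : Set Plane} (hρ : 0 < ρ) (d : Plane)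
    (h2 : IsOpen O₂) (hd : ∀ z ∉ O₂, ∀ s > (0 : ℝ), z + s • d ∈ O₁)
    (hin : O₁ ∩ Metric.ball x ρ ⊆ K) (hout : ∀ z ∈ O₂ ∩ Metric.ball x ρ, z ∉ (K : Set Plane)) :
    ShiftAt K x := by
  refine ⟨ρ / 2, by positivity, fun η hη => ?_⟩
  -- Small enough for the translation to be shorter than `η`, and shorter than `ρ / 2` so that the
  -- half-size ball remains inside the ball of radius `ρ`.
  set s := min η (ρ / 2) / (2 * (‖d‖ + 1)) with hs
  have hm : 0 < min η (ρ / 2) := lt_min hη (by positivity)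
  have hspos : 0 < s := by positivity
  have hsd : ‖s • d‖ < min η (ρ / 2) := by
    rw [norm_smul, Real.norm_of_nonneg hspos.le, hs, div_mul_eq_mul_div, div_lt_iff₀ (by positivity)]
    nlinarith [norm_nonneg d]
  refine ⟨s • d, hsd.trans_le (min_le_left _ _), fun z hz => hin ⟨hd z (fun hz2 => ?_) s hspos, ?_⟩⟩
  · have hzB : z ∈ Metric.ball x ρ :=
      Metric.closedBall_subset_ball (by linarith) hz.2
    obtain ⟨w, hw, hwK⟩ := mem_closure_iff.1 hz.1 _ (h2.inter Metric.isOpen_ball) ⟨hz2, hzB⟩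
    exact hout w hw hwK
  · rw [Metric.mem_ball, dist_eq_norm]
    have h3 : ‖z - x‖ ≤ ρ / 2 := by simpa [dist_eq_norm] using hz.2
    calc ‖z + s • d - x‖ = ‖(z - x) + s • d‖ := by congr 1; abel
      _ ≤ ‖z - x‖ + ‖s • d‖ := norm_add_le _ _
      _ < ρ / 2 + ρ / 2 := add_lt_add_of_le_of_lt h3 (hsd.trans_le (min_le_right _ _))
      _ = ρ := by ring

end VEM

/-! ### Local shape of the element at edges and vertices. -/

namespace VEM

open MeasureTheory Set Filter Topology TopologicalSpace
open scoped ContDiff Distributions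

variable {N : ℕ} {P : Polygon Plane N} {K : Opens Plane}

lemma IsElement.mem_closure (hK : IsElement P K) {z : Plane} (hz : z ∈ P.boundary ℝ) :
    z ∈ closure (K : Set Plane) := by
  rw [← hK.frontier_eq] at hz
  exact frontier_subset_closure hz

lemma cross_affine_left (u w a b : Plane) {s t : ℝ} (hst : s + t = 1) :
    cross (s • a + t • b - u) w = s * cross (a - u) w + t * cross (b - u) w := by
  have : s • a + t • b - u = s • (a - u) + t • (b - u) := by
    have h2 : u = s • u + t • u := by rw [← add_smul, hst, one_smul]
    nth_rewrite 1 [h2]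
    module
  rw [this, cross_add_left, cross_smul_left, cross_smul_left]

lemma isPreconnected_halfPlane (u w x : Plane) (ρ : ℝ) :
    IsPreconnected ({z | 0 < cross (z - u) w} ∩ Metric.ball x ρ) := by
  refine (Convex.inter ?_ (convex_ball x ρ)).isPreconnected
  intro a ha b hb s t hs ht hst
  simp only [mem_ofPred_eq] at ha hb ⊢
  rw [cross_affine_left u w a b hst]
  rcases hs.eq_or_lt with rfl | hs'
  · have : t = 1 := by linarith
    subst this
    simpa using hb
  · have := mul_pos hs' ha
    have := mul_nonneg ht hb.le
    linarith

lemma cross_neg_right (u w : Plane) : cross u (-w) = -cross u w := by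
  simp [cross]; ring

lemma isPreconnected_halfPlane_neg (u w x : Plane) (ρ : ℝ) :
    IsPreconnected ({z | cross (z - u) w < 0} ∩ Metric.ball x ρ) := by
  have := isPreconnected_halfPlane u (-w) x ρ
  simpa only [cross_neg_right, neg_pos] using this

lemma exists_smul_of_cross_eq_zero {v d : Plane} (hd : d ≠ 0) (h : cross v d = 0) :
    ∃ s : ℝ, v = s • d := by
  have h1 : d 0 ^ 2 + d 1 ^ 2 ≠ 0 := by
    rw [← normSq_eq]
    positivity
  refine ⟨(v 0 * d 0 + v 1 * d 1) / (d 0 ^ 2 + d 1 ^ 2), ?_⟩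
  simp only [cross] at h
  ext k
  fin_cases k
  · simp
    field_simp
    linear_combination d 1 * h
  · simp
    field_simp
    linear_combination -d 0 * h

/-- The signed distance (up to scaling) from the line of the `i`-th edge. -/
noncomputable def side (P : Polygon Plane N) (i : Fin N) (z : Plane) : ℝ :=
  cross (z - P i) (edgeVec P i)

lemma continuous_side (i : Fin N) : Continuous (side P i) := continuous_cross_left _ _

lemma isOpen_side_pos (i : Fin N) : IsOpen {z | 0 < side P i z} :=
  isOpen_lt continuous_const (continuous_side i)

lemma isOpen_side_neg (i : Fin N) : IsOpen {z | side P i z < 0} :=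
  isOpen_lt (continuous_side i) continuous_const

lemma side_add_smul_rot (i : Fin N) (z : Plane) (s : ℝ) :
    side P i (z + s • rot (edgeVec P i)) = side P i z + s * ‖edgeVec P i‖ ^ 2 := by
  rw [side, side, add_sub_right_comm, cross_add_left, cross_smul_left, cross_rot]

/-- A neighbourhood of an inner point of an edge meets the boundary in a line. -/
lemma exists_ball_edge (hP : IsSimplePolygon P) (i : Fin N) {t : ℝ} (ht : t ∈ Ioo (0 : ℝ) 1) :
    ∃ ρ > 0, ∀ z ∈ Metric.ball (P.edgePath ℝ i t) ρ, z ∈ P.boundary ℝ ↔ side P i z = 0 := by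
  have hother : ∀ᶠ y in 𝓝 (P.edgePath ℝ i t), ∀ j ∈ ({i}ᶜ : Set (Fin N)), y ∉ P.edgeSet ℝ j :=
    eventually_notMem_edgeSet fun j hj => edgePath_notMem_edgeSet hP hj ht
  obtain ⟨ρ₁, hρ₁, hball⟩ := Metric.eventually_nhds_iff_ball.1 hother
  have hd := norm_pos_iff.2 (edgeVec_ne_zero hP i)
  have hm : 0 < min t (1 - t) := lt_min ht.1 (by linarith [ht.2])
  -- The second radius is the distance to the nearer endpoint: within it the line of the edge does
  -- not run beyond the edge. The first keeps all other edges away.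
  refine ⟨min ρ₁ (min t (1 - t) * ‖edgeVec P i‖), lt_min hρ₁ (by positivity), fun z hz => ?_⟩
  have hz1 := Metric.ball_subset_ball (min_le_left _ _) hz
  have hz2 := Metric.ball_subset_ball (min_le_right _ _) hz
  constructor
  · intro hb
    obtain ⟨j, hj⟩ := mem_iUnion.1 hb
    by_cases hji : j = i
    · exact hji ▸ cross_of_mem_edgeSet hj
    · exact absurd hj (hball z hz1 j hji)
  · intro h0
    obtain ⟨s, hs⟩ := exists_smul_of_cross_eq_zero (edgeVec_ne_zero hP i) h0
    have hz' : z = P.edgePath ℝ i s := by rw [edgePath_eq, ← hs]; abel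
    rw [hz', Metric.mem_ball, dist_eq_norm, edgePath_eq, edgePath_eq, add_sub_add_left_eq_sub,
      ← sub_smul, norm_smul, Real.norm_eq_abs] at hz2
    have h3 : |s - t| < min t (1 - t) := lt_of_mul_lt_mul_right hz2 hd.le
    have h4 := abs_lt.1 (h3.trans_le (min_le_left _ _))
    have h5 := abs_lt.1 (h3.trans_le (min_le_right _ _))
    rw [hz']
    exact edgePath_mem_boundary ⟨by linarith, by linarith⟩

/-- The two local sides of a straight piece of the boundary. -/
lemma straight_dichotomy (hK : IsElement P K) (i : Fin N) {x : Plane} {ρ : ℝ} (hρ : 0 < ρ)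
    (hx : x ∈ P.boundary ℝ)
    (hball : ∀ z ∈ Metric.ball x ρ, z ∈ P.boundary ℝ ↔ side P i z = 0)
    (hnot : ¬ Metric.ball x ρ \ P.boundary ℝ ⊆ (K : Set Plane)) :
    ({z | 0 < side P i z} ∩ Metric.ball x ρ ⊆ K ∧
      ∀ z ∈ {z | side P i z < 0} ∩ Metric.ball x ρ, z ∉ (K : Set Plane)) ∨
    ({z | side P i z < 0} ∩ Metric.ball x ρ ⊆ K ∧
      ∀ z ∈ {z | 0 < side P i z} ∩ Metric.ball x ρ, z ∉ (K : Set Plane)) := by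
  refine sector_dichotomy hK hρ (hK.mem_closure hx) (isPreconnected_halfPlane _ _ _ _)
    (isPreconnected_halfPlane_neg _ _ _ _) (fun z hz => ?_) hnot
  rw [hball z hz]
  simp only [mem_ofPred_eq, not_lt]
  exact ⟨fun h => ⟨h.le, h.ge⟩, fun h => le_antisymm h.1 h.2⟩

/-- Near an inner point of an edge, the element is one of the two half-discs. -/
lemma edge_local (hK : IsElement P K) (i : Fin N) {t : ℝ} (ht : t ∈ Ioo (0 : ℝ) 1) :
    ∃ ρ > 0, ∃ c : ℝ, c ≠ 0 ∧
      ∀ z ∈ Metric.ball (P.edgePath ℝ i t) ρ, z ∈ (K : Set Plane) ↔ 0 < c * side P i z := by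
  obtain ⟨ρ, hρ, hball⟩ := exists_ball_edge hK.simple i ht
  have hx : P.edgePath ℝ i t ∈ P.boundary ℝ := edgePath_mem_boundary ⟨ht.1.le, ht.2.le⟩
  have hnot := not_two_sided hK i ht (Metric.ball_mem_nhds _ hρ)
  rcases straight_dichotomy hK i hρ hx hball hnot with ⟨h1, h2⟩ | ⟨h1, h2⟩
  · refine ⟨ρ, hρ, 1, one_ne_zero, fun z hz => ⟨fun hzK => ?_, fun h => h1 ⟨?_, hz⟩⟩⟩
    · have h3 : ¬ side P i z < 0 := fun h => h2 z ⟨h, hz⟩ hzK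
      have h4 : side P i z ≠ 0 := fun h => hK.disjoint_boundary hzK ((hball z hz).2 h)
      rw [one_mul]
      exact lt_of_le_of_ne (not_lt.1 h3) h4.symm
    · simpa using h
  · refine ⟨ρ, hρ, -1, by norm_num, fun z hz => ⟨fun hzK => ?_, fun h => h1 ⟨?_, hz⟩⟩⟩
    · have h3 : ¬ 0 < side P i z := fun h => h2 z ⟨h, hz⟩ hzK
      have h4 : side P i z ≠ 0 := fun h => hK.disjoint_boundary hzK ((hball z hz).2 h)
      have := lt_of_le_of_ne (not_lt.1 h3) h4
      linarith
    · simp only [mem_ofPred_eq]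
      linarith

lemma shiftAt_straight (hK : IsElement P K) (i : Fin N) {x : Plane} {ρ : ℝ} (hρ : 0 < ρ)
    (hx : x ∈ P.boundary ℝ)
    (hball : ∀ z ∈ Metric.ball x ρ, z ∈ P.boundary ℝ ↔ side P i z = 0)
    (hnot : ¬ Metric.ball x ρ \ P.boundary ℝ ⊆ (K : Set Plane)) : ShiftAt K x := by
  have hd : 0 < ‖edgeVec P i‖ ^ 2 := by
    have := norm_pos_iff.2 (edgeVec_ne_zero hK.simple i)
    positivity
  rcases straight_dichotomy hK i hρ hx hball hnot with ⟨h1, h2⟩ | ⟨h1, h2⟩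
  · refine shiftAt_of_sector hρ (rot (edgeVec P i)) (isOpen_side_neg i) (fun z hz s hs => ?_) h1 h2
    simp only [mem_ofPred_eq, not_lt] at hz ⊢
    rw [side_add_smul_rot]
    have := mul_pos hs hd
    linarith
  · refine shiftAt_of_sector hρ (-rot (edgeVec P i)) (isOpen_side_pos i) (fun z hz s hs => ?_)
      h1 h2
    simp only [mem_ofPred_eq, not_lt] at hz ⊢
    rw [smul_neg, ← neg_smul, side_add_smul_rot]
    have := mul_pos hs hd
    linarith

/-- The data of the boundary near a vertex: the two edges that meet there. -/
lemma exists_ball_vertex (hP : IsSimplePolygon P) (j : Fin N) :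
    ∃ ρ > 0, ∀ z ∈ Metric.ball (P (finRotate N j)) ρ, z ∈ P.boundary ℝ ↔
      (∃ s ≥ (0 : ℝ), z = P (finRotate N j) + s • edgeVec P (finRotate N j)) ∨
      (∃ s ≥ (0 : ℝ), z = P (finRotate N j) - s • edgeVec P j) := by
  set i := finRotate N j with hi
  have hne : ∀ k ∈ ({i, j}ᶜ : Set (Fin N)), P i ∉ P.edgeSet ℝ k := by
    intro k hk hmem
    simp only [mem_compl_iff, mem_insert_iff, mem_singleton_iff, not_or] at hk
    rcases hP.2 i k (Ne.symm hk.1) (P i) ⟨left_mem_edgeSet i, hmem⟩ with ⟨h1, h2⟩ | ⟨h1, _⟩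
    · exact hP.1 i (h1 ▸ h2)
    · exact hk.2 ((finRotate N).injective (h1 ▸ hi : finRotate N k = finRotate N j))
  obtain ⟨ρ₁, hρ₁, hball⟩ := Metric.eventually_nhds_iff_ball.1 (eventually_notMem_edgeSet hne)
  have hdi := norm_pos_iff.2 (edgeVec_ne_zero hP i)
  have hdj := norm_pos_iff.2 (edgeVec_ne_zero hP j)
  have hend : P j = P i - edgeVec P j := by rw [edgeVec, ← hi]; abel
  refine ⟨min ρ₁ (min ‖edgeVec P i‖ ‖edgeVec P j‖), by positivity, fun z hz => ?_⟩
  have hz1 := Metric.ball_subset_ball (min_le_left _ _) hz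
  have hz2 := Metric.ball_subset_ball ((min_le_right _ _).trans (min_le_left _ _)) hz
  have hz3 := Metric.ball_subset_ball ((min_le_right _ _).trans (min_le_right _ _)) hz
  rw [Metric.mem_ball, dist_eq_norm] at hz2 hz3
  constructor
  · intro hb
    obtain ⟨k, hk⟩ := mem_iUnion.1 hb
    have hk' : k = i ∨ k = j := by
      by_contra hcon
      exact hball z hz1 k hcon hk
    obtain ⟨t, ht, rfl⟩ := mem_edgeSet.1 hk
    rcases hk' with rfl | rfl
    · exact Or.inl ⟨t, ht.1, edgePath_eq P _ t⟩
    · refine Or.inr ⟨1 - t, by linarith [ht.2], ?_⟩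
      rw [edgePath_eq, hend, sub_smul, one_smul]
      abel
  · rintro (⟨s, hs, rfl⟩ | ⟨s, hs, rfl⟩)
    · rw [add_sub_cancel_left, norm_smul, Real.norm_of_nonneg hs] at hz2
      rw [← edgePath_eq]
      exact edgePath_mem_boundary ⟨hs, by nlinarith⟩
    · rw [sub_sub_cancel_left, norm_neg, norm_smul, Real.norm_of_nonneg hs] at hz3
      have h4 : P i - s • edgeVec P j = P.edgePath ℝ j (1 - s) := by
        rw [edgePath_eq, hend, sub_smul, one_smul]; abel
      rw [h4]
      exact edgePath_mem_boundary ⟨by nlinarith, by linarith⟩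

/-- The two edges at a vertex do not have the same direction. -/
lemma edgeVec_not_same_ray (hP : IsSimplePolygon P) (j : Fin N) {c : ℝ} (hc : 0 ≤ c) :
    -edgeVec P j ≠ c • edgeVec P (finRotate N j) := by
  intro h
  set i := finRotate N j with hi
  have hji : j ≠ i := fun h' => hP.1 j (by rw [← hi, ← h'])
  -- Chosen so that both `s` and `s * c` are less than `1`: the point at distance parameter `s` from
  -- the vertex is inner to edge `j` and also lies on edge `i`.
  set s := 1 / (2 * (c + 1)) with hs
  have hs0 : 0 < s := by positivity
  have hs1 : s < 1 := by rw [hs, div_lt_one (by positivity)]; linarith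
  have hsc : s * c < 1 := by
    rw [hs, div_mul_eq_mul_div, div_lt_one (by positivity)]; linarith
  have hend : P j = P i - edgeVec P j := by rw [edgeVec, ← hi]; abel
  have h1 : P.edgePath ℝ j (1 - s) = P.edgePath ℝ i (s * c) := by
    rw [edgePath_eq, edgePath_eq, mul_smul, ← h, hend]
    module
  refine edgePath_notMem_edgeSet hP (i := j) (j := i) hji.symm (t := 1 - s)
    ⟨by linarith, by linarith⟩ ?_
  rw [h1]
  exact edgePath_mem_edgeSet ⟨by positivity, hsc.le⟩

lemma cross_swap (u w : Plane) : cross u w = -cross w u := by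
  simp [cross]
  ring

/-- Cramer's rule in the basis `u`, `w`. -/
lemma eq_of_cross_ne_zero {u w : Plane} (h : cross u w ≠ 0) (v : Plane) :
    v = (cross v w / cross u w) • u + (cross u v / cross u w) • w := by
  obtain ⟨D, hD⟩ : ∃ D, D = cross u w := ⟨_, rfl⟩
  rw [← hD] at h ⊢
  ext k
  fin_cases k
  · simp
    field_simp
    rw [hD]
    unfold cross
    ring
  · simp
    field_simp
    rw [hD]
    unfold cross
    ring

/-- Every ball about a vertex contains inner points of the edge that starts there, and
`not_two_sided` applies to those. -/
lemma not_two_sided_vertex (hK : IsElement P K) (i : Fin N) {ρ : ℝ} (hρ : 0 < ρ) :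
    ¬ Metric.ball (P i) ρ \ P.boundary ℝ ⊆ (K : Set Plane) := by
  have hd := norm_pos_iff.2 (edgeVec_ne_zero hK.simple i)
  set t := min (1 / 2) (ρ / (2 * ‖edgeVec P i‖)) with ht
  have ht0 : 0 < t := by positivity
  have ht1 : t < 1 := (min_le_left _ _).trans_lt (by norm_num)
  refine not_two_sided hK i ⟨ht0, ht1⟩ (Metric.isOpen_ball.mem_nhds ?_)
  rw [Metric.mem_ball, dist_eq_norm, edgePath_eq, add_sub_cancel_left, norm_smul,
    Real.norm_of_nonneg ht0.le]
  calc t * ‖edgeVec P i‖ ≤ ρ / (2 * ‖edgeVec P i‖) * ‖edgeVec P i‖ := by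
        gcongr; exact min_le_right _ _
    _ = ρ / 2 := by field_simp
    _ < ρ := by linarith

/-- At a straight angle the boundary is locally a line. Otherwise, in the basis of the two edge
directions `u`, `w` issuing from the vertex, it is the boundary of a quadrant, and `K` is locally
the quadrant or the complementary sector. Shifts along `u + w` or its negative move the closure
inside. -/
lemma shiftAt_vertex (hK : IsElement P K) (j : Fin N) : ShiftAt K (P (finRotate N j)) := by
  have hP := hK.simple
  set i := finRotate N j with hi
  obtain ⟨ρ, hρ, hball⟩ := exists_ball_vertex hP j
  rw [← hi] at hball
  have hxb : P i ∈ P.boundary ℝ := mem_iUnion.2 ⟨i, left_mem_edgeSet i⟩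
  have hnot := not_two_sided_vertex hK i hρ
  set u := -edgeVec P j with hu
  set w := edgeVec P i with hw
  by_cases hcr : cross u w = 0
  · obtain ⟨c, hc⟩ := exists_smul_of_cross_eq_zero (edgeVec_ne_zero hP i) hcr
    -- Collinear edges point in opposite directions, since otherwise they would overlap.
    have hc0 : c < 0 := not_le.1 fun h => edgeVec_not_same_ray hP j h hc
    refine shiftAt_straight hK i hρ hxb (fun z hz => ?_) hnot
    rw [hball z hz]
    constructor
    · rintro (⟨s, -, rfl⟩ | ⟨s, -, rfl⟩)
      · rw [side, add_sub_cancel_left, cross_smul_left, cross_self, mul_zero]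
      · rw [side, sub_sub_cancel_left, ← smul_neg, cross_smul_left, ← hu, hcr, mul_zero]
    · intro h0
      obtain ⟨s, hs⟩ := exists_smul_of_cross_eq_zero (edgeVec_ne_zero hP i) h0
      rcases le_total 0 s with h | h
      · exact Or.inl ⟨s, h, by rw [hw, ← hs]; abel⟩
      · refine Or.inr ⟨s / c, div_nonneg_of_nonpos h hc0.le, ?_⟩
        rw [sub_eq_add_neg, ← smul_neg, ← hu, hc, smul_smul, div_mul_cancel₀ _ hc0.ne, ← hs]
        abel
  -- The coordinates of `z - P i` in the basis `u`, `w`.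
  · set α : Plane → ℝ := fun z => cross (z - P i) w / cross u w with hα
    set β : Plane → ℝ := fun z => cross u (z - P i) / cross u w with hβ
    have hαc : Continuous α := (continuous_cross_left _ _).div_const _
    have hβc : Continuous β := by
      have : β = fun z => -cross (z - P i) u / cross u w := by
        funext z; rw [hβ]; simp only []; rw [cross_swap]
      rw [this]
      exact (continuous_cross_left _ _).neg.div_const _
    have hdec : ∀ z, z = P i + (α z • u + β z • w) := fun z => by
      rw [← eq_of_cross_ne_zero hcr]; abel
    have hαadd : ∀ z s, α (z + s • (u + w)) = α z + s := by
      intro z s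
      simp only [hα]
      rw [add_sub_right_comm, cross_add_left, cross_smul_left, cross_add_left, cross_self, add_zero]
      field_simp
    have hβadd : ∀ z s, β (z + s • (u + w)) = β z + s := by
      intro z s
      simp only [hβ]
      rw [add_sub_right_comm, cross_swap, cross_add_left, cross_smul_left, cross_add_left,
        cross_self, zero_add, cross_swap w u, cross_swap _ u]
      field_simp
      ring
    have hαaff : ∀ a b : Plane, ∀ s t : ℝ, s + t = 1 → α (s • a + t • b) = s * α a + t * α b := by
      intro a b s t hst
      simp only [hα]
      rw [cross_affine_left _ _ _ _ hst, add_div, mul_div_assoc, mul_div_assoc]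
    have hβaff : ∀ a b : Plane, ∀ s t : ℝ, s + t = 1 → β (s • a + t • b) = s * β a + t * β b := by
      intro a b s t hst
      simp only [hβ]
      rw [cross_swap u, cross_affine_left _ _ _ _ hst, cross_swap u (a - P i),
        cross_swap u (b - P i)]
      ring
    have hbd : ∀ z ∈ Metric.ball (P i) ρ, z ∈ P.boundary ℝ ↔
        (α z = 0 ∧ 0 ≤ β z) ∨ (β z = 0 ∧ 0 ≤ α z) := by
      intro z hz
      rw [hball z hz]
      constructor
      · rintro (⟨s, hs, rfl⟩ | ⟨s, hs, rfl⟩)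
        · left
          simp only [hα, hβ]
          rw [add_sub_cancel_left, cross_smul_left, cross_self, cross_swap u (s • w),
            cross_smul_left, cross_swap w u]
          refine ⟨by simp, ?_⟩
          rw [mul_neg, neg_neg, mul_div_assoc, div_self hcr, mul_one]
          exact hs
        · right
          simp only [hα, hβ]
          rw [sub_sub_cancel_left, ← smul_neg, ← hu, cross_smul_left, cross_swap u (s • u),
            cross_smul_left, cross_self]
          refine ⟨by simp, ?_⟩
          rw [mul_div_assoc, div_self hcr, mul_one]
          exact hs
      · rintro (⟨h1, h2⟩ | ⟨h1, h2⟩)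
        · refine Or.inl ⟨β z, h2, ?_⟩
          conv_lhs => rw [hdec z, h1, zero_smul, zero_add]
        · refine Or.inr ⟨α z, h2, ?_⟩
          conv_lhs => rw [hdec z, h1, zero_smul, add_zero]
          rw [hu, smul_neg, sub_eq_add_neg]
    have hconv : ∀ (γ : Plane → ℝ), (∀ a b : Plane, ∀ s t : ℝ, s + t = 1 →
        γ (s • a + t • b) = s * γ a + t * γ b) → Convex ℝ {z | 0 < γ z} ∧ Convex ℝ {z | γ z < 0} := by
      intro γ hγ
      constructor <;>
      · intro a ha b hb s t hs ht hst
        simp only [mem_ofPred_eq] at ha hb ⊢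
        rw [hγ a b s t hst]
        rcases hs.eq_or_lt with rfl | hs'
        · have : t = 1 := by linarith
          subst this
          simpa using hb
        · nlinarith
    set O₁ : Set Plane := {z | 0 < α z} ∩ {z | 0 < β z} with hO₁
    set O₂ : Set Plane := {z | α z < 0} ∪ {z | β z < 0} with hO₂
    have hO₁p : IsPreconnected (O₁ ∩ Metric.ball (P i) ρ) :=
      (((hconv α hαaff).1.inter (hconv β hβaff).1).inter (convex_ball _ _)).isPreconnected
    have hV : α (P i) = 0 ∧ β (P i) = 0 := by
      simp [hα, hβ, cross]
    -- The reflex sector is not convex. It is a union of two convex pieces that share a point on the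
    -- ray in direction `-(u + w)`.
    have hO₂p : IsPreconnected (O₂ ∩ Metric.ball (P i) ρ) := by
      rw [hO₂, union_inter_distrib_right]
      set s := ρ / (2 * (‖u + w‖ + 1)) with hs
      have hs0 : 0 < s := by positivity
      have hsB : P i + (-s) • (u + w) ∈ Metric.ball (P i) ρ := by
        rw [Metric.mem_ball, dist_eq_norm, add_sub_cancel_left, norm_smul, norm_neg,
          Real.norm_of_nonneg hs0.le, hs, div_mul_eq_mul_div, div_lt_iff₀ (by positivity)]
        nlinarith [norm_nonneg (u + w)]
      refine IsPreconnected.union (P i + (-s) • (u + w)) ⟨?_, hsB⟩ ⟨?_, hsB⟩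
        ((hconv α hαaff).2.inter (convex_ball _ _)).isPreconnected
        ((hconv β hβaff).2.inter (convex_ball _ _)).isPreconnected
      · show α _ < 0
        rw [hαadd, hV.1]; linarith
      · show β _ < 0
        rw [hβadd, hV.2]; linarith
    have hdis : ∀ z ∈ Metric.ball (P i) ρ, z ∈ P.boundary ℝ ↔ z ∉ O₁ ∧ z ∉ O₂ := by
      intro z hz
      rw [hbd z hz]
      simp only [hO₁, hO₂, mem_inter_iff, mem_union, mem_ofPred_eq, not_and_or, not_or, not_lt]
      constructor
      · rintro (⟨h1, h2⟩ | ⟨h1, h2⟩)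
        · exact ⟨Or.inl h1.le, h1.ge, h2⟩
        · exact ⟨Or.inr h1.le, h2, h1.ge⟩
      · rintro ⟨h1 | h1, h2, h3⟩
        · exact Or.inl ⟨le_antisymm h1 h2, h3⟩
        · exact Or.inr ⟨le_antisymm h1 h3, h2⟩
    have hopen1 : IsOpen O₁ := (isOpen_lt continuous_const hαc).inter
      (isOpen_lt continuous_const hβc)
    have hopen2 : IsOpen O₂ := (isOpen_lt hαc continuous_const).union
      (isOpen_lt hβc continuous_const)
    rcases sector_dichotomy hK hρ (hK.mem_closure hxb) hO₁p hO₂p hdis hnot with ⟨h1, h2⟩ | ⟨h1, h2⟩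
    · refine shiftAt_of_sector hρ (u + w) hopen2 (fun z hz s hs => ?_) h1 h2
      simp only [hO₁, hO₂, mem_inter_iff, mem_union, mem_ofPred_eq, not_or, not_lt, hαadd,
        hβadd] at hz ⊢
      constructor <;> linarith
    · refine shiftAt_of_sector hρ (-(u + w)) hopen1 (fun z hz s hs => ?_) h1 h2
      rw [smul_neg, ← neg_smul]
      simp only [hO₁, hO₂, mem_inter_iff, mem_union, mem_ofPred_eq, not_and_or, not_lt, hαadd,
        hβadd] at hz ⊢
      rcases hz with h | h
      · left; linarith
      · right; linarith

lemma shiftAt_of_mem_closure (hK : IsElement P K) {x : Plane}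
    (hx : x ∈ closure (K : Set Plane)) : ShiftAt K x := by
  by_cases hxK : x ∈ (K : Set Plane)
  · obtain ⟨r, hr, hrK⟩ := Metric.isOpen_iff.1 K.isOpen x hxK
    refine ⟨r / 2, by positivity, fun η hη => ⟨0, by simpa using hη, fun z hz => ?_⟩⟩
    rw [add_zero]
    exact hrK (Metric.closedBall_subset_ball (by linarith) hz.2)
  · have hxb : x ∈ P.boundary ℝ := by
      rw [← hK.frontier_eq, K.isOpen.frontier_eq]
      exact ⟨hx, hxK⟩
    obtain ⟨i, hi⟩ := mem_iUnion.1 hxb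
    obtain ⟨t, ht, rfl⟩ := mem_edgeSet.1 hi
    rcases ht.1.eq_or_lt with h0 | h0
    · rw [← h0, edgePath_zero]
      have := shiftAt_vertex hK ((finRotate N).symm i)
      rwa [Equiv.apply_symm_apply] at this
    rcases ht.2.eq_or_lt with h1 | h1
    · rw [h1, edgePath_one]
      exact shiftAt_vertex hK i
    obtain ⟨ρ, hρ, hball⟩ := exists_ball_edge hK.simple i ⟨h0, h1⟩
    exact shiftAt_straight hK i hρ hxb hball
      (not_two_sided hK i ⟨h0, h1⟩ (Metric.ball_mem_nhds _ hρ))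

end VEM

namespace VEM

open MeasureTheory Set Filter Topology TopologicalSpace
open scoped ContDiff Distributions

variable {N : ℕ} {P : Polygon Plane N} {K : Opens Plane}

/-! ### Green's formula near an edge -/

lemma exists_coordinates {a b : Plane} (h : cross b a ≠ 0) :
    ∃ L : (ℝ × ℝ) ≃L[ℝ] Plane, ∀ z, L z = z.1 • a + z.2 • b := by
  let f : (ℝ × ℝ) →ₗ[ℝ] Plane := (LinearMap.fst ℝ ℝ ℝ).smulRight a + (LinearMap.snd ℝ ℝ ℝ).smulRight b
  have hf : ∀ z, f z = z.1 • a + z.2 • b := fun z => by simp [f]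
  have hinj : Function.Injective f := by
    rw [← LinearMap.ker_eq_bot, LinearMap.ker_eq_bot']
    intro z hz
    rw [hf] at hz
    have h1 : cross (z.1 • a + z.2 • b) a = 0 := by rw [hz]; simp [cross]
    have h2 : cross (z.1 • a + z.2 • b) b = 0 := by rw [hz]; simp [cross]
    rw [cross_add_left, cross_smul_left, cross_smul_left, cross_self] at h1 h2
    rw [cross_swap] at h2
    have h3 : z.2 = 0 := by simpa [h] using h1
    have h4 : z.1 = 0 := by simpa [h] using h2
    exact Prod.ext h4 h3
  refine ⟨(LinearEquiv.ofInjectiveOfFinrankEq f hinj (by simp)).toContinuousLinearEquiv,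
    fun z => ?_⟩
  exact hf z

/-- Uniqueness of Haar measure provides the Jacobian factor `c`; its value is never needed, only
that it is positive. -/
lemma exists_integral_coordinates {a b : Plane} (h : cross b a ≠ 0) :
    ∃ c : ℝ, 0 < c ∧ ∀ (x₀ : Plane) (f : Plane → ℝ),
      ∫ x, f x = c * ∫ z : ℝ × ℝ, f (x₀ + (z.1 • a + z.2 • b)) := by
  obtain ⟨L, hL⟩ := exists_coordinates h
  let μ : Measure Plane := (volume : Measure (ℝ × ℝ)).map L
  have hμ : μ.IsAddHaarMeasure := L.isAddHaarMeasure_map volume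
  refine ⟨(Measure.addHaarScalarFactor volume μ : ℝ), ?_, fun x₀ f => ?_⟩
  · exact_mod_cast Measure.addHaarScalarFactor_pos_of_isAddHaarMeasure volume μ
  · rw [← integral_add_left_eq_self f x₀]
    conv_lhs => rw [Measure.isAddLeftInvariant_eq_smul (volume : Measure Plane) μ]
    have hmap : ∫ x, f (x₀ + x) ∂μ = ∫ z, f (x₀ + L z) :=
      L.toHomeomorph.measurableEmbedding.integral_map (μ := volume) fun x => f (x₀ + x)
    rw [integral_smul_nnreal_measure, hmap]
    simp only [hL]
    rfl

lemma dirD_add_smul {f : Plane → ℝ} (a b : Plane) (s t : ℝ) (x : Plane) :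
    dirD (s • a + t • b) f x = s * dirD a f x + t * dirD b f x := by
  simp [dirD]

lemma hasDerivAt_line {f : Plane → ℝ} (hf : ContDiff ℝ ∞ f) (x a : Plane) (t : ℝ) :
    HasDerivAt (fun s : ℝ => f (x + s • a)) (dirD a f (x + t • a)) t := by
  have h1 : HasDerivAt (fun s : ℝ => x + s • a) a t := by
    simpa using ((hasDerivAt_id t).smul_const a).const_add x
  exact ((hf.differentiable (by simp) _).hasFDerivAt).comp_hasDerivAt t h1

lemma hasCompactSupport_line {f : Plane → ℝ} (hf : HasCompactSupport f) (x : Plane) {a : Plane}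
    (ha : a ≠ 0) : HasCompactSupport (fun s : ℝ => f (x + s • a)) := by
  refine hf.comp_isClosedEmbedding (g := fun s : ℝ => x + s • a) ?_
  exact (Homeomorph.addLeft x).isClosedEmbedding.comp (isClosedEmbedding_smul_left ha)

lemma integral_line_dirD {f : Plane → ℝ} (hf : ContDiff ℝ ∞ f) (hc : HasCompactSupport f)
    (x : Plane) {a : Plane} (ha : a ≠ 0) : ∫ s : ℝ, dirD a f (x + s • a) = 0 := by
  have hcl := hasCompactSupport_line hc x ha
  have hca : HasCompactSupport (dirD a f) := hc.fderiv_apply ℝ _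
  have hcont : Continuous fun s : ℝ => x + s • a := by fun_prop
  refine integral_eq_zero_of_hasDerivAt_of_integrable
    (f := fun s => f (x + s • a)) (fun t => hasDerivAt_line hf x a t) ?_ ?_
  · exact ((contDiff_dirD hf a).continuous.comp hcont).integrable_of_hasCompactSupport
      (hasCompactSupport_line hca x ha)
  · exact (hf.continuous.comp hcont).integrable_of_hasCompactSupport hcl

lemma integral_ray_dirD {f : Plane → ℝ} (hf : ContDiff ℝ ∞ f) (hc : HasCompactSupport f)
    (x : Plane) {a : Plane} (ha : a ≠ 0) : ∫ s in Ioi (0 : ℝ), dirD a f (x + s • a) = -f x := by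
  have hcl := hasCompactSupport_line hc x ha
  have hca : HasCompactSupport (dirD a f) := hc.fderiv_apply ℝ _
  have hcont : Continuous fun s : ℝ => x + s • a := by fun_prop
  have h := integral_Ioi_of_hasDerivAt_of_tendsto (a := 0) (m := 0)
    (f := fun s => f (x + s • a)) (f' := fun s => dirD a f (x + s • a))
    (hf.continuous.comp hcont).continuousWithinAt
    (fun t _ => hasDerivAt_line hf x a t)
    (((contDiff_dirD hf a).continuous.comp hcont).integrable_of_hasCompactSupport
      (hasCompactSupport_line hca x ha)).integrableOn
    (hcl.is_zero_at_infty.mono_left atTop_le_cocompact)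
  rw [h]
  simp

/-- Green's formula in a half-plane. -/
lemma green_halfPlane {a b : Plane} (h : cross b a ≠ 0) : ∃ c : ℝ, 0 < c ∧
    ∀ (x₀ : Plane) (F : Plane → ℝ), ContDiff ℝ ∞ F → HasCompactSupport F → ∀ u : Plane,
      ∫ x in {x | 0 < cross (x - x₀) a / cross b a}, dirD u F x =
        -c * (cross u a / cross b a) * ∫ t : ℝ, F (x₀ + t • a) := by
  obtain ⟨c, hc, hint⟩ := exists_integral_coordinates h
  have ha : a ≠ 0 := by rintro rfl; exact h (by simp [cross])
  have hb : b ≠ 0 := by rintro rfl; exact h (by simp [cross])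
  obtain ⟨L, hL⟩ := exists_coordinates h
  refine ⟨c, hc, fun x₀ F hF hcF u => ?_⟩
  set H : Set Plane := {x | 0 < cross (x - x₀) a / cross b a} with hH
  have hHopen : IsOpen H := isOpen_lt continuous_const ((continuous_cross_left _ _).div_const _)
  have hpre : ∀ z : ℝ × ℝ, x₀ + (z.1 • a + z.2 • b) ∈ H ↔ z ∈ (univ : Set ℝ) ×ˢ Ioi (0 : ℝ) := by
    intro z
    simp only [hH, mem_ofPred_eq, mem_prod, mem_univ, true_and, mem_Ioi]
    rw [add_sub_cancel_left, cross_add_left, cross_smul_left, cross_smul_left, cross_self, mul_zero,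
      zero_add, mul_div_cancel_right₀ _ h]
  have hform : ∀ G : Plane → ℝ, ∫ x in H, G x =
      c * ∫ z in (univ : Set ℝ) ×ˢ Ioi (0 : ℝ), G (x₀ + (z.1 • a + z.2 • b)) := by
    intro G
    rw [← integral_indicator hHopen.measurableSet, hint x₀,
      ← integral_indicator (MeasurableSet.univ.prod measurableSet_Ioi)]
    congr 1
    refine integral_congr_ae (ae_of_all _ fun z => ?_)
    simp only [indicator, hpre]
  have hint' : ∀ w : Plane, Integrable (fun z : ℝ × ℝ => dirD w F (x₀ + (z.1 • a + z.2 • b))) := by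
    intro w
    have hcw : HasCompactSupport (dirD w F) := hcF.fderiv_apply ℝ _
    have he : Topology.IsClosedEmbedding (fun z : ℝ × ℝ => x₀ + (z.1 • a + z.2 • b)) := by
      have : (fun z : ℝ × ℝ => x₀ + (z.1 • a + z.2 • b)) = (Homeomorph.addLeft x₀) ∘ L := by
        funext z; simp [hL]
      rw [this]
      exact (Homeomorph.addLeft x₀).isClosedEmbedding.comp L.toHomeomorph.isClosedEmbedding
    exact ((contDiff_dirD hF w).continuous.comp he.continuous).integrable_of_hasCompactSupport
      (hcw.comp_isClosedEmbedding he)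
  -- Derivatives along the boundary integrate to zero over full lines, and transversal ones leave
  -- the boundary value at the start of each ray. A general `u` is decomposed along `b` and `a`.
  have hA : ∫ x in H, dirD a F x = 0 := by
    rw [hform, Measure.volume_eq_prod, ← setIntegral_prod_swap, setIntegral_prod]
    · have : ∀ y : ℝ, ∫ t in (univ : Set ℝ), dirD a F (x₀ + (t • a + y • b)) = 0 := by
        intro y
        have := integral_line_dirD hF hcF (x₀ + y • b) ha
        rw [setIntegral_univ, ← this]
        congr 1
        funext t
        congr 1
        abel
      simp only [Prod.fst_swap, Prod.snd_swap, this, integral_zero, mul_zero]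
    · exact (hint' a).swap.integrableOn
  have hB : ∫ x in H, dirD b F x = -c * ∫ t : ℝ, F (x₀ + t • a) := by
    rw [hform, Measure.volume_eq_prod, setIntegral_prod _ (hint' b).integrableOn, setIntegral_univ]
    have : ∀ t : ℝ, ∫ y in Ioi (0 : ℝ), dirD b F (x₀ + (t • a + y • b)) = -F (x₀ + t • a) := by
      intro t
      rw [← integral_ray_dirD hF hcF (x₀ + t • a) hb]
      simp only [add_assoc]
    simp only [this, integral_neg]
    ring
  have hu := eq_of_cross_ne_zero (u := b) (w := a) h u
  have hi : ∀ w : Plane, IntegrableOn (dirD w F) H := fun w =>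
    ((contDiff_dirD hF w).continuous.integrable_of_hasCompactSupport
      (hcF.fderiv_apply ℝ _)).integrableOn
  have hsplit : ∀ x, dirD u F x =
      cross u a / cross b a * dirD b F x + cross b u / cross b a * dirD a F x := by
    intro x
    conv_lhs => rw [hu]
    exact dirD_add_smul _ _ _ _ _
  simp only [hsplit]
  rw [integral_add ((hi b).const_mul _) ((hi a).const_mul _), integral_const_mul,
    integral_const_mul, hA, hB]
  ring

/-- Green's formula near an inner point of an edge. -/
lemma green_edge (hK : IsElement P K) (i : Fin N) {t₀ : ℝ} (ht₀ : t₀ ∈ Ioo (0 : ℝ) 1) :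
    ∃ ρ > 0, ∃ c : ℝ, c ≠ 0 ∧ (∀ t : ℝ, P.edgePath ℝ i t ∈ Metric.ball (P.edgePath ℝ i t₀) ρ →
        t ∈ Ioo (0 : ℝ) 1) ∧
      ∀ F : Plane → ℝ, ContDiff ℝ ∞ F → HasCompactSupport F →
        tsupport F ⊆ Metric.ball (P.edgePath ℝ i t₀) ρ → ∀ u : Plane,
        ∫ x in (K : Set Plane), dirD u F x =
          c * cross u (edgeVec P i) * ∫ t in (0 : ℝ)..1, F (P.edgePath ℝ i t) := by
  obtain ⟨ρ₁, hρ₁, κ, hκ, hloc⟩ := edge_local hK i ht₀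
  have ha := edgeVec_ne_zero hK.simple i
  have ha' := norm_pos_iff.2 ha
  set a := edgeVec P i
  -- The sign of `κ` tells on which side `K` lies, so `κ • rot a` points into `K` and the half-plane
  -- of Green's formula agrees with `K` on the support of `F`.
  have hcr : cross (κ • rot a) a = κ * ‖a‖ ^ 2 := by rw [cross_smul_left, cross_rot]
  have hcr0 : cross (κ • rot a) a ≠ 0 := by rw [hcr]; positivity
  obtain ⟨c, hc, hgreen⟩ := green_halfPlane hcr0
  have hm : 0 < min t₀ (1 - t₀) := lt_min ht₀.1 (by linarith [ht₀.2])
  refine ⟨min ρ₁ (min t₀ (1 - t₀) * ‖a‖), by positivity, -c / cross (κ • rot a) a,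
    div_ne_zero (neg_ne_zero.2 hc.ne') hcr0, ?_, ?_⟩
  · intro t ht
    have h2 := Metric.ball_subset_ball (min_le_right _ _) ht
    rw [Metric.mem_ball, dist_eq_norm, edgePath_eq, edgePath_eq, add_sub_add_left_eq_sub,
      ← sub_smul, norm_smul, Real.norm_eq_abs] at h2
    have h3 : |t - t₀| < min t₀ (1 - t₀) := lt_of_mul_lt_mul_right h2 ha'.le
    have h4 := abs_lt.1 (h3.trans_le (min_le_left _ _))
    have h5 := abs_lt.1 (h3.trans_le (min_le_right _ _))
    exact ⟨by linarith, by linarith⟩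
  · intro F hF hcF hsF u
    have h1 := hgreen (P i) F hF hcF u
    have h2 : ∫ x in (K : Set Plane), dirD u F x =
        ∫ x in {x | 0 < cross (x - P i) a / cross (κ • rot a) a}, dirD u F x := by
      have hopen : IsOpen {x | 0 < cross (x - P i) a / cross (κ • rot a) a} :=
        isOpen_lt continuous_const ((continuous_cross_left _ _).div_const _)
      rw [← integral_indicator K.isOpen.measurableSet, ← integral_indicator hopen.measurableSet]
      congr 1
      funext x
      by_cases hx : x ∈ tsupport F
      · have hxB := Metric.ball_subset_ball (min_le_left _ _) (hsF hx)
        have h3 : x ∈ (K : Set Plane) ↔ x ∈ {x | 0 < cross (x - P i) a / cross (κ • rot a) a} := by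
          rw [hloc x hxB, mem_ofPred_eq, hcr, side]
          have h4 : cross (x - P i) a / (κ * ‖a‖ ^ 2) =
              κ * cross (x - P i) a * (1 / (κ ^ 2 * ‖a‖ ^ 2)) := by
            field_simp
          have h9 : 0 < 1 / (κ ^ 2 * ‖a‖ ^ 2) := by positivity
          rw [h4]
          exact (mul_pos_iff_of_pos_right h9).symm
        simp only [indicator, h3]
      · have h5 : dirD u F x = 0 := by
          have : fderiv ℝ F x = 0 := image_eq_zero_of_notMem_tsupport
            fun h => hx (tsupport_fderiv_subset ℝ h)
          simp [dirD, this]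
        simp [indicator, h5]
    have h6 : ∫ t : ℝ, F (P i + t • a) = ∫ t in (0 : ℝ)..1, F (P.edgePath ℝ i t) := by
      rw [intervalIntegral.integral_of_le zero_le_one]
      simp only [edgePath_eq]
      refine (setIntegral_eq_integral_of_forall_compl_eq_zero fun t ht => ?_).symm
      by_contra hne
      have h7 := hsF (subset_tsupport _ (Function.mem_support.2 hne))
      have h8 := Metric.ball_subset_ball (min_le_right _ _) h7
      rw [Metric.mem_ball, dist_eq_norm, edgePath_eq, add_sub_add_left_eq_sub,
        ← sub_smul, norm_smul, Real.norm_eq_abs] at h8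
      have h3 : |t - t₀| < min t₀ (1 - t₀) := lt_of_mul_lt_mul_right h8 ha'.le
      have h4 := abs_lt.1 (h3.trans_le (min_le_left _ _))
      have h5 := abs_lt.1 (h3.trans_le (min_le_right _ _))
      exact ht ⟨by linarith, by linarith⟩
    rw [h2, h1, h6]
    ring

end VEM

namespace VEM

open MeasureTheory Set Filter Topology TopologicalSpace
open scoped ContDiff Distributions

variable {N : ℕ} {P : Polygon Plane N} {K : Opens Plane}

/-! ### Traces -/

lemma hasCompactSupport_dirD {f : Plane → ℝ} (hf : HasCompactSupport f) (u : Plane) :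
    HasCompactSupport (dirD u f) := hf.fderiv_apply ℝ _

lemma tsupport_dirD_subset (f : Plane → ℝ) (u : Plane) : tsupport (dirD u f) ⊆ tsupport f :=
  (tsupport_comp_subset (g := fun L : Plane →L[ℝ] ℝ => L u) rfl _).trans
    (tsupport_fderiv_subset ℝ)

lemma dirD_mul {f g : Plane → ℝ} (hf : ContDiff ℝ ∞ f) (hg : ContDiff ℝ ∞ g) (u x : Plane) :
    dirD u (f * g) x = dirD u f x * g x + f x * dirD u g x := by
  simp only [dirD]
  rw [fderiv_mul (hf.differentiable (by simp) x) (hg.differentiable (by simp) x)]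
  simp
  ring

lemma memLp_of_test {f : Plane → ℝ} (hf : Continuous f) (hc : HasCompactSupport f)
    (K : Opens Plane) : MemLp f 2 (volume.restrict (K : Set Plane)) :=
  (hf.memLp_of_hasCompactSupport hc).restrict _

lemma intervalIntegral_eq_Icc (f : ℝ → ℝ) :
    ∫ t in (0 : ℝ)..1, f t = ∫ t in Icc (0 : ℝ) 1, f t := by
  rw [intervalIntegral.integral_of_le zero_le_one, integral_Icc_eq_integral_Ioc]

lemma _root_.Continuous.memLp_Icc {f : ℝ → ℝ} (hf : Continuous f) :
    MemLp f 2 (volume.restrict (Icc (0 : ℝ) 1)) := by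
  obtain ⟨C, hC⟩ := isCompact_Icc.exists_bound_of_continuousOn (s := Icc (0 : ℝ) 1) hf.continuousOn
  refine MemLp.of_bound hf.aestronglyMeasurable C ?_
  exact (ae_restrict_iff' measurableSet_Icc).2 (ae_of_all _ hC)

/-- Green's formula for Sobolev functions near an inner point of an edge. -/
lemma trace_green (hK : IsElement P K) (i : Fin N) {t₀ : ℝ} (ht₀ : t₀ ∈ Ioo (0 : ℝ) 1) :
    ∃ ρ > 0, ∃ c : ℝ, c ≠ 0 ∧ (∀ t : ℝ, P.edgePath ℝ i t ∈ Metric.ball (P.edgePath ℝ i t₀) ρ →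
        t ∈ Ioo (0 : ℝ) 1) ∧
      ∀ (w w₁ w₂ : L2 K) (g : Plane → ℝ), HasTrace P K w g → HasWeakDeriv K (1, 0) w w₁ →
        HasWeakDeriv K (0, 1) w w₂ → ∀ ψ : Plane → ℝ, ContDiff ℝ ∞ ψ → HasCompactSupport ψ →
        tsupport ψ ⊆ Metric.ball (P.edgePath ℝ i t₀) ρ → ∀ u : Plane,
        (∫ x in (K : Set Plane), w x * dirD u ψ x) +
          (u 0 * (∫ x in (K : Set Plane), w₁ x * ψ x) +
            u 1 * ∫ x in (K : Set Plane), w₂ x * ψ x) =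
          c * cross u (edgeVec P i) *
            ∫ t in (0 : ℝ)..1, g (P.edgePath ℝ i t) * ψ (P.edgePath ℝ i t) := by
  obtain ⟨ρ, hρ, c, hc, hin, hgreen⟩ := green_edge hK i ht₀
  refine ⟨ρ, hρ, c, hc, hin, fun w w₁ w₂ g hg h₁ h₂ ψ hψ hcψ hsψ u => ?_⟩
  obtain ⟨hm, w₁', w₂', φ, h1, h2, hs, ht, ht1, ht2, hb⟩ := hg
  obtain rfl := h1.unique h₁
  obtain rfl := h2.unique h₂
  -- Green's formula for `φ n * ψ` passes to the limit term by term, because each term pairs an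
  -- `L²`-convergent sequence with a fixed `L²` function.
  have l0 := tendsto_integral_mul (fun n => (hs n).continuous.aestronglyMeasurable) (Lp.memLp w)
    (memLp_of_test (contDiff_dirD hψ u).continuous (hasCompactSupport_dirD hcψ u) K) ht
  have l1 := tendsto_integral_mul
    (fun n => (contDiff_partialD (hs n) 0).continuous.aestronglyMeasurable) (Lp.memLp w₁')
    (memLp_of_test hψ.continuous hcψ K) ht1
  have l2 := tendsto_integral_mul
    (fun n => (contDiff_partialD (hs n) 1).continuous.aestronglyMeasurable) (Lp.memLp w₂')
    (memLp_of_test hψ.continuous hcψ K) ht2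
  have hψe : Continuous fun t : ℝ => ψ (P.edgePath ℝ i t) :=
    hψ.continuous.comp (continuous_edgePath P i)
  have hψm : MemLp (fun t : ℝ => ψ (P.edgePath ℝ i t)) 2 (volume.restrict (Icc (0 : ℝ) 1)) :=
    hψe.memLp_Icc
  have lb := tendsto_integral_mul (f := fun n t => φ n (P.edgePath ℝ i t))
    (fun n => ((hs n).continuous.comp (continuous_edgePath P i)).aestronglyMeasurable) (hm i)
    hψm (hb i)
  refine tendsto_nhds_unique (l0.add ((l1.const_mul (u 0)).add (l2.const_mul (u 1)))) ?_
  rw [intervalIntegral_eq_Icc]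
  refine (lb.const_mul (c * cross u (edgeVec P i))).congr fun n => ?_
  have hg := hgreen (φ n * ψ) ((hs n).mul hψ) hcψ.mul_left
    ((tsupport_mul_subset_right).trans hsψ) u
  rw [intervalIntegral_eq_Icc] at hg
  simp only [Pi.mul_apply] at hg
  rw [← hg]
  have i0 : Integrable (fun x => φ n x * dirD u ψ x) (volume.restrict (K : Set Plane)) :=
    (((hs n).continuous.mul (contDiff_dirD hψ u).continuous).integrable_of_hasCompactSupport
      (hasCompactSupport_dirD hcψ u).mul_left).restrict
  have i1 : ∀ k, Integrable (fun x => partialD k (φ n) x * ψ x)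
      (volume.restrict (K : Set Plane)) := fun k =>
    (((contDiff_partialD (hs n) k).continuous.mul hψ.continuous).integrable_of_hasCompactSupport
      hcψ.mul_left).restrict
  have i2 : Integrable (fun x => u 0 * (partialD 0 (φ n) x * ψ x) +
      u 1 * (partialD 1 (φ n) x * ψ x)) (volume.restrict (K : Set Plane)) :=
    ((i1 0).const_mul _).add ((i1 1).const_mul _)
  rw [← integral_const_mul, ← integral_const_mul, ← integral_add ((i1 0).const_mul _)
    ((i1 1).const_mul _), ← integral_add i0 i2]
  refine integral_congr_ae (ae_of_all _ fun x => ?_)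
  simp only []
  rw [dirD_mul (hs n) hψ, dirD_eq u (φ n)]
  ring

/-- If `G t₀` were positive, a bump in the plane so narrow that on the edge it is nonzero only where
`G` is positive would give a positive integral. The negative case follows by changing the sign. -/
lemma eq_zero_of_integral_bump (hP : IsSimplePolygon P) (i : Fin N) {t₀ : ℝ}
    (ht₀ : t₀ ∈ Ioo (0 : ℝ) 1) {G : ℝ → ℝ} (hG : ContinuousOn G (Icc 0 1)) {ρ : ℝ} (hρ : 0 < ρ)
    (h : ∀ ψ : Plane → ℝ, ContDiff ℝ ∞ ψ → HasCompactSupport ψ →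
      tsupport ψ ⊆ Metric.ball (P.edgePath ℝ i t₀) ρ →
      ∫ t in (0 : ℝ)..1, G t * ψ (P.edgePath ℝ i t) = 0) : G t₀ = 0 := by
  have key : ∀ G : ℝ → ℝ, ContinuousOn G (Icc 0 1) → (∀ ψ : Plane → ℝ, ContDiff ℝ ∞ ψ →
      HasCompactSupport ψ → tsupport ψ ⊆ Metric.ball (P.edgePath ℝ i t₀) ρ →
      ∫ t in (0 : ℝ)..1, G t * ψ (P.edgePath ℝ i t) = 0) → ¬ 0 < G t₀ := by
    intro G hG h hpos
    have ha := norm_pos_iff.2 (edgeVec_ne_zero hP i)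
    have hmem : t₀ ∈ Icc (0 : ℝ) 1 := ⟨ht₀.1.le, ht₀.2.le⟩
    have hev : ∀ᶠ t in 𝓝[Icc 0 1] t₀, 0 < G t := (hG t₀ hmem).eventually (lt_mem_nhds hpos)
    obtain ⟨δ, hδ, hδG⟩ := Metric.mem_nhdsWithin_iff.1 hev
    set r := min (ρ / 2) (δ * ‖edgeVec P i‖) with hr
    have hr0 : 0 < r := by positivity
    let f : ContDiffBump (P.edgePath ℝ i t₀) := ⟨r / 2, r, by positivity, by linarith⟩
    have hf0 := h f f.contDiff f.hasCompactSupport (by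
      rw [f.tsupport_eq]
      refine Metric.closedBall_subset_ball ?_
      have : r ≤ ρ / 2 := min_le_left _ _
      show r < ρ
      linarith)
    have hcont : ContinuousOn (fun t => G t * f (P.edgePath ℝ i t)) (Icc 0 1) :=
      hG.mul (f.continuous.comp (continuous_edgePath P i)).continuousOn
    have hnn : ∀ t ∈ Icc (0 : ℝ) 1, 0 ≤ G t * f (P.edgePath ℝ i t) := by
      intro t ht
      by_cases hd : dist t t₀ < δ
      · have : 0 < G t := hδG ⟨hd, ht⟩
        exact mul_nonneg this.le f.nonneg
      · have : f (P.edgePath ℝ i t) = 0 := by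
          refine f.zero_of_le_dist ?_
          show r ≤ _
          rw [dist_eq_norm, edgePath_eq, edgePath_eq, add_sub_add_left_eq_sub, ← sub_smul, norm_smul,
            ← dist_eq_norm]
          exact (min_le_right _ _).trans (mul_le_mul_of_nonneg_right (not_lt.1 hd) ha.le)
        rw [this, mul_zero]
    have := intervalIntegral.integral_pos one_pos hcont (fun t ht => hnn t ⟨ht.1.le, ht.2⟩)
      ⟨t₀, hmem, mul_pos hpos (f.pos_of_mem_ball (by
        rw [Metric.mem_ball, dist_self]
        exact hr0))⟩
    linarith
  refine le_antisymm (not_lt.1 (key G hG h)) (not_lt.1 fun hneg => ?_)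
  refine key (fun t => -G t) hG.neg (fun ψ h1 h2 h3 => ?_) (neg_pos.2 hneg)
  simp only [neg_mul, intervalIntegral.integral_neg, h ψ h1 h2 h3, neg_zero]

lemma eqOn_boundary_of_Ioo {g g' : Plane → ℝ} (hg : ContinuousOn g (P.boundary ℝ))
    (hg' : ContinuousOn g' (P.boundary ℝ))
    (h : ∀ i, ∀ t ∈ Ioo (0 : ℝ) 1, g (P.edgePath ℝ i t) = g' (P.edgePath ℝ i t)) :
    EqOn g g' (P.boundary ℝ) := by
  intro x hx
  obtain ⟨i, hi⟩ := mem_iUnion.1 hx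
  obtain ⟨t, ht, rfl⟩ := mem_edgeSet.1 hi
  have hc : ∀ f : Plane → ℝ, ContinuousOn f (P.boundary ℝ) →
      ContinuousOn (fun t : ℝ => f (P.edgePath ℝ i t)) (Icc 0 1) := fun f hf =>
    hf.comp (continuous_edgePath P i).continuousOn fun t ht => edgePath_mem_boundary ht
  have hcl : Icc (0 : ℝ) 1 = closure (Ioo 0 1) := (closure_Ioo zero_ne_one).symm
  refine EqOn.of_subset_closure (s := Ioo (0 : ℝ) 1) (fun t ht => h i t ht) (hc g hg) (hc g' hg')
    Ioo_subset_Icc_self hcl.le ht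

lemma continuousOn_edge {g : Plane → ℝ} (hg : ContinuousOn g (P.boundary ℝ)) (i : Fin N) :
    ContinuousOn (fun t : ℝ => g (P.edgePath ℝ i t)) (Icc 0 1) :=
  hg.comp (continuous_edgePath P i).continuousOn fun _ ht => edgePath_mem_boundary ht

/-- For `w = 0` the area terms of `trace_green` vanish, and in the normal direction only a nonzero
multiple of the moments of `g` along the edge is left. -/
lemma HasTrace.eqOn_zero (hK : IsElement P K) {g : Plane → ℝ} (h : HasTrace P K 0 g)
    (hg : ContinuousOn g (P.boundary ℝ)) : EqOn g 0 (P.boundary ℝ) := by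
  refine eqOn_boundary_of_Ioo hg continuousOn_const fun i t ht => ?_
  obtain ⟨ρ, hρ, c, hc, -, hgr⟩ := trace_green hK i ht
  refine eq_zero_of_integral_bump hK.simple i ht (continuousOn_edge hg i) hρ fun ψ h1 h2 h3 => ?_
  have := hgr 0 0 0 g h (hasWeakDeriv_zero K _) (hasWeakDeriv_zero K _) ψ h1 h2 h3
    (rot (edgeVec P i))
  rw [integral_zero_mul, integral_zero_mul, cross_rot] at this
  have ha := norm_pos_iff.2 (edgeVec_ne_zero hK.simple i)
  have h4 : c * ‖edgeVec P i‖ ^ 2 ≠ 0 := by positivity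
  simpa [h4] using this.symm

lemma HasTrace.eqOn (hK : IsElement P K) {w : L2 K} {g g' : Plane → ℝ} (h : HasTrace P K w g)
    (h' : HasTrace P K w g') (hg : ContinuousOn g (P.boundary ℝ))
    (hg' : ContinuousOn g' (P.boundary ℝ)) : EqOn g g' (P.boundary ℝ) := by
  have h1 := h.add (h'.smul (-1))
  rw [neg_one_smul, neg_one_smul, add_neg_cancel] at h1
  intro x hx
  have := HasTrace.eqOn_zero hK h1 (hg.add hg'.neg) hx
  simpa [add_neg_eq_zero] using this

/-- Trace jets are unique on the boundary. -/
lemma IsTraceJet.eqOn (hK : IsElement P K) {p : ℕ} {v : L2 K} {g g' : ℕ × ℕ → Plane → ℝ}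
    (h : IsTraceJet P K p v g) (h' : IsTraceJet P K p v g') {ν : ℕ × ℕ} (hν : ν.1 + ν.2 < p) :
    EqOn (g ν) (g' ν) (P.boundary ℝ) := by
  obtain ⟨hc, w, hw, ht⟩ := h ν hν
  obtain ⟨hc', w', hw', ht'⟩ := h' ν hν
  obtain rfl := hw.unique hw'
  exact ht.eqOn hK ht' hc hc'

lemma dirD_comm {f : Plane → ℝ} (hf : ContDiff ℝ ∞ f) (u w : Plane) :
    dirD u (dirD w f) = dirD w (dirD u f) := by
  have h1 := symb_lin_mul hf u (lin w)
  have h2 := symb_lin_mul hf w (lin u)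
  have h3 : ∀ z, symb (lin z) f = dirD z f := fun z => by
    rw [← mul_one (lin z), symb_lin_mul hf, symb_one]
  rw [h3] at h1 h2
  rw [← h1, ← h2, mul_comm]

/-- Along an edge, the trace of the tangential derivative is the derivative of the trace. -/
lemma trace_tangential (hK : IsElement P K) (i : Fin N) {w w₁ w₂ : L2 K} {g g₁ g₂ : Plane → ℝ}
    (hw : HasTrace P K w g) (hw₁ : HasTrace P K w₁ g₁) (hw₂ : HasTrace P K w₂ g₂)
    (h₁ : HasWeakDeriv K (1, 0) w w₁) (h₂ : HasWeakDeriv K (0, 1) w w₂)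
    (hg₁ : ContinuousOn g₁ (P.boundary ℝ)) (hg₂ : ContinuousOn g₂ (P.boundary ℝ))
    {q : Polynomial ℝ} (hq : ∀ t ∈ Icc (0 : ℝ) 1, g (P.edgePath ℝ i t) = q.eval t) :
    ∀ t ∈ Icc (0 : ℝ) 1, edgeVec P i 0 * g₁ (P.edgePath ℝ i t) +
      edgeVec P i 1 * g₂ (P.edgePath ℝ i t) = q.derivative.eval t := by
  set a := edgeVec P i with ha
  set b := rot a with hb
  have hc₁ := continuousOn_edge hg₁ i
  have hc₂ := continuousOn_edge hg₂ i
  have hcont : ContinuousOn (fun t => a 0 * g₁ (P.edgePath ℝ i t) +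
      a 1 * g₂ (P.edgePath ℝ i t)) (Icc 0 1) :=
    (continuousOn_const.mul hc₁).add (continuousOn_const.mul hc₂)
  have hcl : Icc (0 : ℝ) 1 = closure (Ioo 0 1) := (closure_Ioo zero_ne_one).symm
  refine EqOn.of_subset_closure (s := Ioo (0 : ℝ) 1) (fun t₀ ht₀ => ?_) hcont
    q.derivative.continuous.continuousOn Ioo_subset_Icc_self hcl.le
  obtain ⟨ρ, hρ, c, hc, hin, hgr⟩ := trace_green hK i ht₀
  have hna := norm_pos_iff.2 (edgeVec_ne_zero hK.simple i)
  have hcb : c * cross b a ≠ 0 := by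
    rw [hb, cross_rot]
    positivity
  rw [← sub_eq_zero]
  refine eq_zero_of_integral_bump hK.simple i ht₀ (G := fun t => a 0 * g₁ (P.edgePath ℝ i t) +
      a 1 * g₂ (P.edgePath ℝ i t) - q.derivative.eval t)
    (hcont.sub q.derivative.continuous.continuousOn) hρ fun ψ hψ hcψ hsψ => ?_
  obtain ⟨w₁₁, w₁₂, hw₁₁, hw₁₂⟩ : ∃ w₁₁ w₁₂, HasWeakDeriv K (1, 0) w₁ w₁₁ ∧
      HasWeakDeriv K (0, 1) w₁ w₁₂ := by
    obtain ⟨-, x, y, -, hx, hy, -⟩ := hw₁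
    exact ⟨x, y, hx, hy⟩
  obtain ⟨w₂₁, w₂₂, hw₂₁, hw₂₂⟩ : ∃ w₂₁ w₂₂, HasWeakDeriv K (1, 0) w₂ w₂₁ ∧
      HasWeakDeriv K (0, 1) w₂ w₂₂ := by
    obtain ⟨-, x, y, -, hx, hy, -⟩ := hw₂
    exact ⟨x, y, hx, hy⟩
  -- Both are the weak mixed derivative of `w`.
  have hsym : w₁₂ = w₂₁ := (h₁.comp hw₁₂).unique (h₂.comp hw₂₁)
  subst hsym
  have hda := contDiff_dirD hψ a
  have hdb := contDiff_dirD hψ b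
  have hca := hasCompactSupport_dirD hcψ a
  have hcb' := hasCompactSupport_dirD hcψ b
  have hsa := (tsupport_dirD_subset ψ a).trans hsψ
  have hsb := (tsupport_dirD_subset ψ b).trans hsψ
  -- Green's formula is applied to `w` with `∂_a ψ` in direction `b`, and with `∂_b ψ` in direction
  -- `a`, where the edge term vanishes. All area terms cancel after the first-order terms are
  -- integrated by parts once more, and there remains `∫ (g ∂_a ψ + (a · ∇w) ψ) = 0` on the edge.
  have e1 := hgr w w₁ w₂ g hw h₁ h₂ _ hda hca hsa b
  have e2 := hgr w w₁ w₂ g hw h₁ h₂ _ hdb hcb' hsb a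
  have e3 := hgr w₁ w₁₁ w₁₂ g₁ hw₁ hw₁₁ hw₁₂ ψ hψ hcψ hsψ
  have e4 := hgr w₂ w₁₂ w₂₂ g₂ hw₂ hw₂₁ hw₂₂ ψ hψ hcψ hsψ
  have e3a := e3 a
  have e3b := e3 b
  have e4a := e4 a
  have e4b := e4 b
  rw [← ha, cross_self, mul_zero, zero_mul] at e2 e3a e4a
  rw [← ha] at e1 e3b e4b
  rw [dirD_comm hψ a b] at e2
  have hψe : Continuous fun t : ℝ => ψ (P.edgePath ℝ i t) :=
    hψ.continuous.comp (continuous_edgePath P i)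
  set I₀ := ∫ t in (0 : ℝ)..1, g (P.edgePath ℝ i t) * dirD a ψ (P.edgePath ℝ i t)
  set I₁ := ∫ t in (0 : ℝ)..1, g₁ (P.edgePath ℝ i t) * ψ (P.edgePath ℝ i t) with hI₁
  set I₂ := ∫ t in (0 : ℝ)..1, g₂ (P.edgePath ℝ i t) * ψ (P.edgePath ℝ i t) with hI₂
  have hsum : I₀ + (a 0 * I₁ + a 1 * I₂) = 0 := by
    have : c * cross b a * (I₀ + (a 0 * I₁ + a 1 * I₂)) = 0 := by
      linear_combination -e1 + e2 - a 0 * e3b - a 1 * e4b + b 0 * e3a + b 1 * e4a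
    exact (mul_eq_zero.1 this).resolve_left hcb
  -- The support of `ψ` meets the line of the edge only at inner parameters, so integration by parts
  -- on the edge has no endpoint terms.
  have hend : ∀ s : ℝ, s ∉ Ioo (0 : ℝ) 1 → ψ (P.edgePath ℝ i s) = 0 := fun s hs =>
    image_eq_zero_of_notMem_tsupport fun h => hs (hin s (hsψ h))
  have hder : ∀ t : ℝ, HasDerivAt (fun s : ℝ => ψ (P.edgePath ℝ i s))
      (dirD a ψ (P.edgePath ℝ i t)) t := by
    intro t
    simp only [edgePath_eq]
    exact hasDerivAt_line hψ _ _ _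
  have hparts : I₀ = -∫ t in (0 : ℝ)..1, q.derivative.eval t * ψ (P.edgePath ℝ i t) := by
    have h5 : I₀ = ∫ t in (0 : ℝ)..1, q.eval t * dirD a ψ (P.edgePath ℝ i t) := by
      refine intervalIntegral.integral_congr fun t ht => ?_
      rw [uIcc_of_le zero_le_one] at ht
      simp only [hq t ht]
    rw [h5, intervalIntegral.integral_mul_deriv_eq_deriv_mul (fun t _ => q.hasDerivAt t)
      (fun t _ => hder t) (q.derivative.continuous.intervalIntegrable _ _)
      ((hda.continuous.comp (continuous_edgePath P i)).intervalIntegrable _ _),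
      hend 0 (by simp), hend 1 (by simp)]
    ring
  have hint : ∀ G : ℝ → ℝ, ContinuousOn G (Icc 0 1) →
      IntervalIntegrable (fun t => G t * ψ (P.edgePath ℝ i t)) volume 0 1 := fun G hG =>
    (hG.mul hψe.continuousOn).intervalIntegrable_of_Icc zero_le_one
  simp only [sub_mul, add_mul, mul_assoc]
  have j1 := (hint _ hc₁).const_mul (a 0)
  have j2 := (hint _ hc₂).const_mul (a 1)
  rw [intervalIntegral.integral_sub (j1.add j2) (hint _ q.derivative.continuous.continuousOn),
    intervalIntegral.integral_add j1 j2, intervalIntegral.integral_const_mul,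
    intervalIntegral.integral_const_mul, ← hI₁, ← hI₂]
  linarith

end VEM

namespace VEM

open MeasureTheory Set Filter Topology TopologicalSpace
open scoped ContDiff Distributions

/-! ### Hermite-moment interpolation on the unit interval -/

lemma finrank_degreeLT (n : ℕ) : Module.finrank ℝ (Polynomial.degreeLT ℝ n) = n := by
  rw [(Polynomial.degreeLTEquiv ℝ n).finrank_eq]
  simp

instance (n : ℕ) : FiniteDimensional ℝ (Polynomial.degreeLT ℝ n) :=
  (Polynomial.degreeLTEquiv ℝ n).symm.finiteDimensional

lemma pow_dvd_of_iterate_derivative {q : Polynomial ℝ} {c : ℝ} {k : ℕ}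
    (h : ∀ i < k, (Polynomial.derivative^[i] q).eval c = 0) :
    (Polynomial.X - Polynomial.C c) ^ k ∣ q := by
  rcases eq_or_ne q 0 with rfl | hq
  · exact dvd_zero _
  rcases k with _ | k
  · simp
  rw [← Polynomial.le_rootMultiplicity_iff hq]
  exact (Polynomial.lt_rootMultiplicity_iff_isRoot_iterate_derivative hq).2
    fun m hm => h m (Nat.lt_succ_of_le hm)

lemma polynomial_eq_zero_of_eval_Ioo {w : Polynomial ℝ}
    (h : ∀ t ∈ Ioo (0 : ℝ) 1, w.eval t = 0) : w = 0 :=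
  Polynomial.eq_zero_of_infinite_isRoot _ ((Ioo_infinite one_pos).mono h)

/-- The endpoint conditions force `q = t^k (t - 1)^k w` with `w` of degree less than `l`. Then `w`
is an admissible weight, and its moment is the integral of a function of constant sign. -/
lemma hermite_moment_unique {k l : ℕ} {q : Polynomial ℝ}
    (hq : q ∈ Polynomial.degreeLT ℝ (2 * k + l))
    (h0 : ∀ i < k, (Polynomial.derivative^[i] q).eval 0 = 0)
    (h1 : ∀ i < k, (Polynomial.derivative^[i] q).eval 1 = 0)
    (hm : ∀ w ∈ Polynomial.degreeLT ℝ l, ∫ t in (0 : ℝ)..1, w.eval t * q.eval t = 0) : q = 0 := by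
  have hcop : IsCoprime ((Polynomial.X - Polynomial.C (0 : ℝ)) ^ k)
      ((Polynomial.X - Polynomial.C (1 : ℝ)) ^ k) :=
    (Polynomial.isCoprime_X_sub_C_of_isUnit_sub (by norm_num)).pow
  obtain ⟨w, rfl⟩ := hcop.mul_dvd (pow_dvd_of_iterate_derivative h0)
    (pow_dvd_of_iterate_derivative h1)
  rcases eq_or_ne w 0 with rfl | hw
  · simp
  exfalso
  have hmon : ((Polynomial.X - Polynomial.C (0 : ℝ)) ^ k *
      (Polynomial.X - Polynomial.C (1 : ℝ)) ^ k).Monic :=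
    ((Polynomial.monic_X_sub_C _).pow k).mul ((Polynomial.monic_X_sub_C _).pow k)
  have hwl : w ∈ Polynomial.degreeLT ℝ l := by
    rw [Polynomial.mem_degreeLT] at hq ⊢
    rw [Polynomial.degree_mul, Polynomial.degree_mul, Polynomial.degree_pow,
      Polynomial.degree_pow, Polynomial.degree_X_sub_C, Polynomial.degree_X_sub_C,
      Polynomial.degree_eq_natDegree hw] at hq
    rw [Polynomial.degree_eq_natDegree hw]
    have : k + k + w.natDegree < 2 * k + l := by
      have h2 : ((k + k + w.natDegree : ℕ) : WithBot ℕ) < ((2 * k + l : ℕ) : WithBot ℕ) := by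
        simpa using hq
      exact_mod_cast h2
    have h3 : w.natDegree < l := by omega
    exact_mod_cast h3
  have hint := hm w hwl
  set F : ℝ → ℝ := fun t => t ^ k * (1 - t) ^ k * w.eval t ^ 2 with hF
  have hFc : Continuous F := by
    have := w.continuous
    fun_prop
  have hzero : ∫ t in (0 : ℝ)..1, F t = 0 := by
    have h4 : ∀ t, F t = (-1) ^ k * (w.eval t * (((Polynomial.X - Polynomial.C (0 : ℝ)) ^ k *
        (Polynomial.X - Polynomial.C (1 : ℝ)) ^ k) * w).eval t) := by
      intro t
      have h5 : (1 - t) ^ k = (-1) ^ k * (t - 1) ^ k := by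
        rw [← mul_pow]; ring
      simp only [hF, h5, Polynomial.eval_mul, Polynomial.eval_pow, Polynomial.eval_sub,
        Polynomial.eval_X, Polynomial.eval_C, sub_zero]
      ring
    simp only [h4]
    rw [intervalIntegral.integral_const_mul, hint, mul_zero]
  apply hw
  refine polynomial_eq_zero_of_eval_Ioo fun t ht => ?_
  by_contra hne
  have hpos : 0 < F t := by
    have := ht.1
    have h6 : 0 < 1 - t := by linarith [ht.2]
    positivity
  have := intervalIntegral.integral_pos one_pos hFc.continuousOn
    (fun s hs => by
      have h7 := hs.1.le
      have h8 : 0 ≤ 1 - s := by linarith [hs.2]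
      positivity) ⟨t, ⟨ht.1.le, ht.2.le⟩, hpos⟩
  linarith

/-- There are `2 k + l` conditions on a space of dimension `2 k + l`, so existence follows from
uniqueness. -/
lemma hermite_moment_exists (k l : ℕ) (a b : ℕ → ℝ)
    (m : Module.Dual ℝ (Polynomial.degreeLT ℝ l)) :
    ∃ q ∈ Polynomial.degreeLT ℝ (2 * k + l),
      (∀ i < k, (Polynomial.derivative^[i] q).eval 0 = a i) ∧
      (∀ i < k, (Polynomial.derivative^[i] q).eval 1 = b i) ∧
      ∀ w : Polynomial.degreeLT ℝ l,
        ∫ t in (0 : ℝ)..1, (w : Polynomial ℝ).eval t * q.eval t = m w := by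
  have hint : ∀ u v : Polynomial ℝ, IntervalIntegrable (fun t => u.eval t * v.eval t) volume 0 1 :=
    fun u v => (u.continuous.mul v.continuous).intervalIntegrable _ _
  let D : Polynomial ℝ →ₗ[ℝ] Polynomial ℝ := Polynomial.derivative
  have hD : ∀ i (q : Polynomial ℝ), (D ^ i) q = Polynomial.derivative^[i] q := fun i q => by
    rw [Module.End.pow_apply]
  let M : Polynomial.degreeLT ℝ (2 * k + l) →ₗ[ℝ] Module.Dual ℝ (Polynomial.degreeLT ℝ l) :=
    LinearMap.mk₂ ℝ (fun q w => ∫ t in (0 : ℝ)..1, (w : Polynomial ℝ).eval t *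
        (q : Polynomial ℝ).eval t)
      (fun q q' w => by
        simp only [Submodule.coe_add, Polynomial.eval_add, mul_add]
        exact intervalIntegral.integral_add (hint _ _) (hint _ _))
      (fun c q w => by
        simp only [Submodule.coe_smul, Polynomial.eval_smul, smul_eq_mul, mul_left_comm _ c]
        exact intervalIntegral.integral_const_mul _ _)
      (fun q w w' => by
        simp only [Submodule.coe_add, Polynomial.eval_add, add_mul]
        exact intervalIntegral.integral_add (hint _ _) (hint _ _))
      (fun c q w => by
        simp only [Submodule.coe_smul, Polynomial.eval_smul, smul_eq_mul, mul_assoc]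
        exact intervalIntegral.integral_const_mul _ _)
  let E : ℝ → Polynomial.degreeLT ℝ (2 * k + l) →ₗ[ℝ] (Fin k → ℝ) := fun c =>
    LinearMap.pi fun i => (Polynomial.leval c ∘ₗ (D ^ (i : ℕ))) ∘ₗ Submodule.subtype _
  have hE : ∀ c q i, E c q i = (Polynomial.derivative^[(i : ℕ)] (q : Polynomial ℝ)).eval c := by
    intro c q i
    simp [E, hD]
  let T := (E 0).prod ((E 1).prod M)
  have hinj : Function.Injective T := by
    rw [← LinearMap.ker_eq_bot, LinearMap.ker_eq_bot']
    intro q hq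
    have h0 : E 0 q = 0 := congrArg Prod.fst hq
    have h1 : E 1 q = 0 := congrArg (fun x => x.2.1) hq
    have h2 : M q = 0 := congrArg (fun x => x.2.2) hq
    refine Subtype.ext (hermite_moment_unique q.2 (fun i hi => ?_) (fun i hi => ?_) fun w hw => ?_)
    · rw [← hE 0 q ⟨i, hi⟩, h0, Pi.zero_apply]
    · rw [← hE 1 q ⟨i, hi⟩, h1, Pi.zero_apply]
    · exact LinearMap.congr_fun h2 ⟨w, hw⟩
  have hdim : Module.finrank ℝ (Polynomial.degreeLT ℝ (2 * k + l)) =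
      Module.finrank ℝ ((Fin k → ℝ) × (Fin k → ℝ) × Module.Dual ℝ (Polynomial.degreeLT ℝ l)) := by
    rw [Module.finrank_prod, Module.finrank_prod, Subspace.dual_finrank_eq, finrank_degreeLT,
      finrank_degreeLT, Module.finrank_fin_fun]
    ring
  obtain ⟨q, hq⟩ := (LinearMap.injective_iff_surjective_of_finrank_eq_finrank hdim).1 hinj
    (fun i => a i, fun i => b i, m)
  refine ⟨q, q.2, fun i hi => ?_, fun i hi => ?_, fun w => ?_⟩
  · rw [← hE 0 q ⟨i, hi⟩]
    exact congrFun (congrArg Prod.fst hq) ⟨i, hi⟩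
  · rw [← hE 1 q ⟨i, hi⟩]
    exact congrFun (congrArg (fun x => x.2.1) hq) ⟨i, hi⟩
  · exact LinearMap.congr_fun (congrArg (fun x => x.2.2) hq) w

end VEM

namespace VEM

open MeasureTheory Set Filter Topology TopologicalSpace
open scoped ContDiff Distributions

variable {N : ℕ} {P : Polygon Plane N} {K : Opens Plane}

/-! ### Extension by zero -/

lemma contDiff_mul {f g : Plane → ℝ} (hf : ContDiff ℝ ∞ f) (hg : ContDiff ℝ ∞ g) :
    ContDiff ℝ ∞ (f * g) := hf.mul hg

/-- An additive functional on test functions vanishes if it does so locally. -/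
lemma eq_zero_of_local {B : (Plane → ℝ) → ℝ}
    (hadd : ∀ f g : Plane → ℝ, ContDiff ℝ ∞ f → HasCompactSupport f → ContDiff ℝ ∞ g →
      HasCompactSupport g → B (f + g) = B f + B g) {ψ : Plane → ℝ} (hψ : ContDiff ℝ ∞ ψ)
    (hc : HasCompactSupport ψ)
    (hloc : ∀ x ∈ tsupport ψ, ∃ U ∈ 𝓝 x, ∀ f : Plane → ℝ, ContDiff ℝ ∞ f → HasCompactSupport f →
      tsupport f ⊆ U → tsupport f ⊆ tsupport ψ → B f = 0) : B ψ = 0 := by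
  classical
  choose! U hU hB using hloc
  obtain ⟨s, θ, hs, hθ, hθc, hθs, hsum⟩ := exists_smooth_partition hc hU
  have h0 : B 0 = 0 := by
    have := hadd 0 0 contDiff_const HasCompactSupport.zero contDiff_const HasCompactSupport.zero
    rw [add_zero] at this
    linarith
  have key : ∀ t : Finset s, B (∑ x ∈ t, θ x * ψ) = 0 := by
    intro t
    induction t using Finset.induction_on with
    | empty => simpa using h0
    | insert a t ha ih =>
      rw [Finset.sum_insert ha, hadd _ _ (contDiff_mul (hθ a) hψ) (hc.mul_left)
        (contDiff_finset_sum fun x _ => contDiff_mul (hθ x) hψ) (by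
          have : (∑ x ∈ t, θ x * ψ) = (∑ x ∈ t, θ x) * ψ := by rw [Finset.sum_mul]
          rw [this]
          exact hc.mul_left), ih, add_zero]
      exact hB a (hs a) _ ((hθ a).mul hψ) hc.mul_left
        ((tsupport_mul_subset_left).trans (hθs a)) tsupport_mul_subset_right
  have : ψ = ∑ x, θ x * ψ := by
    funext z
    rw [← Finset.sum_mul, Pi.mul_apply, Finset.sum_apply]
    by_cases hz : z ∈ tsupport ψ
    · rw [(hsum z hz).self_of_nhds, one_mul]
    · rw [image_eq_zero_of_notMem_tsupport hz, mul_zero]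
  rw [this]
  exact key _

/-- The defect in the integration by parts formula for `w ∈ H¹(K)`. -/
noncomputable def defect (K : Opens Plane) (w w₁ w₂ : L2 K) (u : Plane) (ψ : Plane → ℝ) : ℝ :=
  (∫ x in (K : Set Plane), w x * dirD u ψ x) +
    (u 0 * (∫ x in (K : Set Plane), w₁ x * ψ x) + u 1 * ∫ x in (K : Set Plane), w₂ x * ψ x)

lemma dirD_add {f g : Plane → ℝ} (hf : ContDiff ℝ ∞ f) (hg : ContDiff ℝ ∞ g) (u : Plane) :
    dirD u (f + g) = dirD u f + dirD u g := by
  funext x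
  simp only [dirD, Pi.add_apply]
  rw [fderiv_add (hf.differentiable (by simp) x) (hg.differentiable (by simp) x)]
  rfl

lemma defect_add (w w₁ w₂ : L2 K) (u : Plane) (f g : Plane → ℝ) (hf : ContDiff ℝ ∞ f)
    (hcf : HasCompactSupport f) (hg : ContDiff ℝ ∞ g) (hcg : HasCompactSupport g) :
    defect K w w₁ w₂ u (f + g) = defect K w w₁ w₂ u f + defect K w w₁ w₂ u g := by
  have key : ∀ (v : L2 K) {f g : Plane → ℝ}, Continuous f → HasCompactSupport f → Continuous g →
      HasCompactSupport g → ∫ x in (K : Set Plane), v x * (f + g) x =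
        (∫ x in (K : Set Plane), v x * f x) + ∫ x in (K : Set Plane), v x * g x := by
    intro v f g hf hcf hg hcg
    rw [← integral_add (integrable_mul_test v hf hcf) (integrable_mul_test v hg hcg)]
    simp only [Pi.add_apply, mul_add]
  unfold defect
  rw [dirD_add hf hg, key w (contDiff_dirD hf u).continuous (hasCompactSupport_dirD hcf u)
    (contDiff_dirD hg u).continuous (hasCompactSupport_dirD hcg u),
    key w₁ hf.continuous hcf hg.continuous hcg, key w₂ hf.continuous hcf hg.continuous hcg]
  ring

/-- A bump function equal to one near `V`, with support shrinking to `V`. -/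
noncomputable def shrinkingBump (V : Plane) (n : ℕ) (x : Plane) : ℝ :=
  (⟨1, 2, one_pos, one_lt_two⟩ : ContDiffBump (0 : Plane)) (((n : ℝ) + 1) • (x - V))

lemma contDiff_shrinkingBump (V : Plane) (n : ℕ) : ContDiff ℝ ∞ (shrinkingBump V n) :=
  (ContDiffBump.contDiff _).comp ((contDiff_id.sub contDiff_const).const_smul _)

lemma shrinkingBump_one (V : Plane) (n : ℕ) : shrinkingBump V n =ᶠ[𝓝 V] 1 := by
  have : ∀ᶠ x in 𝓝 V, ‖((n : ℝ) + 1) • (x - V)‖ < 1 := by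
    have hc : ContinuousAt (fun x : Plane => ‖((n : ℝ) + 1) • (x - V)‖) V := by fun_prop
    refine hc.eventually_lt continuousAt_const ?_
    simp
  filter_upwards [this] with x hx
  exact ContDiffBump.one_of_mem_closedBall _ (by simpa using hx.le)

lemma shrinkingBump_eq_zero {V : Plane} {n : ℕ} {x : Plane} (h : 2 / ((n : ℝ) + 1) ≤ ‖x - V‖) :
    shrinkingBump V n x = 0 := by
  refine ContDiffBump.zero_of_le_dist _ ?_
  have hn : (0 : ℝ) < n + 1 := by positivity
  rw [dist_zero_right, norm_smul, Real.norm_of_nonneg hn.le]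
  rw [div_le_iff₀ hn] at h
  show (2 : ℝ) ≤ _
  linarith

lemma abs_shrinkingBump_le (V : Plane) (n : ℕ) (x : Plane) : |shrinkingBump V n x| ≤ 1 := by
  unfold shrinkingBump
  rw [abs_of_nonneg (ContDiffBump.nonneg _)]
  exact ContDiffBump.le_one _

/-- The gradient is of size `n` on a disc of radius about `1 / n`, hence bounded in `L²` uniformly
in `n`; this is why points are negligible for `H¹` in the plane. The constant depends neither on `V`
nor on `n`. -/
lemma dirD_shrinkingBump_le (u : Plane) : ∃ M : ℝ, 0 ≤ M ∧ ∀ (V : Plane) (n : ℕ) (x : Plane),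
    |dirD u (shrinkingBump V n) x| ≤
      (Metric.closedBall V (2 / ((n : ℝ) + 1))).indicator (fun _ => M * ((n : ℝ) + 1)) x := by
  set η : ContDiffBump (0 : Plane) := ⟨1, 2, one_pos, one_lt_two⟩ with hη
  obtain ⟨M, hM⟩ := (contDiff_dirD η.contDiff u).continuous.bounded_above_of_compact_support
    (hasCompactSupport_dirD η.hasCompactSupport u)
  have hM0 : 0 ≤ M := (norm_nonneg _).trans (hM 0)
  refine ⟨M, hM0, fun V n x => ?_⟩
  have hn : (0 : ℝ) < n + 1 := by positivity
  by_cases hx : x ∈ Metric.closedBall V (2 / ((n : ℝ) + 1))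
  · rw [indicator_of_mem hx]
    have h1 : HasFDerivAt (fun y : Plane => ((n : ℝ) + 1) • (y - V))
        (((n : ℝ) + 1) • ContinuousLinearMap.id ℝ Plane) x :=
      ((hasFDerivAt_id x).sub_const V).fun_const_smul _
    have h2 := ((η.contDiff : ContDiff ℝ ∞ η).differentiable (by simp)
      (((n : ℝ) + 1) • (x - V))).hasFDerivAt.comp x h1
    have h3 : dirD u (shrinkingBump V n) x = ((n : ℝ) + 1) * dirD u η (((n : ℝ) + 1) • (x - V)) := by
      unfold dirD
      have : shrinkingBump V n = η ∘ fun y : Plane => ((n : ℝ) + 1) • (y - V) := rfl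
      rw [this, h2.fderiv]
      simp
    rw [h3, abs_mul, abs_of_pos hn, mul_comm]
    exact mul_le_mul_of_nonneg_right (hM _) hn.le
  · rw [indicator_of_notMem hx]
    have h0 : shrinkingBump V n =ᶠ[𝓝 x] 0 := by
      filter_upwards [Metric.isClosed_closedBall.isOpen_compl.mem_nhds hx] with y hy
      refine shrinkingBump_eq_zero ?_
      rw [mem_compl_iff, Metric.mem_closedBall, dist_eq_norm, not_le] at hy
      exact hy.le
    rw [dirD, h0.fderiv_eq]
    simp

lemma tendsto_integral_mul_of_shrinking {μ : Measure Plane} {f : Plane → ℝ} (hf : Integrable f μ)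
    {χ : ℕ → Plane → ℝ} (hχ : ∀ n, Continuous (χ n)) (hb : ∀ n x, |χ n x| ≤ 1)
    (h0 : ∀ᵐ x ∂μ, ∀ᶠ n in atTop, χ n x = 0) :
    Tendsto (fun n => ∫ x, f x * χ n x ∂μ) atTop (𝓝 0) := by
  have := tendsto_integral_of_dominated_convergence (F := fun n x => f x * χ n x)
    (f := fun _ => 0) (μ := μ) (fun x => ‖f x‖) (fun n => hf.1.mul (hχ n).aestronglyMeasurable)
    hf.norm (fun n => ae_of_all _ fun x => by
      rw [norm_mul]
      exact mul_le_of_le_one_right (norm_nonneg _) (hb n x)) (by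
      filter_upwards [h0] with x hx
      refine tendsto_const_nhds.congr' ?_
      filter_upwards [hx] with n hn
      rw [hn, mul_zero])
  simpa using this

lemma eventually_shrinkingBump_eq_zero {V x : Plane} (h : x ≠ V) :
    ∀ᶠ n : ℕ in atTop, 2 / ((n : ℝ) + 1) < ‖x - V‖ := by
  have h1 : Tendsto (fun n : ℕ => 2 / ((n : ℝ) + 1)) atTop (𝓝 0) := by
    have := (tendsto_one_div_add_atTop_nhds_zero_nat (𝕜 := ℝ)).const_mul 2
    simpa [div_eq_mul_inv] using this
  exact (tendsto_order.1 h1).2 _ (norm_pos_iff.2 (sub_ne_zero.2 h))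

lemma ae_restrict_ne (K : Opens Plane) (V : Plane) :
    ∀ᵐ x ∂(volume.restrict (K : Set Plane)), x ≠ V :=
  ae_restrict_of_ae (measure_eq_zero_iff_ae_notMem.1 (measure_singleton V))

/-- Young's inequality with a parameter: the integral is at most `ε⁻¹ ∫ w²` over the shrinking
discs, which tends to zero, plus `ε` times the bounded square norm of the gradient. -/
lemma tendsto_integral_mul_gradient {w : Plane → ℝ} {μ : Measure Plane} (hμ : μ ≤ volume)
    (hw : MemLp w 2 μ) {V : Plane} (hV : ∀ᵐ x ∂μ, x ≠ V) {g : ℕ → Plane → ℝ} {L : ℝ}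
    (hg : ∀ (n : ℕ) (x : Plane), |g n x| ≤
      (Metric.closedBall V (2 / ((n : ℝ) + 1))).indicator (fun _ => L * ((n : ℝ) + 1)) x) :
    Tendsto (fun n => ∫ x, w x * g n x ∂μ) atTop (𝓝 0) := by
  set B : ℕ → Set Plane := fun n => Metric.closedBall V (2 / ((n : ℝ) + 1)) with hB
  have hBm : ∀ n, MeasurableSet (B n) := fun n => Metric.isClosed_closedBall.measurableSet
  have hw2 : Integrable (fun x => w x ^ 2) μ := hw.integrable_sq
  have hfin : ∀ n, μ (B n) < ⊤ := fun n =>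
    (hμ _).trans_lt (isCompact_closedBall _ _).measure_lt_top
  have ha : Tendsto (fun n => ∫ x, (B n).indicator (fun y => w y ^ 2) x ∂μ) atTop (𝓝 0) := by
    have := tendsto_integral_of_dominated_convergence
      (F := fun n x => (B n).indicator (fun y => w y ^ 2) x)
      (f := fun _ => 0) (μ := μ) (fun x => ‖w x ^ 2‖)
      (fun n => hw2.1.indicator (hBm n)) hw2.norm
      (fun n => ae_of_all _ fun x => norm_indicator_le_norm_self _ _) (by
        filter_upwards [hV] with x hx
        refine tendsto_const_nhds.congr' ?_
        filter_upwards [eventually_shrinkingBump_eq_zero hx] with n hn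
        rw [indicator_of_notMem]
        simpa [hB, dist_eq_norm] using hn)
    simpa using this
  set β : ℝ := volume.real (Metric.closedBall (0 : Plane) 1)
  -- Here dimension two enters: the area of the disc compensates the square of the gradient bound
  -- exactly.
  have hvol : ∀ n : ℕ, ((n : ℝ) + 1) ^ 2 * μ.real (B n) ≤ 4 * β := by
    intro n
    have hn : (0 : ℝ) < n + 1 := by positivity
    have h1 : μ.real (B n) ≤ volume.real (B n) :=
      ENNReal.toReal_mono (isCompact_closedBall _ _).measure_lt_top.ne (hμ _)
    have h2 : volume.real (B n) = (2 / ((n : ℝ) + 1)) ^ 2 * β := by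
      simp only [hB]
      rw [Measure.real, Measure.addHaar_closedBall' _ _ (by positivity), ENNReal.toReal_mul,
        ENNReal.toReal_ofReal (by positivity)]
      simp [β, Measure.real]
    rw [h2] at h1
    calc ((n : ℝ) + 1) ^ 2 * μ.real (B n) ≤ ((n : ℝ) + 1) ^ 2 * ((2 / ((n : ℝ) + 1)) ^ 2 * β) :=
          mul_le_mul_of_nonneg_left h1 (by positivity)
      _ = 4 * β := by field_simp; ring
  have hle : ∀ ε > 0, ∀ n, |∫ x, w x * g n x ∂μ| ≤
      ε⁻¹ * (∫ x, (B n).indicator (fun y => w y ^ 2) x ∂μ) + ε * (L ^ 2 * (4 * β)) := by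
    intro ε hε n
    have hi1 : Integrable ((B n).indicator fun y => w y ^ 2) μ := hw2.indicator (hBm n)
    have hi2 : Integrable ((B n).indicator fun _ => (L * ((n : ℝ) + 1)) ^ 2) μ :=
      (integrable_indicator_iff (hBm n)).2 (integrableOn_const (hfin n).ne)
    have hi : Integrable (fun x => ε⁻¹ * (B n).indicator (fun y => w y ^ 2) x +
        ε * (B n).indicator (fun _ => (L * ((n : ℝ) + 1)) ^ 2) x) μ :=
      (hi1.const_mul _).add (hi2.const_mul _)
    calc |∫ x, w x * g n x ∂μ| ≤ ∫ x, (ε⁻¹ * (B n).indicator (fun y => w y ^ 2) x +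
          ε * (B n).indicator (fun _ => (L * ((n : ℝ) + 1)) ^ 2) x) ∂μ := by
          rw [← Real.norm_eq_abs]
          refine (norm_integral_le_integral_norm _).trans ?_
          refine integral_mono_of_nonneg (ae_of_all _ fun x => norm_nonneg _) hi
            (ae_of_all _ fun x => ?_)
          have hgx := hg n x
          simp only [Real.norm_eq_abs, abs_mul]
          by_cases hx : x ∈ B n
          · rw [indicator_of_mem hx] at hgx
            simp only [indicator_of_mem hx]
            have h0 : |w x| * |g n x| ≤ |w x| * (L * ((n : ℝ) + 1)) :=
              mul_le_mul_of_nonneg_left hgx (abs_nonneg _)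
            have h1 : 0 ≤ ε⁻¹ * (|w x| - ε * (L * ((n : ℝ) + 1)) / 2) ^ 2 := by positivity
            have h2 : ε⁻¹ * (|w x| - ε * (L * ((n : ℝ) + 1)) / 2) ^ 2 = ε⁻¹ * w x ^ 2 -
                |w x| * (L * ((n : ℝ) + 1)) + ε * (L * ((n : ℝ) + 1)) ^ 2 / 4 := by
              rw [← sq_abs (w x)]
              field_simp
              ring
            have h3 : 0 ≤ ε * (L * ((n : ℝ) + 1)) ^ 2 := by positivity
            linarith
          · rw [indicator_of_notMem hx] at hgx
            simp only [indicator_of_notMem hx]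
            rw [le_antisymm hgx (abs_nonneg _)]
            simp
      _ = ε⁻¹ * (∫ x, (B n).indicator (fun y => w y ^ 2) x ∂μ) +
          ε * (L ^ 2 * (((n : ℝ) + 1) ^ 2 * μ.real (B n))) := by
          rw [integral_add (hi1.const_mul _) (hi2.const_mul _), integral_const_mul,
            integral_const_mul, integral_indicator_const _ (hBm n), smul_eq_mul]
          ring
      _ ≤ _ := by
          have := mul_le_mul_of_nonneg_left (hvol n) (mul_nonneg hε.le (sq_nonneg L))
          linarith
  rw [tendsto_zero_iff_abs_tendsto_zero]
  refine tendsto_order.2 ⟨fun a ha => Eventually.of_forall fun n => ha.trans_le (abs_nonneg _),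
    fun δ hδ => ?_⟩
  have hβ : 0 ≤ L ^ 2 * (4 * β) := by positivity
  obtain ⟨ε, hε, hεδ⟩ : ∃ ε > 0, ε * (L ^ 2 * (4 * β)) < δ / 2 := by
    refine ⟨δ / 2 / (L ^ 2 * (4 * β) + 1), by positivity, ?_⟩
    rw [div_mul_eq_mul_div, div_lt_iff₀ (by positivity)]
    nlinarith
  have h1 := (ha.const_mul ε⁻¹)
  rw [mul_zero] at h1
  filter_upwards [(tendsto_order.1 h1).2 (δ / 2) (by positivity)] with n hn
  have := hle ε hε n
  simp only [Function.comp_apply]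
  linarith

/-- Points are removable for the integration by parts formula. -/
lemma defect_eq_zero_of_punctured (w w₁ w₂ : L2 K) (u V : Plane) {ψ : Plane → ℝ}
    (hψ : ContDiff ℝ ∞ ψ) (hc : HasCompactSupport ψ)
    (h : ∀ f : Plane → ℝ, ContDiff ℝ ∞ f → HasCompactSupport f → tsupport f ⊆ tsupport ψ →
      V ∉ tsupport f → defect K w w₁ w₂ u f = 0) : defect K w w₁ w₂ u ψ = 0 := by
  set χ := shrinkingBump V
  have hχ : ∀ n, ContDiff ℝ ∞ (χ n) := contDiff_shrinkingBump V
  have hχ' : ∀ n, ContDiff ℝ ∞ (1 - χ n) := fun n => contDiff_const.sub (hχ n)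
  -- The function `(1 - χ n) * ψ` vanishes near `V`, so the whole defect is carried by `χ n * ψ`,
  -- whose contribution tends to zero.
  have hsplit : ∀ n, defect K w w₁ w₂ u ψ = defect K w w₁ w₂ u (χ n * ψ) := by
    intro n
    have h1 : ψ = χ n * ψ + (1 - χ n) * ψ := by ring
    conv_lhs => rw [h1]
    rw [defect_add _ _ _ _ _ _ (contDiff_mul (hχ n) hψ) hc.mul_left (contDiff_mul (hχ' n) hψ)
      hc.mul_left, h _ (contDiff_mul (hχ' n) hψ) hc.mul_left tsupport_mul_subset_right, add_zero]
    intro hV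
    refine (notMem_tsupport_iff_eventuallyEq.2 ?_) hV
    filter_upwards [shrinkingBump_one V n] with x hx
    simp [χ, hx]
  obtain ⟨M, hM0, hM⟩ := dirD_shrinkingBump_le u
  obtain ⟨C, hC⟩ := hψ.continuous.bounded_above_of_compact_support hc
  have hC0 : 0 ≤ C := (norm_nonneg _).trans (hC 0)
  have hae : ∀ᵐ x ∂(volume.restrict (K : Set Plane)), ∀ᶠ n in atTop, χ n x = 0 := by
    filter_upwards [ae_restrict_ne K V] with x hx
    filter_upwards [eventually_shrinkingBump_eq_zero hx] with n hn
    exact shrinkingBump_eq_zero hn.le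
  have hsm : ∀ (v : L2 K) {f : Plane → ℝ}, Continuous f → HasCompactSupport f →
      Tendsto (fun n => ∫ x in (K : Set Plane), v x * f x * χ n x) atTop (𝓝 0) :=
    fun v f hf hcf => tendsto_integral_mul_of_shrinking (integrable_mul_test v hf hcf)
      (fun n => (hχ n).continuous) (abs_shrinkingBump_le V) hae
  have hgr : Tendsto (fun n => ∫ x in (K : Set Plane), w x * (dirD u (χ n) x * ψ x)) atTop
      (𝓝 0) := by
    refine tendsto_integral_mul_gradient (L := M * C) Measure.restrict_le_self (Lp.memLp w)
      (ae_restrict_ne K V) fun n x => ?_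
    rw [abs_mul]
    refine (mul_le_mul (hM V n x) (hC x) (norm_nonneg _) ((abs_nonneg _).trans (hM V n x))).trans
      (le_of_eq ?_)
    by_cases hx : x ∈ Metric.closedBall V (2 / ((n : ℝ) + 1))
    · simp only [indicator_of_mem hx]; ring
    · simp only [indicator_of_notMem hx, zero_mul]
  have hlim := (hgr.add (hsm w (contDiff_dirD hψ u).continuous (hasCompactSupport_dirD hc u))).add
    (((hsm w₁ hψ.continuous hc).const_mul (u 0)).add ((hsm w₂ hψ.continuous hc).const_mul (u 1)))
  simp only [mul_zero, add_zero] at hlim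
  refine tendsto_nhds_unique (tendsto_const_nhds.congr fun n => ?_) hlim
  rw [hsplit n, defect]
  have i1 : Integrable (fun x => w x * (dirD u (χ n) x * ψ x)) (volume.restrict (K : Set Plane)) :=
    integrable_mul_test w ((contDiff_dirD (hχ n) u).continuous.mul hψ.continuous) hc.mul_left
  have i2 : Integrable (fun x => w x * dirD u ψ x * χ n x) (volume.restrict (K : Set Plane)) := by
    simp only [mul_assoc]
    exact integrable_mul_test w ((contDiff_dirD hψ u).continuous.mul (hχ n).continuous)
      (hasCompactSupport_dirD hc u).mul_right
  rw [← integral_add i1 i2]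
  congr 1
  · refine integral_congr_ae (ae_of_all _ fun x => ?_)
    simp only [dirD_mul (hχ n) hψ]
    ring
  · simp only [Pi.mul_apply, mul_assoc, mul_comm (ψ _)]

/-- A Sobolev function with zero trace can be extended by zero. -/
lemma zero_extension (hK : IsElement P K) {w w₁ w₂ : L2 K} {g : Plane → ℝ} (hg : HasTrace P K w g)
    (h₁ : HasWeakDeriv K (1, 0) w w₁) (h₂ : HasWeakDeriv K (0, 1) w w₂)
    (h0 : ∀ x ∈ P.boundary ℝ, g x = 0) (u : Plane) {ψ : Plane → ℝ} (hψ : ContDiff ℝ ∞ ψ)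
    (hc : HasCompactSupport ψ) : defect K w w₁ w₂ u ψ = 0 := by
  -- Away from the vertices the formula holds locally: in `K` by the definition of weak derivatives,
  -- at inner points of edges by `trace_green` with zero trace, and outside the closure trivially.
  have hgood : ∀ x : Plane, x ∉ range P → ∃ U ∈ 𝓝 x, ∀ f : Plane → ℝ, ContDiff ℝ ∞ f →
      HasCompactSupport f → tsupport f ⊆ U → defect K w w₁ w₂ u f = 0 := by
    intro x hx
    by_cases hxK : x ∈ (K : Set Plane)
    · refine ⟨K, K.isOpen.mem_nhds hxK, fun f hf hcf hsf => ?_⟩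
      have e1 := h₁ (mkTest f hf hcf hsf)
      have e2 := h₂ (mkTest f hf hcf hsf)
      have e3 : ∫ x in (K : Set Plane), w x * dirD u f x =
          u 0 * (∫ x in (K : Set Plane), w x * partialD 0 f x) +
          u 1 * ∫ x in (K : Set Plane), w x * partialD 1 f x := by
        have i : ∀ k, Integrable (fun x => w x * partialD k f x)
            (volume.restrict (K : Set Plane)) := fun k =>
          integrable_mul_test w (contDiff_partialD hf k).continuous (hasCompactSupport_partialD hcf k)
        rw [← integral_const_mul, ← integral_const_mul,
          ← integral_add ((i 0).const_mul _) ((i 1).const_mul _)]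
        refine integral_congr_ae (ae_of_all _ fun x => ?_)
        simp only [dirD_eq u f]
        ring
      have e1' : ∫ x in (K : Set Plane), w x * partialD 0 f x =
          -∫ x in (K : Set Plane), w₁ x * f x := by
        refine e1.trans ?_
        simp
        rfl
      have e2' : ∫ x in (K : Set Plane), w x * partialD 1 f x =
          -∫ x in (K : Set Plane), w₂ x * f x := by
        refine e2.trans ?_
        simp
        rfl
      rw [defect, e3, e1', e2']
      ring
    by_cases hxc : x ∈ closure (K : Set Plane)
    · have hxb : x ∈ P.boundary ℝ := by
        rw [← hK.frontier_eq, K.isOpen.frontier_eq]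
        exact ⟨hxc, hxK⟩
      obtain ⟨i, hi⟩ := mem_iUnion.1 hxb
      obtain ⟨t, ht, rfl⟩ := mem_edgeSet.1 hi
      have ht' : t ∈ Ioo (0 : ℝ) 1 := by
        refine ⟨lt_of_le_of_ne ht.1 ?_, lt_of_le_of_ne ht.2 ?_⟩
        · rintro rfl
          exact hx ⟨i, (edgePath_zero P i).symm⟩
        · rintro rfl
          exact hx ⟨finRotate N i, (edgePath_one P i).symm⟩
      obtain ⟨ρ, hρ, c, -, -, hgr⟩ := trace_green hK i ht'
      refine ⟨_, Metric.ball_mem_nhds _ hρ, fun f hf hcf hsf => ?_⟩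
      rw [defect, hgr w w₁ w₂ g hg h₁ h₂ f hf hcf hsf u]
      have : ∫ t in (0 : ℝ)..1, g (P.edgePath ℝ i t) * f (P.edgePath ℝ i t) = 0 := by
        rw [intervalIntegral.integral_congr (g := fun _ => 0), intervalIntegral.integral_zero]
        intro t ht
        rw [uIcc_of_le zero_le_one] at ht
        simp only [h0 _ (edgePath_mem_boundary ht), zero_mul]
      rw [this, mul_zero]
    · refine ⟨_, isClosed_closure.isOpen_compl.mem_nhds hxc, fun f hf hcf hsf => ?_⟩
      have hz : ∀ (v : L2 K) {f' : Plane → ℝ}, tsupport f' ⊆ tsupport f →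
          ∫ x in (K : Set Plane), v x * f' x = 0 := by
        intro v f' hf'
        refine setIntegral_eq_zero_of_forall_eq_zero fun x hx => ?_
        rw [image_eq_zero_of_notMem_tsupport fun h => hsf (hf' h) (subset_closure hx), mul_zero]
      rw [defect, hz w (tsupport_dirD_subset f u), hz w₁ subset_rfl, hz w₂ subset_rfl]
      ring
  have hfin : (range P).Finite := finite_range P
  refine eq_zero_of_local (defect_add w w₁ w₂ u) hψ hc fun x _ => ?_
  by_cases hx : x ∈ range P
  -- The neighbourhood excludes all other vertices, so `x` is the only point to be removed.
  · refine ⟨(range P \ {x})ᶜ, (hfin.subset sdiff_subset).isClosed.isOpen_compl.mem_nhds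
      (by simp), fun f hf hcf hsf _ => ?_⟩
    refine defect_eq_zero_of_punctured w w₁ w₂ u x hf hcf fun f' hf' hcf' hsf' hx' => ?_
    refine eq_zero_of_local (defect_add w w₁ w₂ u) hf' hcf' fun y hy => ?_
    obtain ⟨U, hU, hB⟩ := hgood y fun hyP => hsf (hsf' hy) ⟨hyP, fun h => hx' (h ▸ hy)⟩
    exact ⟨U, hU, fun f h1 h2 h3 _ => hB f h1 h2 h3⟩
  · obtain ⟨U, hU, hB⟩ := hgood x hx
    exact ⟨U, hU, fun f h1 h2 h3 _ => hB f h1 h2 h3⟩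

end VEM

namespace VEM

open MeasureTheory Set Filter Topology TopologicalSpace
open scoped ContDiff Distributions

variable {N : ℕ} {P : Polygon Plane N} {K : Opens Plane}

/-! ### Weak jets on the plane -/

/-- The product rule for abstract jets, from Pascal's rule alone. It therefore applies to weak
derivatives as well. -/
lemma jetMul_add_unitIndex (a b : ℕ × ℕ → ℝ) (ν : ℕ × ℕ) (k : Fin 2) :
    jetMul a b (ν + unitIndex k) = jetMul (shiftJet k a) b ν + jetMul a (shiftJet k b) ν := by
  obtain ⟨m, n⟩ := ν
  fin_cases k
  · have h0 : (m, n) + unitIndex ((fun i => i) ⟨0, by norm_num⟩) = (m + 1, n) := rfl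
    rw [h0]
    simp only [jetMul, shiftJet]
    rw [Finset.sum_comm, Finset.sum_comm (s := Finset.HasAntidiagonal.antidiagonal m),
      Finset.sum_comm (s := Finset.HasAntidiagonal.antidiagonal m), ← Finset.sum_add_distrib]
    refine Finset.sum_congr rfl fun l _ => ?_
    have h := Finset.sum_antidiagonal_choose_succ_mul
      (fun i j => (n.choose l.1 : ℝ) * (a (i, l.1) * b (j, l.2))) m
    simp only [mul_assoc]
    rw [h, add_comm]
    congr 1
    refine Finset.sum_congr rfl fun κ hκ => ?_
    rw [Nat.choose_symm_of_eq_add (Finset.HasAntidiagonal.mem_antidiagonal.1 hκ).symm]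
    rfl
  · have h0 : (m, n) + unitIndex ((fun i => i) ⟨1, by norm_num⟩) = (m, n + 1) := rfl
    rw [h0]
    simp only [jetMul, shiftJet]
    rw [← Finset.sum_add_distrib]
    refine Finset.sum_congr rfl fun l _ => ?_
    have h := Finset.sum_antidiagonal_choose_succ_mul
      (fun i j => (m.choose l.1 : ℝ) * (a (l.1, i) * b (l.2, j))) n
    simp only [mul_left_comm ((m.choose l.1 : ℕ) : ℝ)] at h
    simp only [mul_assoc, mul_left_comm ((m.choose l.1 : ℕ) : ℝ)]
    rw [h, add_comm]
    congr 1
    refine Finset.sum_congr rfl fun κ hκ => ?_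
    rw [Nat.choose_symm_of_eq_add (Finset.HasAntidiagonal.mem_antidiagonal.1 hκ).symm]
    rfl

/-- `W` consists of the weak derivatives on the plane of order at most `p` of `W 0 ∈ L²`. -/
structure WeakJet (p : ℕ) (W : ℕ × ℕ → Plane → ℝ) : Prop where
  memLp : ∀ ν, ν.1 + ν.2 ≤ p → MemLp (W ν) 2 volume
  deriv : ∀ ν, ν.1 + ν.2 < p → ∀ (k : Fin 2) (ψ : Plane → ℝ), ContDiff ℝ ∞ ψ →
    HasCompactSupport ψ → ∫ x, W ν x * partialD k ψ x = -∫ x, W (ν + unitIndex k) x * ψ x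

lemma add_unitIndex_sum (ν : ℕ × ℕ) (k : Fin 2) :
    (ν + unitIndex k).1 + (ν + unitIndex k).2 = ν.1 + ν.2 + 1 := by
  have := unitIndex_sum k
  simp only [Prod.fst_add, Prod.snd_add]
  omega

lemma WeakJet.integral_multiD {p : ℕ} {W : ℕ × ℕ → Plane → ℝ} (hW : WeakJet p W) {ν : ℕ × ℕ}
    (hν : ν.1 + ν.2 ≤ p) {ψ : Plane → ℝ} (hψ : ContDiff ℝ ∞ ψ) (hc : HasCompactSupport ψ) :
    ∫ x, W 0 x * multiD ν ψ x = (-1 : ℝ) ^ (ν.1 + ν.2) * ∫ x, W ν x * ψ x := by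
  induction ν using index_induction generalizing ψ with
  | zero => simp [multiD]
  | step ν k ih =>
    rw [add_unitIndex_sum] at hν ⊢
    rw [← multiD_partialD k ν hψ, ih (by omega) (contDiff_partialD hψ k)
      (hasCompactSupport_partialD hc k), hW.deriv ν (by omega) k ψ hψ hc, pow_succ]
    ring

lemma antidiagonal_index_le {ν κ l : ℕ × ℕ} {p : ℕ} (hν : ν.1 + ν.2 ≤ p)
    (hκ : κ ∈ Finset.HasAntidiagonal.antidiagonal ν.1)
    (hl : l ∈ Finset.HasAntidiagonal.antidiagonal ν.2) : κ.2 + l.2 ≤ p := by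
  have h1 := Finset.HasAntidiagonal.mem_antidiagonal.1 hκ
  have h2 := Finset.HasAntidiagonal.mem_antidiagonal.1 hl
  omega

lemma integrable_mul_of_memLp {f ψ : Plane → ℝ} (hf : MemLp f 2 volume) (hψ : Continuous ψ)
    (hc : HasCompactSupport ψ) : Integrable (fun x => f x * ψ x) :=
  hf.integrable_mul (hψ.memLp_of_hasCompactSupport (p := 2) hc)

lemma memLp_bounded_mul {f ψ : Plane → ℝ} (hf : MemLp f 2 volume) (hψ : Continuous ψ)
    (hc : HasCompactSupport ψ) : MemLp (fun x => ψ x * f x) 2 volume := by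
  obtain ⟨C, hC⟩ := hψ.bounded_above_of_compact_support hc
  refine hf.of_le_mul (c := C) (hψ.aestronglyMeasurable.mul hf.1) (ae_of_all _ fun x => ?_)
  rw [norm_mul]
  exact mul_le_mul_of_nonneg_right (hC x) (norm_nonneg _)

lemma memLp_jetMul {p : ℕ} {W : ℕ × ℕ → Plane → ℝ}
    (hW : ∀ ν : ℕ × ℕ, ν.1 + ν.2 ≤ p → MemLp (W ν) 2 volume) {a : ℕ × ℕ → Plane → ℝ}
    (ha : ∀ κ, Continuous (a κ)) (hc : ∀ κ, HasCompactSupport (a κ)) (ν : ℕ × ℕ)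
    (hν : ν.1 + ν.2 ≤ p) : MemLp (fun x => jetMul (fun κ => a κ x) (fun κ => W κ x) ν) 2 volume := by
  unfold jetMul
  refine memLp_finsetSum _ fun κ hκ => memLp_finsetSum _ fun l hl => ?_
  exact (memLp_bounded_mul (hW _ (antidiagonal_index_le hν hκ hl)) (ha _) (hc _)).const_mul _

lemma integral_jetMul_mul {p : ℕ} {W : ℕ × ℕ → Plane → ℝ}
    (hW : ∀ ν : ℕ × ℕ, ν.1 + ν.2 ≤ p → MemLp (W ν) 2 volume) {a : ℕ × ℕ → Plane → ℝ}
    (ha : ∀ κ, Continuous (a κ)) {ψ : Plane → ℝ} (hψ : Continuous ψ) (hc : HasCompactSupport ψ)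
    (ν : ℕ × ℕ) (hν : ν.1 + ν.2 ≤ p) :
    ∫ x, jetMul (fun κ => a κ x) (fun κ => W κ x) ν * ψ x =
      ∑ κ ∈ Finset.HasAntidiagonal.antidiagonal ν.1,
        ∑ l ∈ Finset.HasAntidiagonal.antidiagonal ν.2,
        (ν.1.choose κ.1 : ℝ) * (ν.2.choose l.1) * ∫ x, W (κ.2, l.2) x * (a (κ.1, l.1) x * ψ x) := by
  have hi : ∀ κ ∈ Finset.HasAntidiagonal.antidiagonal ν.1,
      ∀ l ∈ Finset.HasAntidiagonal.antidiagonal ν.2,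
      Integrable fun x => (ν.1.choose κ.1 : ℝ) * (ν.2.choose l.1) *
        (W (κ.2, l.2) x * (a (κ.1, l.1) x * ψ x)) := fun κ hκ l hl =>
    (integrable_mul_of_memLp (hW _ (antidiagonal_index_le hν hκ hl)) ((ha _).mul hψ)
      hc.mul_left).const_mul _
  have h2 : ∀ x, jetMul (fun κ => a κ x) (fun κ => W κ x) ν * ψ x =
      ∑ κ ∈ Finset.HasAntidiagonal.antidiagonal ν.1,
      ∑ l ∈ Finset.HasAntidiagonal.antidiagonal ν.2, (ν.1.choose κ.1 : ℝ) * (ν.2.choose l.1) *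
        (W (κ.2, l.2) x * (a (κ.1, l.1) x * ψ x)) := by
    intro x
    rw [jetMul, Finset.sum_mul]
    refine Finset.sum_congr rfl fun κ _ => ?_
    rw [Finset.sum_mul]
    exact Finset.sum_congr rfl fun l _ => by ring
  simp only [h2]
  rw [integral_finsetSum _ fun κ hκ => integrable_finsetSum _ fun l hl => hi κ hκ l hl]
  refine Finset.sum_congr rfl fun κ hκ => ?_
  rw [integral_finsetSum _ fun l hl => hi κ hκ l hl]
  exact Finset.sum_congr rfl fun l _ => integral_const_mul _ _

/-- Each term of the Leibniz formula is integrated by parts with the test function `D^κ θ * ψ`; the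
derivative that falls on `D^κ θ` is the other half of the product rule for jets. -/
lemma WeakJet.mul {p : ℕ} {W : ℕ × ℕ → Plane → ℝ} (hW : WeakJet p W) {θ : Plane → ℝ}
    (hθ : ContDiff ℝ ∞ θ) (hc : HasCompactSupport θ) :
    WeakJet p fun ν x => jetMul (fun κ => multiD κ θ x) (fun κ => W κ x) ν := by
  have ha : ∀ κ, Continuous (multiD κ θ) := fun κ => (contDiff_multiD hθ κ).continuous
  refine ⟨memLp_jetMul hW.memLp ha fun κ => hasCompactSupport_multiD hc κ, fun ν hν k ψ hψ hcψ => ?_⟩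
  have hsplit : ∀ x, jetMul (fun κ => multiD κ θ x) (fun κ => W κ x) (ν + unitIndex k) * ψ x =
      jetMul (fun κ => multiD (κ + unitIndex k) θ x) (fun κ => W κ x) ν * ψ x +
      jetMul (fun κ => multiD κ θ x) (fun κ => W (κ + unitIndex k) x) ν * ψ x := by
    intro x
    rw [jetMul_add_unitIndex, add_mul]
    rfl
  have hW' : ∀ ν : ℕ × ℕ, ν.1 + ν.2 ≤ p - 1 → MemLp (fun x => W (ν + unitIndex k) x) 2 volume :=
    fun ν hν' => hW.memLp _ (by rw [add_unitIndex_sum]; omega)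
  simp only [hsplit]
  rw [integral_add (integrable_mul_of_memLp (memLp_jetMul hW.memLp (fun κ => ha _)
      (fun κ => hasCompactSupport_multiD hc _) ν hν.le) hψ.continuous hcψ)
    (integrable_mul_of_memLp (memLp_jetMul hW' ha (fun κ => hasCompactSupport_multiD hc _) ν
      (by omega)) hψ.continuous hcψ),
    integral_jetMul_mul hW.memLp ha (contDiff_partialD hψ k).continuous
      (hasCompactSupport_partialD hcψ k) ν hν.le,
    integral_jetMul_mul hW.memLp (fun κ => ha _) hψ.continuous hcψ ν hν.le,
    integral_jetMul_mul hW' ha hψ.continuous hcψ ν (by omega),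
    ← Finset.sum_add_distrib, ← Finset.sum_neg_distrib]
  refine Finset.sum_congr rfl fun κ hκ => ?_
  rw [← Finset.sum_add_distrib, ← Finset.sum_neg_distrib]
  refine Finset.sum_congr rfl fun l hl => ?_
  have hle := antidiagonal_index_le (p := p - 1) (by omega) hκ hl
  rw [← mul_add, ← mul_neg]
  congr 1
  have hm := contDiff_multiD hθ (κ.1, l.1)
  have h3 := hW.deriv (κ.2, l.2) (show κ.2 + l.2 < p by omega) k (multiD (κ.1, l.1) θ * ψ)
    (contDiff_mul hm hψ) hcψ.mul_left
  rw [partialD_mul hm hψ, partialD_multiD k _ hθ] at h3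
  have i1 := integrable_mul_of_memLp (hW.memLp (κ.2, l.2) (show κ.2 + l.2 ≤ p by omega))
    ((ha ((κ.1, l.1) + unitIndex k)).mul hψ.continuous) hcψ.mul_left
  have i2 := integrable_mul_of_memLp (hW.memLp (κ.2, l.2) (show κ.2 + l.2 ≤ p by omega))
    ((ha (κ.1, l.1)).mul (contDiff_partialD hψ k).continuous)
    (hasCompactSupport_partialD hcψ k).mul_left
  have h4 : ∫ x, W (κ.2, l.2) x * (multiD ((κ.1, l.1) + unitIndex k) θ * ψ +
      multiD (κ.1, l.1) θ * partialD k ψ) x =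
      (∫ x, W (κ.2, l.2) x * (multiD ((κ.1, l.1) + unitIndex k) θ x * ψ x)) +
      ∫ x, W (κ.2, l.2) x * (multiD (κ.1, l.1) θ x * partialD k ψ x) := by
    refine Eq.trans ?_ (integral_add i1 i2)
    simp only [Pi.add_apply, Pi.mul_apply, mul_add]
  rw [h4] at h3
  simp only [Pi.mul_apply] at h3
  linarith

/-! ### Regularization -/

/-- Convolution with a test function. -/
noncomputable def conv (f k : Plane → ℝ) : Plane → ℝ :=
  convolution f k (ContinuousLinearMap.mul ℝ ℝ) volume

lemma conv_apply (f k : Plane → ℝ) (x : Plane) : conv f k x = ∫ t, f t * k (x - t) := rfl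

lemma contDiff_conv {f k : Plane → ℝ} (hf : LocallyIntegrable f) (hk : ContDiff ℝ ∞ k)
    (hc : HasCompactSupport k) : ContDiff ℝ ∞ (conv f k) :=
  hc.contDiff_convolution_right _ hf hk

lemma partialD_conv {f k : Plane → ℝ} (hf : LocallyIntegrable f) (hk : ContDiff ℝ ∞ k)
    (hc : HasCompactSupport k) (j : Fin 2) : partialD j (conv f k) = conv f (partialD j k) := by
  funext x
  have h := hc.hasFDerivAt_convolution_right (ContinuousLinearMap.mul ℝ ℝ) hf
    (hk.of_le (by simp)) x
  unfold partialD
  rw [conv, h.fderiv, convolution_precompR_apply _ hf (hc.fderiv ℝ)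
    (hk.continuous_fderiv (by simp))]
  rfl

lemma multiD_conv {f k : Plane → ℝ} (hf : LocallyIntegrable f) (hk : ContDiff ℝ ∞ k)
    (hc : HasCompactSupport k) (ν : ℕ × ℕ) : multiD ν (conv f k) = conv f (multiD ν k) := by
  induction ν using index_induction with
  | zero => rfl
  | step ν j ih =>
    rw [← partialD_multiD j ν (contDiff_conv hf hk hc), ih, partialD_conv hf (contDiff_multiD hk ν)
      (hasCompactSupport_multiD hc ν), partialD_multiD j ν hk]

lemma multiD_comp_sub {k : Plane → ℝ} (hk : ContDiff ℝ ∞ k) (x : Plane) (ν : ℕ × ℕ) :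
    multiD ν (fun t => k (x - t)) = fun t => (-1 : ℝ) ^ (ν.1 + ν.2) * multiD ν k (x - t) := by
  have hsub : ∀ {f : Plane → ℝ}, ContDiff ℝ ∞ f → ContDiff ℝ ∞ fun t => f (x - t) := fun hf =>
    hf.comp (contDiff_const.sub contDiff_id)
  induction ν using index_induction with
  | zero => simp [multiD]
  | step ν j ih =>
    rw [← partialD_multiD j ν (hsub hk), ih, ← partialD_multiD j ν hk]
    have h1 : (fun t => (-1 : ℝ) ^ (ν.1 + ν.2) * multiD ν k (x - t)) =
      (-1 : ℝ) ^ (ν.1 + ν.2) • fun t => multiD ν k (x - t) := rfl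
    rw [h1, partialD_smul (hsub (contDiff_multiD hk ν)), add_unitIndex_sum]
    funext t
    have h2 : partialD j (fun t => multiD ν k (x - t)) t = -partialD j (multiD ν k) (x - t) := by
      unfold partialD
      have h3 : HasFDerivAt (fun t => multiD ν k (x - t))
          ((fderiv ℝ (multiD ν k) (x - t)).comp (-ContinuousLinearMap.id ℝ Plane)) t :=
        ((contDiff_multiD hk ν).differentiable (by simp) (x - t)).hasFDerivAt.comp t
          ((hasFDerivAt_id t).const_sub x)
      rw [h3.fderiv]
      simp
    rw [Pi.smul_apply, smul_eq_mul, h2, pow_succ]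
    ring

/-- The function `t ↦ k (x - t)` is an admissible test function, and the sign from its reflection
cancels the sign in the definition of weak derivatives. -/
lemma WeakJet.multiD_conv {p : ℕ} {W : ℕ × ℕ → Plane → ℝ} (hW : WeakJet p W) {k : Plane → ℝ}
    (hk : ContDiff ℝ ∞ k) (hc : HasCompactSupport k) {ν : ℕ × ℕ} (hν : ν.1 + ν.2 ≤ p) :
    multiD ν (conv (W 0) k) = conv (W ν) k := by
  have hloc : LocallyIntegrable (W 0) := (hW.memLp 0 (by simp)).locallyIntegrable (by norm_num)
  rw [VEM.multiD_conv hloc hk hc]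
  funext x
  have h := hW.integral_multiD hν (ψ := fun t => k (x - t)) (hk.comp (contDiff_const.sub contDiff_id))
    (hc.comp_homeomorph (Homeomorph.subLeft x))
  rw [multiD_comp_sub hk] at h
  rw [conv_apply, conv_apply]
  simp only [mul_left_comm (W 0 _)] at h
  rw [integral_const_mul] at h
  exact mul_left_cancel₀ (pow_ne_zero _ (by norm_num)) h

/-- A correlation is the inner product with a translate, and translations act continuously on `L²`.
-/
lemma continuous_correlation {f g : Plane → ℝ} (hf : MemLp f 2 volume) (hg : MemLp g 2 volume) :
    Continuous fun z => ∫ x, f x * g (x - z) := by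
  let τ : Plane → C(Plane, Plane) := fun z => ⟨fun x => x - z, by fun_prop⟩
  have hτ : Continuous τ := ContinuousMap.continuous_of_continuous_uncurry _
    (show Continuous fun q : Plane × Plane => q.2 - q.1 by fun_prop)
  have hmp : ∀ z, MeasurePreserving (τ z) volume volume := fun z => measurePreserving_sub_right _ z
  have h1 := (continuous_const (y := hg.toLp g)).compMeasurePreservingLp hτ hmp (by norm_num)
  refine (h1.inner (𝕜 := ℝ) (continuous_const (y := hf.toLp f))).congr fun z => ?_
  rw [L2.inner_def]
  refine integral_congr_ae ?_
  rw [Lp.toLp_compMeasurePreserving hg (hmp z)]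
  filter_upwards [hf.coeFn_toLp, (hg.comp_measurePreserving (hmp z)).coeFn_toLp] with x h1 h2
  rw [h1, h2]
  rfl

/-- By Fubini, pairing with a mollified function averages the pairings with its translates. -/
lemma integral_mul_conv {f g k : Plane → ℝ} (hf : MemLp f 2 volume) (hg : MemLp g 2 volume)
    (hk : Continuous k) (hc : HasCompactSupport k) :
    ∫ x, f x * conv g k x = ∫ z, k z * ∫ x, f x * g (x - z) := by
  have hki : Integrable k := hk.integrable_of_hasCompactSupport hc
  have hswap : ∀ x, conv g k x = ∫ z, k z * g (x - z) := by
    intro x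
    rw [conv_apply, ← integral_sub_left_eq_self _ volume x]
    simp only [sub_sub_cancel, mul_comm]
  have hmeas : AEStronglyMeasurable (fun q : Plane × Plane => k q.2 * g (q.1 - q.2))
      (volume.prod volume) :=
    (hki.aestronglyMeasurable).convolution_integrand (ContinuousLinearMap.mul ℝ ℝ) hg.1
  -- The product `f g` is dominated by `f² + g²`, and each square times `k` is integrable on the
  -- product space.
  have hint : Integrable (fun q : Plane × Plane => f q.1 * (k q.2 * g (q.1 - q.2)))
      (volume.prod volume) := by
    have i1 : Integrable (fun q : Plane × Plane => f q.1 ^ 2 * k q.2) (volume.prod volume) :=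
      hf.integrable_sq.mul_prod hki
    have i2 : Integrable (fun q : Plane × Plane => k q.2 * g (q.1 - q.2) ^ 2)
        (volume.prod volume) :=
      hki.convolution_integrand (ContinuousLinearMap.mul ℝ ℝ) hg.integrable_sq
    refine (i1.norm.add i2.norm).mono' (hf.1.comp_fst.mul hmeas) (ae_of_all _ fun q => ?_)
    simp only [Pi.add_apply, norm_mul, norm_pow, Real.norm_eq_abs]
    nlinarith [sq_nonneg (|f q.1| - |g (q.1 - q.2)|), abs_nonneg (k q.2), abs_nonneg (f q.1),
      abs_nonneg (g (q.1 - q.2)), mul_nonneg (abs_nonneg (k q.2))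
        (sq_nonneg (|f q.1| - |g (q.1 - q.2)|)),
      mul_nonneg (abs_nonneg (k q.2)) (add_nonneg (sq_nonneg (|f q.1|)) (sq_nonneg (|g (q.1 - q.2)|)))]
  simp only [hswap, ← integral_const_mul]
  rw [integral_integral_swap hint]
  simp only [mul_left_comm]

/-- Multi-indices of order at most `p`. -/
def indices (p : ℕ) : Finset (ℕ × ℕ) :=
  (Finset.range (p + 1) ×ˢ Finset.range (p + 1)).filter fun ν => ν.1 + ν.2 ≤ p

lemma mem_indices {p : ℕ} {ν : ℕ × ℕ} : ν ∈ indices p ↔ ν.1 + ν.2 ≤ p := by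
  simp only [indices, Finset.mem_filter, Finset.mem_product, Finset.mem_range]
  omega

lemma memLp_indicator (v : L2 K) : MemLp ((K : Set Plane).indicator v) 2 volume :=
  (memLp_indicator_iff_restrict K.isOpen.measurableSet).2 (Lp.memLp v)

lemma setIntegral_mul_eq (v : L2 K) (f : Plane → ℝ) :
    ∫ x in (K : Set Plane), v x * f x = ∫ x, (K : Set Plane).indicator v x * f x := by
  rw [← integral_indicator K.isOpen.measurableSet]
  congr 1
  funext x
  by_cases hx : x ∈ (K : Set Plane) <;> simp [hx]

/-- Functionals annihilating the jets of test functions annihilate the weak jets whose support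
can be moved into `K`. -/
lemma sum_integral_eq_zero_of_shift {p : ℕ} {W : ℕ × ℕ → Plane → ℝ} (hW : WeakJet p W)
    {S : Set Plane} (hS : IsCompact S) (hWS : ∀ ν, ν.1 + ν.2 ≤ p → ∀ x ∉ S, W ν x = 0)
    (hshift : ∀ η > 0, ∃ y : Plane, ‖y‖ < η ∧ ∀ z ∈ S, z + y ∈ K) {T : ℕ × ℕ → L2 K}
    (hT : ∀ φ : 𝓓(K, ℝ), ∑ ν ∈ indices p, ∫ x in (K : Set Plane), T ν x * multiD ν φ x = 0) :
    ∑ ν ∈ indices p, ∫ x in (K : Set Plane), T ν x * W ν x = 0 := by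
  set T' : ℕ × ℕ → Plane → ℝ := fun ν => (K : Set Plane).indicator (T ν) with hT'
  have hT'm : ∀ ν, MemLp (T' ν) 2 volume := fun ν => memLp_indicator _
  simp only [setIntegral_mul_eq] at hT ⊢
  -- `c z` is the functional applied to the jet translated by `z`. Its averages against bumps near
  -- suitable small `y` vanish, because the mollified translate is a test function in `K`; by
  -- continuity `c 0 = 0`.
  set c : Plane → ℝ := fun z => ∑ ν ∈ indices p, ∫ x, T' ν x * W ν (x - z) with hc
  have hcc : Continuous c := continuous_finsetSum _ fun ν hν =>
    continuous_correlation (hT'm ν) (hW.memLp ν (mem_indices.1 hν))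
  have hc0 : c 0 = ∑ ν ∈ indices p, ∫ x, T' ν x * W ν x := by simp [hc]
  rw [← hc0]
  refine abs_eq_zero.1 (le_antisymm (le_of_forall_pos_le_add fun ε hε => ?_) (abs_nonneg _))
  rw [zero_add]
  obtain ⟨δ, hδ, hδc⟩ := Metric.continuous_iff.1 hcc 0 ε hε
  obtain ⟨y, hy, hyS⟩ := hshift (δ / 2) (by positivity)
  have hSy : IsCompact ((fun z => z + y) '' S) := hS.image (by fun_prop)
  obtain ⟨r₀, hr₀, hr₀K⟩ := hSy.exists_cthickening_subset_open K.isOpen (by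
    rintro _ ⟨z, hz, rfl⟩
    exact hyS z hz)
  -- Below `r₀` the mollified translate is still supported in `K`, and below `δ / 2` the bump about
  -- `y` stays where `c` is within `ε` of `c 0`.
  set r := min r₀ (δ / 2) with hr
  have hr0 : 0 < r := by positivity
  let k : ContDiffBump y := ⟨r / 2, r, by positivity, by linarith⟩
  have hkc : ContDiff ℝ ∞ k := k.contDiff
  have hkint : Integrable k := k.integrable
  have hkpos : 0 < ∫ z, k z := k.integral_pos
  have hloc : LocallyIntegrable (W 0) := (hW.memLp 0 (by simp)).locallyIntegrable (by norm_num)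
  have hsupp : ∀ x, x ∉ Metric.cthickening r₀ ((fun z => z + y) '' S) → conv (W 0) k x = 0 := by
    intro x hx
    rw [conv_apply]
    refine integral_eq_zero_of_ae (ae_of_all _ fun t => ?_)
    by_cases ht : t ∈ S
    · have : k (x - t) = 0 := by
        refine k.zero_of_le_dist ?_
        by_contra hlt
        refine hx (Metric.mem_cthickening_of_dist_le x (t + y) r₀ _ ⟨t, ht, rfl⟩ ?_)
        have h1 : dist (x - t) y < r := not_le.1 hlt
        have h2 : dist x (t + y) = dist (x - t) y := by
          rw [dist_eq_norm, dist_eq_norm]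
          congr 1
          abel
        rw [h2]
        exact h1.le.trans (min_le_left _ _)
      simp [this]
    · simp [hWS 0 (by simp) t ht]
  have hcomp : IsCompact (Metric.cthickening r₀ ((fun z => z + y) '' S)) := hSy.cthickening
  have htsupp : tsupport (conv (W 0) k) ⊆ Metric.cthickening r₀ ((fun z => z + y) '' S) := by
    refine closure_minimal (fun x hx => ?_) hcomp.isClosed
    by_contra h
    exact hx (hsupp x h)
  have hφ := hT (mkTest (conv (W 0) k) (contDiff_conv hloc hkc k.hasCompactSupport)
    (HasCompactSupport.of_support_subset_isCompact hcomp ((subset_tsupport _).trans htsupp))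
    (htsupp.trans hr₀K))
  have h1 : ∫ z, k z * c z = 0 := by
    rw [← hφ]
    simp only [hc, Finset.mul_sum]
    rw [integral_finsetSum]
    · refine Finset.sum_congr rfl fun ν hν => ?_
      have h2 := hW.multiD_conv hkc k.hasCompactSupport (mem_indices.1 hν)
      rw [← integral_mul_conv (hT'm ν) (hW.memLp ν (mem_indices.1 hν)) hkc.continuous
        k.hasCompactSupport, ← h2]
      rfl
    · intro ν hν
      exact (hkc.continuous.mul (continuous_correlation (hT'm ν)
        (hW.memLp ν (mem_indices.1 hν)))).integrable_of_hasCompactSupport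
        k.hasCompactSupport.mul_right
  have h2 : (∫ z, k z) * c 0 = ∫ z, k z * (c 0 - c z) := by
    have i1 : Integrable fun z => k z * c 0 := hkint.mul_const _
    have i2 : Integrable fun z => k z * c z :=
      (hkc.continuous.mul hcc).integrable_of_hasCompactSupport k.hasCompactSupport.mul_right
    simp only [mul_sub]
    rw [integral_sub i1 i2, h1, sub_zero, integral_mul_const]
  have h3 : (∫ z, k z) * |c 0| ≤ (∫ z, k z) * ε := by
    rw [← abs_of_pos hkpos, ← abs_mul, abs_of_pos hkpos, h2, ← integral_mul_const]
    rw [← Real.norm_eq_abs]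
    refine norm_integral_le_of_norm_le (hkint.mul_const ε) (ae_of_all _ fun z => ?_)
    rw [norm_mul, Real.norm_of_nonneg k.nonneg]
    by_cases hz : dist z y < r
    · refine mul_le_mul_of_nonneg_left ?_ k.nonneg
      have h4 : dist z 0 < δ := by
        calc dist z 0 ≤ dist z y + dist y 0 := dist_triangle _ _ _
          _ < δ / 2 + δ / 2 := add_lt_add (hz.trans_le (min_le_right _ _)) (by simpa using hy)
          _ = δ := by ring
      have h5 := hδc z h4
      rw [dist_eq_norm] at h5
      rw [norm_sub_rev]
      exact h5.le
    · rw [k.zero_of_le_dist (not_lt.1 hz)]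
      simp
  exact le_of_mul_le_mul_left h3 hkpos

/-! ### Localization of the density argument by a partition of unity. -/

lemma jetMul_sum_left {ι : Type*} (s : Finset ι) (a : ι → ℕ × ℕ → ℝ) (b : ℕ × ℕ → ℝ) (ν : ℕ × ℕ) :
    ∑ i ∈ s, jetMul (a i) b ν = jetMul (fun κ => ∑ i ∈ s, a i κ) b ν := by
  simp only [jetMul]
  rw [Finset.sum_comm]
  refine Finset.sum_congr rfl fun κ _ => ?_
  rw [Finset.sum_comm]
  refine Finset.sum_congr rfl fun l _ => ?_
  rw [Finset.sum_mul, Finset.mul_sum]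

lemma jetMul_one {a b : ℕ × ℕ → ℝ} (ha : a 0 = 1) (h : ∀ κ, κ ≠ 0 → a κ = 0) (ν : ℕ × ℕ) :
    jetMul a b ν = b ν := by
  rw [jetMul, Finset.sum_eq_single (0, ν.1), Finset.sum_eq_single (0, ν.2)]
  · have : a (0, 0) = 1 := ha
    simp [this]
  · intro l hl hne
    rw [h (0, l.1), zero_mul, mul_zero]
    intro h0
    have h1 := Finset.HasAntidiagonal.mem_antidiagonal.1 hl
    have h2 : l.1 = 0 := congrArg Prod.snd h0
    exact hne (Prod.ext h2 (by simp only; omega))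
  · intro hn
    exact absurd (Finset.HasAntidiagonal.mem_antidiagonal.2 (zero_add _)) hn
  · intro κ hκ hne
    refine Finset.sum_eq_zero fun l _ => ?_
    rw [h (κ.1, l.1), zero_mul, mul_zero]
    intro h0
    have h1 := Finset.HasAntidiagonal.mem_antidiagonal.1 hκ
    have h2 : κ.1 = 0 := congrArg Prod.fst h0
    exact hne (Prod.ext h2 (by simp only; omega))
  · intro hn
    exact absurd (Finset.HasAntidiagonal.mem_antidiagonal.2 (zero_add _)) hn

lemma multiD_const (c : ℝ) {κ : ℕ × ℕ} (h : κ ≠ 0) : multiD κ (fun _ => c) = 0 := by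
  have hk : ∀ k, partialD k (fun _ => c) = 0 := fun k => by
    funext x
    simp [partialD]
  induction κ using index_induction with
  | zero => exact absurd rfl h
  | step ν k _ => rw [← multiD_partialD k ν contDiff_const, hk, multiD_zero]

/-- If a finite sum of smooth functions is one near `x`, then it acts as the identity on jets. -/
lemma sum_jetMul_of_sum_eq_one {ι : Type*} [Fintype ι] {θ : ι → Plane → ℝ}
    (hθ : ∀ i, ContDiff ℝ ∞ (θ i)) {x : Plane} (h : ∀ᶠ z in 𝓝 x, ∑ i, θ i z = 1) (b : ℕ × ℕ → ℝ)
    (ν : ℕ × ℕ) : ∑ i, jetMul (fun κ => multiD κ (θ i) x) b ν = b ν := by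
  rw [jetMul_sum_left]
  have h1 : ∀ κ, ∑ i, multiD κ (θ i) x = multiD κ (fun _ => 1) x := by
    intro κ
    rw [← Finset.sum_apply, ← multiD_sum _ _ fun i _ => hθ i]
    refine (multiD_congr ?_ κ).self_of_nhds
    filter_upwards [h] with z hz
    rw [Finset.sum_apply, hz]
  refine jetMul_one ?_ (fun κ hκ => ?_) ν
  · rw [h1]
    rfl
  · rw [h1, multiD_const 1 hκ]
    rfl

/-- The dual form of the density of test functions. A partition of unity cuts the jet into pieces,
each supported in a part of the closure of `K` that arbitrarily small translations move into `K`. -/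
lemma sum_integral_eq_zero (hK : IsElement P K) {p : ℕ} {W : ℕ × ℕ → Plane → ℝ}
    (hW : WeakJet p W) (hWK : ∀ ν, ν.1 + ν.2 ≤ p → ∀ x ∉ (K : Set Plane), W ν x = 0)
    {T : ℕ × ℕ → L2 K}
    (hT : ∀ φ : 𝓓(K, ℝ), ∑ ν ∈ indices p, ∫ x in (K : Set Plane), T ν x * multiD ν φ x = 0) :
    ∑ ν ∈ indices p, ∫ x in (K : Set Plane), T ν x * W ν x = 0 := by
  have hcl : IsCompact (closure (K : Set Plane)) := hK.bounded.isCompact_closure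
  have hsh : ∀ x ∈ closure (K : Set Plane), ShiftAt K x := fun x hx => shiftAt_of_mem_closure hK hx
  choose! ρ hρ hshift using hsh
  obtain ⟨s, θ, hs, hθ, hθc, hθs, hsum⟩ := exists_smooth_partition hcl
    (U := fun x => Metric.closedBall x (ρ x))
    fun x hx => Metric.closedBall_mem_nhds x (hρ x hx)
  have key : ∀ i : s, ∑ ν ∈ indices p, ∫ x in (K : Set Plane), T ν x *
      jetMul (fun κ => multiD κ (θ i) x) (fun κ => W κ x) ν = 0 := by
    intro i
    refine sum_integral_eq_zero_of_shift (hW.mul (hθ i) (hθc i))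
      (hcl.inter_right Metric.isClosed_closedBall) (fun ν hν x hx => ?_) (hshift i (hs i)) hT
    rw [jetMul]
    refine Finset.sum_eq_zero fun κ hκ => Finset.sum_eq_zero fun l hl => ?_
    by_cases hxK : x ∈ (K : Set Plane)
    · have : multiD (κ.1, l.1) (θ i) x = 0 := by
        refine image_eq_zero_of_notMem_tsupport fun h => hx ⟨subset_closure hxK, ?_⟩
        exact hθs i (tsupport_multiD_subset _ _ h)
      rw [this, zero_mul, mul_zero]
    · rw [hWK _ (antidiagonal_index_le hν hκ hl) x hxK, mul_zero, mul_zero]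
  rw [← Finset.sum_eq_zero fun i (_ : i ∈ Finset.univ) => key i, Finset.sum_comm]
  refine Finset.sum_congr rfl fun ν hν => ?_
  rw [← integral_finsetSum]
  · refine setIntegral_congr_fun K.isOpen.measurableSet fun x hx => ?_
    rw [← Finset.mul_sum, sum_jetMul_of_sum_eq_one hθ (hsum x (subset_closure hx))]
  · intro i _
    exact (Lp.memLp (T ν)).integrable_mul
      (((hW.mul (hθ i) (hθc i)).memLp ν (mem_indices.1 hν)).restrict _)

end VEM

namespace VEM

open MeasureTheory Set Filter Topology TopologicalSpace
open scoped ContDiff Distributions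

variable {N : ℕ} {P : Polygon Plane N} {K : Opens Plane}

/-! ### The Hilbert space of jets of functions with zero boundary values -/

/-- Families in `L²(K)` indexed by the multi-indices of order at most `p`. -/
abbrev JetSpace (K : Opens Plane) (p : ℕ) : Type := PiLp 2 fun _ : indices p => L2 K

/-- The component with multi-index `ν`. -/
noncomputable def coord (K : Opens Plane) (p : ℕ) (ν : ℕ × ℕ) : JetSpace K p →L[ℝ] L2 K :=
  if h : ν ∈ indices p then PiLp.proj 2 _ ⟨ν, h⟩ else 0

lemma coord_apply {p : ℕ} {ν : ℕ × ℕ} (h : ν ∈ indices p) (U : JetSpace K p) :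
    coord K p ν U = U ⟨ν, h⟩ := by
  rw [coord, dif_pos h]
  rfl

/-- The jet with given components. -/
noncomputable def mkJet (p : ℕ) (W : ℕ × ℕ → L2 K) : JetSpace K p := WithLp.toLp 2 fun ν => W ν

lemma coord_mkJet {p : ℕ} {ν : ℕ × ℕ} (h : ν.1 + ν.2 ≤ p) (W : ℕ × ℕ → L2 K) :
    coord K p ν (mkJet p W) = W ν := by
  rw [coord_apply (mem_indices.2 h)]
  rfl

/-- A test function as an element of `L²(K)`. -/
noncomputable def testL2 : 𝓓(K, ℝ) →ₗ[ℝ] L2 K where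
  toFun φ := (test_memLp φ).toLp φ
  map_add' φ ψ := MemLp.toLp_add (test_memLp φ) (test_memLp ψ)
  map_smul' c φ := MemLp.toLp_const_smul c (test_memLp φ)

lemma testL2_coe (φ : 𝓓(K, ℝ)) : testL2 φ =ᵐ[volume.restrict (K : Set Plane)] φ :=
  (test_memLp φ).coeFn_toLp

/-- The partial derivative on test functions as a linear map. -/
noncomputable def testDLin (ν : ℕ × ℕ) : 𝓓(K, ℝ) →ₗ[ℝ] 𝓓(K, ℝ) where
  toFun := testD ν
  map_add' φ ψ := DFunLike.coe_injective (multiD_add ν φ.contDiff ψ.contDiff)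
  map_smul' c φ := DFunLike.coe_injective (multiD_smul ν φ.contDiff c)

/-- The jet of a test function. -/
noncomputable def testJet (p : ℕ) : 𝓓(K, ℝ) →ₗ[ℝ] JetSpace K p where
  toFun φ := mkJet p fun ν => testL2 (testDLin ν φ)
  map_add' φ ψ := by
    simp only [map_add]
    rfl
  map_smul' c φ := by
    simp only [map_smul]
    rfl

lemma coord_testJet {p : ℕ} {ν : ℕ × ℕ} (h : ν.1 + ν.2 ≤ p) (φ : 𝓓(K, ℝ)) :
    coord K p ν (testJet p φ) = testL2 (testD ν φ) :=
  coord_mkJet h fun ν => testL2 (testDLin ν φ)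

/-- The closure of the jets of test functions. -/
noncomputable def zeroJets (K : Opens Plane) (p : ℕ) : Submodule ℝ (JetSpace K p) :=
  (LinearMap.range (testJet (K := K) p)).topologicalClosure

lemma inner_L2 (v w : L2 K) : inner ℝ v w = ∫ x in (K : Set Plane), v x * w x := by
  rw [L2.inner_def]
  exact integral_congr_ae (ae_of_all _ fun x => mul_comm _ _)

lemma inner_testL2 (v : L2 K) (φ : 𝓓(K, ℝ)) :
    inner ℝ v (testL2 φ) = ∫ x in (K : Set Plane), v x * φ x := by
  rw [inner_L2]
  refine integral_congr_ae ?_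
  filter_upwards [testL2_coe φ] with x hx
  rw [hx]

lemma inner_jet {p : ℕ} (U W : JetSpace K p) :
    inner ℝ U W = ∑ ν ∈ indices p, inner ℝ (coord K p ν U) (coord K p ν W) := by
  rw [PiLp.inner_apply, ← Finset.sum_coe_sort (indices p)
    fun ν => inner ℝ (coord K p ν U) (coord K p ν W)]
  refine Finset.sum_congr rfl fun ν _ => ?_
  rw [coord_apply ν.2, coord_apply ν.2]

/-- Sobolev functions with vanishing trace jet have their jet in the closure of the test jets. -/
lemma mem_zeroJets (hK : IsElement P K) {p : ℕ} {W : ℕ × ℕ → L2 K}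
    (hW : WeakJet p fun ν => (K : Set Plane).indicator (W ν)) : mkJet p W ∈ zeroJets K p := by
  -- The closure is the double orthogonal complement, so it suffices that each `T` orthogonal to all
  -- test jets is orthogonal to this jet.
  rw [zeroJets, ← Submodule.orthogonal_orthogonal_eq_closure, Submodule.mem_orthogonal]
  intro T hT
  rw [Submodule.mem_orthogonal'] at hT
  have hT' : ∀ φ : 𝓓(K, ℝ), ∑ ν ∈ indices p,
      ∫ x in (K : Set Plane), coord K p ν T x * multiD ν φ x = 0 := by
    intro φ
    rw [← hT _ ⟨φ, rfl⟩, inner_jet]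
    refine Finset.sum_congr rfl fun ν hν => ?_
    rw [coord_testJet (mem_indices.1 hν), inner_testL2]
    rfl
  rw [inner_jet, ← sum_integral_eq_zero hK hW (fun ν _ x hx => indicator_of_notMem hx _) hT']
  refine Finset.sum_congr rfl fun ν hν => ?_
  rw [coord_mkJet (mem_indices.1 hν), inner_L2]
  refine setIntegral_congr_fun K.isOpen.measurableSet fun x hx => ?_
  simp only [indicator_of_mem hx]

/-- For each `|ν| < p` the zero trace of `D^ν v` makes integration by parts hold against test
functions of the whole plane. The extension by zero is thus a weak jet, to which `mem_zeroJets`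
applies. -/
lemma exists_weakJet (hK : IsElement P K) {p : ℕ} {v : L2 K} (hv : MemSobolev K p v)
    {g : ℕ × ℕ → Plane → ℝ} (hg : IsTraceJet P K p v g)
    (h0 : ∀ ν : ℕ × ℕ, ν.1 + ν.2 < p → ∀ x ∈ P.boundary ℝ, g ν x = 0) :
    ∃ U ∈ zeroJets K p, coord K p 0 U = v := by
  choose! W hW using hv
  have hW0 : W 0 = v := (hW 0 (by simp)).unique (HasWeakDeriv.self v)
  refine ⟨mkJet p W, mem_zeroJets hK ⟨fun ν _ => memLp_indicator _, ?_⟩, ?_⟩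
  · intro ν hν k ψ hψ hc
    obtain ⟨hgc, w, hw, ht⟩ := hg ν hν
    obtain rfl := hw.unique (hW ν hν.le)
    have hd : ∀ k : Fin 2, HasWeakDeriv K (unitIndex k) (W ν) (W (ν + unitIndex k)) := fun k =>
      hw.sub_index (hW _ (by rw [add_unitIndex_sum]; omega))
    have hz := zero_extension hK ht (hd 0) (hd 1) (h0 ν hν)
      (EuclideanSpace.single k 1) hψ hc
    rw [defect] at hz
    have hp : dirD (EuclideanSpace.single k 1) ψ = partialD k ψ := rfl
    rw [hp] at hz
    rw [← setIntegral_mul_eq, ← setIntegral_mul_eq]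
    fin_cases k
    · simp at hz
      exact eq_neg_of_add_eq_zero_left hz
    · simp at hz
      exact eq_neg_of_add_eq_zero_left hz
  · rw [coord_mkJet (by simp), hW0]

lemma exists_testJet_tendsto {p : ℕ} {U : JetSpace K p} (hU : U ∈ zeroJets K p) :
    ∃ φ : ℕ → 𝓓(K, ℝ), ∀ ν : ℕ × ℕ, ν.1 + ν.2 ≤ p → Tendsto (fun n =>
      eLpNorm (multiD ν (φ n) - ⇑(coord K p ν U)) 2 (volume.restrict (K : Set Plane)))
      atTop (𝓝 0) := by
  obtain ⟨J, hJ, hlim⟩ := mem_closure_iff_seq_limit.1 hU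
  choose φ hφ using hJ
  refine ⟨φ, fun ν hν => ?_⟩
  have h1 := ((coord K p ν).continuous.tendsto U).comp hlim
  rw [Lp.tendsto_Lp_iff_tendsto_eLpNorm'] at h1
  refine h1.congr fun n => eLpNorm_congr_ae ?_
  have h2 : coord K p ν (J n) = testL2 (testD ν (φ n)) := by rw [← hφ n, coord_testJet hν]
  filter_upwards [testL2_coe (testD ν (φ n))] with x hx
  simp only [Function.comp_apply, Pi.sub_apply]
  rw [h2, hx]
  rfl

lemma zeroJets_hasWeakDeriv {p : ℕ} {U : JetSpace K p} (hU : U ∈ zeroJets K p) {ν : ℕ × ℕ}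
    (hν : ν.1 + ν.2 ≤ p) : HasWeakDeriv K ν (coord K p 0 U) (coord K p ν U) := by
  obtain ⟨φ, hφ⟩ := exists_testJet_tendsto hU
  exact hasWeakDeriv_of_tendsto (fun n => (φ n).contDiff) (hφ 0 (by simp)) (hφ ν hν)

/-- The approximating test functions vanish on the boundary with all derivatives, so they are
themselves the smooth sequences that witness a zero trace. -/
lemma zeroJets_isTraceJet (hK : IsElement P K) {p : ℕ} {U : JetSpace K p}
    (hU : U ∈ zeroJets K p) : IsTraceJet P K p (coord K p 0 U) 0 := by
  obtain ⟨φ, hφ⟩ := exists_testJet_tendsto hU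
  intro ν hν
  have hk : ∀ k, HasWeakDeriv K (unitIndex k) (coord K p ν U) (coord K p (ν + unitIndex k) U) :=
    fun k => (zeroJets_hasWeakDeriv hU hν.le).sub_index
      (zeroJets_hasWeakDeriv hU (by rw [add_unitIndex_sum]; omega))
  have hkt : ∀ k, Tendsto (fun n => eLpNorm (partialD k (multiD ν (φ n)) -
      ⇑(coord K p (ν + unitIndex k) U)) 2 (volume.restrict (K : Set Plane))) atTop (𝓝 0) := by
    intro k
    refine (hφ (ν + unitIndex k) (by rw [add_unitIndex_sum]; omega)).congr fun n => ?_
    rw [partialD_multiD k ν (φ n).contDiff]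
  refine ⟨continuousOn_const, _, zeroJets_hasWeakDeriv hU hν.le, fun i => ?_, _, _,
    fun n => multiD ν (φ n), hk 0, hk 1, fun n => contDiff_multiD (φ n).contDiff ν, hφ ν hν.le,
    hkt 0, hkt 1, fun i => ?_⟩
  · exact MemLp.zero
  · refine tendsto_const_nhds.congr fun n => Eq.symm ?_
    rw [eLpNorm_congr_ae (g := 0), eLpNorm_zero]
    refine (ae_restrict_iff' measurableSet_Icc).2 (ae_of_all _ fun t ht => ?_)
    have h1 : multiD ν (φ n) (P.edgePath ℝ i t) = 0 := by
      refine image_eq_zero_of_notMem_tsupport fun h => ?_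
      have h2 := (φ n).tsupport_subset (tsupport_multiD_subset _ ν h)
      exact hK.disjoint_boundary h2 (edgePath_mem_boundary ht)
    simp [h1]

/-! ### The energy form -/

/-- The bilinear form `∑_{|ν| = p} (p choose ν₁) ∫_K U_ν W_ν`. -/
noncomputable def energy (K : Opens Plane) (p : ℕ) : JetSpace K p →L[ℝ] JetSpace K p →L[ℝ] ℝ :=
  ∑ a ∈ Finset.range (p + 1), (p.choose a : ℝ) •
    (innerSL ℝ : L2 K →L[ℝ] L2 K →L[ℝ] ℝ).bilinearComp (coord K p (a, p - a)) (coord K p (a, p - a))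

lemma energy_apply {p : ℕ} (U W : JetSpace K p) : energy K p U W =
    ∑ a ∈ Finset.range (p + 1), (p.choose a : ℝ) *
      inner ℝ (coord K p (a, p - a) U) (coord K p (a, p - a) W) := by
  simp [energy]

lemma norm_sq_le_energy {p : ℕ} (U : JetSpace K p) {ν : ℕ × ℕ} (hν : ν.1 + ν.2 = p) :
    ‖coord K p ν U‖ ^ 2 ≤ energy K p U U := by
  rw [energy_apply]
  have h1 : ν = (ν.1, p - ν.1) := Prod.ext rfl (by simp only; omega)
  have h2 : ∀ a ∈ Finset.range (p + 1), 0 ≤ (p.choose a : ℝ) *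
      inner ℝ (coord K p (a, p - a) U) (coord K p (a, p - a) U) := fun a _ =>
    mul_nonneg (Nat.cast_nonneg _) real_inner_self_nonneg
  refine le_trans ?_ (Finset.single_le_sum h2 (Finset.mem_range.2 (show ν.1 < p + 1 by omega)))
  rw [← h1, real_inner_self_eq_norm_sq]
  refine le_mul_of_one_le_left (by positivity) ?_
  exact_mod_cast Nat.choose_pos (show ν.1 ≤ p by omega)

/-- Moving the `p` derivatives of `U` onto `φ` doubles each multi-index, and the binomial weights
assemble `Δ^p φ`. Thus `energy` is the weak form of `(-1)^p Δ^p`. -/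
lemma energy_testJet {p : ℕ} {U : JetSpace K p}
    (hU : ∀ ν : ℕ × ℕ, ν.1 + ν.2 ≤ p → HasWeakDeriv K ν (coord K p 0 U) (coord K p ν U))
    (φ : 𝓓(K, ℝ)) : energy K p U (testJet p φ) =
      (-1 : ℝ) ^ p * ∫ x in (K : Set Plane), coord K p 0 U x * polyLaplacian p φ x := by
  have hi : ∀ a ∈ Finset.range (p + 1), Integrable (fun x => (p.choose a : ℝ) *
      (coord K p 0 U x * multiD (2 * a, 2 * (p - a)) φ x)) (volume.restrict (K : Set Plane)) :=
    fun a _ => (integrable_mul_test _ (contDiff_multiD φ.contDiff _).continuous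
      (hasCompactSupport_multiD φ.hasCompactSupport _)).const_mul _
  have h1 : ∀ x, coord K p 0 U x * polyLaplacian p φ x = ∑ a ∈ Finset.range (p + 1),
      (p.choose a : ℝ) * (coord K p 0 U x * multiD (2 * a, 2 * (p - a)) φ x) := by
    intro x
    rw [polyLaplacian_eq_sum p φ.contDiff, Finset.mul_sum]
    exact Finset.sum_congr rfl fun a _ => by ring
  simp only [h1]
  rw [energy_apply, integral_finsetSum _ hi, Finset.mul_sum]
  refine Finset.sum_congr rfl fun a ha => ?_
  have hap : a + (p - a) = p := by
    have := Finset.mem_range.1 ha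
    omega
  rw [coord_testJet hap.le, inner_testL2, integral_const_mul]
  have h2 := hU (a, p - a) hap.le (testD (a, p - a) φ)
  have h3 : multiD (a, p - a) (testD (a, p - a) φ) = multiD (2 * a, 2 * (p - a)) φ := by
    have h4 : (2 * a, 2 * (p - a)) = (a, p - a) + (a, p - a) := by
      rw [Prod.mk_add_mk, two_mul, two_mul]
    rw [h4]
    exact multiD_multiD _ _ φ.contDiff
  rw [h3] at h2
  simp only [hap] at h2
  have h5 : (-1 : ℝ) ^ p * (-1) ^ p = 1 := by
    rw [← mul_pow]
    norm_num
  rw [h2]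
  linear_combination (-(p.choose a : ℝ) *
    ∫ x in (K : Set Plane), coord K p (a, p - a) U x * testD (a, p - a) φ x) * h5

/-- The Poincaré inequality for test functions. -/
lemma poincare {R : ℝ} (hR : ∀ x ∈ (K : Set Plane), ‖x‖ ≤ R) (φ : 𝓓(K, ℝ)) :
    ‖testL2 φ‖ ^ 2 ≤ (2 * R) ^ 2 * ‖testL2 (testD (1, 0) φ)‖ ^ 2 := by
  have hn : ∀ φ : 𝓓(K, ℝ), ‖testL2 φ‖ ^ 2 = ∫ x, φ x * φ x := by
    intro φ
    rw [← real_inner_self_eq_norm_sq, inner_testL2, ← setIntegral_mul_test _ φ.tsupport_subset]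
    refine integral_congr_ae ?_
    filter_upwards [testL2_coe φ] with x hx
    rw [hx]
  rw [hn, hn]
  have hX : ContDiff ℝ ∞ fun x : Plane => x 0 := by fun_prop
  have hφ := φ.contDiff
  -- Integrating `φ² · ∂₀ x₀` by parts gives `∫ φ² = -∫ 2 x₀ φ ∂₀φ`. With `|x₀| ≤ R` the right side
  -- is at most `½ ∫ φ² + 2 R² ∫ (∂₀φ)²`, and the first term is absorbed.
  have h1 := integral_mul_partialD hX (contDiff_mul hφ hφ) φ.hasCompactSupport.mul_left 0
  have h2 : partialD 0 (fun x : Plane => x 0) = fun _ => 1 := by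
    funext x
    have : HasFDerivAt (fun x : Plane => x 0) (EuclideanSpace.proj (𝕜 := ℝ) (0 : Fin 2)) x :=
      (EuclideanSpace.proj (𝕜 := ℝ) (0 : Fin 2)).hasFDerivAt
    rw [partialD, this.fderiv]
    simp
  rw [partialD_mul hφ hφ, h2] at h1
  simp only [Pi.add_apply, Pi.mul_apply, one_mul] at h1
  have hd := contDiff_partialD hφ 0
  have i1 : Integrable fun x => φ x * φ x :=
    (φ.continuous.mul φ.continuous).integrable_of_hasCompactSupport φ.hasCompactSupport.mul_left
  have i2 : Integrable fun x => partialD 0 φ x * partialD 0 φ x :=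
    (hd.continuous.mul hd.continuous).integrable_of_hasCompactSupport
      (hasCompactSupport_partialD φ.hasCompactSupport 0).mul_left
  have i3 : Integrable fun x => 1 / 2 * (φ x * φ x) +
      2 * R ^ 2 * (partialD 0 φ x * partialD 0 φ x) := (i1.const_mul _).add (i2.const_mul _)
  have h3 : ∫ x, φ x * φ x ≤ ∫ x, (1 / 2 * (φ x * φ x) +
      2 * R ^ 2 * (partialD 0 φ x * partialD 0 φ x)) := by
    rw [← neg_neg (∫ x, φ x * φ x), ← h1, ← integral_neg]
    refine integral_mono (Integrable.neg ?_) i3 fun x => ?_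
    · exact (hX.continuous.mul ((hd.continuous.mul φ.continuous).add
        (φ.continuous.mul hd.continuous))).integrable_of_hasCompactSupport
        ((φ.hasCompactSupport.mul_left.add φ.hasCompactSupport.mul_right).mul_left)
    · simp only
      by_cases hx : x ∈ (K : Set Plane)
      · have h4 : |x 0| ≤ R := (PiLp.norm_apply_le x 0).trans (hR x hx)
        have h5 : x 0 ^ 2 ≤ R ^ 2 := sq_le_sq' (abs_le.1 h4).1 (abs_le.1 h4).2
        nlinarith [sq_nonneg (φ x + 2 * x 0 * partialD 0 φ x), sq_nonneg (partialD 0 φ x),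
          mul_le_mul_of_nonneg_right h5 (sq_nonneg (partialD 0 φ x))]
      · have h4 : φ x = 0 := image_eq_zero_of_notMem_tsupport fun h => hx (φ.tsupport_subset h)
        rw [h4]
        simp only [mul_zero, zero_mul, add_zero, zero_add, neg_zero]
        exact mul_nonneg (by positivity) (mul_self_nonneg _)
  rw [integral_add (i1.const_mul _) (i2.const_mul _), integral_const_mul, integral_const_mul] at h3
  have h6 : ∀ x, testD (1, 0) φ x = partialD 0 φ x := fun x => rfl
  simp only [h6]
  linarith

lemma poincare_iterate {R : ℝ} (hR : ∀ x ∈ (K : Set Plane), ‖x‖ ≤ R) (n : ℕ) (ν : ℕ × ℕ)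
    (φ : 𝓓(K, ℝ)) : ‖testL2 (testD ν φ)‖ ^ 2 ≤
      ((2 * R) ^ 2) ^ n * ‖testL2 (testD (ν + (n, 0)) φ)‖ ^ 2 := by
  induction n with
  | zero =>
    have : ν + (0, 0) = ν := add_zero ν
    simp [this]
  | succ n ih =>
    refine ih.trans ?_
    rw [pow_succ _ n, mul_assoc]
    refine mul_le_mul_of_nonneg_left ?_ (by positivity)
    refine (poincare hR _).trans (le_of_eq ?_)
    have : testD (1, 0) (testD (ν + (n, 0)) φ) = testD (ν + (n + 1, 0)) φ := by
      refine DFunLike.coe_injective ?_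
      have h1 : ν + (n + 1, 0) = (1, 0) + (ν + (n, 0)) := by
        exact Prod.ext (by simp only [Prod.fst_add]; omega) (by simp)
      rw [h1]
      exact multiD_multiD _ _ φ.contDiff
    rw [this]

/-- Poincaré's inequality in the single direction `x₀` raises every `ν` to the index `ν + (p - |ν|,
0)` of order `p`, which the energy controls. The estimate is closed and so passes from test jets to
their closure. -/
lemma exists_coercive (hb : Bornology.IsBounded (K : Set Plane)) (p : ℕ) :
    ∃ C > 0, ∀ U ∈ zeroJets K p, ‖U‖ ^ 2 ≤ C * energy K p U U := by
  obtain ⟨R, hR⟩ := hb.exists_norm_le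
  refine ⟨∑ ν ∈ indices p, ((2 * R) ^ 2) ^ (p - (ν.1 + ν.2)) + 1, by positivity, ?_⟩
  have hclosed : IsClosed {U : JetSpace K p | ‖U‖ ^ 2 ≤
      (∑ ν ∈ indices p, ((2 * R) ^ 2) ^ (p - (ν.1 + ν.2)) + 1) * energy K p U U} :=
    isClosed_le (by fun_prop) (continuous_const.mul
      ((energy K p).continuous.clm_apply continuous_id))
  intro U hU
  refine closure_minimal ?_ hclosed hU
  rintro _ ⟨φ, rfl⟩
  set J := testJet p φ with hJ
  have h0 : 0 ≤ energy K p J J := by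
    refine le_trans (sq_nonneg _) (norm_sq_le_energy (ν := (p, 0)) J (by simp))
  rw [mem_ofPred_eq, ← real_inner_self_eq_norm_sq, inner_jet, add_mul, one_mul, Finset.sum_mul]
  refine le_add_of_le_of_nonneg (Finset.sum_le_sum fun ν hν => ?_) h0
  have hν' := mem_indices.1 hν
  rw [real_inner_self_eq_norm_sq, coord_testJet hν']
  refine (poincare_iterate hR (p - (ν.1 + ν.2)) ν φ).trans ?_
  refine mul_le_mul_of_nonneg_left ?_ (by positivity)
  have hs : (ν + (p - (ν.1 + ν.2), 0)).1 + (ν + (p - (ν.1 + ν.2), 0)).2 = p := by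
    simp only [Prod.fst_add, Prod.snd_add]
    omega
  have h2 := norm_sq_le_energy J hs
  rwa [hJ, coord_testJet hs.le] at h2

/-! ### Existence and uniqueness -/

lemma memLp_poly (hb : Bornology.IsBounded (K : Set Plane)) (q : MvPolynomial (Fin 2) ℝ) :
    MemLp (fun x : Plane => MvPolynomial.eval (fun k => x k) q) 2
      (volume.restrict (K : Set Plane)) := by
  have hq : Continuous fun x : Plane => MvPolynomial.eval (fun k => x k) q :=
    (MvPolynomial.continuous_eval q).comp (by fun_prop)
  obtain ⟨C, hC⟩ := hb.isCompact_closure.exists_bound_of_continuousOn hq.continuousOn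
  have : IsFiniteMeasure (volume.restrict (K : Set Plane)) :=
    ⟨by rw [Measure.restrict_apply_univ]; exact hb.measure_lt_top⟩
  refine MemLp.of_bound hq.aestronglyMeasurable C ?_
  exact (ae_restrict_iff' K.isOpen.measurableSet).2 (ae_of_all _ fun x hx =>
    hC x (subset_closure hx))

/-- Functions of a closed subspace represent the bounded functionals through a coercive form. -/
lemma exists_zeroJet (hb : Bornology.IsBounded (K : Set Plane)) (p : ℕ)
    (F : JetSpace K p →L[ℝ] ℝ) : ∃ U ∈ zeroJets K p, ∀ W ∈ zeroJets K p, energy K p U W = F W := by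
  have hcomp : CompleteSpace (zeroJets K p) :=
    (Submodule.isClosed_topologicalClosure _).completeSpace_coe
  let B : zeroJets K p →L[ℝ] zeroJets K p →L[ℝ] ℝ :=
    (energy K p).bilinearComp (zeroJets K p).subtypeL (zeroJets K p).subtypeL
  have hB : IsCoercive B := by
    obtain ⟨C, hC, hc⟩ := exists_coercive hb p
    refine ⟨C⁻¹, by positivity, fun U => ?_⟩
    have h1 : ‖(U : JetSpace K p)‖ ^ 2 ≤ C * energy K p U U := hc U U.2
    have h2 : B U U = energy K p U U := rfl
    rw [h2, mul_assoc, inv_mul_le_iff₀ hC, ← pow_two]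
    exact h1
  let f : zeroJets K p := (InnerProductSpace.toDual ℝ (zeroJets K p)).symm
    (F.comp (zeroJets K p).subtypeL)
  let U := hB.continuousLinearEquivOfBilin.symm f
  refine ⟨U, U.2, fun W hW => ?_⟩
  have h1 := hB.continuousLinearEquivOfBilin_apply U ⟨W, hW⟩
  rw [ContinuousLinearEquiv.apply_symm_apply, InnerProductSpace.toDual_symm_apply] at h1
  exact h1.symm

/-- Solvability of the polyharmonic Dirichlet problem. -/
lemma exists_dirichlet (hb : Bornology.IsBounded (K : Set Plane)) {p : ℕ} {V : JetSpace K p}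
    (hV : ∀ ν : ℕ × ℕ, ν.1 + ν.2 ≤ p → HasWeakDeriv K ν (coord K p 0 V) (coord K p ν V))
    (q : MvPolynomial (Fin 2) ℝ) : ∃ U ∈ zeroJets K p, ∀ φ : 𝓓(K, ℝ),
      ∫ x in (K : Set Plane), (coord K p 0 V + coord K p 0 U : L2 K) x * polyLaplacian p φ x =
        ∫ x in (K : Set Plane), MvPolynomial.eval (fun k => x k) q * φ x := by
  -- The functional is the weak form of `Δ^p U = q - Δ^p V`.
  obtain ⟨U, hU, h⟩ := exists_zeroJet hb p
    ((-1 : ℝ) ^ p • (innerSL ℝ ((memLp_poly hb q).toLp _)).comp (coord K p 0) - energy K p V)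
  refine ⟨U, hU, fun φ => ?_⟩
  have h1 := h (testJet p φ) (subset_closure ⟨φ, rfl⟩)
  have h2 : ((-1 : ℝ) ^ p • (innerSL ℝ ((memLp_poly hb q).toLp _)).comp (coord K p 0) -
      energy K p V) (testJet p φ) = (-1 : ℝ) ^ p * (∫ x in (K : Set Plane),
        MvPolynomial.eval (fun k => x k) q * φ x) - energy K p V (testJet p φ) := by
    rw [sub_apply, smul_apply,
      ContinuousLinearMap.comp_apply, innerSL_apply_apply, coord_testJet (by simp), inner_testL2,
      smul_eq_mul]
    congr 2
    refine integral_congr_ae ?_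
    filter_upwards [(memLp_poly hb q).coeFn_toLp] with x hx
    rw [hx]
    rfl
  rw [h2, energy_testJet (fun ν hν => zeroJets_hasWeakDeriv hU hν) φ, energy_testJet hV φ] at h1
  rw [integral_add_mul _ _ (contDiff_polyLaplacian p φ.contDiff).continuous
    (hasCompactSupport_polyLaplacian p φ.hasCompactSupport)]
  have h3 : ((-1 : ℝ) ^ p) ≠ 0 := pow_ne_zero _ (by norm_num)
  refine mul_left_cancel₀ h3 ?_
  linarith

/-- Uniqueness for the polyharmonic Dirichlet problem. -/
lemma zeroJet_eq_zero (hb : Bornology.IsBounded (K : Set Plane)) {p : ℕ} {U : JetSpace K p}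
    (hU : U ∈ zeroJets K p) {q : MvPolynomial (Fin 2) ℝ}
    (hq : ∀ φ : 𝓓(K, ℝ), ∫ x in (K : Set Plane), coord K p 0 U x * polyLaplacian p φ x =
      ∫ x in (K : Set Plane), MvPolynomial.eval (fun k => x k) q * φ x)
    (h0 : ∫ x in (K : Set Plane), MvPolynomial.eval (fun k => x k) q * coord K p 0 U x = 0) :
    U = 0 := by
  set f : L2 K := (memLp_poly hb q).toLp _ with hf
  have hclosed : IsClosed {W : JetSpace K p | energy K p U W =
      (-1 : ℝ) ^ p * inner ℝ f (coord K p 0 W)} :=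
    isClosed_eq (by fun_prop) (by fun_prop)
  -- The weak equation, known for test jets, extends to their closure and can be tested with `U`
  -- itself; its right side is then the vanishing moment `h0`.
  have h1 : U ∈ {W : JetSpace K p | energy K p U W =
      (-1 : ℝ) ^ p * inner ℝ f (coord K p 0 W)} := by
    refine closure_minimal ?_ hclosed hU
    rintro _ ⟨φ, rfl⟩
    rw [mem_ofPred_eq, energy_testJet (fun ν hν => zeroJets_hasWeakDeriv hU hν) φ, hq φ,
      coord_testJet (by simp), inner_testL2]
    congr 1
    refine integral_congr_ae ?_
    filter_upwards [(memLp_poly hb q).coeFn_toLp] with x hx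
    rw [hx]
    rfl
  have h2 : inner ℝ f (coord K p 0 U) = 0 := by
    rw [inner_L2, ← h0]
    refine integral_congr_ae ?_
    filter_upwards [(memLp_poly hb q).coeFn_toLp] with x hx
    rw [hx]
  rw [mem_ofPred_eq, h2, mul_zero] at h1
  obtain ⟨C, hC, hc⟩ := exists_coercive hb p
  have h3 := hc U hU
  rw [h1, mul_zero] at h3
  exact norm_eq_zero.1 (pow_eq_zero_iff (two_ne_zero)|>.1 (le_antisymm h3 (sq_nonneg _)))

end VEM

namespace VEM

open MeasureTheory Set Filter Topology TopologicalSpace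
open scoped ContDiff Distributions

variable {N : ℕ} {P : Polygon Plane N} {K : Opens Plane}

/-! ### Limits of smooth functions with bounded derivatives -/

lemma tendsto_eLpNorm_of_bounded {α : Type*} [MeasurableSpace α] {μ : Measure α}
    [IsFiniteMeasure μ] {f : ℕ → α → ℝ} {g : α → ℝ} {C : ℝ}
    (hf : ∀ n, AEStronglyMeasurable (f n) μ) (hC : ∀ n, ∀ᵐ x ∂μ, |f n x| ≤ C)
    (hlim : ∀ᵐ x ∂μ, Tendsto (fun n => f n x) atTop (𝓝 (g x))) :
    MemLp g 2 μ ∧ Tendsto (fun n => eLpNorm (f n - g) 2 μ) atTop (𝓝 0) := by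
  have hgm : AEStronglyMeasurable g μ := aestronglyMeasurable_of_tendsto_ae atTop hf hlim
  have hC' := ae_all_iff.2 hC
  have hg : ∀ᵐ x ∂μ, |g x| ≤ C := by
    filter_upwards [hC', hlim] with x h1 h2
    exact le_of_tendsto h2.abs (Eventually.of_forall h1)
  refine ⟨MemLp.of_bound hgm C hg, ?_⟩
  have h1 : Tendsto (fun n => ∫⁻ x, ‖(f n - g) x‖ₑ ^ (2 : ℝ) ∂μ) atTop (𝓝 (∫⁻ _, 0 ∂μ)) := by
    refine tendsto_lintegral_of_dominated_convergence' (fun _ => ENNReal.ofReal (C + C) ^ (2 : ℝ))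
      (fun n => ((hf n).sub hgm).enorm.pow_const _) (fun n => ?_) ?_ ?_
    · filter_upwards [hC n, hg] with x h2 h3
      refine ENNReal.rpow_le_rpow ?_ (by norm_num)
      rw [← ofReal_norm]
      exact ENNReal.ofReal_le_ofReal ((norm_sub_le _ _).trans (add_le_add h2 h3))
    · rw [lintegral_const]
      exact ENNReal.mul_ne_top (ENNReal.rpow_ne_top_of_nonneg (by norm_num) ENNReal.ofReal_ne_top)
        (measure_ne_top _ _)
    · filter_upwards [hlim] with x hx
      have h4 : Tendsto (fun n => ‖(f n - g) x‖ₑ) atTop (𝓝 0) := by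
        have := (hx.sub_const (g x)).enorm
        simpa using this
      have h5 := (ENNReal.continuous_rpow_const (y := (2 : ℝ))).tendsto 0 |>.comp h4
      simpa [ENNReal.zero_rpow_of_pos, Function.comp_def] using h5
  rw [lintegral_zero] at h1
  have h2 := ((ENNReal.continuous_rpow_const (y := (1 / 2 : ℝ))).tendsto 0).comp h1
  rw [ENNReal.zero_rpow_of_pos (by norm_num)] at h2
  refine h2.congr fun n => ?_
  rw [eLpNorm_eq_lintegral_rpow_enorm_toReal (by norm_num) (by norm_num)]
  simp

/-- Sequences that are locally uniformly bounded. -/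
def LocBounded (f : ℕ → Plane → ℝ) : Prop := ∀ R : ℝ, ∃ C : ℝ, ∀ n x, ‖x‖ ≤ R → |f n x| ≤ C

lemma LocBounded.const {f : Plane → ℝ} (hf : Continuous f) : LocBounded fun _ => f := by
  intro R
  obtain ⟨C, hC⟩ := (isCompact_closedBall (0 : Plane) R).exists_bound_of_continuousOn
    hf.continuousOn
  exact ⟨C, fun n x hx => hC x (by simpa using hx)⟩

lemma LocBounded.add {f g : ℕ → Plane → ℝ} (hf : LocBounded f) (hg : LocBounded g) :
    LocBounded fun n x => f n x + g n x := by
  intro R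
  obtain ⟨C, hC⟩ := hf R
  obtain ⟨D, hD⟩ := hg R
  exact ⟨C + D, fun n x hx => (abs_add_le _ _).trans (add_le_add (hC n x hx) (hD n x hx))⟩

lemma LocBounded.mul {f g : ℕ → Plane → ℝ} (hf : LocBounded f) (hg : LocBounded g) :
    LocBounded fun n x => f n x * g n x := by
  intro R
  obtain ⟨C, hC⟩ := hf R
  obtain ⟨D, hD⟩ := hg R
  refine ⟨C * D, fun n x hx => ?_⟩
  rw [abs_mul]
  exact mul_le_mul (hC n x hx) (hD n x hx) (abs_nonneg _) ((abs_nonneg _).trans (hC n x hx))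

lemma LocBounded.sum {ι : Type*} {s : Finset ι} {f : ι → ℕ → Plane → ℝ}
    (hf : ∀ i ∈ s, LocBounded (f i)) : LocBounded fun n x => ∑ i ∈ s, f i n x := by
  classical
  induction s using Finset.induction_on with
  | empty => simpa using LocBounded.const (f := fun _ => 0) continuous_const
  | insert a s ha ih =>
    simp only [Finset.sum_insert ha]
    exact (hf a (by simp)).add (ih fun i hi => hf i (by simp [hi]))

/-- The functions `φ n` are smooth, their derivatives of order at most `p` are locally bounded,
and those of order less than `p` converge to continuous functions `g ν`. -/
structure JetLim (p : ℕ) (φ : ℕ → Plane → ℝ) (g : ℕ × ℕ → Plane → ℝ) : Prop where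
  smooth : ∀ n, ContDiff ℝ ∞ (φ n)
  bounded : ∀ ν : ℕ × ℕ, ν.1 + ν.2 ≤ p → LocBounded fun n => multiD ν (φ n)
  tendsto_ae : ∀ ν : ℕ × ℕ, ν.1 + ν.2 ≤ p →
    ∀ᵐ x, Tendsto (fun n => multiD ν (φ n) x) atTop (𝓝 (g ν x))
  tendsto : ∀ ν : ℕ × ℕ, ν.1 + ν.2 < p →
    ∀ x, Tendsto (fun n => multiD ν (φ n) x) atTop (𝓝 (g ν x))
  continuous : ∀ ν : ℕ × ℕ, ν.1 + ν.2 < p → Continuous (g ν)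

lemma JetLim.const (p : ℕ) {f : Plane → ℝ} (hf : ContDiff ℝ ∞ f) :
    JetLim p (fun _ => f) fun ν => multiD ν f where
  smooth _ := hf
  bounded ν _ := LocBounded.const (contDiff_multiD hf ν).continuous
  tendsto_ae _ _ := ae_of_all _ fun _ => tendsto_const_nhds
  tendsto _ _ _ := tendsto_const_nhds
  continuous ν _ := (contDiff_multiD hf ν).continuous

lemma JetLim.sum {p : ℕ} {ι : Type*} {s : Finset ι} {φ : ι → ℕ → Plane → ℝ}
    {g : ι → ℕ × ℕ → Plane → ℝ} (h : ∀ i ∈ s, JetLim p (φ i) (g i)) :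
    JetLim p (fun n => ∑ i ∈ s, φ i n) fun ν x => ∑ i ∈ s, g i ν x := by
  have hD : ∀ ν n x, multiD ν (∑ i ∈ s, φ i n) x = ∑ i ∈ s, multiD ν (φ i n) x := by
    intro ν n x
    rw [multiD_sum _ _ fun i hi => (h i hi).smooth n, Finset.sum_apply]
  constructor
  · exact fun n => contDiff_finset_sum fun i hi => (h i hi).smooth n
  · intro ν hν
    have := LocBounded.sum (s := s) (f := fun i n => multiD ν (φ i n))
      fun i hi => (h i hi).bounded ν hν
    intro R
    obtain ⟨C, hC⟩ := this R
    exact ⟨C, fun n x hx => (congrArg abs (hD ν n x)).trans_le (hC n x hx)⟩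
  · intro ν hν
    have : ∀ᵐ x, ∀ i ∈ s, Tendsto (fun n => multiD ν (φ i n) x) atTop (𝓝 (g i ν x)) :=
      (ae_ball_iff s.countable_toSet).2 fun i hi => (h i hi).tendsto_ae ν hν
    filter_upwards [this] with x hx
    simp only [hD]
    exact tendsto_finsetSum _ hx
  · intro ν hν x
    simp only [hD]
    exact tendsto_finsetSum _ fun i hi => (h i hi).tendsto ν hν x
  · exact fun ν hν => continuous_finsetSum _ fun i hi => (h i hi).continuous ν hν

lemma tendsto_jetMul {a : ℕ × ℕ → ℝ} {b : ℕ → ℕ × ℕ → ℝ} {c : ℕ × ℕ → ℝ} {ν : ℕ × ℕ}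
    (h : ∀ κ : ℕ × ℕ, κ.1 + κ.2 ≤ ν.1 + ν.2 → Tendsto (fun n => b n κ) atTop (𝓝 (c κ))) :
    Tendsto (fun n => jetMul a (b n) ν) atTop (𝓝 (jetMul a c ν)) := by
  unfold jetMul
  refine tendsto_finsetSum _ fun κ hκ => tendsto_finsetSum _ fun l hl => ?_
  exact ((h _ (antidiagonal_index_le le_rfl hκ hl)).const_mul _).const_mul _

lemma JetLim.mul {p : ℕ} {φ : ℕ → Plane → ℝ} {g : ℕ × ℕ → Plane → ℝ} (h : JetLim p φ g)
    {θ : Plane → ℝ} (hθ : ContDiff ℝ ∞ θ) :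
    JetLim p (fun n => θ * φ n) fun ν x => jetMul (fun κ => multiD κ θ x) (fun κ => g κ x) ν := by
  constructor
  · exact fun n => contDiff_mul hθ (h.smooth n)
  · intro ν hν
    have : LocBounded fun n x => ∑ κ ∈ Finset.HasAntidiagonal.antidiagonal ν.1,
        ∑ l ∈ Finset.HasAntidiagonal.antidiagonal ν.2, (ν.1.choose κ.1 : ℝ) * (ν.2.choose l.1) *
          (multiD (κ.1, l.1) θ x * multiD (κ.2, l.2) (φ n) x) := by
      refine LocBounded.sum fun κ hκ => LocBounded.sum fun l hl => ?_
      exact (LocBounded.const continuous_const).mul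
        ((LocBounded.const (contDiff_multiD hθ _).continuous).mul
          (h.bounded (κ.2, l.2) (show κ.2 + l.2 ≤ p from antidiagonal_index_le hν hκ hl)))
    intro R
    obtain ⟨C, hC⟩ := this R
    exact ⟨C, fun n x hx =>
      (congrArg abs (multiD_mul hθ (h.smooth n) ν x)).trans_le (hC n x hx)⟩
  · intro ν hν
    have : ∀ᵐ x, ∀ κ ∈ indices p, Tendsto (fun n => multiD κ (φ n) x) atTop (𝓝 (g κ x)) :=
      (ae_ball_iff (indices p).countable_toSet).2 fun κ hκ => h.tendsto_ae κ (mem_indices.1 hκ)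
    filter_upwards [this] with x hx
    simp only [multiD_mul hθ (h.smooth _)]
    exact tendsto_jetMul fun κ hκ => hx κ (mem_indices.2 (hκ.trans hν))
  · intro ν hν x
    simp only [multiD_mul hθ (h.smooth _)]
    exact tendsto_jetMul fun κ hκ => h.tendsto κ (hκ.trans_lt hν) x
  · intro ν hν
    unfold jetMul
    refine continuous_finsetSum _ fun κ hκ => continuous_finsetSum _ fun l hl => ?_
    have h1 := antidiagonal_index_le le_rfl hκ hl
    exact continuous_const.mul ((contDiff_multiD hθ _).continuous.mul
      (h.continuous _ (lt_of_le_of_lt h1 hν)))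

/-- Bounded convergence yields `L²` limits on `K` and on the edges. Derivatives of order `p` have no
traces to be identified, so convergence almost everywhere is enough for them. -/
lemma JetLim.exists_jet (hb : Bornology.IsBounded (K : Set Plane)) {p : ℕ} {φ : ℕ → Plane → ℝ}
    {g : ℕ × ℕ → Plane → ℝ} (h : JetLim p φ g) : ∃ V : ℕ × ℕ → L2 K,
      (∀ ν : ℕ × ℕ, ν.1 + ν.2 ≤ p → HasWeakDeriv K ν (V 0) (V ν)) ∧ IsTraceJet P K p (V 0) g := by
  have : IsFiniteMeasure (volume.restrict (K : Set Plane)) :=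
    ⟨by rw [Measure.restrict_apply_univ]; exact hb.measure_lt_top⟩
  obtain ⟨R, hR⟩ := hb.exists_norm_le
  have hK : ∀ ν : ℕ × ℕ, ν.1 + ν.2 ≤ p → MemLp (g ν) 2 (volume.restrict (K : Set Plane)) ∧
      Tendsto (fun n => eLpNorm (multiD ν (φ n) - g ν) 2 (volume.restrict (K : Set Plane)))
        atTop (𝓝 0) := by
    intro ν hν
    obtain ⟨C, hC⟩ := h.bounded ν hν R
    refine tendsto_eLpNorm_of_bounded
      (fun n => (contDiff_multiD (h.smooth n) ν).continuous.aestronglyMeasurable) (C := C)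
      (fun n => ?_) (ae_restrict_of_ae (h.tendsto_ae ν hν))
    exact (ae_restrict_iff' K.isOpen.measurableSet).2 (ae_of_all _ fun x hx => hC n x (hR x hx))
  let V : ℕ × ℕ → L2 K := fun ν => if hν : ν.1 + ν.2 ≤ p then (hK ν hν).1.toLp _ else 0
  have hV : ∀ ν : ℕ × ℕ, ν.1 + ν.2 ≤ p → Tendsto (fun n => eLpNorm (multiD ν (φ n) - ⇑(V ν)) 2
      (volume.restrict (K : Set Plane))) atTop (𝓝 0) := by
    intro ν hν
    refine (hK ν hν).2.congr fun n => eLpNorm_congr_ae ?_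
    have h1 : V ν = (hK ν hν).1.toLp _ := dif_pos hν
    filter_upwards [(hK ν hν).1.coeFn_toLp] with x hx
    rw [Pi.sub_apply, Pi.sub_apply, h1, hx]
  have hW : ∀ ν : ℕ × ℕ, ν.1 + ν.2 ≤ p → HasWeakDeriv K ν (V 0) (V ν) := fun ν hν =>
    hasWeakDeriv_of_tendsto h.smooth (hV 0 (by simp)) (hV ν hν)
  refine ⟨V, hW, fun ν hν => ⟨(h.continuous ν hν).continuousOn, V ν, hW ν hν.le, ?_⟩⟩
  have hk : ∀ k, HasWeakDeriv K (unitIndex k) (V ν) (V (ν + unitIndex k)) :=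
    fun k => (hW ν hν.le).sub_index (hW _ (by rw [add_unitIndex_sum]; omega))
  have hkt : ∀ k, Tendsto (fun n => eLpNorm (partialD k (multiD ν (φ n)) -
      ⇑(V (ν + unitIndex k))) 2 (volume.restrict (K : Set Plane))) atTop (𝓝 0) := by
    intro k
    refine (hV (ν + unitIndex k) (by rw [add_unitIndex_sum]; omega)).congr fun n => ?_
    rw [partialD_multiD k ν (h.smooth n)]
  have hedge : ∀ i, MemLp (fun t : ℝ => g ν (P.edgePath ℝ i t)) 2 (volume.restrict (Icc 0 1)) ∧
      Tendsto (fun n => eLpNorm ((fun t : ℝ => multiD ν (φ n) (P.edgePath ℝ i t)) -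
        fun t : ℝ => g ν (P.edgePath ℝ i t)) 2 (volume.restrict (Icc 0 1))) atTop (𝓝 0) := by
    intro i
    obtain ⟨R', hR'⟩ := (isCompact_edgeSet (P := P) i).isBounded.exists_norm_le
    obtain ⟨C, hC⟩ := h.bounded ν hν.le R'
    refine tendsto_eLpNorm_of_bounded (fun n => ((contDiff_multiD (h.smooth n) ν).continuous.comp
      (continuous_edgePath P i)).aestronglyMeasurable) (C := C) (fun n => ?_)
      (ae_of_all _ fun t => h.tendsto ν hν _)
    exact (ae_restrict_iff' measurableSet_Icc).2 (ae_of_all _ fun t ht =>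
      hC n _ (hR' _ (edgePath_mem_edgeSet ht)))
  exact ⟨fun i => (hedge i).1, _, _, fun n => multiD ν (φ n), hk 0, hk 1,
    fun n => contDiff_multiD (h.smooth n) ν, hV ν hν.le, hkt 0, hkt 1, fun i => (hedge i).2⟩

end VEM

namespace VEM

open MeasureTheory Set Filter Topology TopologicalSpace
open scoped ContDiff Distributions

variable {N : ℕ} {P : Polygon Plane N} {K : Opens Plane}

/-! ### Cut-off functions at a vertex -/

lemma multiD_comp_affine {f : Plane → ℝ} (hf : ContDiff ℝ ∞ f) (c : ℝ) (V : Plane) (ν : ℕ × ℕ) :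
    multiD ν (fun x => f (c • (x - V))) = fun x => c ^ (ν.1 + ν.2) * multiD ν f (c • (x - V)) := by
  have hcomp : ∀ {f : Plane → ℝ}, ContDiff ℝ ∞ f → ContDiff ℝ ∞ fun x => f (c • (x - V)) :=
    fun hf => hf.comp ((contDiff_id.sub contDiff_const).const_smul c)
  induction ν using index_induction with
  | zero => simp [multiD]
  | step ν j ih =>
    rw [← partialD_multiD j ν (hcomp hf), ih, ← partialD_multiD j ν hf]
    have h1 : (fun x => c ^ (ν.1 + ν.2) * multiD ν f (c • (x - V))) =
      c ^ (ν.1 + ν.2) • fun x => multiD ν f (c • (x - V)) := rfl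
    rw [h1, partialD_smul (hcomp (contDiff_multiD hf ν)), add_unitIndex_sum]
    funext x
    have h2 : partialD j (fun x => multiD ν f (c • (x - V))) x =
        c * partialD j (multiD ν f) (c • (x - V)) := by
      have h3 : HasFDerivAt (fun x => multiD ν f (c • (x - V)))
          ((fderiv ℝ (multiD ν f) (c • (x - V))).comp (c • ContinuousLinearMap.id ℝ Plane)) x :=
        ((contDiff_multiD hf ν).differentiable (by simp) (c • (x - V))).hasFDerivAt.comp x
          (((hasFDerivAt_id x).sub_const V).fun_const_smul c)
      unfold partialD
      rw [h3.fderiv]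
      simp
    rw [Pi.smul_apply, smul_eq_mul, h2, pow_succ]
    ring

/-- A smooth function that is homogeneous of degree zero outside the unit ball, equal to one along
one ray and to zero along another one. -/
lemma exists_conical_cutoff {d₁ d₂ : Plane} (h₁ : ‖d₁‖ = 1) (h₂ : ‖d₂‖ = 1) (hne : d₁ ≠ d₂) :
    ∃ χ : Plane → ℝ, ContDiff ℝ ∞ χ ∧
      (∀ x, 1 ≤ ‖x‖ → ∀ l : ℝ, 1 ≤ l → χ (l • x) = χ x) ∧
      (∀ s : ℝ, 1 < s → χ =ᶠ[𝓝 (s • d₁)] 1) ∧ ∀ s : ℝ, 1 < s → χ =ᶠ[𝓝 (s • d₂)] 0 := by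
  set η : ContDiffBump (0 : Plane) := ⟨1 / 2, 1, by norm_num, by norm_num⟩ with hη
  set a : ℝ := 1 - inner ℝ d₁ d₂ with ha
  have ha0 : 0 < a := by
    have := inner_lt_one_iff_real_of_norm_eq_one h₁ h₂ |>.2 hne
    linarith
  set d := d₁ - d₂ with hd
  -- `ζ` depends only on the direction of `x`, and `a` normalizes it to `3/2` along `d₁` and `-1/2`
  -- along `d₂`. Both values lie strictly outside `[0, 1]`, so the smooth transition is locally
  -- constant near the two rays.
  set ζ : Plane → ℝ := fun x => 1 / 2 + inner ℝ x d / (a * ‖x‖) with hζ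
  have hζsm : ∀ x : Plane, x ≠ 0 → ContDiffAt ℝ ∞ ζ x := by
    intro x hx
    have h3 : a * ‖x‖ ≠ 0 := mul_ne_zero ha0.ne' (norm_ne_zero_iff.2 hx)
    exact contDiffAt_const.add ((contDiffAt_id.inner ℝ contDiffAt_const).div
      (contDiffAt_const.mul (contDiffAt_norm ℝ hx)) h3)
  have hout : ∀ x : Plane, 1 ≤ ‖x‖ → η x = 0 := fun x hx =>
    η.zero_of_le_dist (by rw [dist_zero_right]; exact hx)
  have hray : ∀ (e : Plane) (s : ℝ), ‖e‖ = 1 → 1 < s → ζ (s • e) = 1 / 2 + inner ℝ e d / a := by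
    intro e s he hs
    simp only [hζ]
    rw [inner_smul_left, norm_smul, he, Real.norm_of_nonneg (by linarith)]
    simp only [conj_trivial]
    have : s ≠ 0 := by linarith
    field_simp
  have hev : ∀ (e : Plane) (s : ℝ), ‖e‖ = 1 → 1 < s →
      ∀ᶠ x in 𝓝 (s • e), 1 < ‖x‖ := by
    intro e s he hs
    refine continuousAt_const.eventually_lt continuous_norm.continuousAt ?_
    rw [norm_smul, he, Real.norm_of_nonneg (by linarith)]
    linarith
  have hζ1 : inner ℝ d₁ d = a := by
    rw [hd, inner_sub_right, real_inner_self_eq_norm_sq, h₁, ha]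
    norm_num
  have hζ2 : inner ℝ d₂ d = -a := by
    rw [hd, inner_sub_right, real_inner_self_eq_norm_sq, h₂, ha, real_inner_comm]
    norm_num
  have hne0 : ∀ (e : Plane) (s : ℝ), ‖e‖ = 1 → 1 < s → s • e ≠ 0 := by
    intro e s he hs h0
    have := norm_eq_zero.2 h0
    rw [norm_smul, he, Real.norm_of_nonneg (by linarith)] at this
    linarith
  refine ⟨fun x => (1 - η x) * Real.smoothTransition (ζ x), ?_, ?_, ?_, ?_⟩
  · rw [contDiff_iff_contDiffAt]
    intro x
    by_cases hx : x = 0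
    · subst hx
      refine (contDiffAt_const (c := (0 : ℝ))).congr_of_eventuallyEq ?_
      filter_upwards [η.eventuallyEq_one] with y hy
      rw [hy]
      simp
    · exact (contDiffAt_const.sub η.contDiff.contDiffAt).mul
        (Real.smoothTransition.contDiff.contDiffAt.comp x (hζsm x hx))
  · intro x hx l hl
    have h3 : 1 ≤ ‖l • x‖ := by
      rw [norm_smul, Real.norm_of_nonneg (by linarith)]
      nlinarith
    have h4 : ζ (l • x) = ζ x := by
      simp only [hζ]
      rw [inner_smul_left, norm_smul, Real.norm_of_nonneg (by linarith)]
      simp only [conj_trivial]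
      have : l ≠ 0 := by linarith
      have : ‖x‖ ≠ 0 := by linarith
      field_simp
    simp only [hout x hx, hout _ h3, h4]
  · intro s hs
    have h3 : ∀ᶠ x in 𝓝 (s • d₁), 1 < ζ x := by
      refine continuousAt_const.eventually_lt (hζsm _ (hne0 _ _ h₁ hs)).continuousAt ?_
      rw [hray _ _ h₁ hs, hζ1, div_self ha0.ne']
      norm_num
    filter_upwards [h3, hev _ _ h₁ hs] with x h4 h5
    rw [hout x h5.le, Real.smoothTransition.one_of_one_le h4.le]
    simp
  · intro s hs
    have h3 : ∀ᶠ x in 𝓝 (s • d₂), ζ x < 0 := by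
      refine (hζsm _ (hne0 _ _ h₂ hs)).continuousAt.eventually_lt continuousAt_const ?_
      rw [hray _ _ h₂ hs, hζ2, neg_div, div_self ha0.ne']
      norm_num
    filter_upwards [h3] with x h4
    rw [Real.smoothTransition.zero_of_nonpos h4.le]
    simp

/-- Derivatives of a function that is homogeneous of degree zero at infinity. -/
lemma exists_bound_homogeneous {χ : Plane → ℝ} (hχ : ContDiff ℝ ∞ χ)
    (hh : ∀ x, 1 ≤ ‖x‖ → ∀ l : ℝ, 1 ≤ l → χ (l • x) = χ x) (κ : ℕ × ℕ) :
    ∃ C : ℝ, 0 ≤ C ∧ ∀ z, |multiD κ χ z| * ‖z‖ ^ (κ.1 + κ.2) ≤ C := by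
  have hcont : Continuous fun z => |multiD κ χ z| * ‖z‖ ^ (κ.1 + κ.2) :=
    (contDiff_multiD hχ κ).continuous.abs.mul (continuous_norm.pow _)
  obtain ⟨C, hC⟩ := (isCompact_closedBall (0 : Plane) 2).exists_bound_of_continuousOn
    hcont.continuousOn
  have hC' : ∀ z : Plane, ‖z‖ ≤ 2 → |multiD κ χ z| * ‖z‖ ^ (κ.1 + κ.2) ≤ C := fun z hz =>
    (le_abs_self _).trans (hC z (by simpa using hz))
  have hC0 : 0 ≤ C := (norm_nonneg _).trans (hC 0 (by simp))
  refine ⟨C, hC0, fun z => ?_⟩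
  by_cases hz : ‖z‖ ≤ 2
  · exact hC' z hz
  rw [not_le] at hz
  -- Scaling back to norm `2` rather than `1` leaves a neighbourhood on which the homogeneity holds
  -- and can be differentiated.
  set l := ‖z‖ / 2 with hl
  have hl1 : 1 ≤ l := by rw [hl]; linarith
  set z' := l⁻¹ • z with hz'
  have hzz : l • z' = z := by rw [hz', smul_smul, mul_inv_cancel₀ (by linarith), one_smul]
  have hn : ‖z'‖ = 2 := by
    rw [hz', norm_smul, norm_inv, Real.norm_of_nonneg (by linarith), hl]
    field_simp
  have h1 : (fun x => χ (l • (x - 0))) =ᶠ[𝓝 z'] χ := by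
    have : ∀ᶠ x in 𝓝 z', 1 < ‖x‖ :=
      continuousAt_const.eventually_lt continuous_norm.continuousAt (by rw [hn]; norm_num)
    filter_upwards [this] with x hx
    rw [sub_zero, hh x hx.le l hl1]
  have h2 := (multiD_congr h1 κ).self_of_nhds
  rw [multiD_comp_affine hχ] at h2
  simp only [sub_zero, hzz] at h2
  have h3 := hC' z' hn.le
  rw [← h2, abs_mul, abs_of_nonneg (by positivity)] at h3
  calc |multiD κ χ z| * ‖z‖ ^ (κ.1 + κ.2) = l ^ (κ.1 + κ.2) * |multiD κ χ z| *
        ‖z'‖ ^ (κ.1 + κ.2) := by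
        conv_lhs => rw [← hzz, norm_smul, Real.norm_of_nonneg (by linarith : 0 ≤ l), mul_pow, hzz]
        ring
    _ ≤ C := h3

/-- Taylor's estimate for functions vanishing to order `p` at a point. -/
lemma exists_bound_of_vanishing {F : Plane → ℝ} (hF : ContDiff ℝ ∞ F) {V : Plane} {p : ℕ}
    (h0 : ∀ μ : ℕ × ℕ, μ.1 + μ.2 < p → multiD μ F V = 0) (R : ℝ) (m : ℕ) :
    ∀ μ : ℕ × ℕ, μ.1 + μ.2 + m = p →
      ∃ C : ℝ, 0 ≤ C ∧ ∀ x, ‖x - V‖ ≤ R → |multiD μ F x| ≤ C * ‖x - V‖ ^ m := by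
  induction m with
  | zero =>
    intro μ _
    obtain ⟨C, hC⟩ := (isCompact_closedBall V R).exists_bound_of_continuousOn
      (contDiff_multiD hF μ).continuous.continuousOn
    refine ⟨max C 0, le_max_right _ _, fun x hx => ?_⟩
    rw [pow_zero, mul_one]
    exact (hC x (by rwa [Metric.mem_closedBall, dist_eq_norm])).trans (le_max_left _ _)
  | succ m ih =>
    intro μ hμ
    have hk : ∀ k : Fin 2, ∃ C : ℝ, 0 ≤ C ∧ ∀ x, ‖x - V‖ ≤ R →
        |partialD k (multiD μ F) x| ≤ C * ‖x - V‖ ^ m := by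
      intro k
      obtain ⟨C, hC0, hC⟩ := ih (μ + unitIndex k) (by rw [add_unitIndex_sum]; omega)
      refine ⟨C, hC0, fun x hx => ?_⟩
      rw [partialD_multiD k μ hF]
      exact hC x hx
    obtain ⟨C₀, h₀, hC₀⟩ := hk 0
    obtain ⟨C₁, h₁, hC₁⟩ := hk 1
    refine ⟨C₀ + C₁, add_nonneg h₀ h₁, fun x hx => ?_⟩
    have hf : ∀ y ∈ Metric.closedBall V ‖x - V‖,
        ‖fderiv ℝ (multiD μ F) y‖ ≤ (C₀ + C₁) * ‖x - V‖ ^ m := by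
      intro y hy
      rw [Metric.mem_closedBall, dist_eq_norm] at hy
      refine ContinuousLinearMap.opNorm_le_bound _ (by positivity) fun u => ?_
      have h2 := dirD_eq u (multiD μ F) y
      rw [dirD] at h2
      have hpow : ‖y - V‖ ^ m ≤ ‖x - V‖ ^ m := pow_le_pow_left₀ (norm_nonneg _) hy m
      have hu : ∀ k, |u k| ≤ ‖u‖ := fun k => PiLp.norm_apply_le u k
      have e0 := (hC₀ y (hy.trans hx)).trans (mul_le_mul_of_nonneg_left hpow h₀)
      have e1 := (hC₁ y (hy.trans hx)).trans (mul_le_mul_of_nonneg_left hpow h₁)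
      rw [h2, Real.norm_eq_abs]
      refine (abs_add_le _ _).trans ?_
      rw [abs_mul, abs_mul]
      have m0 := mul_le_mul (hu 0) e0 (abs_nonneg _) (norm_nonneg _)
      have m1 := mul_le_mul (hu 1) e1 (abs_nonneg _) (norm_nonneg _)
      linarith
    -- The mean value inequality on the ball through `x`: the gradient bound of order `m` gains one
    -- power of `‖x - V‖`.
    have h3 := (convex_closedBall V ‖x - V‖).norm_image_sub_le_of_norm_fderiv_le
      (fun y _ => (contDiff_multiD hF μ).differentiable (by simp) y) hf
      (Metric.mem_closedBall_self (norm_nonneg _))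
      (show x ∈ Metric.closedBall V ‖x - V‖ by rw [Metric.mem_closedBall, dist_eq_norm])
    rw [h0 μ (by omega), sub_zero] at h3
    rw [pow_succ, ← mul_assoc]
    exact h3

/-- Every derivative of the scaled cut-off costs one power of `‖x - V‖`, whatever the scale, and the
vanishing of `F` to order `p` pays for up to `p` of them. The bound is uniform in `n`. -/
lemma exists_bound_cutoff_mul {χ F : Plane → ℝ} (hχ : ContDiff ℝ ∞ χ)
    (hh : ∀ x, 1 ≤ ‖x‖ → ∀ l : ℝ, 1 ≤ l → χ (l • x) = χ x) (hF : ContDiff ℝ ∞ F) {V : Plane}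
    {p : ℕ} (h0 : ∀ μ : ℕ × ℕ, μ.1 + μ.2 < p → multiD μ F V = 0) (R : ℝ) {ν : ℕ × ℕ}
    (hν : ν.1 + ν.2 ≤ p) : ∃ C : ℝ, ∀ (n : ℕ) (x : Plane), ‖x - V‖ ≤ R →
      |multiD ν ((fun x => χ (((n : ℝ) + 1) • (x - V))) * F) x| ≤
        C * ‖x - V‖ ^ (p - (ν.1 + ν.2)) := by
  choose A hA0 hA using exists_bound_homogeneous hχ hh
  choose! B hB0 hB using fun m => exists_bound_of_vanishing hF h0 R m
  refine ⟨∑ κ ∈ Finset.HasAntidiagonal.antidiagonal ν.1,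
    ∑ l ∈ Finset.HasAntidiagonal.antidiagonal ν.2, (ν.1.choose κ.1 : ℝ) * (ν.2.choose l.1) *
      (A (κ.1, l.1) * B (p - (κ.2 + l.2)) (κ.2, l.2)), fun n x hx => ?_⟩
  have hn : (0 : ℝ) < n + 1 := by positivity
  have hχn : ContDiff ℝ ∞ fun x => χ (((n : ℝ) + 1) • (x - V)) :=
    hχ.comp ((contDiff_id.sub contDiff_const).const_smul _)
  rw [multiD_mul hχn hF, jetMul, Finset.sum_mul]
  refine (Finset.abs_sum_le_sum_abs _ _).trans (Finset.sum_le_sum fun κ hκ => ?_)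
  rw [Finset.sum_mul]
  refine (Finset.abs_sum_le_sum_abs _ _).trans (Finset.sum_le_sum fun l hl => ?_)
  have hle : κ.2 + l.2 ≤ p := antidiagonal_index_le hν hκ hl
  have e1 := Finset.HasAntidiagonal.mem_antidiagonal.1 hκ
  have e2 := Finset.HasAntidiagonal.mem_antidiagonal.1 hl
  rw [abs_mul, abs_of_nonneg
    (show (0 : ℝ) ≤ (ν.1.choose κ.1 : ℝ) * (ν.2.choose l.1) by positivity),
    mul_assoc ((ν.1.choose κ.1 : ℝ) * (ν.2.choose l.1))]
  refine mul_le_mul_of_nonneg_left ?_ (by positivity)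
  rw [multiD_comp_affine hχ, abs_mul, abs_mul, abs_pow, abs_of_pos hn]
  have b1 := hA (κ.1, l.1) (((n : ℝ) + 1) • (x - V))
  have b2 := hB (p - (κ.2 + l.2)) (κ.2, l.2) (by simp only; omega) x hx
  have hpow : p - (κ.2 + l.2) = (κ.1 + l.1) + (p - (ν.1 + ν.2)) := by omega
  rw [norm_smul, Real.norm_of_nonneg hn.le, mul_pow] at b1
  have hB0' := hB0 (p - (κ.2 + l.2)) (κ.2, l.2) (by simp only; omega)
  set Bc := B (p - (κ.2 + l.2)) (κ.2, l.2)
  rw [hpow, pow_add] at b2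
  set r := ‖x - V‖ ^ (κ.1 + l.1)
  set r' := ‖x - V‖ ^ (p - (ν.1 + ν.2))
  have hr' : 0 ≤ r' := by positivity
  set X := |multiD (κ.1, l.1) χ (((n : ℝ) + 1) • (x - V))|
  calc ((n : ℝ) + 1) ^ (κ.1 + l.1) * X * |multiD (κ.2, l.2) F x|
      ≤ ((n : ℝ) + 1) ^ (κ.1 + l.1) * X * (Bc * (r * r')) :=
        mul_le_mul_of_nonneg_left b2 (by positivity)
    _ = (X * (((n : ℝ) + 1) ^ (κ.1 + l.1) * r)) * (Bc * r') := by ring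
    _ ≤ A (κ.1, l.1) * (Bc * r') := mul_le_mul_of_nonneg_right b1 (by positivity)
    _ = A (κ.1, l.1) * Bc * r' := by ring

/-- Two smooth functions with the same jet of order less than `p` at `V` can be joined. -/
lemma exists_join {G₁ G₂ : Plane → ℝ} (hG₁ : ContDiff ℝ ∞ G₁) (hG₂ : ContDiff ℝ ∞ G₂) {V : Plane}
    {p : ℕ} (h0 : ∀ μ : ℕ × ℕ, μ.1 + μ.2 < p → multiD μ G₁ V = multiD μ G₂ V) {d₁ d₂ : Plane}
    (h₁ : ‖d₁‖ = 1) (h₂ : ‖d₂‖ = 1) (hne : d₁ ≠ d₂) :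
    ∃ φ g, JetLim p φ g ∧ ∀ ν : ℕ × ℕ, ν.1 + ν.2 < p → ∀ s : ℝ, 0 ≤ s →
      g ν (V + s • d₁) = multiD ν G₁ (V + s • d₁) ∧ g ν (V + s • d₂) = multiD ν G₂ (V + s • d₂) := by
  obtain ⟨χ, hχ, hh, hχ₁, hχ₂⟩ := exists_conical_cutoff h₁ h₂ hne
  -- The joined function is the limit of `G₂ + χ_n F`: where the cut-off is one it equals `G₁`, and
  -- where it is zero it equals `G₂`.
  set F : Plane → ℝ := G₁ + (-1 : ℝ) • G₂ with hFdef
  have hG₂' : ContDiff ℝ ∞ ((-1 : ℝ) • G₂) := hG₂.const_smul (-1 : ℝ)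
  have hF : ContDiff ℝ ∞ F := hG₁.add hG₂'
  have hDF : ∀ ν x, multiD ν F x = multiD ν G₁ x - multiD ν G₂ x := by
    intro ν x
    rw [hFdef, multiD_add ν hG₁ hG₂', multiD_smul ν hG₂]
    simp [sub_eq_add_neg]
  have hFV : ∀ μ : ℕ × ℕ, μ.1 + μ.2 < p → multiD μ F V = 0 := fun μ hμ => by
    rw [hDF, h0 μ hμ, sub_self]
  set χn : ℕ → Plane → ℝ := fun n x => χ (((n : ℝ) + 1) • (x - V)) with hχn
  have hχs : ∀ n, ContDiff ℝ ∞ (χn n) := fun n =>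
    hχ.comp ((contDiff_id.sub contDiff_const).const_smul _)
  set ψ : ℕ → Plane → ℝ := fun n => χn n * F with hψ
  have hψs : ∀ n, ContDiff ℝ ∞ (ψ n) := fun n => contDiff_mul (hχs n) hF
  -- Outside a disc of radius `1 / (M + 1)` homogeneity makes all later cut-offs equal to the
  -- `M`-th. Away from `V` the sequence is thus locally constant from some index on, and limits of
  -- derivatives are derivatives of one smooth function.
  have hstab : ∀ x, x ≠ V → ∃ M : ℕ, ∃ O ∈ 𝓝 x, ∀ n, M ≤ n → ∀ z ∈ O, ψ n =ᶠ[𝓝 z] ψ M := by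
    intro x hx
    have hx0 : 0 < ‖x - V‖ := norm_pos_iff.2 (sub_ne_zero.2 hx)
    obtain ⟨M, hM⟩ := exists_nat_gt (1 / ‖x - V‖)
    rw [div_lt_iff₀ hx0] at hM
    have hO : IsOpen {z : Plane | 1 < ((M : ℝ) + 1) * ‖z - V‖} :=
      isOpen_lt continuous_const (by fun_prop)
    refine ⟨M, _, hO.mem_nhds (show 1 < ((M : ℝ) + 1) * ‖x - V‖ by nlinarith), fun n hn z hz => ?_⟩
    filter_upwards [hO.mem_nhds hz] with y hy
    have hM0 : (0 : ℝ) < M + 1 := by positivity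
    have h3 := hh (((M : ℝ) + 1) • (y - V)) (by
      rw [norm_smul, Real.norm_of_nonneg hM0.le]
      exact le_of_lt hy) (((n : ℝ) + 1) / (M + 1)) (by
      rw [le_div_iff₀ hM0, one_mul]
      have : (M : ℝ) ≤ n := by exact_mod_cast hn
      linarith)
    rw [smul_smul, div_mul_cancel₀ _ hM0.ne'] at h3
    simp only [hψ, hχn, Pi.mul_apply, h3]
  have hbound : ∀ (ν : ℕ × ℕ), ν.1 + ν.2 ≤ p → ∀ R : ℝ, ∃ C : ℝ, ∀ (n : ℕ) (x : Plane),
      ‖x - V‖ ≤ R → |multiD ν (ψ n) x| ≤ C * ‖x - V‖ ^ (p - (ν.1 + ν.2)) :=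
    fun ν hν R => exists_bound_cutoff_mul hχ hh hF hFV R hν
  have hzero : ∀ ν : ℕ × ℕ, ν.1 + ν.2 < p → ∀ n, multiD ν (ψ n) V = 0 := by
    intro ν hν n
    obtain ⟨C, hC⟩ := hbound ν hν.le 0
    have h3 := hC n V (by simp)
    rw [sub_self, norm_zero, zero_pow (by omega), mul_zero] at h3
    exact abs_eq_zero.1 (le_antisymm h3 (abs_nonneg _))
  set g : ℕ × ℕ → Plane → ℝ := fun ν x => limUnder atTop fun n => multiD ν (ψ n) x with hg
  have hlim : ∀ ν x, x ≠ V → ∃ M : ℕ, ∀ᶠ z in 𝓝 x, (∀ n, M ≤ n → multiD ν (ψ n) z =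
      multiD ν (ψ M) z) ∧ g ν z = multiD ν (ψ M) z := by
    intro ν x hx
    obtain ⟨M, O, hO, hst⟩ := hstab x hx
    refine ⟨M, ?_⟩
    filter_upwards [hO] with z hz
    have h3 : ∀ n, M ≤ n → multiD ν (ψ n) z = multiD ν (ψ M) z := fun n hn =>
      (multiD_congr (hst n hn z hz) ν).self_of_nhds
    exact ⟨h3, (tendsto_const_nhds.congr'
      (eventually_atTop.2 ⟨M, fun n hn => (h3 n hn).symm⟩)).limUnder_eq⟩
  have htend : ∀ ν x, x ≠ V → Tendsto (fun n => multiD ν (ψ n) x) atTop (𝓝 (g ν x)) := by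
    intro ν x hx
    obtain ⟨M, hM⟩ := hlim ν x hx
    obtain ⟨h3, h4⟩ := hM.self_of_nhds
    rw [h4]
    exact tendsto_const_nhds.congr' (eventually_atTop.2 ⟨M, fun n hn => (h3 n hn).symm⟩)
  have hgV : ∀ ν : ℕ × ℕ, ν.1 + ν.2 < p → g ν V = 0 := by
    intro ν hν
    simp only [hg, hzero ν hν]
    exact tendsto_const_nhds.limUnder_eq
  have htend' : ∀ ν : ℕ × ℕ, ν.1 + ν.2 < p → ∀ x,
      Tendsto (fun n => multiD ν (ψ n) x) atTop (𝓝 (g ν x)) := by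
    intro ν hν x
    by_cases hx : x = V
    · subst hx
      rw [hgV ν hν]
      simp only [hzero ν hν]
      exact tendsto_const_nhds
    · exact htend ν x hx
  have hJ : JetLim p ψ g := by
    refine ⟨hψs, fun ν hν R => ?_, fun ν _ => ?_, htend', fun ν hν => ?_⟩
    · obtain ⟨C, hC⟩ := hbound ν hν (R + ‖V‖)
      refine ⟨|C| * (R + ‖V‖) ^ (p - (ν.1 + ν.2)), fun n x hx => ?_⟩
      have h3 : ‖x - V‖ ≤ R + ‖V‖ := (norm_sub_le _ _).trans (by linarith)
      exact (hC n x h3).trans (mul_le_mul (le_abs_self C)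
        (pow_le_pow_left₀ (norm_nonneg _) h3 _) (by positivity) (abs_nonneg _))
    · filter_upwards [measure_eq_zero_iff_ae_notMem.1 (measure_singleton (μ := volume) V)] with x hx
      exact htend ν x hx
    · rw [continuous_iff_continuousAt]
      intro x
      by_cases hx : x = V
      · subst hx
        obtain ⟨C, hC⟩ := hbound ν hν.le 1
        rw [ContinuousAt, hgV ν hν, tendsto_zero_iff_abs_tendsto_zero]
        have h3 : Tendsto (fun y => C * ‖y - x‖ ^ (p - (ν.1 + ν.2))) (𝓝 x) (𝓝 0) := by
          have : Continuous fun y => C * ‖y - x‖ ^ (p - (ν.1 + ν.2)) := by fun_prop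
          have h4 := this.tendsto x
          rwa [sub_self, norm_zero, zero_pow (by omega), mul_zero] at h4
        refine squeeze_zero' (Eventually.of_forall fun y => abs_nonneg _) ?_ h3
        filter_upwards [Metric.closedBall_mem_nhds x one_pos] with y hy
        rw [Metric.mem_closedBall, dist_eq_norm] at hy
        exact le_of_tendsto (htend' ν hν y).abs (Eventually.of_forall fun n => hC n y hy)
      · obtain ⟨M, hM⟩ := hlim ν x hx
        refine ((contDiff_multiD (hψs M) ν).continuous.continuousAt).congr ?_
        filter_upwards [hM] with z hz
        exact hz.2.symm
  have hsum := JetLim.sum (p := p) (s := (Finset.univ : Finset Bool))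
    (φ := fun b => if b then ψ else fun _ => G₂) (g := fun b => if b then g else fun ν => multiD ν G₂)
    (fun b _ => by
      cases b
      · exact JetLim.const p hG₂
      · exact hJ)
  refine ⟨_, _, hsum, fun ν hν s hs => ?_⟩
  simp only [Fintype.univ_bool, Finset.mem_singleton, Bool.true_eq_false, not_false_eq_true,
    Finset.sum_insert, Finset.sum_singleton, if_true, Bool.false_eq_true, if_false]
  rcases hs.eq_or_lt with rfl | hs
  · simp only [zero_smul, add_zero, hgV ν hν, zero_add, h0 ν hν, and_self]
  -- For large `n` the scaled point has left the unit ball along its ray, where the cut-off is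
  -- locally the constant `c`.
  have hcase : ∀ (d : Plane) (c : ℝ), ‖d‖ = 1 → (∀ s : ℝ, 1 < s → χ =ᶠ[𝓝 (s • d)] fun _ => c) →
      g ν (V + s • d) = c * multiD ν F (V + s • d) := by
    intro d c hd hc
    have hne' : V + s • d ≠ V := by
      intro h
      have h3 : s • d = 0 := by simpa using h
      have := norm_eq_zero.2 h3
      rw [norm_smul, hd, Real.norm_of_nonneg hs.le] at this
      linarith
    refine tendsto_nhds_unique (htend ν _ hne') (tendsto_const_nhds.congr' ?_)
    obtain ⟨M, hM⟩ := exists_nat_gt (1 / s)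
    rw [div_lt_iff₀ hs] at hM
    filter_upwards [eventually_ge_atTop M] with n hn
    have hn' : (M : ℝ) ≤ n := by exact_mod_cast hn
    have h3 := hc (((n : ℝ) + 1) * s) (by nlinarith)
    have h4 : Tendsto (fun x : Plane => ((n : ℝ) + 1) • (x - V)) (𝓝 (V + s • d))
        (𝓝 ((((n : ℝ) + 1) * s) • d)) := by
      have : Continuous fun x : Plane => ((n : ℝ) + 1) • (x - V) := by fun_prop
      have h5 := this.tendsto (V + s • d)
      rwa [add_sub_cancel_left, smul_smul] at h5
    have h6 : ψ n =ᶠ[𝓝 (V + s • d)] c • F := by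
      filter_upwards [h4.eventually h3] with y hy
      simp only [hψ, hχn, Pi.mul_apply, Pi.smul_apply, smul_eq_mul, hy]
    rw [(multiD_congr h6 ν).self_of_nhds, multiD_smul ν hF]
    rfl
  rw [hcase d₁ 1 h₁ hχ₁, hcase d₂ 0 h₂ hχ₂, hDF]
  constructor <;> ring

end VEM

namespace VEM

open MeasureTheory Set Filter Topology TopologicalSpace
open scoped ContDiff Distributions

variable {N : ℕ} {P : Polygon Plane N} {K : Opens Plane}

/-! ### Jets in adapted coordinates -/

lemma lin_single (k : Fin 2) : lin (EuclideanSpace.single k 1) = MvPolynomial.X k := by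
  fin_cases k <;> simp [lin]

lemma lin_add_smul (s t : ℝ) (u w : Plane) :
    lin (s • u + t • w) = MvPolynomial.C s * lin u + MvPolynomial.C t * lin w := by
  simp only [lin, PiLp.add_apply, PiLp.smul_apply, smul_eq_mul, map_add, map_mul]
  ring

/-- A jet is determined by its derivatives in two independent directions. -/
lemma jet_eq_zero {h : ℕ × ℕ → ℝ} {u w : Plane} (huw : cross u w ≠ 0) {p : ℕ}
    (hz : ∀ k j, k + j < p → pair h (lin u ^ k * lin w ^ j) = 0) {ν : ℕ × ℕ}
    (hν : ν.1 + ν.2 < p) : h ν = 0 := by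
  -- Each variable is a linear combination of the symbols of `u` and `w`, so a coordinate derivative
  -- can be traded for directional ones of the same total order.
  have hstep : ∀ (σ : MvPolynomial (Fin 2) ℝ) (m : ℕ) (e : Fin 2),
      (∀ k j, m + (k + j) < p → pair h (σ * (lin u ^ k * lin w ^ j)) = 0) →
      ∀ k j, m + 1 + (k + j) < p → pair h (MvPolynomial.X e * σ * (lin u ^ k * lin w ^ j)) = 0 := by
    intro σ m e hσ k j hkj
    have h1 := hσ (k + 1) j (by omega)
    have h2 := hσ k (j + 1) (by omega)
    obtain ⟨α, β, hαβ⟩ : ∃ α β : ℝ, MvPolynomial.X e =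
        MvPolynomial.C α * lin u + MvPolynomial.C β * lin w := by
      refine ⟨cross (EuclideanSpace.single e 1) w / cross u w,
        cross u (EuclideanSpace.single e 1) / cross u w, ?_⟩
      rw [← lin_add_smul, ← eq_of_cross_ne_zero huw, lin_single]
    have h3 : MvPolynomial.X e * σ * (lin u ^ k * lin w ^ j) =
        α • (σ * (lin u ^ (k + 1) * lin w ^ j)) + β • (σ * (lin u ^ k * lin w ^ (j + 1))) := by
      rw [hαβ, MvPolynomial.smul_eq_C_mul, MvPolynomial.smul_eq_C_mul]
      ring
    rw [h3, map_add, map_smul, map_smul, h1, h2, smul_zero, smul_zero, add_zero]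
  have hb : ∀ b k j, b + (k + j) < p →
      pair h (MvPolynomial.X 1 ^ b * (lin u ^ k * lin w ^ j)) = 0 := by
    intro b
    induction b with
    | zero => intro k j hkj; simpa using hz k j (by omega)
    | succ b ih => rw [pow_succ']; exact hstep _ b 1 ih
  have ha : ∀ b a k j, a + b + (k + j) < p →
      pair h (MvPolynomial.X 0 ^ a * MvPolynomial.X 1 ^ b * (lin u ^ k * lin w ^ j)) = 0 := by
    intro b a
    induction a with
    | zero => intro k j hkj; simpa using hb b k j (by omega)
    | succ a ih =>
      rw [pow_succ', mul_assoc (MvPolynomial.X 0)]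
      intro k j hkj
      exact hstep _ (a + b) 0 ih k j (by omega)
  have h1 := ha ν.2 ν.1 0 0 (by omega)
  have h2 := pair_X_pow_mul h ν.1 ν.2 1
  rw [map_one, one_mul, one_mul] at h2
  rw [pow_zero, pow_zero, mul_one, mul_one, h2] at h1
  exact h1

lemma jet_eq {g g' : ℕ × ℕ → ℝ} {u w : Plane} (huw : cross u w ≠ 0) {p : ℕ}
    (hz : ∀ k j, k + j < p → pair g (lin u ^ k * lin w ^ j) = pair g' (lin u ^ k * lin w ^ j))
    {ν : ℕ × ℕ} (hν : ν.1 + ν.2 < p) : g ν = g' ν := by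
  refine sub_eq_zero.1 (jet_eq_zero (h := g - g') huw (fun k j hkj => ?_) hν)
  rw [pair_sub_jet, hz k j hkj, sub_self]

/-! ### Polynomials with prescribed normal derivatives on an edge -/

lemma edgeLength_eq (P : Polygon Plane N) (i : Fin N) : edgeLength P i = ‖edgeVec P i‖ := by
  rw [edgeLength, edgeVec, dist_eq_norm, norm_sub_rev]

lemma edgeNormal_eq (P : Polygon Plane N) (i : Fin N) :
    edgeNormal P i = ‖edgeVec P i‖⁻¹ • rot (edgeVec P i) := by
  rw [edgeNormal, edgeLength_eq]
  simp [rot, edgeVec]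

lemma inner_plane (u w : Plane) : inner ℝ u w = u 0 * w 0 + u 1 * w 1 := by
  simp [PiLp.inner_apply, mul_comm]

lemma inner_edgeNormal (P : Polygon Plane N) (i : Fin N) :
    inner ℝ (edgeVec P i) (edgeNormal P i) = 0 := by
  rw [edgeNormal_eq, inner_smul_right, inner_plane]
  simp [rot]
  right
  ring

lemma inner_edgeNormal_self (hP : IsSimplePolygon P) (i : Fin N) :
    inner ℝ (edgeNormal P i) (edgeNormal P i) = 1 := by
  have h0 := norm_ne_zero_iff.2 (edgeVec_ne_zero hP i)
  have h1 : inner ℝ (rot (edgeVec P i)) (rot (edgeVec P i)) = ‖edgeVec P i‖ ^ 2 := by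
    rw [normSq_eq, inner_plane]
    simp [rot]
    ring
  rw [edgeNormal_eq, inner_smul_left, inner_smul_right, h1]
  simp only [conj_trivial]
  field_simp

lemma cross_edge_ne_zero (hP : IsSimplePolygon P) (i : Fin N) :
    cross (edgeVec P i) (edgeNormal P i) ≠ 0 := by
  have h0 := norm_ne_zero_iff.2 (edgeVec_ne_zero hP i)
  rw [cross_swap, edgeNormal_eq, cross_smul_left, cross_rot]
  exact neg_ne_zero.2 (mul_ne_zero (inv_ne_zero h0) (pow_ne_zero 2 h0))

/-- The function `q(t) y^m / m!` in the coordinates `t` along and `y` normal to the edge. -/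
noncomputable def edgeTerm (P : Polygon Plane N) (i : Fin N) (q : Polynomial ℝ) (m : ℕ)
    (x : Plane) : ℝ :=
  q.eval (inner ℝ (x - P i) (edgeVec P i) / ‖edgeVec P i‖ ^ 2) *
    (inner ℝ (x - P i) (edgeNormal P i) ^ m / m.factorial)

lemma contDiff_edgeTerm (P : Polygon Plane N) (i : Fin N) (q : Polynomial ℝ) (m : ℕ) :
    ContDiff ℝ ∞ (edgeTerm P i q m) := by
  have h1 : ContDiff ℝ ∞ fun x : Plane => inner ℝ (x - P i) (edgeVec P i) / ‖edgeVec P i‖ ^ 2 :=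
    ((contDiff_id.sub contDiff_const).inner ℝ contDiff_const).div_const _
  have h2 : ContDiff ℝ ∞ fun x : Plane => inner ℝ (x - P i) (edgeNormal P i) ^ m / m.factorial :=
    (((contDiff_id.sub contDiff_const).inner ℝ contDiff_const).pow m).div_const _
  exact ((Polynomial.contDiff_aeval q ∞).comp h1).mul h2

/-- Differentiation along the edge acts on `q` and normal differentiation lowers `m`; the factor `1
/ m!` removes the coefficient of the lowered power. -/
lemma dirD_edgeTerm (P : Polygon Plane N) (i : Fin N) (q : Polynomial ℝ) (m : ℕ) (u x : Plane) :
    dirD u (edgeTerm P i q m) x =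
      inner ℝ u (edgeVec P i) / ‖edgeVec P i‖ ^ 2 * edgeTerm P i q.derivative m x +
      inner ℝ u (edgeNormal P i) *
        (if m = 0 then 0 else edgeTerm P i q (m - 1) x) := by
  set a := edgeVec P i
  set n := edgeNormal P i
  have h := hasDerivAt_line (contDiff_edgeTerm P i q m) x u 0
  rw [zero_smul, add_zero] at h
  refine h.unique ?_
  have e1 : HasDerivAt (fun s : ℝ => inner ℝ (x + s • u - P i) a / ‖a‖ ^ 2)
      (inner ℝ u a / ‖a‖ ^ 2) 0 := by
    have : (fun s : ℝ => inner ℝ (x + s • u - P i) a / ‖a‖ ^ 2) =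
        fun s : ℝ => (inner ℝ (x - P i) a + s * inner ℝ u a) / ‖a‖ ^ 2 := by
      funext s
      rw [add_sub_right_comm, inner_add_left, inner_smul_left]
      rfl
    rw [this]
    simpa using (((hasDerivAt_id (0 : ℝ)).mul_const (inner ℝ u a)).const_add
      (inner ℝ (x - P i) a)).div_const (‖a‖ ^ 2)
  have e2 : HasDerivAt (fun s : ℝ => inner ℝ (x + s • u - P i) n) (inner ℝ u n) 0 := by
    have : (fun s : ℝ => inner ℝ (x + s • u - P i) n) =
        fun s : ℝ => inner ℝ (x - P i) n + s * inner ℝ u n := by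
      funext s
      rw [add_sub_right_comm, inner_add_left, inner_smul_left]
      rfl
    rw [this]
    simpa using ((hasDerivAt_id (0 : ℝ)).mul_const (inner ℝ u n)).const_add (inner ℝ (x - P i) n)
  have e3 := ((q.hasDerivAt _).comp (0 : ℝ) e1).mul ((e2.pow m).div_const (m.factorial : ℝ))
  refine HasDerivAt.congr_deriv (f := fun s : ℝ => edgeTerm P i q m (x + s • u)) e3 ?_
  simp only [Function.comp_apply, zero_smul, add_zero, edgeTerm, Pi.pow_apply]
  rcases m with _ | m
  · simp
    ring
  · simp only [Nat.succ_ne_zero, if_false, Nat.add_sub_cancel, Nat.factorial_succ]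
    push_cast
    simp only [a, n]
    field_simp

/-- The polynomial function with normal derivatives `Q j`, `j < p`, on the edge. -/
noncomputable def edgeFun (P : Polygon Plane N) (i : Fin N) (p : ℕ) (Q : ℕ → Polynomial ℝ) :
    Plane → ℝ := ∑ m ∈ Finset.range p, edgeTerm P i (Q m) m

lemma contDiff_edgeFun (P : Polygon Plane N) (i : Fin N) (p : ℕ) (Q : ℕ → Polynomial ℝ) :
    ContDiff ℝ ∞ (edgeFun P i p Q) :=
  contDiff_finset_sum fun _ _ => contDiff_edgeTerm P i _ _

lemma dirD_edgeFun (P : Polygon Plane N) (i : Fin N) (p : ℕ) (Q : ℕ → Polynomial ℝ) (u x : Plane) :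
    dirD u (edgeFun P i p Q) x = ∑ m ∈ Finset.range p, dirD u (edgeTerm P i (Q m) m) x := by
  simp only [dirD_eq, edgeFun]
  rw [partialD_sum _ _ fun _ _ => contDiff_edgeTerm P i _ _,
    partialD_sum _ _ fun _ _ => contDiff_edgeTerm P i _ _, Finset.sum_apply, Finset.sum_apply,
    Finset.mul_sum, Finset.mul_sum, Finset.sum_add_distrib]

lemma dirD_edgeVec_edgeFun (hP : IsSimplePolygon P) (i : Fin N) (p : ℕ) (Q : ℕ → Polynomial ℝ) :
    dirD (edgeVec P i) (edgeFun P i p Q) = edgeFun P i p fun m => (Q m).derivative := by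
  funext x
  have h0 := norm_ne_zero_iff.2 (edgeVec_ne_zero hP i)
  rw [dirD_edgeFun, edgeFun, Finset.sum_apply]
  refine Finset.sum_congr rfl fun m _ => ?_
  rw [dirD_edgeTerm, inner_edgeNormal, real_inner_self_eq_norm_sq, div_self (pow_ne_zero 2 h0)]
  ring

lemma dirD_edgeNormal_edgeFun (hP : IsSimplePolygon P) (i : Fin N) (p : ℕ)
    (Q : ℕ → Polynomial ℝ) :
    dirD (edgeNormal P i) (edgeFun P i p Q) = edgeFun P i (p - 1) fun m => Q (m + 1) := by
  funext x
  have h1 : ∀ m, dirD (edgeNormal P i) (edgeTerm P i (Q m) m) x =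
      if m = 0 then 0 else edgeTerm P i (Q m) (m - 1) x := by
    intro m
    rw [dirD_edgeTerm, inner_edgeNormal_self hP, real_inner_comm, inner_edgeNormal]
    ring
  rw [dirD_edgeFun, edgeFun, Finset.sum_apply]
  simp only [h1]
  rcases p with _ | p
  · simp
  · rw [Finset.sum_range_succ']
    simp

lemma edgeFun_edgePath (hP : IsSimplePolygon P) (i : Fin N) {p : ℕ} (hp : 0 < p)
    (Q : ℕ → Polynomial ℝ) (t : ℝ) : edgeFun P i p Q (P.edgePath ℝ i t) = (Q 0).eval t := by
  have h0 := norm_ne_zero_iff.2 (edgeVec_ne_zero hP i)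
  rw [edgeFun, Finset.sum_apply, Finset.sum_eq_single 0]
  · rw [edgeTerm, edgePath_eq, add_sub_cancel_left, inner_smul_left, real_inner_self_eq_norm_sq]
    simp [h0]
  · intro m _ hm
    rw [edgeTerm, edgePath_eq, add_sub_cancel_left, inner_smul_left (x := edgeVec P i)
      (y := edgeNormal P i), inner_edgeNormal]
    simp [hm]
  · intro h
    exact absurd (Finset.mem_range.2 hp) h

/-- Normal derivatives shift the family `Q`, tangential ones differentiate its members, and on the
edge only the term of index zero survives. -/
lemma pair_edgeFun (hP : IsSimplePolygon P) (i : Fin N) {p : ℕ} (Q : ℕ → Polynomial ℝ) {k j : ℕ}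
    (hj : j < p) (t : ℝ) :
    pair (fun ν => multiD ν (edgeFun P i p Q) (P.edgePath ℝ i t))
      (lin (edgeVec P i) ^ k * lin (edgeNormal P i) ^ j) =
      (Polynomial.derivative^[k] (Q j)).eval t := by
  have h1 : ∀ j, (dirD (edgeNormal P i))^[j] (edgeFun P i p Q) =
      edgeFun P i (p - j) fun m => Q (m + j) := by
    intro j
    induction j with
    | zero => rfl
    | succ j ih =>
      rw [Function.iterate_succ_apply', ih, dirD_edgeNormal_edgeFun hP, Nat.sub_sub]
      simp only [add_assoc, add_comm 1 j]
  have h2 : ∀ k (p : ℕ) (Q : ℕ → Polynomial ℝ), (dirD (edgeVec P i))^[k] (edgeFun P i p Q) =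
      edgeFun P i p fun m => Polynomial.derivative^[k] (Q m) := by
    intro k
    induction k with
    | zero => intros; rfl
    | succ k ih =>
      intro p Q
      rw [Function.iterate_succ_apply', ih, dirD_edgeVec_edgeFun hP]
      simp only [Function.iterate_succ_apply']
  have h3 := congrFun (symb_lin_pow (contDiff_edgeFun P i p Q) (edgeVec P i) (edgeNormal P i) k j)
    (P.edgePath ℝ i t)
  rw [h1, h2, edgeFun_edgePath hP i (by omega), zero_add] at h3
  exact h3

end VEM

/-! ### Lifting of compatible edge data into the element. -/

namespace VEM

open MeasureTheory Set Filter Topology TopologicalSpace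
open scoped ContDiff Distributions

variable {N : ℕ} {P : Polygon Plane N} {K : Opens Plane}

lemma jetMul_congr {a b b' : ℕ × ℕ → ℝ} {ν : ℕ × ℕ} {p : ℕ} (hν : ν.1 + ν.2 < p)
    (h : ∀ κ : ℕ × ℕ, κ.1 + κ.2 < p → b κ = b' κ) : jetMul a b ν = jetMul a b' ν := by
  refine Finset.sum_congr rfl fun κ hκ => Finset.sum_congr rfl fun l hl => ?_
  have h1 := Finset.HasAntidiagonal.mem_antidiagonal.1 hκ
  have h2 := Finset.HasAntidiagonal.mem_antidiagonal.1 hl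
  rw [h (κ.2, l.2) (show κ.2 + l.2 < p by omega)]

lemma jetMul_zero_left (b : ℕ × ℕ → ℝ) (ν : ℕ × ℕ) : jetMul (fun _ => 0) b ν = 0 := by
  simp [jetMul]

/-- Only two edges meet in a vertex. -/
lemma eq_or_eq_of_vertex_mem_edgeSet (hP : IsSimplePolygon P) {j k : Fin N}
    (h : P (finRotate N j) ∈ P.edgeSet ℝ k) : k = j ∨ k = finRotate N j := by
  by_contra! hne
  rcases hP.2 (finRotate N j) k hne.2.symm _ ⟨left_mem_edgeSet _, h⟩ with ⟨h1, h2⟩ | ⟨h1, -⟩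
  · rw [h1] at h2
    exact hP.1 (finRotate N j) h2
  · exact hne.1 ((finRotate N).injective h1).symm

/-- Smooth functions on the edges with matching jets at the vertices are joined near a point. -/
lemma exists_local_lift (hP : IsSimplePolygon P) {p : ℕ} {G : Fin N → Plane → ℝ}
    (hG : ∀ i, ContDiff ℝ ∞ (G i))
    (hc : ∀ i, ∀ ν : ℕ × ℕ, ν.1 + ν.2 < p →
      multiD ν (G (finRotate N i)) (P (finRotate N i)) = multiD ν (G i) (P (finRotate N i)))
    (x : Plane) :
    ∃ φ g, JetLim p φ g ∧ ∀ i, x ∈ P.edgeSet ℝ i → ∀ t ∈ Icc (0 : ℝ) 1,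
      ∀ ν : ℕ × ℕ, ν.1 + ν.2 < p →
        g ν (P.edgePath ℝ i t) = multiD ν (G i) (P.edgePath ℝ i t) := by
  by_cases hv : ∃ j, x = P (finRotate N j)
  · obtain ⟨j, rfl⟩ := hv
    have ha := norm_ne_zero_iff.2 (edgeVec_ne_zero hP j)
    have hb := norm_ne_zero_iff.2 (edgeVec_ne_zero hP (finRotate N j))
    -- The directions `d₁` and `d₂` both issue from the vertex, the first along the next edge and
    -- the second backwards along edge `j`.
    obtain ⟨φ, g, hφ, hg⟩ := exists_join (hG (finRotate N j)) (hG j) (hc j)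
      (d₁ := ‖edgeVec P (finRotate N j)‖⁻¹ • edgeVec P (finRotate N j))
      (d₂ := ‖edgeVec P j‖⁻¹ • -edgeVec P j)
      (by rw [norm_smul, norm_inv, norm_norm, inv_mul_cancel₀ hb])
      (by rw [norm_smul, norm_inv, norm_norm, norm_neg, inv_mul_cancel₀ ha]) (by
        intro h
        refine edgeVec_not_same_ray hP j
          (c := ‖edgeVec P j‖ * ‖edgeVec P (finRotate N j)‖⁻¹) (by positivity) ?_
        rw [mul_smul, h, smul_smul, mul_inv_cancel₀ ha, one_smul])
    refine ⟨φ, g, hφ, fun i hi t ht ν hν => ?_⟩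
    rcases eq_or_eq_of_vertex_mem_edgeSet hP hi with rfl | rfl
    · have h1 := (hg ν hν ((1 - t) * ‖edgeVec P i‖)
        (mul_nonneg (sub_nonneg.2 ht.2) (norm_nonneg _))).2
      have h2 : P (finRotate N i) + ((1 - t) * ‖edgeVec P i‖) • ‖edgeVec P i‖⁻¹ • -edgeVec P i =
          P.edgePath ℝ i t := by
        rw [smul_smul, mul_assoc, mul_inv_cancel₀ ha, mul_one, edgePath_eq, edgeVec]
        module
      rwa [h2] at h1
    · have h1 := (hg ν hν (t * ‖edgeVec P (finRotate N j)‖)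
        (mul_nonneg ht.1 (norm_nonneg _))).1
      rwa [smul_smul, mul_assoc, mul_inv_cancel₀ hb, mul_one, ← edgePath_eq] at h1
  · by_cases hx : ∃ j, x ∈ P.edgeSet ℝ j
    · obtain ⟨j, hj⟩ := hx
      refine ⟨_, _, JetLim.const p (hG j), fun i hi t _ ν _ => ?_⟩
      obtain ⟨s, hs, rfl⟩ := mem_edgeSet.1 hj
      have h0 : s ≠ 0 := by
        rintro rfl
        exact hv ⟨(finRotate N).symm j, by rw [Equiv.apply_symm_apply, edgePath_zero]⟩
      have h1 : s ≠ 1 := by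
        rintro rfl
        exact hv ⟨j, edgePath_one P j⟩
      have hij : i = j := by
        by_contra hne
        exact edgePath_notMem_edgeSet hP hne ⟨lt_of_le_of_ne hs.1 h0.symm, lt_of_le_of_ne hs.2 h1⟩ hi
      rw [hij]
    · exact ⟨_, _, JetLim.const p (contDiff_const (c := (0 : ℝ))), fun i hi => absurd ⟨i, hi⟩ hx⟩

/-- Smooth functions on the edges with matching jets at the vertices extend to the element. -/
lemma exists_lift (hK : IsElement P K) {p : ℕ} {G : Fin N → Plane → ℝ}
    (hG : ∀ i, ContDiff ℝ ∞ (G i))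
    (hc : ∀ i, ∀ ν : ℕ × ℕ, ν.1 + ν.2 < p →
      multiD ν (G (finRotate N i)) (P (finRotate N i)) = multiD ν (G i) (P (finRotate N i))) :
    ∃ (V : ℕ × ℕ → L2 K) (g : ℕ × ℕ → Plane → ℝ),
      (∀ ν : ℕ × ℕ, ν.1 + ν.2 ≤ p → HasWeakDeriv K ν (V 0) (V ν)) ∧ IsTraceJet P K p (V 0) g ∧
      ∀ i, ∀ t ∈ Icc (0 : ℝ) 1, ∀ ν : ℕ × ℕ, ν.1 + ν.2 < p →
        g ν (P.edgePath ℝ i t) = multiD ν (G i) (P.edgePath ℝ i t) := by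
  choose φ g hφ hg using exists_local_lift hK.simple hG hc
  -- A neighbourhood of `x` that meets only edges through `x`, which are those on which the local
  -- lift is correct.
  set U : Plane → Set Plane := fun x => {y | ∀ i ∈ {i | x ∉ P.edgeSet ℝ i}, y ∉ P.edgeSet ℝ i}
  obtain ⟨s, θ, -, hθ, -, hθU, hθ1⟩ := exists_smooth_partition
    hK.bounded.isCompact_closure (U := U) fun x _ => eventually_notMem_edgeSet fun i hi => hi
  have hlim := JetLim.sum (p := p) (s := Finset.univ) (φ := fun x : s => fun n => θ x * φ x n)
    fun x _ => (hφ x).mul (hθ x)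
  obtain ⟨V, hV, hVt⟩ := hlim.exists_jet (P := P) hK.bounded
  refine ⟨V, _, hV, hVt, fun i t ht ν hν => ?_⟩
  have hy : P.edgePath ℝ i t ∈ closure (K : Set Plane) := by
    refine frontier_subset_closure ?_
    rw [hK.frontier_eq]
    exact edgePath_mem_boundary ht
  -- The right side is split by the same partition of unity. Each summand then agrees either because
  -- the local lift is correct there or because the jet of `θ x` vanishes.
  rw [← sum_jetMul_of_sum_eq_one hθ (hθ1 _ hy) (fun κ => multiD κ (G i) (P.edgePath ℝ i t)) ν]
  refine Finset.sum_congr rfl fun x _ => ?_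
  by_cases hx : P.edgePath ℝ i t ∈ tsupport (θ x)
  · refine jetMul_congr hν fun κ hκ => hg x i ?_ t ht κ hκ
    by_contra h
    exact hθU x hx i h (edgePath_mem_edgeSet ht)
  · have h0 : (fun κ => multiD κ (θ x) (P.edgePath ℝ i t)) = fun _ => 0 := by
      funext κ
      exact image_eq_zero_of_notMem_tsupport fun h => hx (tsupport_multiD_subset _ _ h)
    rw [h0, jetMul_zero_left, jetMul_zero_left]

/-- Compatible polynomial data on the boundary extend to the element. -/
lemma exists_polynomial_lift (hK : IsElement P K) {p : ℕ} {A : Fin N → ℕ × ℕ → ℝ}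
    {Q : Fin N → ℕ → Polynomial ℝ}
    (h0 : ∀ i k j, k + j < p → (Polynomial.derivative^[k] (Q i j)).eval 0 =
      pair (A i) (lin (edgeVec P i) ^ k * lin (edgeNormal P i) ^ j))
    (h1 : ∀ i k j, k + j < p → (Polynomial.derivative^[k] (Q i j)).eval 1 =
      pair (A (finRotate N i)) (lin (edgeVec P i) ^ k * lin (edgeNormal P i) ^ j)) :
    ∃ (V : ℕ × ℕ → L2 K) (g : ℕ × ℕ → Plane → ℝ),
      (∀ ν : ℕ × ℕ, ν.1 + ν.2 ≤ p → HasWeakDeriv K ν (V 0) (V ν)) ∧ IsTraceJet P K p (V 0) g ∧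
      (∀ i, ∀ ν : ℕ × ℕ, ν.1 + ν.2 < p → g ν (P i) = A i ν) ∧
      ∀ i, ∀ j < p, ∀ t ∈ Icc (0 : ℝ) 1, normalTrace P i j g t = (Q i j).eval t := by
  have hP := hK.simple
  -- The tangential and normal derivatives at an endpoint determine the full jet there, so adjacent
  -- edge functions have the same jet `A` at their common vertex.
  have hl : ∀ i, ∀ ν : ℕ × ℕ, ν.1 + ν.2 < p → multiD ν (edgeFun P i p (Q i)) (P i) = A i ν := by
    intro i ν hν
    refine jet_eq (g := fun ν => multiD ν (edgeFun P i p (Q i)) (P i))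
      (cross_edge_ne_zero hP i) (fun k j hkj => ?_) hν
    rw [← h0 i k j hkj, ← pair_edgeFun hP i (Q i) (show j < p by omega), edgePath_zero]
  have hr : ∀ i, ∀ ν : ℕ × ℕ, ν.1 + ν.2 < p →
      multiD ν (edgeFun P i p (Q i)) (P (finRotate N i)) = A (finRotate N i) ν := by
    intro i ν hν
    refine jet_eq (g := fun ν => multiD ν (edgeFun P i p (Q i)) (P (finRotate N i)))
      (cross_edge_ne_zero hP i) (fun k j hkj => ?_) hν
    rw [← h1 i k j hkj, ← pair_edgeFun hP i (Q i) (show j < p by omega), edgePath_one]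
  obtain ⟨V, g, hV, hg, he⟩ := exists_lift hK (p := p) (G := fun i => edgeFun P i p (Q i))
    (fun i => contDiff_edgeFun P i p (Q i))
    fun i ν hν => (hl _ ν hν).trans (hr i ν hν).symm
  refine ⟨V, g, hV, hg, fun i ν hν => ?_, fun i j hj t ht => ?_⟩
  · rw [← hl i ν hν, ← edgePath_zero P i, he i 0 ⟨le_rfl, zero_le_one⟩ ν hν]
  · have h2 : normalTrace P i j g t =
        normalTrace P i j (fun ν => multiD ν (edgeFun P i p (Q i))) t := by
      refine Finset.sum_congr rfl fun a ha => ?_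
      have := Finset.mem_range.1 ha
      rw [he i t ht (a, j - a) (show a + (j - a) < p by omega)]
    have h3 := pair_edgeFun hP i (Q i) (k := 0) hj t
    rw [pow_zero, one_mul] at h3
    rw [h2, normalTrace_eq_pair]
    exact h3

end VEM

/-! ### Mixed tangential and normal derivatives of a trace jet. -/

namespace VEM

open MeasureTheory Set Filter Topology TopologicalSpace
open scoped ContDiff Distributions

variable {N : ℕ} {P : Polygon Plane N} {K : Opens Plane}

/-- `w` and its gradient have the traces given by the jet `g` and the symbol `σ`. -/
def SymbolTrace (P : Polygon Plane N) (K : Opens Plane) (g : ℕ × ℕ → Plane → ℝ)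
    (σ : MvPolynomial (Fin 2) ℝ) : Prop :=
  ∃ w w₁ w₂ : L2 K, HasTrace P K w (fun x => pair (fun ν => g ν x) σ) ∧
    HasTrace P K w₁ (fun x => pair (fun ν => g ν x) (MvPolynomial.X 0 * σ)) ∧
    HasTrace P K w₂ (fun x => pair (fun ν => g ν x) (MvPolynomial.X 1 * σ)) ∧
    HasWeakDeriv K (1, 0) w w₁ ∧ HasWeakDeriv K (0, 1) w w₂

lemma SymbolTrace.add {g : ℕ × ℕ → Plane → ℝ} {σ τ : MvPolynomial (Fin 2) ℝ}
    (h : SymbolTrace P K g σ) (h' : SymbolTrace P K g τ) : SymbolTrace P K g (σ + τ) := by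
  obtain ⟨w, w₁, w₂, h0, h1, h2, d1, d2⟩ := h
  obtain ⟨w', w₁', w₂', h0', h1', h2', d1', d2'⟩ := h'
  refine ⟨w + w', w₁ + w₁', w₂ + w₂', ?_, ?_, ?_, d1.add d1', d2.add d2'⟩
  · simp only [map_add]
    exact h0.add h0'
  · simp only [map_add, mul_add]
    exact h1.add h1'
  · simp only [map_add, mul_add]
    exact h2.add h2'

lemma symbolTrace_zero (g : ℕ × ℕ → Plane → ℝ) : SymbolTrace P K g 0 := by
  refine ⟨0, 0, 0, ?_, ?_, ?_, hasWeakDeriv_zero K _, hasWeakDeriv_zero K _⟩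
  all_goals
    simp only [mul_zero, map_zero]
    exact hasTrace_zero P K

lemma IsTraceJet.symbolTrace_monomial {p : ℕ} {v : L2 K} {g : ℕ × ℕ → Plane → ℝ}
    (h : IsTraceJet P K p v g) {s : Fin 2 →₀ ℕ} (hs : s 0 + s 1 + 1 < p) (c : ℝ) :
    SymbolTrace P K g (MvPolynomial.monomial s c) := by
  obtain ⟨-, w, hw, ht⟩ := h (s 0, s 1) (show s 0 + s 1 < p by omega)
  obtain ⟨-, w₁, hw₁, ht₁⟩ := h ((s 0, s 1) + (1, 0)) (show s 0 + 1 + (s 1 + 0) < p by omega)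
  obtain ⟨-, w₂, hw₂, ht₂⟩ := h ((s 0, s 1) + (0, 1)) (show s 0 + 0 + (s 1 + 1) < p by omega)
  refine ⟨c • w, c • w₁, c • w₂, ?_, ?_, ?_, (hw.sub_index hw₁).smul c, (hw.sub_index hw₂).smul c⟩
  · simp only [pair_monomial]
    exact ht.smul c
  · simp only [pair_X_mul, pair_monomial]
    exact ht₁.smul c
  · simp only [pair_X_mul, pair_monomial]
    exact ht₂.smul c

lemma index_sum_of_isHomogeneous {σ : MvPolynomial (Fin 2) ℝ} {m : ℕ} (hσ : σ.IsHomogeneous m)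
    {s : Fin 2 →₀ ℕ} (hs : s ∈ σ.support) : s 0 + s 1 = m := by
  have h := hσ (MvPolynomial.mem_support_iff.1 hs)
  rw [← h]
  simp [Finsupp.weight_apply, Finsupp.sum_fintype]

lemma IsTraceJet.symbolTrace {p m : ℕ} {v : L2 K} {g : ℕ × ℕ → Plane → ℝ}
    (h : IsTraceJet P K p v g) {σ : MvPolynomial (Fin 2) ℝ} (hσ : σ.IsHomogeneous m)
    (hm : m + 1 < p) : SymbolTrace P K g σ := by
  rw [σ.as_sum]
  refine Finset.sum_induction _ _ (fun _ _ => SymbolTrace.add) (symbolTrace_zero g) fun s hs => ?_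
  exact h.symbolTrace_monomial (by rw [index_sum_of_isHomogeneous hσ hs]; exact hm) _

lemma IsTraceJet.continuousOn_pair {p m : ℕ} {v : L2 K} {g : ℕ × ℕ → Plane → ℝ}
    (h : IsTraceJet P K p v g) {σ : MvPolynomial (Fin 2) ℝ} (hσ : σ.IsHomogeneous m)
    (hm : m < p) : ContinuousOn (fun x => pair (fun ν => g ν x) σ) (P.boundary ℝ) := by
  simp only [pair_eq_sum]
  refine continuousOn_finsetSum _ fun s hs => continuousOn_const.mul (h _ ?_).1
  exact (index_sum_of_isHomogeneous hσ hs).trans_lt hm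

lemma isHomogeneous_lin (u : Plane) : (lin u).IsHomogeneous 1 := by
  have h : ∀ (c : ℝ) (k : Fin 2),
      (MvPolynomial.C c * MvPolynomial.X k : MvPolynomial (Fin 2) ℝ).IsHomogeneous 1 := fun c k => by
    simpa using (MvPolynomial.isHomogeneous_C (Fin 2) c).mul (MvPolynomial.isHomogeneous_X ℝ k)
  exact (h _ _).add (h _ _)

lemma isHomogeneous_lin_pow_mul (u w : Plane) (k j : ℕ) :
    (lin u ^ k * lin w ^ j).IsHomogeneous (k + j) := by
  simpa using ((isHomogeneous_lin u).pow k).mul ((isHomogeneous_lin w).pow j)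

/-- Tangential derivatives of polynomial normal traces. -/
lemma IsTraceJet.pair_eq (hK : IsElement P K) {p : ℕ} {v : L2 K} {g : ℕ × ℕ → Plane → ℝ}
    (h : IsTraceJet P K p v g) (i : Fin N) {j : ℕ} {q : Polynomial ℝ}
    (hq : ∀ t ∈ Icc (0 : ℝ) 1, normalTrace P i j g t = q.eval t) (k : ℕ) (hkj : k + j < p) :
    ∀ t ∈ Icc (0 : ℝ) 1, pair (fun ν => g ν (P.edgePath ℝ i t))
      (lin (edgeVec P i) ^ k * lin (edgeNormal P i) ^ j) =
        (Polynomial.derivative^[k] q).eval t := by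
  induction k with
  | zero =>
    intro t ht
    rw [pow_zero, one_mul, ← normalTrace_eq_pair]
    exact hq t ht
  | succ k ih =>
    have hσ := isHomogeneous_lin_pow_mul (edgeVec P i) (edgeNormal P i) k j
    obtain ⟨w, w₁, w₂, h0, h1, h2, d1, d2⟩ := h.symbolTrace hσ (by omega)
    have hX : ∀ e : Fin 2, (MvPolynomial.X e *
        (lin (edgeVec P i) ^ k * lin (edgeNormal P i) ^ j)).IsHomogeneous (1 + (k + j)) :=
      fun e => (MvPolynomial.isHomogeneous_X ℝ e).mul hσ
    -- The trace of order `k + j` is already a polynomial on the edge, so one more tangential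
    -- derivative can be read off from it.
    have h3 := trace_tangential hK i h0 h1 h2 d1 d2 (h.continuousOn_pair (hX 0) (by omega))
      (h.continuousOn_pair (hX 1) (by omega)) (ih (by omega))
    intro t ht
    rw [Function.iterate_succ_apply', ← h3 t ht, pow_succ', mul_assoc, pair_lin_mul, pair_X_mul,
      pair_X_mul]

end VEM

namespace VEM

open MeasureTheory Set Filter Topology TopologicalSpace
open scoped ContDiff Distributions

variable {N : ℕ} {P : Polygon Plane N} {K : Opens Plane}

/-! ### Boundary degrees of freedom -/

lemma pair_congr {a b : ℕ × ℕ → ℝ} {p m : ℕ} {σ : MvPolynomial (Fin 2) ℝ}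
    (hσ : σ.IsHomogeneous m) (hm : m < p) (h : ∀ ν : ℕ × ℕ, ν.1 + ν.2 < p → a ν = b ν) :
    pair a σ = pair b σ := by
  rw [pair_eq_sum, pair_eq_sum]
  refine Finset.sum_congr rfl fun s hs => ?_
  rw [h _ (show s 0 + s 1 < p by rw [index_sum_of_isHomogeneous hσ hs]; exact hm)]

lemma IsTraceJet.continuousOn_normalTrace {p : ℕ} {v : L2 K} {g : ℕ × ℕ → Plane → ℝ}
    (h : IsTraceJet P K p v g) (i : Fin N) {j : ℕ} (hj : j < p) :
    ContinuousOn (normalTrace P i j g) (Icc 0 1) := by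
  refine continuousOn_finsetSum _ fun a ha => continuousOn_const.mul (continuousOn_edge (h _ ?_).1 i)
  have := Finset.mem_range.1 ha
  show a + (j - a) < p
  omega

lemma IsTraceJet.intervalIntegrable {p : ℕ} {v : L2 K} {g : ℕ × ℕ → Plane → ℝ}
    (h : IsTraceJet P K p v g) (i : Fin N) {j : ℕ} (hj : j < p) (q : Polynomial ℝ) :
    IntervalIntegrable (fun t => q.eval t * normalTrace P i j g t) volume 0 1 := by
  refine ContinuousOn.intervalIntegrable ?_
  rw [uIcc_of_le zero_le_one]
  exact q.continuous.continuousOn.mul (h.continuousOn_normalTrace i hj)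

/-- A trace jet with polynomial normal traces and vanishing degrees of freedom vanishes. -/
lemma IsTraceJet.eq_zero_of_dofs (hK : IsElement P K) {p : ℕ} {d μ : ℕ → ℤ}
    (hd : ∀ j < p, (d j + 1).toNat = 2 * (p - j) + (μ j + 1).toNat) {v : L2 K}
    {g : ℕ × ℕ → Plane → ℝ} (h : IsTraceJet P K p v g)
    (he : ∀ i, ∀ j < p, IsEdgePoly (d j) (normalTrace P i j g))
    (hv : ∀ i, ∀ ν : ℕ × ℕ, ν.1 + ν.2 < p → g ν (P i) = 0)
    (hm : ∀ i, ∀ j < p, ∀ q ∈ edgePoly (μ j),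
      ∫ t in (0 : ℝ)..1, q.eval t * normalTrace P i j g t = 0)
    {ν : ℕ × ℕ} (hν : ν.1 + ν.2 < p) {x : Plane} (hx : x ∈ P.boundary ℝ) : g ν x = 0 := by
  have hz : ∀ i k j, k + j < p → ∀ t ∈ Icc (0 : ℝ) 1, pair (fun ν => g ν (P.edgePath ℝ i t))
      (lin (edgeVec P i) ^ k * lin (edgeNormal P i) ^ j) = 0 := by
    intro i k j hkj t ht
    obtain ⟨q, hq, hqe⟩ := he i j (by omega)
    have hpair : ∀ k, k + j < p → _ := fun k hkj => h.pair_eq hK i hqe k hkj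
    have hvert : ∀ (y : Plane) k, k + j < p → (∀ ν : ℕ × ℕ, ν.1 + ν.2 < p → g ν y = 0) →
        pair (fun ν => g ν y) (lin (edgeVec P i) ^ k * lin (edgeNormal P i) ^ j) = 0 := by
      intro y k hkj hy
      rw [pair_congr (b := fun _ => 0) (isHomogeneous_lin_pow_mul _ _ _ _) hkj hy, pair_eq_sum]
      simp
    -- The tangential derivatives of order below `p - j` at both ends are combinations of the
    -- vanishing vertex jets, and `hd` matches the degree of `q` with the count in
    -- `hermite_moment_unique`.
    have hq0 : q = 0 := by
      rw [edgePoly, hd j (by omega)] at hq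
      refine hermite_moment_unique hq (fun k hk => ?_) (fun k hk => ?_) fun w hw => ?_
      · rw [← hpair k (by omega) 0 ⟨le_rfl, zero_le_one⟩, edgePath_zero]
        exact hvert _ _ (by omega) (hv i)
      · rw [← hpair k (by omega) 1 ⟨zero_le_one, le_rfl⟩, edgePath_one]
        exact hvert _ _ (by omega) (hv _)
      · refine (intervalIntegral.integral_congr fun t ht => ?_).trans (hm i j (by omega) w hw)
        rw [uIcc_of_le (zero_le_one' ℝ)] at ht
        simp only [hqe t ht]
    rw [hpair k hkj t ht, hq0, Polynomial.iterate_derivative_zero, Polynomial.eval_zero]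
  obtain ⟨i, hi⟩ := mem_iUnion.1 hx
  obtain ⟨t, ht, rfl⟩ := mem_edgeSet.1 hi
  exact jet_eq_zero (h := fun ν => g ν (P.edgePath ℝ i t)) (cross_edge_ne_zero hK.simple i)
    (fun k j hkj => hz i k j hkj t ht) hν

/-- Every choice of the boundary degrees of freedom is attained. -/
lemma exists_boundary_dofs (hK : IsElement P K) {p : ℕ} {d μ : ℕ → ℤ}
    (hd : ∀ j < p, (d j + 1).toNat = 2 * (p - j) + (μ j + 1).toNat)
    (a : Fin N → ℕ × ℕ → ℝ) (m : Fin N → (j : Fin p) → Module.Dual ℝ (edgePoly (μ j))) :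
    ∃ (V : ℕ × ℕ → L2 K) (g : ℕ × ℕ → Plane → ℝ),
      (∀ ν : ℕ × ℕ, ν.1 + ν.2 ≤ p → HasWeakDeriv K ν (V 0) (V ν)) ∧ IsTraceJet P K p (V 0) g ∧
      (∀ i, ∀ j < p, IsEdgePoly (d j) (normalTrace P i j g)) ∧
      (∀ i, ∀ ν : ℕ × ℕ, ν.1 + ν.2 < p → g ν (P i) = a i ν) ∧
      ∀ i (j : Fin p) (q : edgePoly (μ j)),
        ∫ t in (0 : ℝ)..1, (q : Polynomial ℝ).eval t * normalTrace P i j g t = m i j q := by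
  -- The condition `j < p` stands inside the existential so that `choose` yields polynomials for
  -- every natural `j`.
  have hQ : ∀ i j, ∃ q : Polynomial ℝ, ∀ hj : j < p, q ∈ edgePoly (d j) ∧
      (∀ k < p - j, (Polynomial.derivative^[k] q).eval 0 =
        pair (a i) (lin (edgeVec P i) ^ k * lin (edgeNormal P i) ^ j)) ∧
      (∀ k < p - j, (Polynomial.derivative^[k] q).eval 1 =
        pair (a (finRotate N i)) (lin (edgeVec P i) ^ k * lin (edgeNormal P i) ^ j)) ∧
      ∀ w : edgePoly (μ j), ∫ t in (0 : ℝ)..1, (w : Polynomial ℝ).eval t * q.eval t =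
        m i ⟨j, hj⟩ w := by
    intro i j
    by_cases hj : j < p
    · obtain ⟨q, hq, h0, h1, h2⟩ := hermite_moment_exists (p - j) (μ j + 1).toNat
        (fun k => pair (a i) (lin (edgeVec P i) ^ k * lin (edgeNormal P i) ^ j))
        (fun k => pair (a (finRotate N i)) (lin (edgeVec P i) ^ k * lin (edgeNormal P i) ^ j))
        (m i ⟨j, hj⟩)
      refine ⟨q, fun _ => ⟨?_, h0, h1, h2⟩⟩
      rwa [edgePoly, hd j hj]
    · exact ⟨0, fun h => absurd h hj⟩
  choose Q hQ using hQ
  obtain ⟨V, g, hV, hg, hvert, hedge⟩ := exists_polynomial_lift hK (p := p) (A := a) (Q := Q)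
    (fun i k j hkj => (hQ i j (by omega)).2.1 k (by omega))
    fun i k j hkj => (hQ i j (by omega)).2.2.1 k (by omega)
  refine ⟨V, g, hV, hg, fun i j hj => ⟨Q i j, (hQ i j hj).1, hedge i j hj⟩, hvert,
    fun i j q => ?_⟩
  rw [← (hQ i j j.2).2.2.2 q]
  refine intervalIntegral.integral_congr fun t ht => ?_
  rw [uIcc_of_le zero_le_one] at ht
  simp only [hedge i j j.2 t ht]

/-! ### Bulk degrees of freedom -/

/-- The moments of functions in `L²(K)` against polynomials. -/
noncomputable def bulkMoment (hb : Bornology.IsBounded (K : Set Plane)) :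
    MvPolynomial (Fin 2) ℝ →ₗ[ℝ] L2 K →ₗ[ℝ] ℝ :=
  LinearMap.mk₂ ℝ (fun q v => inner ℝ ((memLp_poly hb q).toLp _) v)
    (fun q q' v => by
      rw [← inner_add_left, ← MemLp.toLp_add]
      congr 2
      funext x
      simp)
    (fun c q v => by
      rw [smul_eq_mul, ← real_inner_smul_left, ← MemLp.toLp_const_smul]
      congr 2
      funext x
      simp [MvPolynomial.smul_eval])
    (fun q v w => inner_add_right _ _ _)
    (fun c q v => real_inner_smul_right _ _ _)

lemma bulkMoment_apply (hb : Bornology.IsBounded (K : Set Plane)) (q : MvPolynomial (Fin 2) ℝ)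
    (v : L2 K) : bulkMoment hb q v =
      ∫ x in (K : Set Plane), MvPolynomial.eval (fun k => x k) q * v x := by
  rw [bulkMoment, LinearMap.mk₂_apply, inner_L2]
  refine integral_congr_ae ?_
  filter_upwards [(memLp_poly hb q).coeFn_toLp] with x hx
  rw [hx]

lemma bulkPoly_mono {m s : ℤ} (h : m ≤ s) : bulkPoly m ≤ bulkPoly s := by
  intro q hq
  rw [bulkPoly] at hq ⊢
  split_ifs at hq with h1
  · rw [(Submodule.mem_bot ℝ).1 hq]
    exact zero_mem _
  · rw [if_neg (by omega)]
    rw [MvPolynomial.mem_restrictTotalDegree] at hq ⊢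
    exact hq.trans (Int.toNat_le_toNat h)

instance (m : ℤ) : FiniteDimensional ℝ (bulkPoly m) := by
  by_cases h : m < 0
  · rw [bulkPoly, if_pos h]
    infer_instance
  · rw [bulkPoly, if_neg h]
    infer_instance

lemma polynomial_eq_zero_of_open {S : Set Plane} (hS : IsOpen S) (hne : S.Nonempty)
    {q : MvPolynomial (Fin 2) ℝ} (h : ∀ x ∈ S, MvPolynomial.eval (fun k => x k) q = 0) : q = 0 := by
  obtain ⟨x, hx⟩ := hne
  have ho : IsOpen ((WithLp.toLp 2 : (Fin 2 → ℝ) → Plane) ⁻¹' S) :=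
    hS.preimage (PiLp.continuous_toLp 2 _)
  obtain ⟨ε, hε, hb⟩ := Metric.isOpen_iff.1 ho x.ofLp hx
  refine MvPolynomial.funext_set (fun k => Metric.ball (x k) ε) (fun k => ?_) fun y hy => ?_
  · exact infinite_of_mem_nhds (x k) (Metric.ball_mem_nhds _ hε)
  · rw [map_zero]
    exact h (WithLp.toLp 2 y) (hb (by rwa [ball_pi _ hε]))

lemma polynomial_eq_zero_of_test (hne : (K : Set Plane).Nonempty) {q : MvPolynomial (Fin 2) ℝ}
    (hb : Bornology.IsBounded (K : Set Plane))
    (h : ∀ φ : 𝓓(K, ℝ), ∫ x in (K : Set Plane), MvPolynomial.eval (fun k => x k) q * φ x = 0) :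
    q = 0 := by
  have h1 : (memLp_poly hb q).toLp _ = (0 : L2 K) := by
    refine L2_eq_of_test fun φ => ?_
    rw [integral_zero_mul, ← h φ]
    refine integral_congr_ae ?_
    filter_upwards [(memLp_poly hb q).coeFn_toLp] with x hx
    rw [hx]
  have hq : Continuous fun x : Plane => MvPolynomial.eval (fun k => x k) q :=
    (MvPolynomial.continuous_eval q).comp (by fun_prop)
  refine polynomial_eq_zero_of_open K.isOpen hne fun x hx => ?_
  refine Measure.eqOn_open_of_ae_eq (μ := volume) (g := fun _ => (0 : ℝ)) ?_ K.isOpen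
    hq.continuousOn continuousOn_const hx
  filter_upwards [(memLp_poly hb q).coeFn_toLp,
    Lp.coeFn_zero ℝ 2 (volume.restrict (K : Set Plane))] with x h2 h3
  rw [← h2, h1, h3]
  rfl

/-- The jets of `H^p_0(K)` with a polynomial in `ℙ_m(K)` as their polyharmonic operator. -/
def bubbleSpace (K : Opens Plane) (p : ℕ) (m : ℤ) : Submodule ℝ (JetSpace K p) where
  carrier := {U | U ∈ zeroJets K p ∧ HasPolyLaplacian K p m (coord K p 0 U)}
  zero_mem' := by
    refine ⟨zero_mem _, 0, zero_mem _, fun φ => ?_⟩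
    rw [map_zero, integral_zero_mul]
    simp
  add_mem' := by
    rintro U W ⟨hU, hU'⟩ ⟨hW, hW'⟩
    refine ⟨add_mem hU hW, ?_⟩
    rw [map_add]
    exact hU'.add hW'
  smul_mem' := by
    rintro c U ⟨hU, hU'⟩
    refine ⟨Submodule.smul_mem _ c hU, ?_⟩
    rw [map_smul]
    exact hU'.smul c

/-- Functions in `H^p_0(K)` with polynomial `Δ^p` attain all bulk moments. -/
lemma exists_bubble (hK : IsElement P K) {p : ℕ} {m : ℤ} (ℓ : Module.Dual ℝ (bulkPoly m)) :
    ∃ U ∈ zeroJets K p, HasPolyLaplacian K p m (coord K p 0 U) ∧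
      ∀ q : bulkPoly m, bulkMoment hK.bounded q (coord K p 0 U) = ℓ q := by
  set B : bulkPoly m →ₗ[ℝ] bubbleSpace K p m →ₗ[ℝ] ℝ :=
    (bulkMoment hK.bounded).compl₁₂ (bulkPoly m).subtype
      ((coord K p 0).toLinearMap.comp (bubbleSpace K p m).subtype) with hB
  -- A weight whose moments vanish on all bubbles has vanishing moment on the solution of `Δ^p U =
  -- q` with zero boundary data; then `U = 0`, hence `q = 0`. As the weights form a
  -- finite-dimensional space, this injectivity is the surjectivity of the transpose.
  have hinj : Function.Injective B := by
    rw [injective_iff_map_eq_zero]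
    rintro ⟨q, hq⟩ h0
    obtain ⟨U, hU, hUq⟩ := exists_dirichlet hK.bounded (p := p) (V := 0)
      (fun ν _ => by rw [map_zero, map_zero]; exact hasWeakDeriv_zero K ν) q
    simp only [map_zero, zero_add] at hUq
    have hmem : U ∈ bubbleSpace K p m := ⟨hU, q, hq, hUq⟩
    have h1 : bulkMoment hK.bounded q (coord K p 0 U) = 0 := LinearMap.congr_fun h0 ⟨U, hmem⟩
    rw [bulkMoment_apply] at h1
    have h2 := zeroJet_eq_zero hK.bounded hU hUq h1
    refine Subtype.ext (polynomial_eq_zero_of_test hK.connected.nonempty hK.bounded fun φ => ?_)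
    rw [← hUq φ, h2, map_zero, integral_zero_mul]
  obtain ⟨⟨U, hU, hU'⟩, h⟩ := LinearMap.flip_surjective_iff₁.2 hinj ℓ
  exact ⟨U, hU, hU', fun q => LinearMap.congr_fun h q⟩

end VEM

namespace VEM

open MeasureTheory Set Filter Topology TopologicalSpace
open scoped ContDiff Distributions

variable {N : ℕ} {P : Polygon Plane N} {K : Opens Plane} {h : Fin N → ℝ} {p : ℕ} {μ : ℕ → ℤ} {s : ℤ}

/-! ### Unisolvence -/

lemma vertex_mem_boundary (P : Polygon Plane N) (i : Fin N) : P i ∈ P.boundary ℝ :=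
  mem_iUnion.2 ⟨i, left_mem_edgeSet i⟩

lemma HasDofs.unique (hK : IsElement P K) {v : L2 K} {D D' : DofData N p μ s}
    (hD : HasDofs P K h p μ s v D) (hD' : HasDofs P K h p μ s v D') : D = D' := by
  obtain ⟨⟨g, hg, h1, h2⟩, h3⟩ := hD
  obtain ⟨⟨g', hg', h1', h2'⟩, h3'⟩ := hD'
  refine Prod.ext ?_ (Prod.ext ?_ ?_)
  · funext i ν
    rw [h1, h1', hg.eqOn hK hg' ν.2 (vertex_mem_boundary P i)]
  · funext i j
    refine LinearMap.ext fun q => ?_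
    rw [h2, h2', edgeIntegral, edgeIntegral]
    congr 2
    refine intervalIntegral.integral_congr fun t ht => ?_
    rw [uIcc_of_le (zero_le_one' ℝ)] at ht
    simp only [normalTrace]
    congr 1
    refine Finset.sum_congr rfl fun a ha => ?_
    have := Finset.mem_range.1 ha
    have hj := j.2
    rw [hg.eqOn hK hg' (ν := (a, (j : ℕ) - a)) (show a + ((j : ℕ) - a) < p by omega)
      (edgePath_mem_boundary ht)]
  · refine LinearMap.ext fun q => ?_
    rw [h3, h3']

lemma HasDofs.add (hb : Bornology.IsBounded (K : Set Plane)) {v v' : L2 K} {D D' : DofData N p μ s}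
    (hD : HasDofs P K h p μ s v D) (hD' : HasDofs P K h p μ s v' D') :
    HasDofs P K h p μ s (v + v') (D + D') := by
  obtain ⟨⟨g, hg, h1, h2⟩, h3⟩ := hD
  obtain ⟨⟨g', hg', h1', h2'⟩, h3'⟩ := hD'
  refine ⟨⟨g + g', hg.add hg', fun i ν => ?_, fun i j q => ?_⟩, fun q => ?_⟩
  · simp only [Prod.fst_add, Pi.add_apply, h1, h1', mul_add]
  · simp only [Prod.snd_add, Prod.fst_add, Pi.add_apply, LinearMap.add_apply, h2, h2',
      normalTrace_add, mul_add, edgeIntegral]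
    rw [intervalIntegral.integral_add (hg.intervalIntegrable i j.2 _)
      (hg'.intervalIntegrable i j.2 _)]
    ring
  · simp only [Prod.snd_add, LinearMap.add_apply, h3, h3', ← bulkMoment_apply hb, map_add, mul_add]

lemma HasDofs.smul (hb : Bornology.IsBounded (K : Set Plane)) {v : L2 K} {D : DofData N p μ s}
    (c : ℝ) (hD : HasDofs P K h p μ s v D) : HasDofs P K h p μ s (c • v) (c • D) := by
  obtain ⟨⟨g, hg, h1, h2⟩, h3⟩ := hD
  refine ⟨⟨c • g, hg.smul c, fun i ν => ?_, fun i j q => ?_⟩, fun q => ?_⟩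
  · simp only [Prod.smul_fst, Pi.smul_apply, h1, smul_eq_mul]
    ring
  · simp only [Prod.smul_snd, Prod.smul_fst, Pi.smul_apply, LinearMap.smul_apply, h2,
      normalTrace_smul, mul_left_comm _ c, edgeIntegral, intervalIntegral.integral_const_mul,
      smul_eq_mul]
  · simp only [Prod.smul_snd, LinearMap.smul_apply, h3, ← bulkMoment_apply hb, map_smul,
      smul_eq_mul, mul_left_comm _ c]

lemma exists_hasDofs (hb : Bornology.IsBounded (K : Set Plane)) {v : L2 K}
    {g : ℕ × ℕ → Plane → ℝ} (hg : IsTraceJet P K p v g) :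
    ∃ D : DofData N p μ s, HasDofs P K h p μ s v D := by
  refine ⟨(fun i ν => h i ^ (ν.1.1 + ν.1.2) * g ν.1 (P i), fun i j =>
    { toFun := fun q => edgeLength P i ^ (-1 + (j : ℤ)) *
        edgeIntegral P i fun t => (q : Polynomial ℝ).eval t * normalTrace P i j g t
      map_add' := fun q q' => ?_
      map_smul' := fun c q => ?_ },
    Metric.diam (K : Set Plane) ^ (-2 : ℤ) •
      ((bulkMoment hb).flip v).comp (bulkPoly s).subtype),
    ⟨g, hg, fun i ν => rfl, fun i j q => rfl⟩, fun q => ?_⟩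
  · simp only [Submodule.coe_add, Polynomial.eval_add, add_mul, edgeIntegral]
    rw [intervalIntegral.integral_add (hg.intervalIntegrable i j.2 _)
      (hg.intervalIntegrable i j.2 _)]
    ring
  · simp only [Submodule.coe_smul, Polynomial.eval_smul, smul_eq_mul, mul_assoc, edgeIntegral,
      intervalIntegral.integral_const_mul, RingHom.id_apply]
    ring
  · rw [← bulkMoment_apply hb]
    rfl

/-- Uniqueness of trace jets makes `HasDofs` single-valued; it is also total and compatible with
sums and multiples, so it is the graph of a linear map. -/
lemma exists_dofMap (hK : IsElement P K) (h : Fin N → ℝ) (p : ℕ) (μ : ℕ → ℤ) (s m : ℤ)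
    (d : ℕ → ℤ) : ∃ Φ : vemSpace P K p m d →ₗ[ℝ] DofData N p μ s,
      ∀ (v : vemSpace P K p m d) (D : DofData N p μ s), HasDofs P K h p μ s v D ↔ Φ v = D := by
  have hex : ∀ v : vemSpace P K p m d, ∃ D : DofData N p μ s, HasDofs P K h p μ s v D := by
    rintro ⟨v, -, -, g, hg, -⟩
    exact exists_hasDofs hK.bounded hg
  choose Φ hΦ using hex
  refine ⟨{ toFun := Φ, map_add' := fun v w => ?_, map_smul' := fun c v => ?_ }, fun v D => ⟨?_, ?_⟩⟩
  · exact (hΦ (v + w)).unique hK ((hΦ v).add hK.bounded (hΦ w))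
  · exact (hΦ (c • v)).unique hK ((hΦ v).smul hK.bounded c)
  · exact (hΦ v).unique hK
  · rintro rfl
    exact hΦ v

lemma edgeLength_ne_zero (hP : IsSimplePolygon P) (i : Fin N) : edgeLength P i ≠ 0 := by
  rw [edgeLength_eq]
  exact norm_ne_zero_iff.2 (edgeVec_ne_zero hP i)

lemma IsElement.diam_ne_zero (hK : IsElement P K) : Metric.diam (K : Set Plane) ≠ 0 := by
  obtain ⟨x, hx⟩ := hK.connected.nonempty
  exact (Metric.diam_pos (infinite_of_mem_nhds x (K.isOpen.mem_nhds hx)).nontrivial hK.bounded).ne'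

/-- Functions with vanishing degrees of freedom vanish. -/
lemma HasDofs.eq_zero (hK : IsElement P K) (hh : ∀ i, 0 < h i) {m : ℤ} {d : ℕ → ℤ}
    (hd : ∀ j < p, (d j + 1).toNat = 2 * (p - j) + (μ j + 1).toNat) (hms : m ≤ s) {v : L2 K}
    (hv : v ∈ vemSpace P K p m d) (hD : HasDofs P K h p μ s v 0) : v = 0 := by
  obtain ⟨hs, ⟨q, hq, hqv⟩, g, hg, he⟩ := hv
  obtain ⟨⟨g', hg', h1, h2⟩, h3⟩ := hD
  have heq : ∀ ν : ℕ × ℕ, ν.1 + ν.2 < p → EqOn (g ν) (g' ν) (P.boundary ℝ) :=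
    fun ν hν => hg.eqOn hK hg' hν
  have he' : ∀ i, ∀ j < p, ∀ t ∈ Icc (0 : ℝ) 1, normalTrace P i j g' t = normalTrace P i j g t := by
    intro i j hj t ht
    refine Finset.sum_congr rfl fun a ha => ?_
    have := Finset.mem_range.1 ha
    rw [heq (a, j - a) (show a + (j - a) < p by omega) (edgePath_mem_boundary ht)]
  have hzero : ∀ ν : ℕ × ℕ, ν.1 + ν.2 < p → ∀ x ∈ P.boundary ℝ, g' ν x = 0 := by
    intro ν hν x hx
    refine hg'.eq_zero_of_dofs hK hd (fun i j hj => ?_) (fun i κ hκ => ?_) (fun i j hj w hw => ?_)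
      hν hx
    · obtain ⟨w, hw, hwe⟩ := he i j hj
      exact ⟨w, hw, fun t ht => (he' i j hj t ht).trans (hwe t ht)⟩
    · have h4 := h1 i ⟨κ, hκ⟩
      exact (mul_eq_zero.1 h4.symm).resolve_left (pow_ne_zero _ (hh i).ne')
    · have h4 := h2 i ⟨j, hj⟩ ⟨w, hw⟩
      have hl := edgeLength_ne_zero hK.simple i
      exact (mul_eq_zero.1 ((mul_eq_zero.1 h4.symm).resolve_left (zpow_ne_zero _ hl))).resolve_left hl
  obtain ⟨U, hU, rfl⟩ := exists_weakJet hK hs hg' hzero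
  -- The polynomial `Δ^p v` is itself one of the bulk weights because `m ≤ s`, so its moment against
  -- `v` vanishes.
  have h5 := (mul_eq_zero.1 (h3 ⟨q, bulkPoly_mono hms hq⟩).symm).resolve_left
    (zpow_ne_zero _ hK.diam_ne_zero)
  rw [zeroJet_eq_zero hK.bounded hU hqv h5, map_zero]

/-- All values of the degrees of freedom are attained. -/
lemma exists_of_dofs (hK : IsElement P K) (hh : ∀ i, 0 < h i) {m : ℤ} {d : ℕ → ℤ}
    (hd : ∀ j < p, (d j + 1).toNat = 2 * (p - j) + (μ j + 1).toNat) (D : DofData N p μ m) :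
    ∃ v ∈ vemSpace P K p m d, HasDofs P K h p μ m v D := by
  classical
  have hl := edgeLength_ne_zero hK.simple
  -- The prescribed values are divided by the scale factors of the degrees of freedom. The second
  -- factor `edgeLength P i` comes from the arc length in `edgeIntegral`.
  obtain ⟨V, g, hV, hg, he, hvert, hmom⟩ := exists_boundary_dofs hK hd
    (fun i ν => if hν : ν.1 + ν.2 < p then (h i ^ (ν.1 + ν.2))⁻¹ * D.1 i ⟨ν, hν⟩ else 0)
    (fun i j => (edgeLength P i ^ (-1 + (j : ℤ)) * edgeLength P i)⁻¹ • D.2.1 i j)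
  have hc : ∀ ν : ℕ × ℕ, ν.1 + ν.2 ≤ p → coord K p ν (mkJet p V) = V ν :=
    fun ν hν => coord_mkJet hν V
  -- `U` makes the lift polyharmonic, and the bubble `W` then supplies the missing bulk moments.
  -- Neither changes the traces.
  obtain ⟨U, hU, hUq⟩ := exists_dirichlet hK.bounded (p := p) (V := mkJet p V)
    (fun ν hν => by rw [hc ν hν, hc 0 (by simp)]; exact hV ν hν) 0
  rw [hc 0 (by simp)] at hUq
  obtain ⟨W, hW, hWp, hWm⟩ := exists_bubble hK (p := p) (m := m)
    (Metric.diam (K : Set Plane) ^ 2 • D.2.2 -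
      ((bulkMoment hK.bounded).flip (V 0 + coord K p 0 U)).comp (bulkPoly m).subtype)
  have htr : IsTraceJet P K p (V 0 + coord K p 0 U + coord K p 0 W) g := by
    simpa only [add_zero] using
      (hg.add (zeroJets_isTraceJet hK hU)).add (zeroJets_isTraceJet hK hW)
  refine ⟨V 0 + coord K p 0 U + coord K p 0 W, ⟨fun ν hν => ?_, ?_, g, htr, he⟩,
    ⟨g, htr, fun i ν => ?_, fun i j q => ?_⟩, fun q => ?_⟩
  · exact ⟨_, ((hV ν hν).add (zeroJets_hasWeakDeriv hU hν)).add (zeroJets_hasWeakDeriv hW hν)⟩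
  · exact HasPolyLaplacian.add ⟨0, zero_mem _, hUq⟩ hWp
  · rw [hvert i ν.1 ν.2, dif_pos ν.2, mul_inv_cancel_left₀ (pow_ne_zero _ (hh i).ne')]
  · rw [edgeIntegral, hmom, ← mul_assoc, LinearMap.smul_apply, smul_eq_mul,
      mul_inv_cancel_left₀ (mul_ne_zero (zpow_ne_zero _ (hl i)) (hl i))]
  · have hdm := hK.diam_ne_zero
    have h1 : bulkMoment hK.bounded q (coord K p 0 W) = Metric.diam (K : Set Plane) ^ 2 * D.2.2 q -
        bulkMoment hK.bounded q (V 0 + coord K p 0 U) := hWm q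
    rw [← bulkMoment_apply hK.bounded, map_add, h1, add_sub_cancel, zpow_neg,
      show (2 : ℤ) = ((2 : ℕ) : ℤ) from rfl, zpow_natCast,
      inv_mul_cancel_left₀ (pow_ne_zero _ hdm)]

/-- In `hd`, `2 (p - j)` counts the Hermite conditions at the two ends of an edge and the last term
the moments of `∂_n^j v`. For uniqueness the bulk weights only need to contain all possible values
of `Δ^p v`. -/
theorem determined_vemSpace (hK : IsElement P K) (hh : ∀ i, 0 < h i) {m : ℤ} {d : ℕ → ℤ}
    (hd : ∀ j < p, (d j + 1).toNat = 2 * (p - j) + (μ j + 1).toNat) (hms : m ≤ s) :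
    Determined P K h p μ s (vemSpace P K p m d) := by
  obtain ⟨Φ, hΦ⟩ := exists_dofMap hK h p μ s m d
  refine ⟨Φ, (injective_iff_map_eq_zero Φ).2 fun v hv => Subtype.ext ?_, hΦ⟩
  exact ((hΦ v 0).2 hv).eq_zero hK hh hd hms v.2

theorem unisolvent_vemSpace (hK : IsElement P K) (hh : ∀ i, 0 < h i) {m : ℤ} {d : ℕ → ℤ}
    (hd : ∀ j < p, (d j + 1).toNat = 2 * (p - j) + (μ j + 1).toNat) :
    Unisolvent P K h p μ m (vemSpace P K p m d) := by
  obtain ⟨Φ, hinj, hΦ⟩ := determined_vemSpace (s := m) hK hh hd le_rfl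
  refine ⟨LinearEquiv.ofBijective Φ ⟨hinj, fun D => ?_⟩, hΦ⟩
  obtain ⟨v, hv, hD⟩ := exists_of_dofs hK hh hd D
  exact ⟨⟨v, hv⟩, (hΦ ⟨v, hv⟩ D).1 hD⟩

end VEM

theorem mainTheorem2 {N : ℕ} (P : Polygon VEM.Plane N) (K : TopologicalSpace.Opens VEM.Plane)
    (hK : VEM.IsElement P K) (h : Fin N → ℝ) (hh : ∀ i, 0 < h i) (p : ℕ) (hp : 1 ≤ p) :
    -- (D1)-(D4) on the local space
    (∀ r : ℕ, 2 * p - 1 ≤ r →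
      VEM.Unisolvent P K h p (fun j => (r : ℤ) - 2 * p + j) ((r : ℤ) - 2 * p)
        (VEM.localSpace P K p r)) ∧
    -- (D1)-(D3) and (D4')
    (∀ r t : ℕ, 2 * p - 1 ≤ r → t ≤ p - 1 →
      VEM.Determined P K h p (fun j => (r : ℤ) - 2 * p + j) ((r : ℤ) - 2 * ((p : ℤ) - t))
        (VEM.localSpace P K p r) ∧
      VEM.Unisolvent P K h p (fun j => (r : ℤ) - 2 * p + j) ((r : ℤ) - 2 * ((p : ℤ) - t))
        (VEM.enlargedSpace P K p r t)) ∧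
    -- (D1') and (D2') on the modified lowest order space
    VEM.Unisolvent P K h p (fun j => (j : ℤ) - 2) (-1) (VEM.modifiedSpace P K p) := by
  -- For `r ≥ 2p - 1` and `j < p` both dimensions are nonnegative as integers, so `toNat` cuts
  -- nothing off. The parameter `t` affects only the bulk degree.
  have hd : ∀ r : ℕ, 2 * p - 1 ≤ r → ∀ j < p, ((r : ℤ) - j + 1).toNat =
      2 * (p - j) + ((r : ℤ) - 2 * p + j + 1).toNat := by
    intro r hr j hj
    omega
  refine ⟨fun r hr => VEM.unisolvent_vemSpace hK hh (hd r hr), fun r t hr ht =>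
    ⟨VEM.determined_vemSpace hK hh (hd r hr) (by omega),
      VEM.unisolvent_vemSpace hK hh (hd r hr)⟩, VEM.unisolvent_vemSpace hK hh fun j hj => ?_⟩
  -- For `j = 0` the weight degree is `-2`, whose dimension `toNat` truncates to `0`, and `2p = 2p +
  -- 0`. For `j ≥ 1` the count is `2p - 1 - j = 2 (p - j) + (j - 1)`.
  split_ifs <;> omega
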